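/- Let $p>2$ be a prime, $\Bbbk$ a field of characteristic $p$ and $n\ge 1$. Conventions. A $p$-complex is a $\mathbb Z$-graded $\Bbbk$-vector space $M$ with an operator $\partial$ of degree $2$ and $\partial^p=0$; $\mathcal C(\Bbbk,\partial_q)$ is the category of $p$-complexes modulo the maps $\sum_{i=0}^{p-1}\partial^i h\,\partial^{p-1-i}$ with $h$ linear of degree $2-2p$. $V_i$ $(0\le i\le p-1)$ is the $p$-complex with basis $e_0,\dots,e_i$, $\deg e_j=2j-i$, $\partial e_j=e_{j+1}$, $\partial e_i=0$; $q^a$ shifts degrees up by $a$; $M[1]=M\otimes q^{-p}V_{p-2}$, $M[-1]=M\otimes q^{p}V_{p-2}$, and $[m]$, $[-m]$ denote their $m$-fold iterates. The slash homology of $M$ is the $p$-complex $\mathrm H^/(M)=\bigoplus_{j=0}^{p-2}\ker\partial^{j+1}/(\operatorname{im}\partial^{p-j-1}+\ker\partial^{j})$, with the map induced by $\partial$. The homology. Let $R=\Bbbk[x_1,x_2]$, $\deg x_i=2$, with the derivation $\partial_q(x_i)=x_i^2$, and $B=R\otimes_{R^{S_2}}R$, on which $\partial_q$ acts by the Leibniz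 rule. Let $pT=q^{-3}\bigl(B\xrightarrow{br}R[-1]\bigr)$ with $br(f\otimes g)=fg$, where $R[-1]$ is $p-1$ copies of $R$ joined by identity maps, in positions $-1,\dots,-(p-1)$. The braid $\sigma_1^n$ on two strands, whose closure is the torus link $T_{2,n}$, is assigned the $p$-complex of bimodules $pT^{\otimes_R n}$ with topological differential $\partial_t$ (acting by the Leibniz rule, without signs). For a bimodule $M$ with compatible $\partial_q$, let $\mathrm{HH}_\bullet(M)$ be the homology of the Koszul complex $M\otimes\Lambda(dx_1,dx_2)$ whose differential is contraction sending $dx_i$ to $m\mapsto x_im-mx_i$; here $\deg dx_i=4$ and $\partial_q$ acts on $m\,dx_I$ by $\partial_q(m)\,dx_I+\sum_{i\in I}(x_im+mx_i)\,dx_I$. Contraction sending $dx_i$ to $m\mapsto x_i^2m+mx_i^2$ induces $d_C:\mathrm{HH}_j\to\mathrm{HH}_{j-1}$. Let $p\mathrm{HH}_\bullet(M)$ be $$\mathrm{HH}_2\xrightarrow{d_C}\mathrm{HH}_1=\cdots=\mathrm{HH}_1\xrightarrow{d_C}\mathrm{HH}_0$$ with $p-1$ copies of $\mathrm{HH}_1$,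 in positions $p,p-1,\dots,1,0$, and let $\partial_C$ be the displayed $p$-differential. All (Hochschild and topological) positions are collapsed onto the $q$-grading, a term in position $i$ being shifted by $q^{-2i}$. Then $p\mathrm{HH}_\bullet(pT^{\otimes n})$ with $\partial_T=\partial_t+\partial_C+\partial_q$ is a $p$-complex, and the $\mathfrak{sl}_2$ $p$-homology of $T_{2,n}$ (with the blackboard framing of the braid closure, so with no framing factor) is $$p\mathrm H(T_{2,n}):=q^{-2}\,\mathrm H^/\bigl(p\mathrm{HH}_\bullet(pT^{\otimes n}),\partial_T\bigr).$$ The claim. $\bigl(p\mathrm{HH}_\bullet(pT^{\otimes n}),\partial_T\bigr)$ is a $p$-complex, and in $\mathcal C(\Bbbk,\partial_q)$ $$p\mathrm H(T_{2,n})\cong\begin{cases} q^{-3n-2}\Bigl(q^5V_1[1]\oplus\bigoplus_{i=1}^{(n-1)/2}X_i\Bigr)[-n] & 2\nmid n,\\[2pt] q^{-3n-2}\Bigl(q^5V_1[1]\oplus\bigoplus_{i=1}^{(n-2)/2}X_i\oplus Y_{n/2}\Bigr)[-n] & 2\mid n,\end{cases}$$ where, if $p=3$, the indices $i$ divisible by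 $3$ are omitted from the sums. Here $$X_i=\begin{cases} q^{4i+5}V_1[2i+1]\oplus q^{4i-1}V_1[2i] & p\nmid 2i+1,\ p\nmid 2i-1,\\ q^{4i+4}(V_0\oplus q^2V_0)[2i+1]\oplus q^{4i-1}V_1[2i] & p\mid 2i+1,\\ q^{4i+5}V_1[2i+1]\oplus q^{4i-2}(V_0\oplus q^2V_0)[2i] & p\mid 2i-1,\end{cases}$$ $$Y_{n/2}=\begin{cases} q^{2n}V_2[n]\oplus q^{2n+2}V_2[n] & p\nmid n-1,\ p\nmid n,\\ q^{2(n-1)}(V_0\oplus q^2V_0\oplus q^4V_0)[n]\oplus q^{2n+2}V_2[n] & p\mid n-1,\\ q^{2n}V_2[n]\oplus q^{2n}(V_0\oplus q^2V_0\oplus q^4V_0)[n] & p\mid n.\end{cases}$$ -/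

import Mathlib

universe u

namespace TorusLink

section Complexes

/-!
### Graded modules over `H_q = k[∂_q]/(∂_q^p)`, `deg ∂_q = 2`, and their homotopy category
-/

/-- A `k`-vector space with a family of subspaces indexed by the `q`-degree and an operator.
It is a graded `H_q`-module (a `p`-complex) when it satisfies `QComplex.IsPComplex`. -/
structure QComplex (k : Type u) [Field k] where
  carrier : Type u
  [acg : AddCommGroup carrier]
  [mod : Module k carrier]
  /-- the homogeneous subspaces -/
  gr : ℤ → Submodule k carrier
  /-- the operator -/
  diff : carrier →ₗ[k] carrier

attribute [instance] QComplex.acg QComplex.mod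

namespace QComplex

variable {k : Type u} [Field k]

/-- The space is graded by its homogeneous subspaces, the operator has degree `2`, and its `p`-th
power is zero: a `p`-complex, that is, a graded `H_q`-module. -/
structure IsPComplex (p : ℕ) (M : QComplex k) : Prop where
  internal : DirectSum.IsInternal M.gr
  diff_mem : ∀ (e : ℤ), ∀ x ∈ M.gr e, M.diff x ∈ M.gr (e + 2)
  diff_pow : M.diff ^ p = 0

/-- Morphisms of graded `H_q`-modules: degree-preserving linear maps commuting with `∂`. -/
structure IsHom (M N : QComplex k) (f : M.carrier →ₗ[k] N.carrier) : Prop where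
  comm : ∀ x, f (M.diff x) = N.diff (f x)
  map_mem : ∀ (e : ℤ), ∀ x ∈ M.gr e, f x ∈ N.gr e

/-- Null-homotopic maps: `f = ∑_{i=0}^{p-1} ∂^i h ∂^{p-1-i}` with `h` of degree `2 - 2p`. -/
def NullHomotopic (p : ℕ) (M N : QComplex k) (f : M.carrier →ₗ[k] N.carrier) : Prop :=
  ∃ h : M.carrier →ₗ[k] N.carrier,
    (∀ (e : ℤ), ∀ x ∈ M.gr e, h x ∈ N.gr (e + 2 - 2 * (p : ℤ))) ∧
    f = ∑ i ∈ Finset.range p, (N.diff ^ i) ∘ₗ h ∘ₗ (M.diff ^ (p - 1 - i))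

/-- Isomorphism in the homotopy category `C(k, ∂_q)`, the quotient of the category of graded
`H_q`-modules by the ideal of null-homotopic morphisms. -/
def HomotopyIso (p : ℕ) (M N : QComplex k) : Prop :=
  ∃ (f : M.carrier →ₗ[k] N.carrier) (g : N.carrier →ₗ[k] M.carrier),
    IsHom M N f ∧ IsHom N M g ∧
    NullHomotopic p M M (g ∘ₗ f - LinearMap.id) ∧
    NullHomotopic p N N (f ∘ₗ g - LinearMap.id)

/-- The grading shift `q^a M`: degrees are shifted up by `a`. -/
def qShift (a : ℤ) (M : QComplex k) : QComplex k where
  carrier := M.carrier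
  gr := fun e => M.gr (e - a)
  diff := M.diff

/-- The balanced complex `V_i`: basis `e_0, …, e_i` with `e_j` in degree `2j - i`,
`∂ e_j = e_{j+1}` and `∂ e_i = 0`. -/
def V (k : Type u) [Field k] (i : ℕ) : QComplex k where
  carrier := Fin (i + 1) → k
  gr := fun e =>
    { carrier := {v | ∀ j : Fin (i + 1), 2 * ((j : ℕ) : ℤ) - (i : ℤ) ≠ e → v j = 0}
      zero_mem' := fun _ _ => rfl
      add_mem' := fun {v w} hv hw j hj => by
        have h1 := hv j hj
        have h2 := hw j hj
        simp [h1, h2]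
      smul_mem' := fun c v hv j hj => by
        have h1 := hv j hj
        simp [h1] }
  diff := LinearMap.pi fun j =>
    if h : (j : ℕ) = 0 then 0
    else LinearMap.proj (⟨(j : ℕ) - 1, by have := j.isLt; omega⟩ : Fin (i + 1))

/-- Direct sum of two complexes. -/
def sum (M N : QComplex k) : QComplex k where
  carrier := M.carrier × N.carrier
  gr := fun e => (M.gr e).prod (N.gr e)
  diff := M.diff.prodMap N.diff

/-- Finite direct sum of complexes. -/
def bigSum (s : Finset ℕ) (M : ℕ → QComplex k) : QComplex k where
  carrier := ∀ i : s, (M i).carrier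
  gr := fun e => Submodule.pi Set.univ fun i : s => (M i).gr e
  diff := LinearMap.pi fun i : s => (M i).diff ∘ₗ LinearMap.proj i

/-- Tensor product over `k`, with `∂` acting by the Leibniz rule. -/
def tensor (M N : QComplex k) : QComplex k where
  carrier := TensorProduct k M.carrier N.carrier
  gr := fun e => ⨆ i : ℤ,
    Submodule.map₂ (TensorProduct.mk k M.carrier N.carrier) (M.gr i) (N.gr (e - i))
  diff := M.diff.rTensor N.carrier + N.diff.lTensor M.carrier

/-- The homological shift `M[1]_∂ = M ⊗ q^{-p} V_{p-2}`. -/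
def shiftOne (p : ℕ) (M : QComplex k) : QComplex k :=
  M.tensor ((V k (p - 2)).qShift (-(p : ℤ)))

/-- The inverse homological shift `M[-1]_∂ = M ⊗ q^{p} V_{p-2}`. -/
def shiftNegOne (p : ℕ) (M : QComplex k) : QComplex k :=
  M.tensor ((V k (p - 2)).qShift (p : ℤ))

/-- The iterated homological shift `M[m]_∂`, `m ≥ 0`. -/
def shift (p m : ℕ) (M : QComplex k) : QComplex k := (shiftOne p)^[m] M

/-- The iterated inverse homological shift `M[-m]_∂`, `m ≥ 0`. -/
def shiftNeg (p m : ℕ) (M : QComplex k) : QComplex k := (shiftNegOne p)^[m] M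

/-!
### Slash homology
-/

/-- `Im(∂^{p-j-1}) + Ker(∂^j)` inside `Ker(∂^{j+1})`. -/
def slashRel (p : ℕ) (M : QComplex k) (j : ℕ) : Submodule k (LinearMap.ker (M.diff ^ (j + 1))) :=
  (LinearMap.range (M.diff ^ (p - j - 1)) ⊔ LinearMap.ker (M.diff ^ j)).comap
    (LinearMap.ker (M.diff ^ (j + 1))).subtype

/-- `H^{/j}(M) = Ker(∂^{j+1}) / (Im(∂^{p-j-1}) + Ker(∂^j))`. -/
abbrev SlashPart (p : ℕ) (M : QComplex k) (j : ℕ) : Type u :=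
  LinearMap.ker (M.diff ^ (j + 1)) ⧸ slashRel p M j

/-- `∂` as a map `Ker(∂^{j+2}) → Ker(∂^{j+1})`. -/
def kerDiff (M : QComplex k) (j : ℕ) :
    LinearMap.ker (M.diff ^ (j + 2)) →ₗ[k] LinearMap.ker (M.diff ^ (j + 1)) :=
  M.diff.restrict fun x hx => by
    rw [LinearMap.mem_ker] at hx ⊢
    rw [← hx, pow_succ M.diff (j + 1), Module.End.mul_apply]

/-- The map `∂ : H^{/(j+1)}(M) → H^{/j}(M)` (for `j + 1 ≤ p - 2`). -/
def slashDiff (p : ℕ) (M : QComplex k) (j : ℕ) (hj : j + 1 < p - 1) :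
    SlashPart p M (j + 1) →ₗ[k] SlashPart p M j :=
  Submodule.mapQ _ _ (kerDiff M j) fun x hx => by
    have hx' : (x : M.carrier) ∈ LinearMap.range (M.diff ^ (p - (j + 1) - 1)) ⊔
        LinearMap.ker (M.diff ^ (j + 1)) := hx
    show M.diff (x : M.carrier) ∈ LinearMap.range (M.diff ^ (p - j - 1)) ⊔
        LinearMap.ker (M.diff ^ j)
    obtain ⟨y, ⟨w, rfl⟩, z, hz, hyz⟩ := Submodule.mem_sup.mp hx'
    rw [← hyz, map_add]
    refine Submodule.add_mem_sup ⟨w, ?_⟩ ?_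
    · rw [show p - j - 1 = (p - (j + 1) - 1) + 1 by omega, pow_succ', Module.End.mul_apply]
    · rw [LinearMap.mem_ker] at hz ⊢
      rw [← hz, pow_succ, Module.End.mul_apply]

/-- The slash homology `H^/(M) = ⨁_{j=0}^{p-2} H^{/j}(M)`, graded by the `q`-degree and with the
operator induced by `∂`. -/
def slash (p : ℕ) (M : QComplex k) : QComplex k where
  carrier := ∀ j : Fin (p - 1), SlashPart p M j
  gr := fun e => Submodule.pi Set.univ fun j : Fin (p - 1) =>
    ((M.gr e).comap (LinearMap.ker (M.diff ^ ((j : ℕ) + 1))).subtype).map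
      (slashRel p M j).mkQ
  diff := LinearMap.pi fun j =>
    if h : (j : ℕ) + 1 < p - 1 then
      slashDiff p M j h ∘ₗ LinearMap.proj (⟨(j : ℕ) + 1, h⟩ : Fin (p - 1))
    else 0

end QComplex

end Complexes

section Bimodules

/-!
### `H_q`-equivariant bimodules over `R = k[x_1, x_2]`
-/

/-- `R = k[x_1, x_2]`. -/
abbrev Pol (k : Type u) [Field k] : Type u := MvPolynomial (Fin 2) k

/-- The derivation `∂_q` of `R` with `∂_q(x_i) = x_i^2`. -/
noncomputable def polDer (k : Type u) [Field k] : Derivation k (Pol k) (Pol k) :=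
  MvPolynomial.mkDerivation k fun i => MvPolynomial.X i ^ 2

/-- An `(R,R)`-bimodule with an operator `∂_q` obeying the Leibniz rule over `∂_q` on `R`, and a
bimodule endomorphism `∂_t` commuting with `∂_q` (the topological differential). The grading is the
single `q`-grading into which the topological grading is collapsed, `t^i` becoming `q^{-2i}`; so a
`p`-chain complex of bimodules is recorded by the direct sum of its terms. -/
structure HqBimod (k : Type u) [Field k] where
  carrier : Type u
  [acg : AddCommGroup carrier]
  [mod : Module k carrier]
  /-- left action of `R` -/
  lft : Pol k →ₐ[k] Module.End k carrier
  /-- right action of `R` -/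
  rgt : Pol k →ₐ[k] Module.End k carrier
  lft_rgt : ∀ a b m, lft a (rgt b m) = rgt b (lft a m)
  /-- the internal differential -/
  dq : carrier →ₗ[k] carrier
  dq_lft : ∀ a m, dq (lft a m) = lft (polDer k a) m + lft a (dq m)
  dq_rgt : ∀ a m, dq (rgt a m) = rgt (polDer k a) m + rgt a (dq m)
  /-- the topological differential -/
  dt : carrier →ₗ[k] carrier
  dt_lft : ∀ a m, dt (lft a m) = lft a (dt m)
  dt_rgt : ∀ a m, dt (rgt a m) = rgt a (dt m)
  dt_dq : ∀ m, dt (dq m) = dq (dt m)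
  /-- the homogeneous subspaces -/
  gr : ℤ → Submodule k carrier

attribute [instance] HqBimod.acg HqBimod.mod

namespace HqBimod

variable {k : Type u} [Field k]

/-- The regular bimodule `R`, with `x_1, x_2` in degree `2`. -/
noncomputable def reg (k : Type u) [Field k] : HqBimod k where
  carrier := Pol k
  lft := Algebra.lmul k (Pol k)
  rgt := Algebra.lmul k (Pol k)
  lft_rgt := fun a b m => by simp [mul_left_comm]
  dq := (polDer k : Pol k →ₗ[k] Pol k)
  dq_lft := fun a m => by simp [Derivation.leibniz]; ring
  dq_rgt := fun a m => by simp [Derivation.leibniz]; ring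
  dt := 0
  dt_lft := fun a m => by simp
  dt_rgt := fun a m => by simp
  dt_dq := fun m => by simp
  gr := fun e => MvPolynomial.weightedHomogeneousSubmodule k (fun _ : Fin 2 => (2 : ℤ)) e

/-- The relations `m a ⊗ n = m ⊗ a n`, `a ∈ A`. -/
def tensorRel (A : Subalgebra k (Pol k)) (M N : HqBimod k) :
    Submodule k (TensorProduct k M.carrier N.carrier) :=
  Submodule.span k {z | ∃ m n, ∃ a ∈ A,
    z = TensorProduct.tmul k (M.rgt a m) n - TensorProduct.tmul k m (N.lft a n)}

lemma tensorRel_le {A : Subalgebra k (Pol k)} {M N : HqBimod k}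
    (f : TensorProduct k M.carrier N.carrier →ₗ[k] TensorProduct k M.carrier N.carrier)
    (hf : ∀ m n, ∀ a ∈ A, f (TensorProduct.tmul k (M.rgt a m) n -
      TensorProduct.tmul k m (N.lft a n)) ∈ tensorRel A M N) :
    tensorRel A M N ≤ (tensorRel A M N).comap f := by
  refine Submodule.span_le.mpr ?_
  rintro z ⟨m, n, a, ha, rfl⟩
  exact hf m n a ha

lemma mem_tensorRel {A : Subalgebra k (Pol k)} {M N : HqBimod k} (m : M.carrier) (n : N.carrier)
    {a : Pol k} (ha : a ∈ A) :
    TensorProduct.tmul k (M.rgt a m) n - TensorProduct.tmul k m (N.lft a n) ∈ tensorRel A M N :=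
  Submodule.subset_span ⟨m, n, a, ha, rfl⟩

lemma tensorRel_le_lft (A : Subalgebra k (Pol k)) (M N : HqBimod k) (b : Pol k) :
    tensorRel A M N ≤ (tensorRel A M N).comap ((M.lft b).rTensor N.carrier) :=
  tensorRel_le _ fun m n a ha => by
    simpa [M.lft_rgt] using mem_tensorRel (M.lft b m) n ha

lemma tensorRel_le_rgt (A : Subalgebra k (Pol k)) (M N : HqBimod k) (b : Pol k) :
    tensorRel A M N ≤ (tensorRel A M N).comap ((N.rgt b).lTensor M.carrier) :=
  tensorRel_le _ fun m n a ha => by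
    simpa [N.lft_rgt] using mem_tensorRel m (N.rgt b n) ha

lemma tensorRel_le_dq (A : Subalgebra k (Pol k)) (hA : ∀ a ∈ A, polDer k a ∈ A)
    (M N : HqBimod k) :
    tensorRel A M N ≤ (tensorRel A M N).comap
      (M.dq.rTensor N.carrier + N.dq.lTensor M.carrier) :=
  tensorRel_le _ fun m n a ha => by
    have h := add_mem (add_mem (mem_tensorRel m n (hA a ha)) (mem_tensorRel (M.dq m) n ha))
      (mem_tensorRel m (N.dq n) ha)
    convert h using 1
    simp only [map_sub, LinearMap.add_apply, LinearMap.rTensor_tmul, LinearMap.lTensor_tmul,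
      M.dq_rgt, N.dq_lft, TensorProduct.add_tmul, TensorProduct.tmul_add]
    abel

lemma tensorRel_le_dt (A : Subalgebra k (Pol k)) (M N : HqBimod k) :
    tensorRel A M N ≤ (tensorRel A M N).comap
      (M.dt.rTensor N.carrier + N.dt.lTensor M.carrier) :=
  tensorRel_le _ fun m n a ha => by
    have h := add_mem (mem_tensorRel (M.dt m) n ha) (mem_tensorRel m (N.dt n) ha)
    convert h using 1
    simp only [map_sub, LinearMap.add_apply, LinearMap.rTensor_tmul, LinearMap.lTensor_tmul,
      M.dt_rgt, N.dt_lft]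
    abel

lemma tensor_induction {A : Subalgebra k (Pol k)} {M N : HqBimod k}
    {P : TensorProduct k M.carrier N.carrier ⧸ tensorRel A M N → Prop}
    (h0 : ∀ m n, P (Submodule.Quotient.mk (TensorProduct.tmul k m n)))
    (hadd : ∀ x y, P x → P y → P (x + y)) (x) : P x := by
  obtain ⟨y, rfl⟩ := Submodule.Quotient.mk_surjective _ x
  induction y using TensorProduct.induction_on with
  | zero => simpa using h0 0 0
  | tmul m n => exact h0 m n
  | add a b ha hb => simpa using hadd _ _ ha hb

lemma tensor_ext {A : Subalgebra k (Pol k)} {M N : HqBimod k}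
    {f g : Module.End k (TensorProduct k M.carrier N.carrier ⧸ tensorRel A M N)}
    (h : ∀ m n, f (Submodule.Quotient.mk (TensorProduct.tmul k m n)) =
      g (Submodule.Quotient.mk (TensorProduct.tmul k m n))) : f = g := by
  refine LinearMap.ext fun x => ?_
  induction x using tensor_induction with
  | h0 m n => exact h m n
  | hadd x y hx hy => rw [map_add, map_add, hx, hy]

/-- The tensor product `M ⊗_A N` over a subalgebra `A ⊆ R` stable under `∂_q`, with the left action
on `M`, the right action on `N`, and `∂_q`, `∂_t` acting by the Leibniz rule. -/
noncomputable def tensor (A : Subalgebra k (Pol k)) (hA : ∀ a ∈ A, polDer k a ∈ A)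
    (M N : HqBimod k) : HqBimod k where
  carrier := TensorProduct k M.carrier N.carrier ⧸ tensorRel A M N
  lft :=
    { toFun := fun b => Submodule.mapQ _ _ _ (tensorRel_le_lft A M N b)
      map_one' := tensor_ext fun m n => by simp
      map_mul' := fun a b => tensor_ext fun m n => by simp
      map_zero' := tensor_ext fun m n => by simp
      map_add' := fun a b => tensor_ext fun m n => by simp
      commutes' := fun c => tensor_ext fun m n => by simp [Module.algebraMap_end_apply, ← TensorProduct.smul_tmul'] }
  rgt :=
    { toFun := fun b => Submodule.mapQ _ _ _ (tensorRel_le_rgt A M N b)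
      map_one' := tensor_ext fun m n => by simp
      map_mul' := fun a b => tensor_ext fun m n => by simp
      map_zero' := tensor_ext fun m n => by simp
      map_add' := fun a b => tensor_ext fun m n => by simp
      commutes' := fun c => tensor_ext fun m n => by simp [Module.algebraMap_end_apply] }
  lft_rgt := fun a b x => by
    induction x using tensor_induction with
    | h0 m n => simp
    | hadd x y hx hy => simp only [map_add, hx, hy]
  dq := Submodule.mapQ _ _ _ (tensorRel_le_dq A hA M N)
  dq_lft := fun a x => by
    induction x using tensor_induction with
    | h0 m n =>
      simp [M.dq_lft, TensorProduct.add_tmul, add_assoc]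
    | hadd x y hx hy => simp only [map_add, hx, hy]; abel
  dq_rgt := fun a x => by
    induction x using tensor_induction with
    | h0 m n =>
      simp [N.dq_rgt, TensorProduct.tmul_add, add_left_comm]
    | hadd x y hx hy => simp only [map_add, hx, hy]; abel
  dt := Submodule.mapQ _ _ _ (tensorRel_le_dt A M N)
  dt_lft := fun a x => by
    induction x using tensor_induction with
    | h0 m n => simp [M.dt_lft]
    | hadd x y hx hy => simp only [map_add, hx, hy]
  dt_rgt := fun a x => by
    induction x using tensor_induction with
    | h0 m n => simp [N.dt_rgt]
    | hadd x y hx hy => simp only [map_add, hx, hy]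
  dt_dq := fun x => by
    induction x using tensor_induction with
    | h0 m n =>
      simp [M.dt_dq, N.dt_dq]
      abel
    | hadd x y hx hy => simp only [map_add, hx, hy]
  gr := fun e => (⨆ i : ℤ, Submodule.map₂ (TensorProduct.mk k M.carrier N.carrier)
    (M.gr i) (N.gr (e - i))).map (tensorRel A M N).mkQ

lemma polDer_rename (s : Equiv.Perm (Fin 2)) (f : Pol k) :
    MvPolynomial.rename s (polDer k f) = polDer k (MvPolynomial.rename s f) := by
  induction f using MvPolynomial.induction_on with
  | C a => simp [polDer]
  | add f g hf hg => simp [hf, hg]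
  | mul_X f i hf =>
    simp only [Derivation.leibniz, map_add, smul_eq_mul, map_mul, hf, MvPolynomial.rename_X]
    simp [polDer]

lemma polDer_symmetric (a : Pol k) (ha : a ∈ MvPolynomial.symmetricSubalgebra (Fin 2) k) :
    polDer k a ∈ MvPolynomial.symmetricSubalgebra (Fin 2) k := by
  rw [MvPolynomial.mem_symmetricSubalgebra] at ha ⊢
  intro s
  rw [polDer_rename, ha s]

/-- The bimodule `B = R ⊗_{R^{S_2}} R`. -/
noncomputable def B (k : Type u) [Field k] : HqBimod k :=
  tensor (MvPolynomial.symmetricSubalgebra (Fin 2) k) polDer_symmetric (reg k) (reg k)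

/-- The tensor product `M ⊗_R N`. -/
noncomputable def tensorR (M N : HqBimod k) : HqBimod k :=
  tensor ⊤ (fun _ _ => Algebra.mem_top) M N

lemma mul'_rel (m n a : Pol k) : LinearMap.mul' k (Pol k)
    (TensorProduct.tmul k (a * m) n - TensorProduct.tmul k m (a * n)) = 0 := by
  rw [map_sub, LinearMap.mul'_apply, LinearMap.mul'_apply]
  ring

/-- The multiplication map `br : B → R`, `f ⊗ g ↦ f g`. -/
noncomputable def br (k : Type u) [Field k] : (B k).carrier →ₗ[k] (reg k).carrier :=
  Submodule.liftQ (tensorRel (MvPolynomial.symmetricSubalgebra (Fin 2) k) (reg k) (reg k))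
    (LinearMap.mul' k (Pol k)) <| Submodule.span_le.mpr <| by
      rintro z ⟨m, n, a, ha, rfl⟩
      exact mul'_rel m n a

lemma br_comm (f : (B k).carrier →ₗ[k] (B k).carrier) (g : (reg k).carrier →ₗ[k] (reg k).carrier)
    (h : ∀ m n : (reg k).carrier, br k (f (Submodule.Quotient.mk (TensorProduct.tmul k m n))) =
      g (br k (Submodule.Quotient.mk (TensorProduct.tmul k m n)))) (x : (B k).carrier) :
    br k (f x) = g (br k x) := by
  induction x using tensor_induction with
  | h0 m n => exact h m n
  | hadd x y hx hy =>
    have e1 : br k (f (x + y)) = br k (f x) + br k (f y) :=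
      (congrArg (br k) (map_add f x y)).trans (map_add (br k) _ _)
    have e2 : g (br k (x + y)) = g (br k x) + g (br k y) :=
      (congrArg g (map_add (br k) x y)).trans (map_add g _ _)
    exact e1.trans ((congrArg₂ (· + ·) hx hy).trans e2.symm)

lemma br_lft (a : Pol k) (x : (B k).carrier) : br k ((B k).lft a x) = (reg k).lft a (br k x) :=
  br_comm ((B k).lft a) ((reg k).lft a) (fun m n => mul_assoc (G := Pol k) a m n) x

lemma br_rgt (a : Pol k) (x : (B k).carrier) : br k ((B k).rgt a x) = (reg k).rgt a (br k x) :=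
  br_comm ((B k).rgt a) ((reg k).rgt a) (fun m n => mul_left_comm (G := Pol k) m a n) x

lemma polDer_mul (m n : Pol k) :
    polDer k m * n + m * polDer k n = polDer k (m * n) := by
  rw [Derivation.leibniz, smul_eq_mul, smul_eq_mul]
  ring

lemma br_dq (x : (B k).carrier) : br k ((B k).dq x) = (reg k).dq (br k x) :=
  br_comm (B k).dq (reg k).dq (fun m n => polDer_mul m n) x

/-- The elementary braiding complex `pT = q^{-3} (B → R[-1])` on two strands, `R[-1]` consisting of
`p - 1` copies of `R` joined by identity maps, in collapsed `q`-shifts `2, 4, …, 2p - 2`. -/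
noncomputable def pT (k : Type u) [Field k] (p : ℕ) : HqBimod k where
  carrier := (B k).carrier × (Fin (p - 1) → (reg k).carrier)
  lft :=
    { toFun := fun a => ((B k).lft a).prodMap (((reg k).lft a).compLeft (Fin (p - 1)))
      map_one' := by ext <;> simp
      map_mul' := fun a b => by ext <;> simp
      map_zero' := by ext <;> simp
      map_add' := fun a b => by ext <;> simp
      commutes' := fun c => by ext <;> simp [Module.algebraMap_end_apply] }
  rgt :=
    { toFun := fun a => ((B k).rgt a).prodMap (((reg k).rgt a).compLeft (Fin (p - 1)))
      map_one' := by ext <;> simp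
      map_mul' := fun a b => by ext <;> simp
      map_zero' := by ext <;> simp
      map_add' := fun a b => by ext <;> simp
      commutes' := fun c => by ext <;> simp [Module.algebraMap_end_apply] }
  lft_rgt := fun a b m =>
    Prod.ext ((B k).lft_rgt a b m.1) (funext fun j => (reg k).lft_rgt a b (m.2 j))
  dq := (B k).dq.prodMap ((reg k).dq.compLeft (Fin (p - 1)))
  dq_lft := fun a m =>
    Prod.ext ((B k).dq_lft a m.1) (funext fun j => (reg k).dq_lft a (m.2 j))
  dq_rgt := fun a m =>
    Prod.ext ((B k).dq_rgt a m.1) (funext fun j => (reg k).dq_rgt a (m.2 j))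
  dt := LinearMap.prod 0 <| LinearMap.pi fun j : Fin (p - 1) =>
    if h : (j : ℕ) = 0 then br k ∘ₗ LinearMap.fst k _ _
    else LinearMap.proj (⟨(j : ℕ) - 1, by have := j.isLt; omega⟩ : Fin (p - 1)) ∘ₗ
      LinearMap.snd k _ _
  dt_lft := fun a m => by
    refine Prod.ext ?_ (funext fun j => ?_)
    · simp
    · by_cases h : (j : ℕ) = 0 <;> simp [h, br_lft]
  dt_rgt := fun a m => by
    refine Prod.ext ?_ (funext fun j => ?_)
    · simp
    · by_cases h : (j : ℕ) = 0 <;> simp [h, br_rgt]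
  dt_dq := fun m => by
    refine Prod.ext ?_ (funext fun j => ?_)
    · simp
    · by_cases h : (j : ℕ) = 0 <;> simp [h, br_dq]
  gr := fun e => ((B k).gr (e + 3)).prod <| Submodule.pi Set.univ fun j : Fin (p - 1) =>
    (reg k).gr (e + 3 - 2 * (((j : ℕ) : ℤ) + 1))

/-- The complex `pT_β = pT ⊗_R ⋯ ⊗_R pT` (`n` factors) of the braid `β = σ_1^n` on two strands,
whose closure is the torus link `T_{2,n}`. -/
noncomputable def braidComplex (k : Type u) [Field k] (p : ℕ) : ℕ → HqBimod k
  | 0 => reg k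
  | n + 1 => tensorR (braidComplex k p n) (pT k p)

/-!
### Hochschild homology

The relative Hochschild homology of a bimodule `M` is the homology of the Koszul complex
`M → M ⊕ M → M`, that is, `M ⊗_{R ⊗ R} C_2` for the two-variable Koszul resolution `C_2` of `R`.
-/

open MvPolynomial in
/-- The commutator `m ↦ x_i m - m x_i`. -/
noncomputable def kos (M : HqBimod k) (i : Fin 2) : Module.End k M.carrier :=
  M.lft (X i) - M.rgt (X i)

open MvPolynomial in
/-- The operator `m ↦ x_i m + m x_i`, the twist of `∂_q` on the Koszul generator `dx_i`. -/
noncomputable def twist (M : HqBimod k) (i : Fin 2) : Module.End k M.carrier :=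
  M.lft (X i) + M.rgt (X i)

open MvPolynomial in
/-- The operator `m ↦ x_i^2 m + m x_i^2`. -/
noncomputable def cau (M : HqBimod k) (i : Fin 2) : Module.End k M.carrier :=
  M.lft (X i ^ 2) + M.rgt (X i ^ 2)

/-- Koszul differential from Hochschild degree one to zero. -/
noncomputable def kosD1 (M : HqBimod k) : M.carrier × M.carrier →ₗ[k] M.carrier :=
  (kos M 0).coprod (kos M 1)

/-- Koszul differential from Hochschild degree two to one. -/
noncomputable def kosD2 (M : HqBimod k) : M.carrier →ₗ[k] M.carrier × M.carrier :=
  (kos M 1).prod (-(kos M 0))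

/-- The differential `d_C` on the Koszul complex, from Hochschild degree one to zero. -/
noncomputable def cauD1 (M : HqBimod k) : M.carrier × M.carrier →ₗ[k] M.carrier :=
  (cau M 0).coprod (cau M 1)

/-- The differential `d_C` on the Koszul complex, from Hochschild degree two to one. -/
noncomputable def cauD2 (M : HqBimod k) : M.carrier →ₗ[k] M.carrier × M.carrier :=
  (cau M 1).prod (-(cau M 0))

/-- `∂_q` on the Koszul complex in Hochschild degree one. -/
noncomputable def dq1 (M : HqBimod k) : M.carrier × M.carrier →ₗ[k] M.carrier × M.carrier :=
  (M.dq + twist M 0).prodMap (M.dq + twist M 1)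

/-- `∂_q` on the Koszul complex in Hochschild degree two. -/
noncomputable def dq2 (M : HqBimod k) : M.carrier →ₗ[k] M.carrier :=
  M.dq + twist M 0 + twist M 1

/-- Hochschild homology in degree zero. -/
abbrev HH0 (M : HqBimod k) : Type u := M.carrier ⧸ LinearMap.range (kosD1 M)

/-- Hochschild homology in degree one. -/
abbrev HH1 (M : HqBimod k) : Type u :=
  LinearMap.ker (kosD1 M) ⧸
    (LinearMap.range (kosD2 M)).comap (LinearMap.ker (kosD1 M)).subtype

/-- Hochschild homology in degree two. -/
abbrev HH2 (M : HqBimod k) : Type u := LinearMap.ker (kosD2 M)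

section Induced

variable {M : HqBimod k}

/-- The map induced on `HH0` by an endomorphism of the Koszul complex. -/
noncomputable def mapHH0 {f0 : M.carrier →ₗ[k] M.carrier}
    {f1 : M.carrier × M.carrier →ₗ[k] M.carrier × M.carrier}
    (h : ∀ v, f0 (kosD1 M v) = kosD1 M (f1 v)) : HH0 M →ₗ[k] HH0 M :=
  Submodule.mapQ _ _ f0 (by rintro _ ⟨v, rfl⟩; exact ⟨f1 v, (h v).symm⟩)

/-- The map induced on `HH1` by an endomorphism of the Koszul complex. -/
noncomputable def mapHH1 {f0 : M.carrier →ₗ[k] M.carrier}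
    {f1 : M.carrier × M.carrier →ₗ[k] M.carrier × M.carrier} {f2 : M.carrier →ₗ[k] M.carrier}
    (h : ∀ v, f0 (kosD1 M v) = kosD1 M (f1 v)) (h' : ∀ m, f1 (kosD2 M m) = kosD2 M (f2 m)) :
    HH1 M →ₗ[k] HH1 M :=
  Submodule.mapQ _ _
    (f1.restrict fun v hv => by
      rw [LinearMap.mem_ker] at hv ⊢
      rw [← h, hv, map_zero])
    (by
      rintro v ⟨m, hm⟩
      exact ⟨f2 m, (h' m).symm.trans (congrArg f1 hm)⟩)

/-- The map induced on `HH2` by an endomorphism of the Koszul complex. -/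
noncomputable def mapHH2 {f1 : M.carrier × M.carrier →ₗ[k] M.carrier × M.carrier}
    {f2 : M.carrier →ₗ[k] M.carrier} (h' : ∀ m, f1 (kosD2 M m) = kosD2 M (f2 m)) :
    HH2 M →ₗ[k] HH2 M :=
  f2.restrict fun m hm => by
    rw [LinearMap.mem_ker] at hm ⊢
    rw [← h', hm, map_zero]

end Induced

lemma lft_comm (M : HqBimod k) (a b : Pol k) (m : M.carrier) :
    M.lft a (M.lft b m) = M.lft b (M.lft a m) := by
  rw [← Module.End.mul_apply, ← Module.End.mul_apply, ← map_mul, ← map_mul, mul_comm]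

lemma rgt_comm (M : HqBimod k) (a b : Pol k) (m : M.carrier) :
    M.rgt a (M.rgt b m) = M.rgt b (M.rgt a m) := by
  rw [← Module.End.mul_apply, ← Module.End.mul_apply, ← map_mul, ← map_mul, mul_comm]

lemma kos_cau (M : HqBimod k) (i j : Fin 2) (m : M.carrier) :
    kos M i (cau M j m) = cau M j (kos M i m) := by
  simp only [kos, cau, LinearMap.sub_apply, LinearMap.add_apply, map_add, map_sub, M.lft_rgt]
  rw [M.lft_comm (MvPolynomial.X i), M.rgt_comm (MvPolynomial.X i)]
  abel

lemma kos_twist (M : HqBimod k) (i j : Fin 2) (m : M.carrier) :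
    kos M i (twist M j m) = twist M j (kos M i m) := by
  simp only [kos, twist, LinearMap.sub_apply, LinearMap.add_apply, map_add, map_sub, M.lft_rgt]
  rw [M.lft_comm (MvPolynomial.X i), M.rgt_comm (MvPolynomial.X i)]
  abel

lemma dq_kos (M : HqBimod k) (i : Fin 2) (m : M.carrier) :
    M.dq (kos M i m) = kos M i (M.dq m) + kos M i (twist M i m) := by
  have h : polDer k (MvPolynomial.X i) = MvPolynomial.X i * MvPolynomial.X i := by
    simp [polDer, pow_two]
  simp only [kos, twist, LinearMap.sub_apply, LinearMap.add_apply, map_sub, map_add, M.dq_lft,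
    M.dq_rgt, h, map_mul, Module.End.mul_apply, M.lft_rgt]
  abel

lemma dt_kos (M : HqBimod k) (i : Fin 2) (m : M.carrier) :
    M.dt (kos M i m) = kos M i (M.dt m) := by
  simp only [kos, LinearMap.sub_apply, map_sub, M.dt_lft, M.dt_rgt]

lemma dq_kosD1 (M : HqBimod k) (v : M.carrier × M.carrier) :
    M.dq (kosD1 M v) = kosD1 M (dq1 M v) := by
  simp [kosD1, dq1, dq_kos]

lemma dq_kosD2 (M : HqBimod k) (m : M.carrier) : dq1 M (kosD2 M m) = kosD2 M (dq2 M m) := by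
  simp only [kosD2, dq1, dq2, LinearMap.prodMap_apply, LinearMap.prod_apply, Function.prod_apply,
    LinearMap.add_apply, LinearMap.neg_apply, map_add, map_neg, dq_kos, ← kos_twist]
  refine Prod.ext ?_ ?_ <;> simp only [Prod.fst_add, Prod.snd_add] <;> abel

lemma dt_kosD1 (M : HqBimod k) (v : M.carrier × M.carrier) :
    M.dt (kosD1 M v) = kosD1 M (M.dt.prodMap M.dt v) := by
  simp [kosD1, dt_kos]

lemma dt_kosD2 (M : HqBimod k) (m : M.carrier) :
    M.dt.prodMap M.dt (kosD2 M m) = kosD2 M (M.dt m) := by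
  simp [kosD2, dt_kos]

/-- The map `d_C : HH1 → HH0`. -/
noncomputable def cauHH1 (M : HqBimod k) : HH1 M →ₗ[k] HH0 M :=
  Submodule.mapQ _ _ (cauD1 M ∘ₗ (LinearMap.ker (kosD1 M)).subtype) <| by
    rintro v ⟨m, hm⟩
    have hm' : kosD2 M m = (v : M.carrier × M.carrier) := hm
    refine ⟨(-(cau M 1 m), cau M 0 m), ?_⟩
    simp only [LinearMap.comp_apply, Submodule.subtype_apply, ← hm']
    simp only [kosD1, kosD2, cauD1, LinearMap.coprod_apply, LinearMap.prod_apply,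
      Function.prod_apply, LinearMap.neg_apply, map_neg, kos_cau]
    abel

/-- The map `d_C : HH2 → HH1`. -/
noncomputable def cauHH2 (M : HqBimod k) : HH2 M →ₗ[k] HH1 M :=
  Submodule.mkQ _ ∘ₗ
    LinearMap.codRestrict (LinearMap.ker (kosD1 M))
      (cauD2 M ∘ₗ (LinearMap.ker (kosD2 M)).subtype) fun m => by
        have hm : kosD2 M (m : M.carrier) = 0 := m.2
        have h1 : kos M 1 (m : M.carrier) = 0 := congrArg Prod.fst hm
        have h0 : kos M 0 (m : M.carrier) = 0 := neg_eq_zero.mp (congrArg Prod.snd hm)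
        rw [LinearMap.mem_ker]
        simp [kosD1, cauD2, kos_cau, h0, h1]

/-- The `p`-Hochschild homology of `M`: the `p`-extension of Hochschild homology, in which the odd
term `HH1` is repeated `p - 1` times, so that `HH2` sits in position `p`, the copy of `HH1` with
index `s` in position `s + 1`, and `HH0` in position `0`. -/
abbrev PHH (p : ℕ) (M : HqBimod k) : Type u := HH2 M × (Fin (p - 1) → HH1 M) × HH0 M

/-- The `p`-differential `∂_C`: the map `d_C` on `HH2 → HH1` and `HH1 → HH0`, and the identity
between the repeated terms. -/
noncomputable def dC (p : ℕ) (M : HqBimod k) : PHH p M →ₗ[k] PHH p M :=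
  LinearMap.prod 0 <| LinearMap.prod
    (LinearMap.pi fun s : Fin (p - 1) =>
      if h : (s : ℕ) + 1 < p - 1 then
        LinearMap.proj (⟨(s : ℕ) + 1, h⟩ : Fin (p - 1)) ∘ₗ LinearMap.fst k _ _ ∘ₗ
          LinearMap.snd k _ _
      else cauHH2 M ∘ₗ LinearMap.fst k _ _)
    (if h : 0 < p - 1 then
      cauHH1 M ∘ₗ LinearMap.proj (⟨0, h⟩ : Fin (p - 1)) ∘ₗ LinearMap.fst k _ _ ∘ₗ
        LinearMap.snd k _ _
    else 0)

/-- The internal differential `∂_q` on `p`-Hochschild homology. -/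
noncomputable def dqPHH (p : ℕ) (M : HqBimod k) : PHH p M →ₗ[k] PHH p M :=
  (mapHH2 (dq_kosD2 M)).prodMap
    (((mapHH1 (dq_kosD1 M) (dq_kosD2 M)).compLeft (Fin (p - 1))).prodMap (mapHH0 (dq_kosD1 M)))

/-- The topological differential `∂_t` induced on `p`-Hochschild homology. -/
noncomputable def dtPHH (p : ℕ) (M : HqBimod k) : PHH p M →ₗ[k] PHH p M :=
  (mapHH2 (dt_kosD2 M)).prodMap
    (((mapHH1 (dt_kosD1 M) (dt_kosD2 M)).compLeft (Fin (p - 1))).prodMap (mapHH0 (dt_kosD1 M)))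

/-- The `p`-Hochschild homology with total differential `∂_T = ∂_t + ∂_C + ∂_q`, singly graded: the
Hochschild shift `a` is specialized to `q^2 [1]_∂`, so each Koszul generator `dx_i` contributes `4`
to the degree and the position `i` of a term contributes `-2i`. -/
noncomputable def total (p : ℕ) (M : HqBimod k) : QComplex k where
  carrier := PHH p M
  gr := fun e =>
    ((M.gr (e - 8 + 2 * (p : ℤ))).comap (LinearMap.ker (kosD2 M)).subtype).prod <|
      (Submodule.pi Set.univ fun s : Fin (p - 1) =>
        ((((M.gr (e - 4 + 2 * (((s : ℕ) : ℤ) + 1))).prod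
          (M.gr (e - 4 + 2 * (((s : ℕ) : ℤ) + 1)))).comap
            (LinearMap.ker (kosD1 M)).subtype).map (Submodule.mkQ _))).prod <|
      (M.gr e).map (Submodule.mkQ _)
  diff := dtPHH p M + dC p M + dqPHH p M

end HqBimod

open HqBimod

/-- The total complex `(pHH(pT_β), ∂_T)` of the closure `T_{2,n}` of `β = σ_1^n`. -/
noncomputable def torusComplex (k : Type u) [Field k] (p n : ℕ) : QComplex k :=
  total p (braidComplex k p n)

/-- The `sl_2` `p`-homology `pH(T_{2,n}) = q^{-2} H^/(pHH(pT_β), ∂_T)`, computed from the two-strand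
braid `σ_1^n` (with blackboard framing, so without framing factor). -/
noncomputable def pH (k : Type u) [Field k] (p n : ℕ) : QComplex k :=
  ((torusComplex k p n).slash p).qShift (-2)

end Bimodules

section Answer

open QComplex

variable (k : Type u) [Field k]

/-- `V_0 ⊕ q^2 V_0`. -/
def twoV : QComplex k := (V k 0).sum ((V k 0).qShift 2)

/-- `V_0 ⊕ q^2 V_0 ⊕ q^4 V_0`. -/
def threeV : QComplex k := (V k 0).sum (((V k 0).qShift 2).sum ((V k 0).qShift 4))

/-- The `p`-complex `X_i`. -/
def XComplex (p i : ℕ) : QComplex k :=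
  if (p : ℤ) ∣ 2 * (i : ℤ) + 1 then
    (((twoV k).qShift (4 * (i : ℤ) + 4)).shift p (2 * i + 1)).sum
      (((V k 1).qShift (4 * (i : ℤ) - 1)).shift p (2 * i))
  else if (p : ℤ) ∣ 2 * (i : ℤ) - 1 then
    (((V k 1).qShift (4 * (i : ℤ) + 5)).shift p (2 * i + 1)).sum
      (((twoV k).qShift (4 * (i : ℤ) - 2)).shift p (2 * i))
  else
    (((V k 1).qShift (4 * (i : ℤ) + 5)).shift p (2 * i + 1)).sum
      (((V k 1).qShift (4 * (i : ℤ) - 1)).shift p (2 * i))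

/-- The `p`-complex `Y_{n/2}` (for even `n`). -/
def YComplex (p n : ℕ) : QComplex k :=
  if (p : ℤ) ∣ (n : ℤ) - 1 then
    (((threeV k).qShift (2 * ((n : ℤ) - 1))).shift p n).sum (((V k 2).qShift (2 * (n : ℤ) + 2)).shift p n)
  else if (p : ℤ) ∣ (n : ℤ) then
    (((V k 2).qShift (2 * (n : ℤ))).shift p n).sum (((threeV k).qShift (2 * (n : ℤ))).shift p n)
  else
    (((V k 2).qShift (2 * (n : ℤ))).shift p n).sum (((V k 2).qShift (2 * (n : ℤ) + 2)).shift p n)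

/-- The indices `1 ≤ i ≤ m`, without the multiples of `3` when `p = 3`. -/
def indexSet (p m : ℕ) : Finset ℕ := (Finset.Icc 1 m).filter fun i => ¬ (p = 3 ∧ 3 ∣ i)

/-- The answer for `n` odd:
`q^{-3n-2} [-n] (q^5 V_1 [1] ⊕ ⨁_i X_i)`, `1 ≤ i ≤ (n-1)/2`. -/
def answerOdd (p n : ℕ) : QComplex k :=
  ((((V k 1).qShift 5).shift p 1).sum
    (bigSum (indexSet p ((n - 1) / 2)) (XComplex k p))).shiftNeg p n |>.qShift (-3 * (n : ℤ) - 2)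

/-- The answer for `n` even:
`q^{-3n-2} [-n] (q^5 V_1 [1] ⊕ ⨁_i X_i ⊕ Y_{n/2})`, `1 ≤ i ≤ (n-2)/2`. -/
def answerEven (p n : ℕ) : QComplex k :=
  ((((V k 1).qShift 5).shift p 1).sum
    ((bigSum (indexSet p ((n - 2) / 2)) (XComplex k p)).sum (YComplex k p n))).shiftNeg p n
      |>.qShift (-3 * (n : ℤ) - 2)

end Answer

end TorusLink

/-!
The complex of `T_{2,n}` is computed by a recursion on `n` in the homotopy category of `p`-complexes.
There a surjection with acyclic kernel is an isomorphism (`homotopyIso_of_surjective`, since graded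
acyclic complexes are contractible), and the square of the functor `[-1]` is the shift `q^{2p}`
(`sm_sm`). Write `T_n` for the total complex of the braid `σ_1^n`, and `e = x_1 + x_2`, `d = x_1 - x_2`.

Reduction to `B`. Since `M ⊗_R B = M ⊕ M y_1`, the bimodules of the braid have an explicit model `Mn`
(`exists_braidEquiv`), and `T_{n+1}` is `q^{-3}` times the cone of `pHH(M_n ⊗_R B) → T_n`
(`total_twistB`). For the left action of `R`, the right action of symmetric polynomials, `∂_t` and
`∂_q`, the complex `M_n` retracts onto a copy of `R` with twisted `∂_q` (`PolRetract.succ`). Hence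
`M_n ⊗_R B` may be replaced by a twisted copy `B_n` of `B` (`PolRetract.cone_iso`).

The maps. The map `pHH(B_{n+1}) → T_{n+1}` factors through a map `ψ : B_{n+1} → B_n` and the summand
`B_n` of `T_{n+1}`. For `n` even `ψ` vanishes on Hochschild homology (`tot_psi_even`), so `T_{n+2}` is the
sum of `pHH(B_{n+1})` and `T_{n+1}[-1]`, up to shifts (`cone_iso_even`). For `n` odd this shows that
`T_{n+1}` splits, so `T_{n+2}` is the sum of the cone of `ψ` and `T_n`, up to shifts
(`cone_iso_of_eq_zero`).

Finite models. The sequence `HH_2(B_n) → HH_1(B_n) → HH_0(B_n)` is the Koszul complex of a regular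
sequence (`Bn_acyclicSurj`), so `pHH(B_n)` is the algebra `k[e, d]/(e³, d² + e²)`, where `∂` is
multiplication by `n e` on powers of `e` and by `(n + 1) e` on their multiples by `d`; for `n` odd `ψ` is
multiplication by `d`. Its cone is the sum of two-dimensional complexes with operators
`n + 2` and `n` times a Jordan block (`cone_opD_iso_sum`), except that for `p = 3` it is contractible when
both factors are nonzero (`cone_opD_contractible`): these are the omitted indices. A nonzero factor
gives a balanced complex, the factor zero a sum of lines, whence the case distinctions.

All complexes obtained are sums of shifts of balanced complexes, which are isomorphic to their slash
homology (`SlashStable`), and slash homology is a homotopy functor.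
-/

namespace TorusLink

open Finset QComplex
open LinearMap (ker fst snd proj)
open MvPolynomial (X C esymm symmetricSubalgebra)
open scoped TensorProduct

variable {k : Type u} [Field k]

/-- The polynomials of a given degree, where the variables have degree two. -/
notation "polGr(" k ")" => MvPolynomial.weightedHomogeneousSubmodule k (fun _ : Fin 2 => (2 : ℤ))

/-! ### Commuting operators in characteristic `p` -/

section CharP

open scoped IsMulCommutative in
/-- The action of `k[x_1, x_2]` given by a commuting pair of elements of a `k`-algebra. -/
noncomputable def polHom {E : Type*} [Ring E] [Algebra k E] (a b : E) (h : Commute a b) :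
    Pol k →ₐ[k] E :=
  haveI : IsMulCommutative (Algebra.adjoin k ({a, b} : Set E)) :=
    Algebra.isMulCommutative_adjoin k (by
      intro x hx y hy
      rcases hx with rfl | rfl <;> rcases hy with rfl | rfl
      exacts [rfl, h.eq, h.eq.symm, rfl])
  (Subalgebra.val (Algebra.adjoin k ({a, b} : Set E))).comp
    (MvPolynomial.aeval (S₁ := Algebra.adjoin k ({a, b} : Set E))
      ![⟨a, Algebra.subset_adjoin (by simp)⟩, ⟨b, Algebra.subset_adjoin (by simp)⟩])

@[simp] lemma polHom_X0 {E : Type*} [Ring E] [Algebra k E] (a b : E) (h : Commute a b) :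
    polHom (k := k) a b h (X 0) = a := by
  simp [polHom]

@[simp] lemma polHom_X1 {E : Type*} [Ring E] [Algebra k E] (a b : E) (h : Commute a b) :
    polHom (k := k) a b h (X 1) = b := by
  simp [polHom]

variable (k) in
/-- In characteristic `p` the geometric sum `∑ a^i b^(p-1-i)` is the power `(a-b)^(p-1)`. -/
lemma geom_sum_eq_sub_pow (p : ℕ) [Fact p.Prime] [CharP k p] {E : Type*} [Ring E] [Algebra k E]
    (a b : E) (h : Commute a b) :
    ∑ i ∈ range p, a ^ i * b ^ (p - 1 - i) = (a - b) ^ (p - 1) := by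
  have hp : 0 < p := (Fact.out : p.Prime).pos
  have key : ∑ i ∈ range p, (X 0 : Pol k) ^ i * X 1 ^ (p - 1 - i) =
      (X 0 - X 1) ^ (p - 1) := by
    have hne : (X 0 - X 1 : Pol k) ≠ 0 := by
      rw [sub_ne_zero]
      exact fun h => by simpa using (MvPolynomial.X_injective (R := k) h)
    apply mul_right_cancel₀ hne
    rw [(Commute.all _ _).geom_sum₂_mul, ← pow_succ, Nat.sub_add_cancel hp, sub_pow_char]
  simpa using congrArg (polHom (k := k) a b h) key

variable (k) in
lemma add_pow_of_commute_zero (p : ℕ) [Fact p.Prime] [CharP k p] {E : Type*} [Ring E] [Algebra k E]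
    {a b : E} (h : Commute a b) (ha : a ^ p = 0) (hb : b ^ p = 0) : (a + b) ^ p = 0 := by
  have key : (X 0 + X 1 : Pol k) ^ p =
      X 0 ^ p + X 1 ^ p := add_pow_char _ _ _
  simpa [ha, hb] using congrArg (polHom (k := k) a b h) key

end CharP

section Homotopy

variable {M N L : Type*} [AddCommGroup M] [Module k M] [AddCommGroup N] [Module k N]
  [AddCommGroup L] [Module k L]

/-- The map `∑ ∂^i h ∂^(p-1-i)` attached to a homotopy `h`. -/
def homotopySum (p : ℕ) (D : M →ₗ[k] M) (D' : N →ₗ[k] N) (h : M →ₗ[k] N) : M →ₗ[k] N :=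
  ∑ i ∈ range p, (D' ^ i) ∘ₗ h ∘ₗ (D ^ (p - 1 - i))

/-- The commutator `h ↦ ∂ h - h ∂` on linear maps. -/
def adOp (D : M →ₗ[k] M) (D' : N →ₗ[k] N) : Module.End k (M →ₗ[k] N) where
  toFun h := D' ∘ₗ h - h ∘ₗ D
  map_add' := fun f g => by ext; simp; abel
  map_smul' := fun c f => by ext; simp [smul_sub]

lemma adOp_apply (D : M →ₗ[k] M) (D' : N →ₗ[k] N) (h : M →ₗ[k] N) :
    adOp D D' h = D' ∘ₗ h - h ∘ₗ D := rfl

lemma homotopySum_eq_adOp (p : ℕ) [Fact p.Prime] [CharP k p] (D : M →ₗ[k] M) (D' : N →ₗ[k] N)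
    (h : M →ₗ[k] N) : homotopySum p D D' h = ((adOp D D') ^ (p - 1)) h := by
  let L : Module.End k (M →ₗ[k] N) := LinearMap.compRight k D'
  let R : Module.End k (M →ₗ[k] N) := LinearMap.lcomp k N D
  have hL : ∀ (n : ℕ) (f : M →ₗ[k] N), (L ^ n) f = (D' ^ n) ∘ₗ f := by
    intro n
    induction n with
    | zero => intro f; simp [Module.End.one_eq_id]
    | succ n ih =>
      intro f; rw [pow_succ', Module.End.mul_apply, ih, pow_succ']; rfl
  have hR : ∀ (n : ℕ) (f : M →ₗ[k] N), (R ^ n) f = f ∘ₗ (D ^ n) := by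
    intro n
    induction n with
    | zero => intro f; simp [Module.End.one_eq_id]
    | succ n ih =>
      intro f; rw [pow_succ', Module.End.mul_apply, ih, pow_succ]; rfl
  have hc : Commute L R := by ext f x; rfl
  have e : adOp D D' = L - R := rfl
  rw [e, ← geom_sum_eq_sub_pow k p L R hc, homotopySum, LinearMap.sum_apply]
  refine sum_congr rfl fun i _ => ?_
  rw [Module.End.mul_apply, hR, hL]

lemma homotopySum_apply_of_diff_eq_zero {p : ℕ} (hp : 0 < p) {D : M →ₗ[k] M} {D' : N →ₗ[k] N}
    {h : M →ₗ[k] N} {x : M} (hx : D x = 0) :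
    homotopySum p D D' h x = (D' ^ (p - 1)) (h x) := by
  rw [homotopySum, LinearMap.sum_apply, sum_eq_single (p - 1)]
  · simp
  · intro i hi hne
    have : p - 1 - i = (p - 1 - i - 1) + 1 := by have := mem_range.mp hi; omega
    rw [this]
    simp [pow_succ, hx]
  · intro h; exact absurd (mem_range.mpr (by omega)) h

lemma homotopySum_comm {p : ℕ} {D : M →ₗ[k] M} {D' : N →ₗ[k] N}
    (hD : D ^ p = 0) (hD' : D' ^ p = 0) (h : M →ₗ[k] N) :
    D' ∘ₗ homotopySum p D D' h = homotopySum p D D' h ∘ₗ D := by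
  have h1 : D' ∘ₗ homotopySum p D D' h =
      ∑ i ∈ range p, (D' ^ (i + 1)) ∘ₗ h ∘ₗ (D ^ (p - (i + 1))) := by
    ext x; simp only [homotopySum, LinearMap.comp_apply, LinearMap.sum_apply, map_sum]
    refine sum_congr rfl fun i _ => ?_
    rw [pow_succ', Module.End.mul_apply, Nat.sub_sub, add_comm 1 i]
  have h2 : homotopySum p D D' h ∘ₗ D =
      ∑ i ∈ range p, (D' ^ i) ∘ₗ h ∘ₗ (D ^ (p - i)) := by
    ext x; simp only [homotopySum, LinearMap.comp_apply, LinearMap.sum_apply]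
    refine sum_congr rfl fun i hi => ?_
    have : p - i = (p - 1 - i) + 1 := by have := mem_range.mp hi; omega
    rw [this, pow_succ, Module.End.mul_apply]
  rw [h1, h2, ← sub_eq_zero, ← sum_sub_distrib,
    sum_range_sub (fun i => (D' ^ i) ∘ₗ h ∘ₗ (D ^ (p - i)))]
  simp [hD, hD']

lemma comp_pow_of_comm {D : M →ₗ[k] M} {D' : N →ₗ[k] N} {f : M →ₗ[k] N}
    (hf : ∀ x, f (D x) = D' (f x)) (n : ℕ) (x : M) : f ((D ^ n) x) = (D' ^ n) (f x) := by
  induction n generalizing x with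
  | zero => simp
  | succ n ih => rw [pow_succ, pow_succ, Module.End.mul_apply, Module.End.mul_apply, ih, hf]

lemma homotopySum_comp_left {p : ℕ} {D : M →ₗ[k] M} {D' : N →ₗ[k] N} {E : L →ₗ[k] L}
    {f : N →ₗ[k] L} (hf : ∀ x, f (D' x) = E (f x)) (h : M →ₗ[k] N) :
    f ∘ₗ homotopySum p D D' h = homotopySum p D E (f ∘ₗ h) := by
  ext x
  simp only [homotopySum, LinearMap.comp_apply, LinearMap.sum_apply, map_sum]
  exact sum_congr rfl fun i _ => comp_pow_of_comm hf _ _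

lemma homotopySum_comp_right {p : ℕ} {D : M →ₗ[k] M} {D' : N →ₗ[k] N} {E : L →ₗ[k] L}
    {f : L →ₗ[k] M} (hf : ∀ x, f (E x) = D (f x)) (h : M →ₗ[k] N) :
    homotopySum p D D' h ∘ₗ f = homotopySum p E D' (h ∘ₗ f) := by
  ext x
  simp only [homotopySum, LinearMap.comp_apply, LinearMap.sum_apply]
  exact sum_congr rfl fun i _ => by rw [comp_pow_of_comm hf]

/-- A homotopy commuting with a part `E`, `E'` of the differentials only sees the rest. -/
lemma homotopySum_add {p : ℕ} [Fact p.Prime] [CharP k p] {D E : M →ₗ[k] M} {D' E' : N →ₗ[k] N}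
    {h : M →ₗ[k] N} (hE : ∀ x, h (E x) = E' (h x)) (hDE : ∀ x, D (E x) = E (D x))
    (hDE' : ∀ x, D' (E' x) = E' (D' x)) :
    homotopySum p (D + E) (D' + E') h = homotopySum p D D' h := by
  rw [homotopySum_eq_adOp, homotopySum_eq_adOp]
  have : ∀ n : ℕ, ((adOp (D + E) (D' + E')) ^ n) h = ((adOp D D') ^ n) h ∧
      ∀ x, ((adOp D D') ^ n) h (E x) = E' (((adOp D D') ^ n) h x) := by
    intro n
    induction n with
    | zero => exact ⟨rfl, hE⟩
    | succ n ih =>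
      rw [pow_succ', pow_succ', Module.End.mul_apply, Module.End.mul_apply, ih.1]
      refine ⟨?_, fun x => ?_⟩
      · ext x; simp [adOp_apply, ih.2]
      · simp [adOp_apply, ih.2, hDE, hDE']
  exact (this _).1

end Homotopy

/-! ### Gradings -/

section Grading

variable {M N : Type*} [AddCommGroup M] [Module k M] [AddCommGroup N] [Module k N]

/-- `c` is the family of projections onto the homogeneous components of a grading. -/
structure IsProj (gr : ℤ → Submodule k M) (c : ℤ → M →ₗ[k] M) : Prop where
  mem : ∀ e x, c e x ∈ gr e
  same : ∀ e, ∀ x ∈ gr e, c e x = x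
  other : ∀ e e', e ≠ e' → ∀ x ∈ gr e, c e' x = 0
  fin : ∀ x, ∃ s : Finset ℤ, (∀ e ∉ s, c e x = 0) ∧ ∑ e ∈ s, c e x = x

lemma IsProj.isInternal {gr : ℤ → Submodule k M} {c : ℤ → M →ₗ[k] M} (h : IsProj gr c) :
    DirectSum.IsInternal gr := by
  classical
  constructor
  · rw [injective_iff_map_eq_zero]
    intro z hz
    refine DFinsupp.ext fun e => ?_
    have key : ∀ z : DirectSum ℤ fun i => gr i,
        c e (DirectSum.coeAddMonoidHom gr z) = (z e : M) := by
      intro z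
      induction z using DirectSum.induction_on with
      | zero => simp
      | of i x =>
        rw [DirectSum.coeAddMonoidHom_of]
        by_cases hi : i = e
        · subst hi; rw [h.same _ _ x.2, DirectSum.of_eq_same]
        · rw [h.other _ _ hi _ x.2, DirectSum.of_eq_of_ne _ _ _ (Ne.symm hi)]; rfl
      | add x y hx hy => rw [map_add, map_add, hx, hy]; rfl
    have := key z
    rw [hz, map_zero] at this
    exact Subtype.ext this.symm
  · intro x
    obtain ⟨s, -, hs⟩ := h.fin x
    refine ⟨∑ e ∈ s, DirectSum.of (fun i => gr i) e ⟨c e x, h.mem e x⟩, ?_⟩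
    rw [map_sum]
    simpa using hs

lemma exists_isProj {gr : ℤ → Submodule k M} (h : DirectSum.IsInternal gr) :
    ∃ c : ℤ → M →ₗ[k] M, IsProj gr c := by
  classical
  let φ : (DirectSum ℤ fun i => gr i) ≃ₗ[k] M :=
    LinearEquiv.ofBijective (DirectSum.coeLinearMap gr) h
  have hφ : ∀ e (x : gr e), φ.symm x = DirectSum.of (fun i => gr i) e x := by
    intro e x
    rw [LinearEquiv.symm_apply_eq]
    exact (DirectSum.coeLinearMap_of gr e x).symm
  refine ⟨fun e => (gr e).subtype ∘ₗ DirectSum.component k ℤ (fun i => gr i) e ∘ₗ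
    φ.symm.toLinearMap, ⟨fun e x => Subtype.property _, ?_, ?_, ?_⟩⟩
  · intro e x hx
    have := hφ e ⟨x, hx⟩
    simp only [LinearMap.comp_apply, LinearEquiv.coe_coe] at this ⊢
    rw [this]
    exact congrArg (Subtype.val (p := fun y => y ∈ gr e))
      (DirectSum.of_eq_same (β := fun i => gr i) e ⟨x, hx⟩)
  · intro e e' hne x hx
    have := hφ e ⟨x, hx⟩
    simp only [LinearMap.comp_apply, LinearEquiv.coe_coe] at this ⊢
    rw [this]
    exact congrArg (Subtype.val (p := fun y => y ∈ gr e'))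
      (DirectSum.of_eq_of_ne (β := fun i => gr i) e e' ⟨x, hx⟩ (Ne.symm hne))
  · intro x
    obtain ⟨z, rfl⟩ := φ.surjective x
    refine ⟨DFinsupp.support z, ?_, ?_⟩
    · intro e he
      have : z e = 0 := by simpa using he
      simp only [LinearMap.comp_apply, LinearEquiv.coe_coe, LinearEquiv.symm_apply_apply]
      exact congrArg Subtype.val this
    · have h2 : φ z = ∑ e ∈ DFinsupp.support z, (z e : M) := by
        conv_lhs => rw [← DirectSum.sum_support_of z]
        rw [map_sum]
        exact sum_congr rfl fun e _ => DirectSum.coeLinearMap_of gr e (z e)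
      rw [h2]
      refine sum_congr rfl fun e _ => ?_
      rw [← h2]
      simp only [LinearMap.comp_apply, LinearEquiv.coe_coe, LinearEquiv.symm_apply_apply]
      rfl

lemma IsProj.hom {gr : ℤ → Submodule k M} {c : ℤ → M →ₗ[k] M} (hc : IsProj gr c)
    {gr' : ℤ → Submodule k N} {c' : ℤ → N →ₗ[k] N} (hc' : IsProj gr' c')
    {f : M →ₗ[k] N} {d : ℤ} (hf : ∀ e, ∀ x ∈ gr e, f x ∈ gr' (e + d)) (e : ℤ) (x : M) :
    c' (e + d) (f x) = f (c e x) := by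
  obtain ⟨s, hs0, hs⟩ := hc.fin x
  conv_lhs => rw [← hs]
  rw [map_sum, map_sum]
  by_cases he : e ∈ s
  · rw [sum_eq_single_of_mem e he]
    · exact hc'.same _ _ (hf _ _ (hc.mem _ _))
    · intro b _ hb
      exact hc'.other _ _ (by omega) _ (hf _ _ (hc.mem _ _))
  · rw [hs0 e he, map_zero]
    refine sum_eq_zero fun b hb => hc'.other _ _ ?_ _ (hf _ _ (hc.mem _ _))
    intro h; apply he; rwa [show e = b by omega]

lemma IsProj.ext_hom {gr : ℤ → Submodule k M} {c : ℤ → M →ₗ[k] M} (hc : IsProj gr c)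
    {f g : M →ₗ[k] N} (h : ∀ e, ∀ x ∈ gr e, f x = g x) : f = g := by
  ext x
  obtain ⟨s, -, hs⟩ := hc.fin x
  rw [← hs, map_sum, map_sum]
  exact sum_congr rfl fun e _ => h e _ (hc.mem _ _)

/-- A subspace stable under the projections is graded. -/
lemma isProj_ker {gr : ℤ → Submodule k M} {c : ℤ → M →ₗ[k] M} (hc : IsProj gr c)
    {U : Submodule k M} (hU : ∀ e, ∀ x ∈ U, c e x ∈ U) :
    IsProj (fun e => (gr e).comap U.subtype) (fun e => (c e).restrict (hU e)) where
  mem e x := hc.mem e x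
  same e x hx := Subtype.ext (hc.same e x hx)
  other e e' hne x hx := Subtype.ext (hc.other e e' hne x hx)
  fin x := by
    obtain ⟨s, h0, hs⟩ := hc.fin x
    refine ⟨s, fun e he => Subtype.ext (h0 e he), Subtype.ext ?_⟩
    rw [Submodule.coe_sum]
    exact hs

lemma isProj_quot {gr : ℤ → Submodule k M} {c : ℤ → M →ₗ[k] M} (hc : IsProj gr c)
    {U : Submodule k M} (hU : ∀ e, ∀ x ∈ U, c e x ∈ U) :
    IsProj (fun e => (gr e).map U.mkQ) (fun e => U.mapQ U (c e) (hU e)) where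
  mem e x := by
    obtain ⟨x, rfl⟩ := Submodule.mkQ_surjective U x
    exact ⟨c e x, hc.mem e x, rfl⟩
  same e x hx := by
    obtain ⟨x, hx, rfl⟩ := hx
    exact congrArg U.mkQ (hc.same e x hx)
  other e e' hne x hx := by
    obtain ⟨x, hx, rfl⟩ := hx
    exact (congrArg U.mkQ (hc.other e e' hne x hx)).trans (map_zero _)
  fin x := by
    obtain ⟨x, rfl⟩ := Submodule.mkQ_surjective U x
    obtain ⟨s, h0, hs⟩ := hc.fin x
    refine ⟨s, fun e he => (congrArg U.mkQ (h0 e he)).trans (map_zero _), ?_⟩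
    conv_rhs => rw [← hs]
    rw [map_sum]
    rfl

lemma isProj_prod {gr : ℤ → Submodule k M} {c : ℤ → M →ₗ[k] M} (hc : IsProj gr c)
    {gr' : ℤ → Submodule k N} {c' : ℤ → N →ₗ[k] N} (hc' : IsProj gr' c') :
    IsProj (fun e => (gr e).prod (gr' e)) (fun e => (c e).prodMap (c' e)) where
  mem e x := ⟨hc.mem e _, hc'.mem e _⟩
  same e x hx := Prod.ext (hc.same e _ hx.1) (hc'.same e _ hx.2)
  other e e' hne x hx := Prod.ext (hc.other e e' hne _ hx.1) (hc'.other e e' hne _ hx.2)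
  fin x := by
    classical
    obtain ⟨s, h0, hs⟩ := hc.fin x.1
    obtain ⟨s', h0', hs'⟩ := hc'.fin x.2
    refine ⟨s ∪ s', fun e he => Prod.ext (h0 e fun h => he (mem_union_left _ h))
      (h0' e fun h => he (mem_union_right _ h)), Prod.ext ?_ ?_⟩
    · rw [Prod.fst_sum]
      refine Eq.trans (sum_subset subset_union_left fun e _ he => h0 e he).symm hs
    · rw [Prod.snd_sum]
      refine Eq.trans (sum_subset subset_union_right fun e _ he => h0' e he).symm hs'

lemma isProj_pi {ι : Type*} [Fintype ι] {M : ι → Type*} [∀ i, AddCommGroup (M i)]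
    [∀ i, Module k (M i)] {gr : ∀ i, ℤ → Submodule k (M i)} {c : ∀ i, ℤ → M i →ₗ[k] M i}
    (hc : ∀ i, IsProj (gr i) (c i)) :
    IsProj (fun e => Submodule.pi Set.univ fun i => gr i e)
      (fun e => LinearMap.pi fun i => c i e ∘ₗ proj i) where
  mem e x := fun i _ => (hc i).mem e _
  same e x hx := funext fun i => (hc i).same e _ (hx i trivial)
  other e e' hne x hx := funext fun i => (hc i).other e e' hne _ (hx i trivial)
  fin x := by
    classical
    choose s h0 hs using fun i => (hc i).fin (x i)
    refine ⟨univ.biUnion s, fun e he => funext fun i => h0 i e fun h =>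
      he (mem_biUnion.mpr ⟨i, mem_univ i, h⟩), funext fun i => ?_⟩
    rw [Finset.sum_apply]
    refine Eq.trans (sum_subset (subset_biUnion_of_mem s (mem_univ i)) fun e _ he => h0 i e he).symm
      (hs i)

lemma isProj_shift {gr : ℤ → Submodule k M} {c : ℤ → M →ₗ[k] M} (hc : IsProj gr c) (a : ℤ) :
    IsProj (fun e => gr (e + a)) (fun e => c (e + a)) where
  mem e x := hc.mem _ x
  same e x hx := hc.same _ x hx
  other e e' hne x hx := hc.other _ _ (by omega) x hx
  fin x := by
    obtain ⟨s, h0, hs⟩ := hc.fin x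
    refine ⟨s.map (Equiv.subRight a).toEmbedding, fun e he => h0 _ fun h => he ?_, ?_⟩
    · exact mem_map.mpr ⟨e + a, h, by simp⟩
    · rw [sum_map]; simpa using hs

/-- A homogeneous map between graded spaces has a homogeneous pseudo-inverse. -/
lemma exists_pseudoInverse {gr : ℤ → Submodule k M} {gr' : ℤ → Submodule k N}
    (hM : DirectSum.IsInternal gr) (hN : DirectSum.IsInternal gr')
    (f : M →ₗ[k] N) (d : ℤ) (hf : ∀ e, ∀ x ∈ gr e, f x ∈ gr' (e + d)) :
    ∃ g : N →ₗ[k] M, (∀ e, ∀ x ∈ gr' e, g x ∈ gr (e - d)) ∧ f ∘ₗ g ∘ₗ f = f := by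
  classical
  have step : ∀ e, ∃ g : N →ₗ[k] gr e, ∀ x ∈ gr e, f (g (f x)) = f x := by
    intro e
    let fe : gr e →ₗ[k] N := f ∘ₗ (gr e).subtype
    obtain ⟨σ, hσ⟩ := fe.rangeRestrict.exists_rightInverse_of_surjective fe.range_rangeRestrict
    obtain ⟨ρ, hρ⟩ := (LinearMap.range fe).subtype.exists_leftInverse_of_injective
      (Submodule.ker_subtype _)
    refine ⟨σ ∘ₗ ρ, fun x hx => ?_⟩
    have h1 : ρ (f x) = fe.rangeRestrict ⟨x, hx⟩ :=
      LinearMap.congr_fun hρ (fe.rangeRestrict ⟨x, hx⟩)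
    have h2 : fe.rangeRestrict (σ (ρ (f x))) = ρ (f x) := LinearMap.congr_fun hσ (ρ (f x))
    have h3 := congrArg Subtype.val (h2.trans h1)
    exact h3
  choose g hg using step
  let φ : (DirectSum ℤ fun i => gr' i) ≃ₗ[k] N :=
    LinearEquiv.ofBijective (DirectSum.coeLinearMap gr') hN
  have hφ : ∀ e (x : gr' e), φ.symm x = DirectSum.lof k ℤ (fun i => gr' i) e x := by
    intro e x
    rw [LinearEquiv.symm_apply_eq]
    exact (DirectSum.coeLinearMap_lof gr' e x).symm
  let ψ : N →ₗ[k] M := DirectSum.toModule k ℤ M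
    (fun e => (gr (e - d)).subtype ∘ₗ g (e - d) ∘ₗ (gr' e).subtype) ∘ₗ φ.symm.toLinearMap
  have hψ : ∀ e, ∀ x ∈ gr' e, ψ x = g (e - d) x := by
    intro e x hx
    have := hφ e ⟨x, hx⟩
    simp only [ψ, LinearMap.comp_apply, LinearEquiv.coe_coe] at this ⊢
    rw [this, DirectSum.toModule_lof]
    rfl
  refine ⟨ψ, fun e x hx => ?_, ?_⟩
  · rw [hψ e x hx]; exact Subtype.property _
  · obtain ⟨c, hc⟩ := exists_isProj hM
    refine hc.ext_hom fun e x hx => ?_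
    rw [LinearMap.comp_apply, LinearMap.comp_apply, hψ _ _ (hf e x hx), add_sub_cancel_right]
    exact hg e x hx

end Grading

/-! ### Acyclic complexes -/

section Acyclic

variable {M N : Type*} [AddCommGroup M] [Module k M] [AddCommGroup N] [Module k N]

/-- On the subspace `U`, every cycle of `∂` is in the image of `∂^(p-1)`. -/
def AcyclicOn (p : ℕ) (D : M →ₗ[k] M) (U : Submodule k M) : Prop :=
  ∀ x ∈ U, D x = 0 → ∃ y ∈ U, (D ^ (p - 1)) y = x

lemma pow_mem_of_stable {D : M →ₗ[k] M} {U : Submodule k M} (h : ∀ x ∈ U, D x ∈ U) (n : ℕ) {x : M}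
    (hx : x ∈ U) : (D ^ n) x ∈ U := by
  induction n generalizing x with
  | zero => simpa using hx
  | succ n ih => rw [pow_succ, Module.End.mul_apply]; exact ih (h x hx)

/-- An extension of acyclic complexes is acyclic. -/
lemma AcyclicOn.of_map {p : ℕ} (hp : 0 < p) {D : M →ₗ[k] M} {D' : N →ₗ[k] N} {U : Submodule k M}
    (hU : ∀ x ∈ U, D x ∈ U) (hD : ∀ x ∈ U, (D ^ p) x = 0) (f : M →ₗ[k] N)
    (hf : ∀ x ∈ U, f (D x) = D' (f x)) (h1 : AcyclicOn p D (U ⊓ ker f))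
    (h2 : AcyclicOn p D' (U.map f)) : AcyclicOn p D U := by
  have hfn : ∀ (n : ℕ), ∀ x ∈ U, f ((D ^ n) x) = (D' ^ n) (f x) := by
    intro n
    induction n with
    | zero => simp
    | succ n ih =>
      intro x hx
      rw [pow_succ, pow_succ, Module.End.mul_apply, Module.End.mul_apply, ih _ (hU x hx), hf x hx]
  intro x hx hDx
  obtain ⟨y', ⟨y, hy, rfl⟩, hy'⟩ := h2 (f x) ⟨x, hx, rfl⟩ (by rw [← hf x hx, hDx, map_zero])
  rw [← hfn _ _ hy] at hy'
  obtain ⟨w, hw, hw'⟩ := h1 (x - (D ^ (p - 1)) y)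
    ⟨U.sub_mem hx (pow_mem_of_stable hU _ hy), by simp [hy']⟩ (by
      rw [map_sub, hDx, ← Module.End.mul_apply, ← pow_succ', Nat.sub_add_cancel hp, hD y hy,
        sub_zero])
  refine ⟨y + w, U.add_mem hy hw.1, ?_⟩
  rw [map_add, hw']; abel

lemma AcyclicOn.map {p : ℕ} {D : M →ₗ[k] M} {D' : N →ₗ[k] N} {U : Submodule k M}
    (h : AcyclicOn p D U) {f : M →ₗ[k] N} (hf : ∀ x, f (D x) = D' (f x))
    (hinj : Function.Injective f) : AcyclicOn p D' (U.map f) := by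
  rintro _ ⟨x, hx, rfl⟩ hx'
  rw [← hf] at hx'
  obtain ⟨y, hy, hy'⟩ := h x hx (hinj (by rw [hx', map_zero]))
  exact ⟨f y, ⟨y, hy, rfl⟩, by rw [← comp_pow_of_comm hf, hy']⟩

lemma acyclicOn_bot (p : ℕ) (D : M →ₗ[k] M) : AcyclicOn p D ⊥ := by
  rintro x hx -
  exact ⟨0, zero_mem _, by rw [map_zero, (Submodule.mem_bot k).mp hx]⟩

lemma acyclicOn_top_of_homotopy {p : ℕ} (hp : 0 < p) {D : M →ₗ[k] M} {h : M →ₗ[k] M}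
    (H : homotopySum p D D h = LinearMap.id) : AcyclicOn p D ⊤ := by
  intro x _ hx
  refine ⟨h x, trivial, ?_⟩
  rw [← homotopySum_apply_of_diff_eq_zero hp hx, H]; rfl

/-- The operator on `M^m` shifting the copies of `M`. -/
def blkShift (k : Type u) [Field k] (m : ℕ) (M : Type*) [AddCommGroup M] [Module k M] :
    (Fin m → M) →ₗ[k] (Fin m → M) :=
  LinearMap.pi fun j =>
    if h : (j : ℕ) = 0 then 0
    else proj (⟨(j : ℕ) - 1, by have := j.isLt; omega⟩ : Fin m)

lemma blkShift_apply (m : ℕ) (y : Fin m → M) (j : Fin m) :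
    blkShift k m M y j = if h : (j : ℕ) = 0 then 0 else y ⟨(j : ℕ) - 1, by omega⟩ := by
  simp only [blkShift, LinearMap.pi_apply]
  split_ifs <;> simp

lemma blkShift_pow_apply (m n : ℕ) (y : Fin m → M) (j : Fin m) :
    (blkShift k m M ^ n) y j = if h : n ≤ (j : ℕ) then y ⟨(j : ℕ) - n, by omega⟩ else 0 := by
  induction n generalizing j with
  | zero => simp
  | succ n ih =>
    rw [pow_succ', Module.End.mul_apply, blkShift_apply]
    by_cases h0 : (j : ℕ) = 0
    · rw [dif_pos h0, dif_neg (by omega)]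
    · rw [dif_neg h0, ih]
      by_cases h : n + 1 ≤ (j : ℕ)
      · rw [dif_pos (by simp; omega), dif_pos h]
        congr 2; simp; omega
      · rw [dif_neg (by simp; omega), dif_neg h]

lemma blkShift_pow_eq_zero {m n : ℕ} (h : m ≤ n) : blkShift k m M ^ n = 0 := by
  refine LinearMap.ext fun y => funext fun j => ?_
  rw [blkShift_pow_apply, dif_neg (by omega)]; rfl

/-- The differential of `m` copies of `M` joined by identity maps. -/
def blkDiff (m : ℕ) (D : M →ₗ[k] M) : (Fin m → M) →ₗ[k] (Fin m → M) :=
  blkShift k m M + D.compLeft (Fin m)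

lemma blkDiff_apply (m : ℕ) (D : M →ₗ[k] M) (y : Fin m → M) (j : Fin m) :
    blkDiff m D y j = (if h : (j : ℕ) = 0 then 0 else y ⟨(j : ℕ) - 1, by omega⟩) + D (y j) := by
  simp [blkDiff, blkShift_apply]

lemma blkShift_comm (m : ℕ) (D : M →ₗ[k] N) (y : Fin m → M) :
    blkShift k m N (D.compLeft (Fin m) y) = D.compLeft (Fin m) (blkShift k m M y) := by
  funext j
  simp only [blkShift_apply, LinearMap.compLeft_apply, Function.comp_apply]
  split_ifs <;> simp

lemma blkDiff_map {D : M →ₗ[k] M} {D' : N →ₗ[k] N} {f : M →ₗ[k] N} (hf : ∀ x, f (D x) = D' (f x))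
    (m : ℕ) (y : Fin m → M) :
    f.compLeft (Fin m) (blkDiff m D y) = blkDiff m D' (f.compLeft (Fin m) y) := by
  simp only [blkDiff, LinearMap.add_apply, map_add, blkShift_comm]
  congr 1
  funext j; simp [hf]

lemma compLeft_pow (D : M →ₗ[k] M) (m n : ℕ) :
    (D.compLeft (Fin m)) ^ n = (D ^ n).compLeft (Fin m) := by
  induction n with
  | zero => rfl
  | succ n ih => rw [pow_succ, ih, pow_succ]; rfl

lemma blkDiff_pow {p m : ℕ} [Fact p.Prime] [CharP k p] (hm : m ≤ p) {D : M →ₗ[k] M}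
    (hD : D ^ p = 0) : blkDiff m D ^ p = 0 := by
  apply add_pow_of_commute_zero k p
  · exact LinearMap.ext fun y => blkShift_comm m D y
  · exact blkShift_pow_eq_zero hm
  · rw [compLeft_pow, hD]; rfl

/-- The contracting homotopy of `p` copies of `M` joined by identity maps: the last copy goes to
the first. -/
def blkHomotopy (k : Type u) [Field k] (p : ℕ) (hp : 0 < p) (M : Type*) [AddCommGroup M]
    [Module k M] : (Fin p → M) →ₗ[k] (Fin p → M) :=
  LinearMap.single k (fun _ => M) (⟨0, hp⟩ : Fin p) ∘ₗ proj (⟨p - 1, by omega⟩ : Fin p)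

lemma blkShift_homotopySum (p : ℕ) (hp : 0 < p) :
    homotopySum p (blkShift k p M) (blkShift k p M) (blkHomotopy k p hp M) = LinearMap.id := by
  refine LinearMap.ext fun y => funext fun j => ?_
  simp only [homotopySum, LinearMap.sum_apply, LinearMap.comp_apply, Finset.sum_apply,
    LinearMap.id_apply]
  rw [sum_eq_single (j : ℕ)]
  · rw [blkShift_pow_apply, dif_pos le_rfl]
    simp only [blkHomotopy, LinearMap.comp_apply, LinearMap.proj_apply, blkShift_pow_apply,
      Nat.sub_self, LinearMap.single_apply, Pi.single_eq_same]
    rw [dif_pos (by simp)]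
    congr 1
    ext; simp; omega
  · intro i hi hne
    have := mem_range.mp hi
    rw [blkShift_pow_apply]
    split_ifs with h
    · simp only [blkHomotopy, LinearMap.comp_apply, LinearMap.single_apply]
      rw [Pi.single_eq_of_ne]
      intro he; have := congrArg Fin.val he; simp at this; omega
    · rfl
  · intro h; exact absurd (mem_range.mpr j.isLt) h

lemma blkDiff_homotopySum (p : ℕ) [Fact p.Prime] [CharP k p] (hp : 0 < p) (D : M →ₗ[k] M) :
    homotopySum p (blkDiff p D) (blkDiff p D) (blkHomotopy k p hp M) = LinearMap.id := by
  rw [blkDiff, homotopySum_add, blkShift_homotopySum]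
  · intro y; funext j
    simp only [blkHomotopy, LinearMap.comp_apply, LinearMap.single_apply, LinearMap.compLeft_apply,
      LinearMap.proj_apply, Function.comp_apply]
    by_cases hj : j = ⟨0, hp⟩
    · subst hj; simp
    · rw [Pi.single_eq_of_ne hj, Pi.single_eq_of_ne hj, map_zero]
  · exact blkShift_comm p D
  · exact blkShift_comm p D

/-- Copies of an acyclic complex joined by identity maps form an acyclic complex. -/
lemma AcyclicOn.blk {p m : ℕ} [Fact p.Prime] [CharP k p] (hm : m ≤ p) {D : M →ₗ[k] M}
    (hD : D ^ p = 0) {U : Submodule k M} (hU : ∀ x ∈ U, D x ∈ U) (h : AcyclicOn p D U) :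
    AcyclicOn p (blkDiff m D) (Submodule.pi Set.univ fun _ => U) := by
  have hp : 0 < p := (Fact.out : p.Prime).pos
  -- filter by the subcomplexes of the last `m - i` copies
  let W : ℕ → Submodule k (Fin m → M) := fun i =>
    { carrier := {y | ∀ j : Fin m, y j ∈ U ∧ ((j : ℕ) < i → y j = 0)}
      zero_mem' := fun j => ⟨U.zero_mem, fun _ => rfl⟩
      add_mem' := fun {y z} hy hz j => ⟨U.add_mem (hy j).1 (hz j).1, fun hj => by
        simp [(hy j).2 hj, (hz j).2 hj]⟩
      smul_mem' := fun c y hy j => ⟨U.smul_mem c (hy j).1, fun hj => by simp [(hy j).2 hj]⟩ }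
  have hW0 : (Submodule.pi Set.univ fun _ => U) = W 0 := by
    ext y; exact ⟨fun hy j => ⟨hy j trivial, fun h => absurd h (by omega)⟩, fun hy j _ => (hy j).1⟩
  have hst : ∀ i, ∀ y ∈ W i, blkDiff m D y ∈ W i := by
    intro i y hy j
    rw [blkDiff_apply]
    refine ⟨U.add_mem ?_ (hU _ (hy j).1), fun hj => ?_⟩
    · split_ifs
      exacts [U.zero_mem, (hy _).1]
    · rw [(hy j).2 hj, map_zero, add_zero]
      split_ifs
      exacts [rfl, (hy _).2 (by simp; omega)]
  rw [hW0]
  suffices H : ∀ n, ∀ i, m - i = n → AcyclicOn p (blkDiff m D) (W i) from H m 0 rfl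
  intro n
  induction n with
  | zero =>
    intro i hi
    have : W i = ⊥ := by
      rw [eq_bot_iff]
      intro y hy
      exact funext fun j => (hy j).2 (by omega)
    rw [this]; exact acyclicOn_bot _ _
  | succ n ih =>
    intro i hi
    have him : i < m := by omega
    refine AcyclicOn.of_map (D' := D) hp (hst i) (fun y _ => by rw [blkDiff_pow hm hD]; rfl)
      (proj (⟨i, him⟩ : Fin m)) ?_ ?_ ?_
    · intro y hy
      simp only [LinearMap.proj_apply, blkDiff_apply]
      split_ifs with h0
      · rw [zero_add]
      · rw [(hy _).2 (by simp; omega), zero_add]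
    · have : W i ⊓ ker (proj (⟨i, him⟩ : Fin m)) = W (i + 1) := by
        ext y
        constructor
        · rintro ⟨hy, hy'⟩ j
          refine ⟨(hy j).1, fun hj => ?_⟩
          rcases Nat.lt_succ_iff_lt_or_eq.mp hj with h | h
          · exact (hy j).2 h
          · have : j = ⟨i, him⟩ := Fin.ext h
            rw [this]; exact hy'
        · intro hy
          exact ⟨fun j => ⟨(hy j).1, fun hj => (hy j).2 (by omega)⟩, (hy ⟨i, him⟩).2 (by simp)⟩
      rw [this]
      exact ih (i + 1) (by omega)
    · have : (W i).map (proj (⟨i, him⟩ : Fin m)) = U := by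
        ext x
        constructor
        · rintro ⟨y, hy, rfl⟩; exact (hy _).1
        · intro hx
          refine ⟨Pi.single ⟨i, him⟩ x, fun j => ?_, by simp⟩
          by_cases hj : j = ⟨i, him⟩
          · subst hj; simpa using hx
          · simp [Pi.single_eq_of_ne hj]
      rw [this]; exact h

end Acyclic

namespace QComplex

/-! ### The homotopy category -/

section Basic

variable {p : ℕ} {M N L M' N' : QComplex k}

lemma IsPComplex.pow_mem (hM : IsPComplex p M) (n : ℕ) {e : ℤ} {x : M.carrier} (hx : x ∈ M.gr e) :
    (M.diff ^ n) x ∈ M.gr (e + 2 * n) := by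
  induction n generalizing e x with
  | zero => simpa using hx
  | succ n ih =>
    rw [pow_succ, Module.End.mul_apply]
    convert ih (hM.diff_mem e x hx) using 2
    push_cast; ring

lemma IsHom.id (M : QComplex k) : IsHom M M LinearMap.id := ⟨fun _ => rfl, fun _ _ h => h⟩

lemma IsHom.comp {f : M.carrier →ₗ[k] N.carrier} {g : N.carrier →ₗ[k] L.carrier}
    (hg : IsHom N L g) (hf : IsHom M N f) : IsHom M L (g ∘ₗ f) :=
  ⟨fun x => by simp [hf.comm, hg.comm], fun e x hx => hg.map_mem e _ (hf.map_mem e x hx)⟩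

lemma NullHomotopic.zero : NullHomotopic p M N 0 :=
  ⟨0, fun _ _ _ => zero_mem _, by simp⟩

lemma NullHomotopic.add {f g : M.carrier →ₗ[k] N.carrier} (hf : NullHomotopic p M N f)
    (hg : NullHomotopic p M N g) : NullHomotopic p M N (f + g) := by
  obtain ⟨h, hh, rfl⟩ := hf
  obtain ⟨h', hh', rfl⟩ := hg
  refine ⟨h + h', fun e x hx => add_mem (hh e x hx) (hh' e x hx), ?_⟩
  rw [← sum_add_distrib]
  exact sum_congr rfl fun i _ => by ext; simp

lemma NullHomotopic.comp_left {f : M.carrier →ₗ[k] N.carrier} (hf : NullHomotopic p M N f)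
    {g : N.carrier →ₗ[k] L.carrier} (hg : IsHom N L g) : NullHomotopic p M L (g ∘ₗ f) := by
  obtain ⟨h, hh, rfl⟩ := hf
  exact ⟨g ∘ₗ h, fun e x hx => hg.map_mem _ _ (hh e x hx), homotopySum_comp_left hg.comm h⟩

lemma NullHomotopic.comp_right {f : M.carrier →ₗ[k] N.carrier} (hf : NullHomotopic p M N f)
    {g : L.carrier →ₗ[k] M.carrier} (hg : IsHom L M g) : NullHomotopic p L N (f ∘ₗ g) := by
  obtain ⟨h, hh, rfl⟩ := hf
  exact ⟨h ∘ₗ g, fun e x hx => hh _ _ (hg.map_mem e x hx), homotopySum_comp_right hg.comm h⟩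

lemma HomotopyIso.symm (h : HomotopyIso p M N) : HomotopyIso p N M := by
  obtain ⟨f, g, hf, hg, h1, h2⟩ := h
  exact ⟨g, f, hg, hf, h2, h1⟩

lemma homotopyIso_of_inverse {f : M.carrier →ₗ[k] N.carrier} {g : N.carrier →ₗ[k] M.carrier}
    (hf : IsHom M N f) (hg : IsHom N M g) (h1 : ∀ x, g (f x) = x) (h2 : ∀ x, f (g x) = x) :
    HomotopyIso p M N := by
  refine ⟨f, g, hf, hg, ?_, ?_⟩
  · rw [show g ∘ₗ f - LinearMap.id = 0 by ext x; simp [h1]]; exact NullHomotopic.zero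
  · rw [show f ∘ₗ g - LinearMap.id = 0 by ext x; simp [h2]]; exact NullHomotopic.zero

lemma HomotopyIso.refl (M : QComplex k) : HomotopyIso p M M :=
  homotopyIso_of_inverse (IsHom.id M) (IsHom.id M) (fun _ => rfl) fun _ => rfl

lemma HomotopyIso.of_eq (h : M = N) : HomotopyIso p M N := h ▸ HomotopyIso.refl M

lemma HomotopyIso.trans (h : HomotopyIso p M N) (h' : HomotopyIso p N L) : HomotopyIso p M L := by
  obtain ⟨f, g, hf, hg, h1, h2⟩ := h
  obtain ⟨f', g', hf', hg', h1', h2'⟩ := h'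
  refine ⟨f' ∘ₗ f, g ∘ₗ g', hf'.comp hf, hg.comp hg', ?_, ?_⟩
  · convert ((h1'.comp_left hg).comp_right hf).add h1 using 1
    ext x; simp
  · convert ((h2.comp_left hf').comp_right hg').add h2' using 1
    ext x; simp

/-- An isomorphism of complexes given by a bijective morphism whose inverse preserves degrees. -/
lemma homotopyIso_of_equiv (e : M.carrier ≃ₗ[k] N.carrier) (hc : ∀ x, e (M.diff x) = N.diff (e x))
    (h1 : ∀ d, ∀ x ∈ M.gr d, e x ∈ N.gr d) (h2 : ∀ d, ∀ x ∈ N.gr d, e.symm x ∈ M.gr d) :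
    HomotopyIso p M N := by
  refine homotopyIso_of_inverse (f := e.toLinearMap) (g := e.symm.toLinearMap)
    ⟨hc, h1⟩ ⟨fun x => ?_, h2⟩ (fun x => e.symm_apply_apply x) fun x => e.apply_symm_apply x
  have := hc (e.symm x)
  rw [e.apply_symm_apply] at this
  exact e.injective (by simp [this])

lemma homotopySum_mem (hM : IsPComplex p M) (hN : IsPComplex p N)
    {h : M.carrier →ₗ[k] N.carrier}
    (hh : ∀ (e : ℤ), ∀ x ∈ M.gr e, h x ∈ N.gr (e + 2 - 2 * (p : ℤ))) {e : ℤ} {x : M.carrier}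
    (hx : x ∈ M.gr e) : homotopySum p M.diff N.diff h x ∈ N.gr e := by
  rw [homotopySum, LinearMap.sum_apply]
  refine sum_mem fun i hi => ?_
  have hi := mem_range.mp hi
  have := hN.pow_mem i (hh _ _ (hM.pow_mem (p - 1 - i) hx))
  rw [LinearMap.comp_apply, LinearMap.comp_apply]
  convert this using 2
  push_cast [Nat.sub_sub, show 1 + i ≤ p by omega]
  ring

/-- The complex is contractible: its identity is null-homotopic. -/
def Contractible (p : ℕ) (M : QComplex k) : Prop := NullHomotopic p M M LinearMap.id

lemma Contractible.acyclicOn (hp : 0 < p) (h : Contractible p M) : AcyclicOn p M.diff ⊤ := by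
  obtain ⟨h, -, hh⟩ := h
  exact acyclicOn_top_of_homotopy hp hh.symm

/-- A graded acyclic complex is contractible. A pseudo-inverse of `∂^(p-1)` is a homotopy whose
associated endomorphism is unipotent; dividing by it gives a contraction. -/
lemma IsPComplex.contractible (hp : 0 < p) (hM : IsPComplex p M) (h : AcyclicOn p M.diff ⊤) :
    Contractible p M := by
  obtain ⟨ψ, hψ, hψ'⟩ := exists_pseudoInverse hM.internal hM.internal (M.diff ^ (p - 1))
    (2 * ((p - 1 : ℕ) : ℤ)) (fun e x hx => hM.pow_mem (p - 1) hx)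
  have hψ1 : ∀ (e : ℤ), ∀ x ∈ M.gr e, ψ x ∈ M.gr (e + 2 - 2 * (p : ℤ)) := by
    intro e x hx
    convert hψ e x hx using 2
    push_cast [show 1 ≤ p by omega]; ring
  set E : Module.End k M.carrier := homotopySum p M.diff M.diff ψ with hE
  have hcomm : ∀ x, E (M.diff x) = M.diff (E x) := fun x =>
    (LinearMap.congr_fun (homotopySum_comm hM.diff_pow hM.diff_pow ψ) x).symm
  set U : Module.End k M.carrier := 1 - E with hUdef
  have hUc : ∀ x, U (M.diff x) = M.diff (U x) := fun x => by simp [hUdef, hcomm]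
  -- `E` is the identity on cycles, so `U` lowers the order of nilpotency of `∂`
  have hU : ∀ n x, (M.diff ^ n) x = 0 → (U ^ n) x = 0 := by
    intro n
    induction n with
    | zero => intro x hx; exact hx
    | succ n ih =>
      intro x hx
      rw [pow_succ, Module.End.mul_apply]
      apply ih
      rw [← comp_pow_of_comm hUc]
      have hx' : M.diff ((M.diff ^ n) x) = 0 := by rw [← hx, pow_succ']; rfl
      obtain ⟨y, -, hy⟩ := h _ trivial hx'
      have h1 : E ((M.diff ^ n) x) = (M.diff ^ n) x := by
        rw [hE, homotopySum_apply_of_diff_eq_zero hp hx', ← hy]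
        exact LinearMap.congr_fun hψ' y
      simp [hUdef, h1]
  have hUp : U ^ p = 0 := LinearMap.ext fun x => hU p x (by rw [hM.diff_pow]; rfl)
  set S : Module.End k M.carrier := ∑ i ∈ range p, U ^ i with hS
  have hES : E * S = 1 := by
    have := mul_neg_geom_sum U p
    rw [hUp, sub_zero, ← hS] at this
    rwa [show 1 - U = E by rw [hUdef]; abel] at this
  have hSc : ∀ x, S (M.diff x) = M.diff (S x) := by
    intro x
    simp only [hS, LinearMap.sum_apply, map_sum]
    refine sum_congr rfl fun i _ => ?_
    have : Commute (U ^ i) M.diff := Commute.pow_left (LinearMap.ext hUc) i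
    exact LinearMap.congr_fun this.eq x
  have hUm : ∀ (i : ℕ) (e : ℤ), ∀ x ∈ M.gr e, (U ^ i) x ∈ M.gr e := by
    intro i e
    induction i with
    | zero => intro x hx; simpa using hx
    | succ i ih =>
      intro x hx
      rw [pow_succ, Module.End.mul_apply]
      exact ih _ (sub_mem hx (homotopySum_mem hM hM hψ1 hx))
  refine ⟨ψ ∘ₗ S, fun e x hx => hψ1 _ _ ?_, ?_⟩
  · rw [hS, LinearMap.sum_apply]
    exact sum_mem fun i _ => hUm i e x hx
  · exact (hES.symm.trans (homotopySum_comp_right hSc ψ))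

/-- The subcomplex on a subspace stable under the differential. -/
def sub (M : QComplex k) (U : Submodule k M.carrier) (hU : ∀ x ∈ U, M.diff x ∈ U) : QComplex k where
  carrier := U
  gr := fun e => (M.gr e).comap U.subtype
  diff := M.diff.restrict hU

/-- The inclusion of a subcomplex. -/
def subIncl (M : QComplex k) (U : Submodule k M.carrier) (hU : ∀ x ∈ U, M.diff x ∈ U) :
    (M.sub U hU).carrier →ₗ[k] M.carrier := U.subtype

lemma subIncl_comm (U : Submodule k M.carrier) (hU : ∀ x ∈ U, M.diff x ∈ U)
    (x : (M.sub U hU).carrier) :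
    M.subIncl U hU ((M.sub U hU).diff x) = M.diff (M.subIncl U hU x) := rfl

lemma subIncl_injective (U : Submodule k M.carrier) (hU : ∀ x ∈ U, M.diff x ∈ U) :
    Function.Injective (M.subIncl U hU) := Subtype.val_injective

lemma IsPComplex.sub_ker (hM : IsPComplex p M) (hN : IsPComplex p N)
    {f : M.carrier →ₗ[k] N.carrier} (hf : IsHom M N f)
    (hU : ∀ x ∈ ker f, M.diff x ∈ ker f) :
    IsPComplex p (M.sub (ker f) hU) where
  internal := by
    obtain ⟨c, hc⟩ := exists_isProj hM.internal
    obtain ⟨c', hc'⟩ := exists_isProj hN.internal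
    refine (isProj_ker hc (U := ker f) fun e x hx => ?_).isInternal
    have := hc.hom hc' (d := 0) (f := f) (by simpa using hf.map_mem) e x
    rw [LinearMap.mem_ker] at hx ⊢
    rw [← this, hx, map_zero]
  diff_mem e x hx := hM.diff_mem e (M.subIncl _ hU x) hx
  diff_pow := by
    refine LinearMap.ext fun x => subIncl_injective _ hU ?_
    rw [comp_pow_of_comm (subIncl_comm _ hU), hM.diff_pow]
    rfl

/-- A surjective morphism with acyclic kernel is an isomorphism in the homotopy category. -/
lemma homotopyIso_of_surjective (hp : 0 < p) (hM : IsPComplex p M) (hN : IsPComplex p N)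
    {f : M.carrier →ₗ[k] N.carrier} (hf : IsHom M N f) (hs : Function.Surjective f)
    (ha : AcyclicOn p M.diff (ker f)) : HomotopyIso p M N := by
  have hU : ∀ x ∈ ker f, M.diff x ∈ ker f := by
    intro x hx
    rw [LinearMap.mem_ker] at hx ⊢
    rw [hf.comm, hx, map_zero]
  obtain ⟨c, hc⟩ := exists_isProj hM.internal
  have hK := hM.sub_ker hN hf hU
  set i := M.subIncl (ker f) hU with hi
  have hincl : ∀ x, i ((M.sub _ hU).diff x) = M.diff (i x) := subIncl_comm _ hU
  have hinj : Function.Injective i := subIncl_injective _ hU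
  have hik : ∀ x, f (i x) = 0 := fun x => Subtype.property x
  have hiex : ∀ x ∈ ker f, ∃ y, i y = x := fun x hx => ⟨⟨x, hx⟩, rfl⟩
  obtain ⟨hk, hk1, hk2⟩ := hK.contractible hp (by
    intro x _ hx
    obtain ⟨y, hy, hyx⟩ := ha (i x) (hik x) (by rw [← hincl, hx, map_zero])
    obtain ⟨y, rfl⟩ := hiex y hy
    exact ⟨y, trivial, hinj (by rw [comp_pow_of_comm hincl, hyx])⟩)
  -- a homogeneous section `σ` of `f`; subtracting `E σ` makes it commute with `∂`
  obtain ⟨σ, hσ, hσ'⟩ := exists_pseudoInverse hM.internal hN.internal f 0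
    (by simpa using hf.map_mem)
  have hfσ : ∀ y, f (σ y) = y := by
    intro y
    obtain ⟨x, rfl⟩ := hs y
    exact LinearMap.congr_fun hσ' x
  let π : M.carrier →ₗ[k] (M.sub (ker f) hU).carrier :=
    LinearMap.codRestrict (ker f) (LinearMap.id - σ ∘ₗ f) fun x => by simp [hfσ]
  have hiπ : ∀ x, i (π x) = x - σ (f x) := fun x => rfl
  have hπ : ∀ x, π (i x) = x := fun x => hinj (by rw [hiπ, hik, map_zero, sub_zero])
  let h : M.carrier →ₗ[k] M.carrier := i ∘ₗ hk ∘ₗ π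
  have hh : ∀ (e : ℤ), ∀ x ∈ M.gr e, h x ∈ M.gr (e + 2 - 2 * (p : ℤ)) := fun e x hx =>
    hk1 e (π x) (sub_mem hx (by simpa using hσ _ _ (hf.map_mem _ _ hx)))
  set E := homotopySum p M.diff M.diff h with hE
  have hcomm : ∀ x, E (M.diff x) = M.diff (E x) := fun x =>
    (LinearMap.congr_fun (homotopySum_comm hM.diff_pow hM.diff_pow h) x).symm
  have hfE : ∀ x, f (E x) = 0 := by
    intro x
    have h0 : f ∘ₗ h = 0 := LinearMap.ext fun x => hik (hk (π x))
    have := LinearMap.congr_fun (homotopySum_comp_left (p := p) (D := M.diff) hf.comm h) x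
    rw [h0] at this
    exact this.trans (by simp [homotopySum])
  have hEk : ∀ x ∈ ker f, E x = x := by
    intro x hx
    have h0 : h ∘ₗ i = i ∘ₗ hk := LinearMap.ext fun x => by simp [h, hπ]
    have h1 := homotopySum_comp_right (p := p) (D' := M.diff) hincl h
    rw [h0, ← homotopySum_comp_left hincl hk] at h1
    obtain ⟨y, rfl⟩ := hiex x hx
    exact (LinearMap.congr_fun h1 y).trans (congrArg i (LinearMap.congr_fun hk2 y).symm)
  have hgf : ∀ x, σ (f x) - E (σ (f x)) = x - E x := by
    intro x
    have := hEk (x - σ (f x)) (by simp [hfσ])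
    rw [map_sub, sub_eq_sub_iff_add_eq_add] at this
    rw [sub_eq_sub_iff_add_eq_add, add_comm, this, add_comm]
  refine ⟨f, σ - E ∘ₗ σ, hf, ⟨fun y => ?_, fun e y hy => ?_⟩, ?_, ?_⟩
  · obtain ⟨x, rfl⟩ := hs y
    rw [← hf.comm]
    simp only [LinearMap.sub_apply, LinearMap.comp_apply, hgf]
    rw [map_sub, hcomm]
  · have h1 : σ y ∈ M.gr e := by simpa using hσ e y hy
    exact sub_mem h1 (homotopySum_mem hM hM hh h1)
  · refine ⟨-h, fun e x hx => neg_mem (hh e x hx), ?_⟩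
    have : homotopySum p M.diff M.diff (-h) = -E := by
      ext x; simp [hE, homotopySum, LinearMap.sum_apply]
    refine Eq.trans ?_ this.symm
    ext x
    simp [hgf]
  · rw [show f ∘ₗ (σ - E ∘ₗ σ) - LinearMap.id = 0 by ext x; simp [hfσ, hfE]]
    exact NullHomotopic.zero

end Basic

/-! ### Shifts, sums, blocks -/

section Constructions

variable {p : ℕ} {M N L M' N' : QComplex k}

lemma NullHomotopic.neg {f : M.carrier →ₗ[k] N.carrier} (hf : NullHomotopic p M N f) :
    NullHomotopic p M N (-f) := by
  have := hf.comp_left (g := -LinearMap.id)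
    ⟨fun x => (map_neg N.diff x).symm, fun _ _ h => neg_mem h⟩
  convert this using 1
  ext x; simp

/-- Reducible copy of the direct sum. -/
abbrev sumC (M N : QComplex k) : QComplex k where
  carrier := M.carrier × N.carrier
  gr := fun e => (M.gr e).prod (N.gr e)
  diff := M.diff.prodMap N.diff

lemma sum_eq (M N : QComplex k) : M.sum N = sumC M N := rfl

lemma qShift_qShift (a b : ℤ) (M : QComplex k) : (M.qShift a).qShift b = M.qShift (a + b) := by
  simp only [qShift]
  congr 1
  funext e
  rw [sub_sub, add_comm]

lemma qShift_zero (M : QComplex k) : M.qShift 0 = M := by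
  obtain ⟨_, _, _⟩ := M
  simp [qShift]

lemma IsPComplex.qShift (hM : IsPComplex p M) (a : ℤ) : IsPComplex p (M.qShift a) where
  internal := by
    obtain ⟨c, hc⟩ := exists_isProj hM.internal
    exact (isProj_shift hc (-a)).isInternal
  diff_mem e x hx := by
    have : M.diff x ∈ M.gr (e - a + 2) := hM.diff_mem (e - a) x hx
    rwa [show e - a + 2 = e + 2 - a by ring] at this
  diff_pow := hM.diff_pow

lemma IsHom.qShift {f : M.carrier →ₗ[k] N.carrier} (hf : IsHom M N f) (a : ℤ) :
    IsHom (M.qShift a) (N.qShift a) f := ⟨hf.comm, fun e => hf.map_mem (e - a)⟩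

lemma NullHomotopic.qShift {f : M.carrier →ₗ[k] N.carrier} (hf : NullHomotopic p M N f) (a : ℤ) :
    NullHomotopic p (M.qShift a) (N.qShift a) f := by
  obtain ⟨h, hh, he⟩ := hf
  refine ⟨h, fun e x hx => ?_, he⟩
  have : h x ∈ N.gr (e - a + 2 - 2 * (p : ℤ)) := hh (e - a) x hx
  rwa [show e - a + 2 - 2 * (p : ℤ) = e + 2 - 2 * (p : ℤ) - a by ring] at this

lemma HomotopyIso.qShift (h : HomotopyIso p M N) (a : ℤ) :
    HomotopyIso p (M.qShift a) (N.qShift a) := by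
  obtain ⟨f, g, hf, hg, h1, h2⟩ := h
  exact ⟨f, g, hf.qShift a, hg.qShift a, h1.qShift a, h2.qShift a⟩

lemma prodMap_pow {M N : Type*} [AddCommGroup M] [Module k M] [AddCommGroup N] [Module k N]
    (f : M →ₗ[k] M) (g : N →ₗ[k] N) (n : ℕ) : (f.prodMap g) ^ n = (f ^ n).prodMap (g ^ n) := by
  induction n with
  | zero => rfl
  | succ n ih => rw [pow_succ, ih, pow_succ, pow_succ]; rfl

lemma IsPComplex.sum (hM : IsPComplex p M) (hN : IsPComplex p N) : IsPComplex p (M.sum N) where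
  internal := by
    obtain ⟨c, hc⟩ := exists_isProj hM.internal
    obtain ⟨c', hc'⟩ := exists_isProj hN.internal
    exact (isProj_prod hc hc').isInternal
  diff_mem e x hx := ⟨hM.diff_mem e _ hx.1, hN.diff_mem e _ hx.2⟩
  diff_pow := by
    refine (prodMap_pow M.diff N.diff p).trans ?_
    rw [hM.diff_pow, hN.diff_pow]
    rfl

lemma NullHomotopic.prodMap {f : M.carrier →ₗ[k] M'.carrier} (hf : NullHomotopic p M M' f)
    {g : N.carrier →ₗ[k] N'.carrier} (hg : NullHomotopic p N N' g) :
    NullHomotopic p (sumC M N) (sumC M' N') (f.prodMap g) := by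
  obtain ⟨h, hh, rfl⟩ := hf
  obtain ⟨h', hh', rfl⟩ := hg
  refine ⟨h.prodMap h', fun e x hx => ⟨hh e _ hx.1, hh' e _ hx.2⟩, ?_⟩
  refine LinearMap.ext fun x => ?_
  simp only [prodMap_pow, LinearMap.sum_apply]
  refine Prod.ext ?_ ?_
  · rw [Prod.fst_sum]
    exact LinearMap.sum_apply _ _ _
  · rw [Prod.snd_sum]
    exact LinearMap.sum_apply _ _ _

lemma HomotopyIso.sum (h : HomotopyIso p M M') (h' : HomotopyIso p N N') :
    HomotopyIso p (M.sum N) (M'.sum N') := by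
  obtain ⟨f, g, hf, hg, h1, h2⟩ := h
  obtain ⟨f', g', hf', hg', h1', h2'⟩ := h'
  rw [sum_eq, sum_eq]
  refine ⟨f.prodMap f', g.prodMap g', ⟨fun x => Prod.ext (hf.comm _) (hf'.comm _),
    fun e x hx => ⟨hf.map_mem e _ hx.1, hf'.map_mem e _ hx.2⟩⟩,
    ⟨fun x => Prod.ext (hg.comm _) (hg'.comm _),
    fun e x hx => ⟨hg.map_mem e _ hx.1, hg'.map_mem e _ hx.2⟩⟩, ?_, ?_⟩
  · exact h1.prodMap h1'
  · exact h2.prodMap h2'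

lemma sum_comm_iso (M N : QComplex k) : HomotopyIso p (M.sum N) (N.sum M) :=
  homotopyIso_of_equiv (LinearEquiv.prodComm k M.carrier N.carrier) (fun _ => rfl)
    (fun _ _ h => ⟨h.2, h.1⟩) fun _ _ h => ⟨h.2, h.1⟩

lemma sum_assoc_iso (M N L : QComplex k) :
    HomotopyIso p ((M.sum N).sum L) (M.sum (N.sum L)) :=
  homotopyIso_of_equiv (LinearEquiv.prodAssoc k M.carrier N.carrier L.carrier) (fun _ => rfl)
    (fun _ _ h => ⟨h.1.1, h.1.2, h.2⟩) fun _ _ h => ⟨⟨h.1, h.2.1⟩, h.2.2⟩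

lemma sum_contractible (M : QComplex k) (h : Contractible p N) : HomotopyIso p (M.sum N) M := by
  rw [sum_eq]
  refine ⟨fst k _ _, LinearMap.inl k _ _, ⟨fun _ => rfl, fun _ _ h => h.1⟩,
    ⟨fun x => Prod.ext rfl (map_zero N.diff).symm, fun _ _ h => ⟨h, zero_mem _⟩⟩, ?_, ?_⟩
  · have := NullHomotopic.prodMap (NullHomotopic.zero (p := p) (M := M) (N := M)) h.neg
    convert this using 1
    ext x <;> simp
  · rw [show fst k M.carrier N.carrier ∘ₗ LinearMap.inl k _ _ - LinearMap.id = 0 by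
      ext x; simp]
    exact NullHomotopic.zero

lemma Contractible.homotopyIso (hM : Contractible p M) (hN : Contractible p N) :
    HomotopyIso p M N :=
  ((sum_contractible M hN).symm.trans (sum_comm_iso M N)).trans (sum_contractible N hM)

lemma Contractible.of_homotopyIso (h : HomotopyIso p M N) (hN : Contractible p N) :
    Contractible p M := by
  obtain ⟨f, g, hf, hg, h1, h2⟩ := h
  have h3 : NullHomotopic p M M (g ∘ₗ f) := by
    simpa using (hN.comp_left hg).comp_right hf
  simpa [Contractible] using h3.add h1.neg

lemma Contractible.qShift (h : Contractible p M) (a : ℤ) : Contractible p (M.qShift a) :=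
  NullHomotopic.qShift h a

lemma contractible_of_subsingleton (M : QComplex k) [Subsingleton M.carrier] : Contractible p M :=
  ⟨0, fun _ _ _ => zero_mem _, LinearMap.ext fun _ => Subsingleton.elim _ _⟩

/-- `m` copies of `M` joined by identity maps, the first one in degree shift `s`: the tensor product
of `M` with a Jordan block of size `m`. -/
abbrev Blk (m : ℕ) (s : ℤ) (M : QComplex k) : QComplex k where
  carrier := Fin m → M.carrier
  gr := fun e => Submodule.pi Set.univ fun j => M.gr (e - s - 2 * ((j : ℕ) : ℤ))
  diff := blkDiff m M.diff

lemma mem_Blk {m : ℕ} {s e : ℤ} {y : Fin m → M.carrier} :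
    y ∈ (Blk m s M).gr e ↔ ∀ j : Fin m, y j ∈ M.gr (e - s - 2 * ((j : ℕ) : ℤ)) :=
  ⟨fun h j => h j trivial, fun h j _ => h j⟩

lemma blkDiff_mem_aux {m : ℕ} {s e : ℤ} (hM : ∀ e, ∀ x ∈ M.gr e, M.diff x ∈ M.gr (e + 2))
    {y : Fin m → M.carrier} (hy : y ∈ (Blk m s M).gr e) :
    blkDiff m M.diff y ∈ (Blk m s M).gr (e + 2) := by
  rw [mem_Blk] at hy ⊢
  intro j
  rw [blkDiff_apply]
  refine add_mem ?_ ?_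
  · split_ifs with h
    · exact zero_mem _
    · have := hy ⟨(j : ℕ) - 1, by omega⟩
      convert this using 2
      push_cast [show 1 ≤ (j : ℕ) by omega]; ring
  · convert hM _ _ (hy j) using 2
    ring

lemma IsPComplex.blk [Fact p.Prime] [CharP k p] {m : ℕ} (hm : m ≤ p) (hM : IsPComplex p M)
    (s : ℤ) : IsPComplex p (Blk m s M) where
  internal := by
    obtain ⟨c, hc⟩ := exists_isProj hM.internal
    have := isProj_pi fun j : Fin m => isProj_shift hc (-s - 2 * ((j : ℕ) : ℤ))
    have h2 := this.isInternal
    convert h2 using 6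
    simp only [sub_eq_add_neg, add_assoc]
  diff_mem e x hx := blkDiff_mem_aux hM.diff_mem hx
  diff_pow := blkDiff_pow hm hM.diff_pow

lemma NullHomotopic.blk [Fact p.Prime] [CharP k p] {f : M.carrier →ₗ[k] N.carrier}
    (hf : NullHomotopic p M N f) (m : ℕ) (s : ℤ) :
    NullHomotopic p (Blk m s M) (Blk m s N) (f.compLeft (Fin m)) := by
  obtain ⟨h, hh, rfl⟩ := hf
  refine ⟨h.compLeft (Fin m), fun e y hy => ?_, ?_⟩
  · rw [mem_Blk] at hy ⊢
    intro j
    have := hh _ _ (hy j)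
    rwa [show e - s - 2 * ((j : ℕ) : ℤ) + 2 - 2 * (p : ℤ) =
      e + 2 - 2 * (p : ℤ) - s - 2 * ((j : ℕ) : ℤ) by ring] at this
  · change _ = homotopySum p (blkDiff m M.diff) (blkDiff m N.diff) _
    rw [blkDiff, blkDiff, add_comm, add_comm (blkShift k m N.carrier),
      homotopySum_add (fun y => (blkShift_comm m h y).symm)
        (fun y => (blkShift_comm m M.diff y).symm) (fun y => (blkShift_comm m N.diff y).symm)]
    refine LinearMap.ext fun y => funext fun j => ?_
    simp only [homotopySum, compLeft_pow, LinearMap.sum_apply, Finset.sum_apply,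
      LinearMap.compLeft_apply, LinearMap.comp_apply, Function.comp_apply]

lemma IsHom.blk {f : M.carrier →ₗ[k] N.carrier} (hf : IsHom M N f) (m : ℕ) (s : ℤ) :
    IsHom (Blk m s M) (Blk m s N) (f.compLeft (Fin m)) :=
  ⟨blkDiff_map hf.comm m, fun _ _ hy j _ => hf.map_mem _ _ (hy j trivial)⟩

lemma HomotopyIso.blk [Fact p.Prime] [CharP k p] (h : HomotopyIso p M N) (m : ℕ) (s : ℤ) :
    HomotopyIso p (Blk m s M) (Blk m s N) := by
  obtain ⟨f, g, hf, hg, h1, h2⟩ := h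
  exact ⟨_, _, hf.blk m s, hg.blk m s, h1.blk m s, h2.blk m s⟩

lemma Contractible.blk [Fact p.Prime] [CharP k p] (h : Contractible p M) (m : ℕ) (s : ℤ) :
    Contractible p (Blk m s M) := NullHomotopic.blk h m s

lemma blk_qShift (m : ℕ) (s a : ℤ) (M : QComplex k) :
    Blk m s (M.qShift a) = (Blk m s M).qShift a := by
  simp only [qShift, Blk]
  congr 1
  funext e
  congr 1
  funext j
  congr 1
  ring

lemma blk_add_shift (m : ℕ) (s t : ℤ) (M : QComplex k) :
    Blk m (s + t) M = (Blk m s M).qShift t := by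
  simp only [qShift, Blk]
  congr 1
  funext e
  congr 1
  funext j
  congr 1
  ring

lemma blk_sum (m : ℕ) (s : ℤ) (M N : QComplex k) :
    HomotopyIso p (Blk m s (M.sum N)) ((Blk m s M).sum (Blk m s N)) := by
  let e : (Fin m → M.carrier × N.carrier) ≃ₗ[k] (Fin m → M.carrier) × (Fin m → N.carrier) :=
    { toFun := fun y => (fun j => (y j).1, fun j => (y j).2)
      invFun := fun y j => (y.1 j, y.2 j)
      map_add' := fun _ _ => rfl
      map_smul' := fun _ _ => rfl
      left_inv := fun _ => rfl
      right_inv := fun _ => rfl }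
  refine homotopyIso_of_equiv (M := Blk m s (M.sum N)) (N := (Blk m s M).sum (Blk m s N)) e
    (fun y => ?_) (fun d y hy => ⟨fun j _ => (hy j trivial).1, fun j _ => (hy j trivial).2⟩)
    fun d y hy j _ => ⟨hy.1 j trivial, hy.2 j trivial⟩
  refine Prod.ext (funext fun j => ?_) (funext fun j => ?_)
  · refine (congrArg Prod.fst (blkDiff_apply m (M.sum N).diff y j)).trans
      (Eq.trans ?_ (blkDiff_apply m M.diff (fun j => (y j).1) j).symm)
    split_ifs <;> rfl
  · refine (congrArg Prod.snd (blkDiff_apply m (M.sum N).diff y j)).trans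
      (Eq.trans ?_ (blkDiff_apply m N.diff (fun j => (y j).2) j).symm)
    split_ifs <;> rfl

lemma blk_contractible [Fact p.Prime] [CharP k p] (s : ℤ) (M : QComplex k) :
    Contractible p (Blk p s M) := by
  have hp : 0 < p := (Fact.out : p.Prime).pos
  refine ⟨blkHomotopy k p hp M.carrier, fun e y hy => ?_, (blkDiff_homotopySum p hp M.diff).symm⟩
  rw [mem_Blk] at hy ⊢
  intro j
  change Pi.single (M := fun _ => M.carrier) _ _ j ∈ _
  by_cases hj : j = ⟨0, hp⟩
  · subst hj
    rw [Pi.single_eq_same]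
    change y ⟨p - 1, _⟩ ∈ _
    convert hy ⟨p - 1, by omega⟩ using 2
    push_cast [show 1 ≤ p by omega]; ring
  · rw [Pi.single_eq_of_ne hj]; exact zero_mem _

/-- The complex `M[-1]`, written as `p - 1` copies of `M` joined by identity maps. -/
abbrev Sm (p : ℕ) (M : QComplex k) : QComplex k := Blk (p - 1) 2 M

/-- Tensoring with a balanced complex gives copies of the complex joined by identity maps. -/
lemma tensor_V (m : ℕ) (a : ℤ) (M : QComplex k) :
    HomotopyIso p (M.tensor ((V k m).qShift a)) (Blk (m + 1) (a - m) M) := by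
  let e : TensorProduct k M.carrier (Fin (m + 1) → k) ≃ₗ[k] (Fin (m + 1) → M.carrier) :=
    TensorProduct.piScalarRight k k M.carrier (Fin (m + 1))
  have he : ∀ x (v : Fin (m + 1) → k) j, e (TensorProduct.tmul k x v) j = v j • x := by
    intro x v j
    simp [e, TensorProduct.piScalarRight_apply]
  have hes : ∀ (j : Fin (m + 1)) x, e.symm (Pi.single j x) = TensorProduct.tmul k x (Pi.single j 1) := by
    intro j x
    rw [LinearEquiv.symm_apply_eq]
    funext i
    rw [he]
    by_cases h : i = j
    · subst h; simp
    · simp [Pi.single_eq_of_ne h]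
  let D : TensorProduct k M.carrier (Fin (m + 1) → k) →ₗ[k] TensorProduct k M.carrier (Fin (m + 1) → k) :=
    M.diff.rTensor _ + (blkShift k (m + 1) k).lTensor _
  have hD : e.toLinearMap ∘ₗ D = blkDiff (m + 1) M.diff ∘ₗ e.toLinearMap := by
    refine TensorProduct.ext' fun x v => funext fun j => ?_
    simp only [LinearMap.comp_apply, D, LinearMap.add_apply, LinearMap.rTensor_tmul,
      LinearMap.lTensor_tmul, LinearEquiv.coe_coe, map_add, Pi.add_apply, he, blkDiff_apply,
      blkShift_apply, map_smul]
    rw [add_comm]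
    congr 1
    split_ifs
    · rw [zero_smul]
    · rfl
  let G : ℤ → Submodule k (TensorProduct k M.carrier (Fin (m + 1) → k)) := fun d => ⨆ i : ℤ,
    Submodule.map₂ (TensorProduct.mk k M.carrier (Fin (m + 1) → k)) (M.gr i) ((V k m).gr (d - i - a))
  have h1 : ∀ d, G d ≤ ((Blk (m + 1) (a - m) M).gr d).comap e.toLinearMap := by
    intro d
    refine iSup_le fun i => Submodule.map₂_le.mpr fun x hx v hv => ?_
    rw [Submodule.mem_comap, mem_Blk]
    intro j
    change e (TensorProduct.tmul k x v) j ∈ _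
    rw [he]
    by_cases h : 2 * ((j : ℕ) : ℤ) - (m : ℤ) = d - i - a
    · apply Submodule.smul_mem
      rwa [show d - (a - m) - 2 * ((j : ℕ) : ℤ) = i by linarith]
    · rw [hv j h, zero_smul]; exact zero_mem _
  have h2 : ∀ d, ∀ y ∈ (Blk (m + 1) (a - m) M).gr d, e.symm y ∈ G d := by
    intro d y hy
    rw [mem_Blk] at hy
    rw [← Finset.univ_sum_single y, map_sum]
    refine sum_mem fun j _ => ?_
    rw [hes]
    refine Submodule.mem_iSup_of_mem (d - (a - m) - 2 * ((j : ℕ) : ℤ))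
      (Submodule.apply_mem_map₂ _ (hy j) fun i hi => ?_)
    rw [Pi.single_eq_of_ne]
    rintro rfl
    exact hi (by ring)
  exact homotopyIso_of_equiv (M := M.tensor ((V k m).qShift a)) (N := Blk (m + 1) (a - m) M) e
    (fun x => LinearMap.congr_fun hD x) (fun d x hx => h1 d hx) fun d y hy => h2 d y hy

lemma shiftNegOne_iso [Fact p.Prime] (hp : 2 < p) (M : QComplex k) :
    HomotopyIso p (shiftNegOne p M) (Sm p M) := by
  refine (tensor_V (p - 2) p M).trans (HomotopyIso.of_eq ?_)
  rw [show (p : ℤ) - ((p - 2 : ℕ) : ℤ) = 2 by push_cast [show 2 ≤ p by omega]; ring,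
    show p - 2 + 1 = p - 1 by omega]

lemma shiftOne_iso [Fact p.Prime] (hp : 2 < p) (M : QComplex k) :
    HomotopyIso p (shiftOne p M) ((Sm p M).qShift (-2 * (p : ℤ))) := by
  refine (tensor_V (p - 2) (-p) M).trans (HomotopyIso.of_eq ?_)
  rw [← blk_add_shift,
    show -(p : ℤ) - ((p - 2 : ℕ) : ℤ) = 2 + -2 * (p : ℤ) by push_cast [show 2 ≤ p by omega]; ring,
    show p - 2 + 1 = p - 1 by omega]

end Constructions

/-! ### Cones -/

section Cones

variable {p : ℕ} {X Y Z X' Y' M : QComplex k}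

/-- The map sending `x` to `f x` in the first of `m` copies. -/
def coneInj (m : ℕ) {X Y : Type*} [AddCommGroup X] [Module k X] [AddCommGroup Y] [Module k Y]
    (f : X →ₗ[k] Y) : X →ₗ[k] (Fin m → Y) :=
  LinearMap.pi fun j => if (j : ℕ) = 0 then f else 0

lemma coneInj_apply (m : ℕ) {X Y : Type*} [AddCommGroup X] [Module k X] [AddCommGroup Y]
    [Module k Y] (f : X →ₗ[k] Y) (x : X) (j : Fin m) :
    coneInj m f x j = if (j : ℕ) = 0 then f x else 0 := by
  simp only [coneInj, LinearMap.pi_apply]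
  split_ifs <;> simp

/-- The cone of a morphism `f : X → Y`: the complex `X → Y = ⋯ = Y` with `p - 1` copies of `Y`. -/
abbrev cone (p : ℕ) (X Y : QComplex k) (f : X.carrier →ₗ[k] Y.carrier) : QComplex k where
  carrier := X.carrier × (Fin (p - 1) → Y.carrier)
  gr := fun e => (X.gr e).prod ((Sm p Y).gr e)
  diff := LinearMap.prod (X.diff ∘ₗ fst k _ _)
    (blkDiff (p - 1) Y.diff ∘ₗ snd k _ _ + coneInj (p - 1) f ∘ₗ fst k _ _)

lemma cone_diff (f : X.carrier →ₗ[k] Y.carrier) (z : X.carrier × (Fin (p - 1) → Y.carrier)) :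
    (cone p X Y f).diff z =
      (X.diff z.1, blkDiff (p - 1) Y.diff z.2 + coneInj (p - 1) f z.1) := rfl

/-- The cone of `f` maps to `p` copies of `Y`, by `f` on `X`. -/
def coneToBlk (p : ℕ) (f : X.carrier →ₗ[k] Y.carrier) :
    (X.carrier × (Fin (p - 1) → Y.carrier)) →ₗ[k] (Fin p → Y.carrier) :=
  LinearMap.pi fun j =>
    if h : (j : ℕ) = 0 then f ∘ₗ fst k _ _
    else proj (⟨(j : ℕ) - 1, by omega⟩ : Fin (p - 1)) ∘ₗ snd k _ _

lemma coneToBlk_apply (f : X.carrier →ₗ[k] Y.carrier) (z : X.carrier × (Fin (p - 1) → Y.carrier))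
    (j : Fin p) : coneToBlk p f z j =
      if h : (j : ℕ) = 0 then f z.1 else z.2 ⟨(j : ℕ) - 1, by omega⟩ := by
  simp only [coneToBlk, LinearMap.pi_apply]
  split_ifs <;> rfl

lemma coneToBlk_comm {f : X.carrier →ₗ[k] Y.carrier} (hf : IsHom X Y f)
    (z : X.carrier × (Fin (p - 1) → Y.carrier)) :
    coneToBlk p f ((cone p X Y f).diff z) = blkDiff p Y.diff (coneToBlk p f z) := by
  funext j
  rw [coneToBlk_apply, blkDiff_apply, coneToBlk_apply, cone_diff]
  by_cases h : (j : ℕ) = 0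
  · simp only [dif_pos h, hf.comm, zero_add, coneToBlk_apply]
  · simp only [dif_neg h, Pi.add_apply, blkDiff_apply, coneInj_apply, coneToBlk_apply]
    by_cases h1 : (j : ℕ) - 1 = 0
    · simp only [dif_pos h1, if_pos h1, zero_add]; rw [add_comm]
    · simp only [dif_neg h1, if_neg h1, add_zero]

lemma IsPComplex.cone [Fact p.Prime] [CharP k p] (hX : IsPComplex p X) (hY : IsPComplex p Y)
    {f : X.carrier →ₗ[k] Y.carrier} (hf : IsHom X Y f) : IsPComplex p (cone p X Y f) where
  internal := by
    obtain ⟨c, hc⟩ := exists_isProj hX.internal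
    obtain ⟨c', hc'⟩ := exists_isProj (hY.blk (Nat.sub_le p 1) 2).internal
    exact (isProj_prod hc hc').isInternal
  diff_mem e z hz := by
    rw [cone_diff]
    refine ⟨hX.diff_mem e _ hz.1, add_mem (blkDiff_mem_aux hY.diff_mem hz.2) ?_⟩
    intro j _
    rw [coneInj_apply]
    split_ifs with h
    · convert hf.map_mem _ _ hz.1 using 2
      simp [h]
    · exact zero_mem _
  diff_pow := by
    refine LinearMap.ext fun z => ?_
    have h1 : (((TorusLink.QComplex.cone p X Y f).diff ^ p) z).1 = 0 := by
      have := comp_pow_of_comm (D := (TorusLink.QComplex.cone p X Y f).diff) (D' := X.diff)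
        (f := fst k _ _) (fun _ => rfl) p z
      rw [hX.diff_pow] at this
      exact this
    have h2 := comp_pow_of_comm (coneToBlk_comm (p := p) hf) p z
    rw [blkDiff_pow le_rfl hY.diff_pow] at h2
    refine Prod.ext h1 (funext fun j => ?_)
    have h3 := congrFun h2 ⟨(j : ℕ) + 1, by omega⟩
    rw [coneToBlk_apply, dif_neg (by simp)] at h3
    exact h3

/-- The cone is invariant under surjections with acyclic kernels. -/
lemma cone_surjective [Fact p.Prime] [CharP k p] (hX : IsPComplex p X) (hY : IsPComplex p Y)
    (hX' : IsPComplex p X') (hY' : IsPComplex p Y') {f : X.carrier →ₗ[k] Y.carrier}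
    {f' : X'.carrier →ₗ[k] Y'.carrier} (hf : IsHom X Y f) (hf' : IsHom X' Y' f')
    {a : X.carrier →ₗ[k] X'.carrier} {b : Y.carrier →ₗ[k] Y'.carrier} (ha : IsHom X X' a)
    (hb : IsHom Y Y' b) (hab : ∀ x, f' (a x) = b (f x)) (has : Function.Surjective a)
    (hbs : Function.Surjective b) (haa : AcyclicOn p X.diff (ker a))
    (hba : AcyclicOn p Y.diff (ker b)) :
    HomotopyIso p (cone p X Y f) (cone p X' Y' f') := by
  have hp : 0 < p := (Fact.out : p.Prime).pos
  have hker : ∀ z : X.carrier × (Fin (p - 1) → Y.carrier),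
      z ∈ ker (a.prodMap (b.compLeft (Fin (p - 1)))) ↔ a z.1 = 0 ∧ ∀ j, b (z.2 j) = 0 :=
    fun z => ⟨fun h => ⟨congrArg Prod.fst h, fun j => congrFun (congrArg Prod.snd h) j⟩,
      fun h => Prod.ext h.1 (funext h.2)⟩
  have hcomm : ∀ z, a.prodMap (b.compLeft (Fin (p - 1))) ((cone p X Y f).diff z) =
      (cone p X' Y' f').diff (a.prodMap (b.compLeft (Fin (p - 1))) z) := by
    intro z
    rw [cone_diff, cone_diff]
    refine Prod.ext (ha.comm _) ?_
    simp only [LinearMap.prodMap_apply, map_add, blkDiff_map hb.comm]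
    congr 1
    funext j
    simp only [LinearMap.compLeft_apply, Function.comp_apply, coneInj_apply, apply_ite b, hab,
      map_zero]
  refine homotopyIso_of_surjective hp (hX.cone hY hf) (hX'.cone hY' hf')
    (f := a.prodMap (b.compLeft (Fin (p - 1)))) ⟨hcomm, ?_⟩ ?_ ?_
  · exact fun e z hz => ⟨ha.map_mem e _ hz.1, fun j _ => hb.map_mem _ _ (hz.2 j trivial)⟩
  · rintro ⟨x, y⟩
    obtain ⟨x, rfl⟩ := has x
    choose y' hy' using fun j => hbs (y j)
    exact ⟨(x, y'), Prod.ext rfl (funext hy')⟩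
  · refine AcyclicOn.of_map (D' := X.diff) hp ?_ ?_ (fst k _ _) (fun _ _ => rfl) ?_ ?_
    · intro z hz
      rw [LinearMap.mem_ker] at hz ⊢
      rw [hcomm, hz, map_zero]
    · intro z _; rw [(hX.cone hY hf).diff_pow]; rfl
    · have : ker (a.prodMap (b.compLeft (Fin (p - 1)))) ⊓
          ker (fst k X.carrier (Fin (p - 1) → Y.carrier)) =
          (Submodule.pi Set.univ fun _ => ker b).map (LinearMap.inr k _ _) := by
        ext z
        constructor
        · rintro ⟨h1, h2⟩
          exact ⟨z.2, fun j _ => ((hker z).mp h1).2 j, Prod.ext (LinearMap.mem_ker.mp h2).symm rfl⟩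
        · rintro ⟨y, hy, rfl⟩
          exact ⟨(hker _).mpr ⟨map_zero a, fun j => hy j trivial⟩, rfl⟩
      rw [this]
      refine AcyclicOn.map (hba.blk (Nat.sub_le p 1) hY.diff_pow ?_) ?_ LinearMap.inr_injective
      · intro x hx
        rw [LinearMap.mem_ker] at hx ⊢
        rw [hb.comm, hx, map_zero]
      · intro y
        rw [cone_diff]
        exact Prod.ext (map_zero _).symm (by simp)
    · have : (ker (a.prodMap (b.compLeft (Fin (p - 1))))).map (fst k _ _) =
          ker a := by
        ext x
        constructor
        · rintro ⟨z, hz, rfl⟩; exact ((hker z).mp hz).1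
        · intro hx; exact ⟨(x, 0), (hker _).mpr ⟨hx, fun j => map_zero b⟩, rfl⟩
      rw [this]; exact haa

/-- The cone of the zero map. -/
lemma cone_zero (X Y : QComplex k) : HomotopyIso p (cone p X Y 0) (X.sum (Sm p Y)) := by
  refine homotopyIso_of_equiv (M := cone p X Y 0) (N := X.sum (Sm p Y))
    (LinearEquiv.refl k (X.carrier × (Fin (p - 1) → Y.carrier))) (fun z => ?_)
    (fun _ _ h => h) fun _ _ h => h
  refine Prod.ext rfl ?_
  refine Eq.trans ?_ (add_zero (blkDiff (p - 1) Y.diff z.2))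
  refine congrArg (blkDiff (p - 1) Y.diff z.2 + ·) (funext fun j => ?_)
  change coneInj (p - 1) (0 : X.carrier →ₗ[k] Y.carrier) z.1 j = 0
  rw [coneInj_apply]; split_ifs <;> rfl

/-- The cone of a map with one component zero. -/
lemma cone_inl (X Y Z : QComplex k) (f : X.carrier →ₗ[k] Y.carrier) :
    HomotopyIso p (cone p X (sumC Y Z) (LinearMap.inl k _ _ ∘ₗ f))
      ((cone p X Y f).sum (Sm p Z)) := by
  let e : (X.carrier × (Fin (p - 1) → Y.carrier × Z.carrier)) ≃ₗ[k]
      (X.carrier × (Fin (p - 1) → Y.carrier)) × (Fin (p - 1) → Z.carrier) :=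
    { toFun := fun z => ((z.1, fun j => (z.2 j).1), fun j => (z.2 j).2)
      invFun := fun z => (z.1.1, fun j => (z.1.2 j, z.2 j))
      map_add' := fun _ _ => rfl
      map_smul' := fun _ _ => rfl
      left_inv := fun _ => rfl
      right_inv := fun _ => rfl }
  rw [sum_eq]
  refine homotopyIso_of_equiv (M := cone p X (sumC Y Z) (LinearMap.inl k _ _ ∘ₗ f))
    (N := sumC (cone p X Y f) (Sm p Z)) e (fun z => ?_)
    (fun d z hz => ⟨⟨hz.1, fun j _ => (hz.2 j trivial).1⟩, fun j _ => (hz.2 j trivial).2⟩)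
    fun d z hz => ⟨hz.1.1, fun j _ => ⟨hz.1.2 j trivial, hz.2 j trivial⟩⟩
  rw [cone_diff]
  refine Prod.ext (Prod.ext rfl (funext fun j => ?_)) (funext fun j => ?_)
  · change (blkDiff (p - 1) (sumC Y Z).diff z.2 j + coneInj (p - 1) _ z.1 j).1 =
      blkDiff (p - 1) Y.diff (fun j => (z.2 j).1) j + coneInj (p - 1) f z.1 j
    rw [blkDiff_apply, blkDiff_apply, coneInj_apply, coneInj_apply]
    split_ifs <;> simp
  · change (blkDiff (p - 1) (sumC Y Z).diff z.2 j + coneInj (p - 1) _ z.1 j).2 =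
      blkDiff (p - 1) Z.diff (fun j => (z.2 j).2) j
    rw [blkDiff_apply, blkDiff_apply, coneInj_apply]
    split_ifs <;> simp

/-- If `X` retracts onto `X'` up to a homotopy `η` vanishing on `X'`, the cone of a map `X → Y`
surjects with acyclic kernel onto the cone of its restriction to `X'`. -/
lemma exists_cone_retract [Fact p.Prime] [CharP k p] (hp : 2 < p) (hX : IsPComplex p X)
    (hY : IsPComplex p Y)
    {π : X.carrier →ₗ[k] Y.carrier} (hπ : IsHom X Y π) {ι : X'.carrier →ₗ[k] X.carrier}
    (hι : IsHom X' X ι) {r : X.carrier →ₗ[k] X'.carrier} (hr : IsHom X X' r)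
    (hrι : ∀ x, r (ι x) = x) {η : X.carrier →ₗ[k] X.carrier}
    (hη : ∀ (e : ℤ), ∀ x ∈ X.gr e, η x ∈ X.gr (e + 2 - 2 * (p : ℤ)))
    (hηι : ∀ x, η (ι x) = 0)
    (h1 : ∀ x, homotopySum p X.diff X.diff η x = x - ι (r x)) :
    ∃ F : (X.carrier × (Fin (p - 1) → Y.carrier)) →ₗ[k]
        (X'.carrier × (Fin (p - 1) → Y.carrier)),
      IsHom (cone p X Y π) (cone p X' Y (π ∘ₗ ι)) F ∧ Function.Surjective F ∧
      AcyclicOn p (cone p X Y π).diff (ker F) ∧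
      ∀ x, F (ι x, 0) = (x, 0) := by
  have hp0 : 0 < p := by omega
  -- `A (p - 1) = π - π ι r`, so the maps `A n` with alternating signs correct the square of `π` and `π ι`
  let A : ℕ → (X.carrier →ₗ[k] Y.carrier) := fun n => ((adOp X.diff Y.diff) ^ n) (π ∘ₗ η)
  have hA : ∀ n, A (n + 1) = Y.diff ∘ₗ A n - A n ∘ₗ X.diff := by
    intro n
    simp only [A]
    rw [pow_succ', Module.End.mul_apply, adOp_apply]
  have hAι : ∀ n x, A n (ι x) = 0 := by
    intro n
    induction n with
    | zero => intro x; simp [A, hηι]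
    | succ n ih =>
      intro x
      rw [hA, LinearMap.sub_apply, LinearMap.comp_apply, LinearMap.comp_apply, ih, ← hι.comm, ih]
      simp
  have hAd : ∀ (n : ℕ) (e : ℤ), ∀ x ∈ X.gr e, A n x ∈ Y.gr (e + 2 - 2 * (p : ℤ) + 2 * n) := by
    intro n
    induction n with
    | zero => intro e x hx; simpa [A] using hπ.map_mem _ _ (hη e x hx)
    | succ n ih =>
      intro e x hx
      rw [hA, LinearMap.sub_apply, LinearMap.comp_apply, LinearMap.comp_apply]
      refine sub_mem ?_ ?_
      · convert hY.diff_mem _ _ (ih e x hx) using 2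
        push_cast; ring
      · convert ih _ _ (hX.diff_mem e x hx) using 2
        push_cast; ring
  have hAp : ∀ x, A (p - 1) x = π x - π (ι (r x)) := by
    intro x
    have := LinearMap.congr_fun (homotopySum_comp_left (p := p) (D := X.diff) hπ.comm η) x
    rw [LinearMap.comp_apply, h1, map_sub, homotopySum_eq_adOp] at this
    exact this.symm
  let s : Fin (p - 1) → (X.carrier →ₗ[k] Y.carrier) := fun j =>
    -((-1 : k) ^ (p - 2 - (j : ℕ)) • A (p - 2 - (j : ℕ)))
  have hs0 : ∀ (j : Fin (p - 1)) x, (j : ℕ) = 0 → s j (X.diff x) - Y.diff (s j x) =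
      π (ι (r x)) - π x := by
    intro j x hj
    have hodd : Odd (p - 2) := by
      have := (Fact.out : p.Prime).eq_two_or_odd'
      rcases this with h | ⟨m, hm⟩
      · omega
      · exact ⟨m - 1, by omega⟩
    have h2 := hA (p - 2)
    rw [show p - 2 + 1 = p - 1 by omega] at h2
    have h3 := hAp x
    rw [h2] at h3
    simp only [s, hj, Nat.sub_zero, hodd.neg_one_pow]
    simp only [LinearMap.sub_apply, LinearMap.comp_apply] at h3
    simp only [neg_smul, one_smul, neg_neg]
    rw [← neg_sub, h3, neg_sub]
  have hs1 : ∀ (j : Fin (p - 1)) x, (h : (j : ℕ) ≠ 0) → s j (X.diff x) - Y.diff (s j x) =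
      s ⟨(j : ℕ) - 1, by omega⟩ x := by
    intro j x hj
    have h2 := hA (p - 2 - (j : ℕ))
    simp only [s]
    rw [show p - 2 - ((j : ℕ) - 1) = p - 2 - (j : ℕ) + 1 by omega, h2, pow_succ]
    simp only [LinearMap.neg_apply, LinearMap.smul_apply, LinearMap.sub_apply,
      LinearMap.comp_apply, map_neg, map_smul, mul_neg, mul_one, neg_smul, smul_sub]
    abel
  let F : (X.carrier × (Fin (p - 1) → Y.carrier)) →ₗ[k]
      (X'.carrier × (Fin (p - 1) → Y.carrier)) :=
    LinearMap.prod (r ∘ₗ fst k _ _)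
      (snd k _ _ + LinearMap.pi s ∘ₗ fst k _ _)
  have hF : ∀ z, F z = (r z.1, fun j => z.2 j + s j z.1) := fun z => rfl
  have hFc : ∀ z, F ((cone p X Y π).diff z) = (cone p X' Y (π ∘ₗ ι)).diff (F z) := by
    intro z
    rw [cone_diff, cone_diff, hF, hF]
    refine Prod.ext (hr.comm _) (funext fun j => ?_)
    simp only [Pi.add_apply, blkDiff_apply, coneInj_apply, LinearMap.comp_apply, map_add]
    by_cases hj : (j : ℕ) = 0
    · simp only [dif_pos hj, if_pos hj, zero_add]
      have := hs0 j z.1 hj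
      rw [sub_eq_sub_iff_add_eq_add] at this
      rw [add_assoc, add_comm (π z.1), this]
      abel
    · simp only [dif_neg hj, if_neg hj, add_zero]
      have := hs1 j z.1 hj
      rw [sub_eq_iff_eq_add] at this
      rw [this]; abel
  have hker : ∀ z, z ∈ ker F ↔ r z.1 = 0 ∧ ∀ j, z.2 j = - s j z.1 := by
    intro z
    rw [LinearMap.mem_ker, hF]
    constructor
    · intro h
      exact ⟨congrArg Prod.fst h, fun j => eq_neg_of_add_eq_zero_left (congrFun (congrArg Prod.snd h) j)⟩
    · rintro ⟨h1, h2⟩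
      exact Prod.ext h1 (funext fun j => by simp [h2])
  refine ⟨F, ⟨hFc, fun e z hz => ?_⟩, ?_, ?_, ?_⟩
  · refine ⟨hr.map_mem e _ hz.1, fun j _ => add_mem (hz.2 j trivial) ?_⟩
    refine neg_mem (Submodule.smul_mem _ _ ?_)
    change A (p - 2 - (j : ℕ)) z.1 ∈ _
    convert hAd _ _ _ hz.1 using 2
    have := j.isLt
    push_cast [show (j : ℕ) ≤ p - 2 by omega, show 2 ≤ p by omega]
    ring
  · rintro ⟨x, y⟩
    refine ⟨(ι x, fun j => y j - s j (ι x)), ?_⟩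
    rw [hF]
    exact Prod.ext (hrι x) (funext fun j => by simp)
  · refine AcyclicOn.of_map (D' := X.diff) hp0 ?_ ?_ (fst k _ _) (fun _ _ => rfl) ?_ ?_
    · intro z hz
      rw [LinearMap.mem_ker] at hz ⊢
      rw [hFc, hz, map_zero]
    · intro z _; rw [(hX.cone hY hπ).diff_pow]; rfl
    · have : ker F ⊓ ker (fst k X.carrier (Fin (p - 1) → Y.carrier)) =
          ⊥ := by
        rw [eq_bot_iff]
        rintro z ⟨h1, h2⟩
        have h3 : z.1 = 0 := h2
        exact Prod.ext h3 (funext fun j => by rw [((hker z).mp h1).2 j, h3, map_zero, neg_zero]; rfl)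
      rw [this]; exact acyclicOn_bot _ _
    · rintro _ ⟨z, hz, rfl⟩ hx
      have h0 : r z.1 = 0 := ((hker z).mp hz).1
      have hx' : X.diff z.1 = 0 := hx
      have h2 := h1 z.1
      rw [homotopySum_apply_of_diff_eq_zero hp0 hx', h0, map_zero, sub_zero] at h2
      refine ⟨η z.1 - ι (r (η z.1)), ⟨(η z.1 - ι (r (η z.1)), fun j => - s j (η z.1 - ι (r (η z.1)))),
        (hker _).mpr ⟨by simp [hrι], fun j => rfl⟩, rfl⟩, ?_⟩
      rw [map_sub, ← comp_pow_of_comm hι.comm, ← comp_pow_of_comm hr.comm, h2, h0, map_zero, sub_zero]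
      rfl
  · intro x
    rw [hF]
    refine Prod.ext (hrι x) (funext fun j => ?_)
    simp [s, hAι]

end Cones

/-! ### Rotation -/

section Rotation

variable {p : ℕ} {X P Y : QComplex k}

/-- For a short exact sequence `X → P → Y` with `P` acyclic, `Y` is the shift `X[1]`. Both are
quotients, with acyclic kernels, of the complex `X = ⋯ = X → P` with `p - 1` copies of `X`. -/
lemma homotopyIso_of_exact [Fact p.Prime] [CharP k p] (hp : 2 < p) (hX : IsPComplex p X)
    (hP : IsPComplex p P) (hY : IsPComplex p Y) {f : X.carrier →ₗ[k] P.carrier} (hf : IsHom X P f)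
    {g : P.carrier →ₗ[k] Y.carrier} (hg : IsHom P Y g) (hfi : Function.Injective f)
    (hgs : Function.Surjective g) (hfg : ∀ x, g x = 0 ↔ ∃ y, f y = x)
    (ha : AcyclicOn p P.diff ⊤) :
    HomotopyIso p Y ((Sm p X).qShift (-2 * (p : ℤ))) := by
  have hp0 : 0 < p := by omega
  have hp1 : p - 1 - 1 < p - 1 := by omega
  let fl : (Fin (p - 1) → X.carrier) →ₗ[k] P.carrier := f ∘ₗ proj ⟨p - 1 - 1, hp1⟩
  let Q : QComplex k :=
    { carrier := (Fin (p - 1) → X.carrier) × P.carrier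
      gr := fun e => ((Blk (p - 1) (2 + -2 * (p : ℤ)) X).gr e).prod (P.gr e)
      diff := LinearMap.prod (blkDiff (p - 1) X.diff ∘ₗ fst k _ _)
        (P.diff ∘ₗ snd k _ _ + fl ∘ₗ fst k _ _) }
  have hQd : ∀ z : (Fin (p - 1) → X.carrier) × P.carrier, Q.diff z =
      (blkDiff (p - 1) X.diff z.1, P.diff z.2 + f (z.1 ⟨p - 1 - 1, hp1⟩)) := fun z => rfl
  -- `p` copies of `X` map to `Q`, by `f` on the last copy
  let a : (Fin p → X.carrier) →ₗ[k] Q.carrier := LinearMap.prod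
    (LinearMap.pi fun j : Fin (p - 1) => proj (⟨j, by omega⟩ : Fin p))
    (f ∘ₗ proj (⟨p - 1, by omega⟩ : Fin p))
  have hac : ∀ y, a (blkDiff p X.diff y) = Q.diff (a y) := by
    intro y
    rw [hQd]
    refine Prod.ext (funext fun j => ?_) ?_
    · refine Eq.trans ?_ (blkDiff_apply _ _ _ _).symm
      exact blkDiff_apply _ _ _ _
    · refine (congrArg f (blkDiff_apply p X.diff y _)).trans ?_
      rw [dif_neg (by simp; omega), map_add, hf.comm, add_comm]
      rfl
  have hai : Function.Injective a := by
    rw [injective_iff_map_eq_zero]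
    intro y hy
    funext j
    by_cases h : (j : ℕ) < p - 1
    · exact congrFun (congrArg Prod.fst hy) ⟨j, h⟩
    · have h2 : j = ⟨p - 1, by omega⟩ := Fin.ext (by simp; omega)
      rw [h2]
      exact hfi ((congrArg Prod.snd hy).trans (map_zero f).symm)
  -- `Q` embeds into `p` copies of `P`
  let b : Q.carrier →ₗ[k] (Fin p → P.carrier) := LinearMap.pi fun j =>
    if h : (j : ℕ) < p - 1 then f ∘ₗ proj (⟨j, h⟩ : Fin (p - 1)) ∘ₗ fst k _ _
    else snd k _ _
  have hb : ∀ z j, b z j = if h : (j : ℕ) < p - 1 then f (z.1 ⟨j, h⟩) else z.2 := by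
    intro z j
    simp only [b, LinearMap.pi_apply]
    split_ifs <;> rfl
  have hbc : ∀ z, b (Q.diff z) = blkDiff p P.diff (b z) := by
    intro z
    funext j
    rw [hb (Q.diff z) j, blkDiff_apply, hb z j, hQd]
    by_cases h : (j : ℕ) < p - 1
    · rw [dif_pos h, dif_pos h]
      change f (blkDiff (p - 1) X.diff z.1 ⟨j, h⟩) = _
      rw [blkDiff_apply, map_add, hf.comm]
      congr 1
      by_cases h0 : (j : ℕ) = 0
      · rw [dif_pos h0, dif_pos h0, map_zero]
      · have h1 : (j : ℕ) - 1 < p - 1 := by omega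
        rw [dif_neg h0, dif_neg h0, hb]
        exact (dif_pos (t := fun h => f (z.1 (⟨(j : ℕ) - 1, h⟩ : Fin (p - 1))))
          (e := fun _ => z.2) h1).symm
    · have h1 : (j : ℕ) - 1 < p - 1 := by omega
      have h2 : (⟨(j : ℕ) - 1, h1⟩ : Fin (p - 1)) = ⟨p - 1 - 1, hp1⟩ := Fin.ext (by simp; omega)
      rw [dif_neg h, dif_neg h, dif_neg (by omega), hb]
      refine (add_comm _ _).trans (congrArg (· + P.diff z.2) ((dif_pos h1).trans ?_).symm)
      exact congrArg (fun i => f (z.1 i)) h2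
  have hbi : Function.Injective b := by
    rw [injective_iff_map_eq_zero]
    intro z hz
    refine Prod.ext (funext fun j => hfi ?_) ?_
    · have := congrFun hz ⟨j, by omega⟩
      rw [hb, dif_pos (by simp)] at this
      exact this.trans (map_zero f).symm
    · have := congrFun hz ⟨p - 1, by omega⟩
      rw [hb, dif_neg (by simp)] at this
      exact this
  have hB := hX.blk (Nat.sub_le p 1) (2 + -2 * (p : ℤ))
  have hQ : IsPComplex p Q :=
    { internal := by
        obtain ⟨c, hc⟩ := exists_isProj hB.internal
        obtain ⟨c', hc'⟩ := exists_isProj hP.internal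
        exact (isProj_prod hc hc').isInternal
      diff_mem := fun e z hz => by
        refine ⟨blkDiff_mem_aux hX.diff_mem hz.1, add_mem (hP.diff_mem e _ hz.2) ?_⟩
        have := hf.map_mem _ _ (hz.1 ⟨p - 1 - 1, hp1⟩ trivial)
        change f (z.1 ⟨p - 1 - 1, hp1⟩) ∈ _
        convert this using 2
        push_cast [show 1 ≤ p - 1 by omega, show 1 ≤ p by omega]
        ring
      diff_pow := LinearMap.ext fun z => hbi (by
        rw [comp_pow_of_comm hbc, blkDiff_pow le_rfl hP.diff_pow]; exact (map_zero b).symm) }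
  have h1 : HomotopyIso p Q Y := by
    refine homotopyIso_of_surjective hp0 hQ hY (f := g ∘ₗ snd k _ _) ⟨fun z => ?_, fun e z hz =>
      hg.map_mem e _ hz.2⟩ (fun y => ?_) ?_
    · rw [hQd]
      have : g (f (z.1 ⟨p - 1 - 1, hp1⟩)) = 0 := (hfg _).mpr ⟨_, rfl⟩
      change g (P.diff z.2 + f (z.1 ⟨p - 1 - 1, hp1⟩)) = Y.diff (g z.2)
      rw [map_add, hg.comm, this, add_zero]
    · obtain ⟨x, rfl⟩ := hgs y; exact ⟨(0, x), rfl⟩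
    · have : ker (g ∘ₗ snd k (Fin (p - 1) → X.carrier) P.carrier) =
          (⊤ : Submodule k (Fin p → X.carrier)).map a := by
        ext z
        constructor
        · intro hz
          obtain ⟨y, hy⟩ := (hfg z.2).mp hz
          refine ⟨fun j => if h : (j : ℕ) < p - 1 then z.1 ⟨j, h⟩ else y, trivial,
            Prod.ext (funext fun j => ?_) ?_⟩
          · exact dif_pos j.isLt
          · exact (congrArg f (dif_neg (by simp))).trans hy
        · rintro ⟨y, -, rfl⟩
          exact (hfg _).mpr ⟨_, rfl⟩
      rw [this]
      exact ((blk_contractible 0 X).acyclicOn hp0).map hac hai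
  have h2 : HomotopyIso p Q (Blk (p - 1) (2 + -2 * (p : ℤ)) X) := by
    refine homotopyIso_of_surjective hp0 hQ hB (f := fst k _ _)
      ⟨fun z => rfl, fun e z hz => hz.1⟩ (fun y => ⟨(y, 0), rfl⟩) ?_
    have : ker (fst k (Fin (p - 1) → X.carrier) P.carrier) =
        (⊤ : Submodule k P.carrier).map (LinearMap.inr k _ _) := by
      ext z
      exact ⟨fun hz => ⟨z.2, trivial, Prod.ext (LinearMap.mem_ker.mp hz).symm rfl⟩, by
        rintro ⟨y, -, rfl⟩; rfl⟩
    rw [this]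
    refine ha.map (fun x => ?_) LinearMap.inr_injective
    rw [hQd]
    refine Prod.ext (map_zero _).symm ?_
    change P.diff x = P.diff x + f 0
    rw [map_zero, add_zero]
  refine (h1.symm.trans h2).trans (HomotopyIso.of_eq ?_)
  rw [blk_add_shift]

/-- Complementary blocks are exchanged by the homological shift. -/
lemma blk_rotate [Fact p.Prime] [CharP k p] (hp : 2 < p) {M : QComplex k} (hM : IsPComplex p M)
    {m n : ℕ} (hmn : m + n = p) :
    HomotopyIso p (Blk m 0 M) ((Sm p (Blk n (2 * m) M)).qShift (-2 * (p : ℤ))) := by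
  let f : (Fin n → M.carrier) →ₗ[k] (Fin p → M.carrier) := LinearMap.pi fun j =>
    if h : m ≤ (j : ℕ) then proj (⟨(j : ℕ) - m, by omega⟩ : Fin n) else 0
  have hf : ∀ y j, f y j = if h : m ≤ (j : ℕ) then y ⟨(j : ℕ) - m, by omega⟩ else 0 := by
    intro y j
    simp only [f, LinearMap.pi_apply]
    split_ifs <;> rfl
  let g : (Fin p → M.carrier) →ₗ[k] (Fin m → M.carrier) := LinearMap.pi fun j =>
    proj (⟨j, by omega⟩ : Fin p)
  have hg : ∀ y j, g y j = y ⟨j, by omega⟩ := fun y j => rfl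
  refine homotopyIso_of_exact hp (hM.blk (by omega) _) (hM.blk le_rfl 0) (hM.blk (by omega) 0)
    (f := f) ⟨fun y => funext fun j => ?_, fun e y hy j _ => ?_⟩
    (g := g) ⟨fun y => funext fun j => ?_, fun e y hy j _ => ?_⟩ ?_ ?_ (fun y => ⟨fun h => ?_, ?_⟩)
    ((blk_contractible 0 M).acyclicOn (by omega))
  · rw [hf, blkDiff_apply, hf y j, hf]
    by_cases h : m ≤ (j : ℕ)
    · rw [dif_pos h, dif_pos h]
      refine (blkDiff_apply _ _ _ _).trans ?_
      congr 1
      by_cases h0 : (j : ℕ) - m = 0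
      · rw [dif_pos h0]
        by_cases h2 : (j : ℕ) = 0
        · rw [dif_pos h2]
        · have h1 : ¬ m ≤ (j : ℕ) - 1 := by omega
          rw [dif_neg h2, dif_neg h1]
      · have h1 : m ≤ (j : ℕ) - 1 := by omega
        rw [dif_neg h0, dif_neg (by omega), dif_pos h1]
        congr 2
        simp; omega
    · have h1 : ¬ m ≤ (j : ℕ) - 1 := by omega
      rw [dif_neg h, dif_neg h, map_zero, add_zero, dif_neg h1]
      split_ifs <;> rfl
  · change f y j ∈ M.gr _
    rw [hf]
    split_ifs with h
    · have := hy ⟨(j : ℕ) - m, by omega⟩ trivial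
      change y ⟨(j : ℕ) - m, _⟩ ∈ M.gr (e - 2 * m - 2 * (((j : ℕ) - m : ℕ) : ℤ)) at this
      convert this using 2
      push_cast [h]; ring
    · exact zero_mem _
  · rw [hg]
    exact (blkDiff_apply p M.diff y _).trans (blkDiff_apply m M.diff (g y) j).symm
  · exact hy (⟨j, by omega⟩ : Fin p) trivial
  · rw [injective_iff_map_eq_zero]
    intro y hy
    funext j
    have := congrFun hy ⟨m + j, by omega⟩
    rw [hf, dif_pos (by simp)] at this
    refine Eq.trans (congrArg y (Fin.ext ?_)) this
    simp
  · intro y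
    refine ⟨fun j => if h : (j : ℕ) < m then y ⟨j, h⟩ else 0, funext fun j => ?_⟩
    exact dif_pos j.isLt
  · refine ⟨fun j => y ⟨m + j, by omega⟩, funext fun j => ?_⟩
    rw [hf]
    split_ifs with h1
    · congr 1; ext; simp; omega
    · exact (congrFun h ⟨j, by omega⟩).symm
  · rintro ⟨y, rfl⟩
    funext j
    exact (hf _ _).trans (dif_neg (by simp))

/-- The shift `[-2]` is a shift of the `q`-grading. -/
lemma sm_sm [Fact p.Prime] [CharP k p] (hp : 2 < p) {M : QComplex k} (hM : IsPComplex p M) :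
    HomotopyIso p (Sm p (Sm p M)) (M.qShift (2 * p)) := by
  have h := (blk_rotate hp hM (show 1 + (p - 1) = p by omega)).qShift (2 * p)
  rw [qShift_qShift, show -2 * (p : ℤ) + 2 * p = 0 by ring, qShift_zero] at h
  refine (HomotopyIso.trans ?_ h).symm
  refine HomotopyIso.qShift ?_ _
  let e : M.carrier ≃ₗ[k] (Fin 1 → M.carrier) :=
    { toFun := fun x _ => x
      invFun := fun y => y 0
      map_add' := fun _ _ => rfl
      map_smul' := fun _ _ => rfl
      left_inv := fun _ => rfl
      right_inv := fun y => funext fun j => by rw [Subsingleton.elim j 0] }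
  refine homotopyIso_of_equiv (M := M) (N := Blk 1 0 M) e (fun x => funext fun j => ?_)
    (fun d x hx j _ => ?_) fun d y hy => ?_
  · refine Eq.trans ?_ (blkDiff_apply _ _ _ _).symm
    rw [dif_pos (by omega), zero_add]; rfl
  · change x ∈ M.gr (d - 0 - 2 * ((j : ℕ) : ℤ))
    rwa [show d - 0 - 2 * ((j : ℕ) : ℤ) = d by have := j.isLt; omega]
  · have : y 0 ∈ M.gr (d - 0 - 2 * ((0 : ℕ) : ℤ)) := hy 0 trivial
    rwa [show d - 0 - 2 * ((0 : ℕ) : ℤ) = d by simp] at this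

end Rotation

/-! ### Slash homology is a homotopy functor -/

section Slash

variable {p : ℕ} {M N L : QComplex k}

lemma ker_pow_of_comm {f : M.carrier →ₗ[k] N.carrier} (hf : ∀ x, f (M.diff x) = N.diff (f x)) (n : ℕ)
    {x : M.carrier} (hx : x ∈ ker (M.diff ^ n)) : f x ∈ ker (N.diff ^ n) := by
  rw [LinearMap.mem_ker] at hx ⊢
  rw [← comp_pow_of_comm hf, hx, map_zero]

lemma slashRel_le_comap {f : M.carrier →ₗ[k] N.carrier} (hf : ∀ x, f (M.diff x) = N.diff (f x))
    (j : ℕ) : slashRel p M j ≤ (slashRel p N j).comap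
      (f.restrict fun _ hx => ker_pow_of_comm hf (j + 1) hx) := by
  intro x hx
  have hx' : (x : M.carrier) ∈ LinearMap.range (M.diff ^ (p - j - 1)) ⊔
    ker (M.diff ^ j) := hx
  obtain ⟨y, ⟨w, rfl⟩, z, hz, hyz⟩ := Submodule.mem_sup.mp hx'
  change f (x : M.carrier) ∈ LinearMap.range (N.diff ^ (p - j - 1)) ⊔ ker (N.diff ^ j)
  rw [← hyz, map_add, comp_pow_of_comm hf]
  exact Submodule.add_mem_sup ⟨_, rfl⟩ (ker_pow_of_comm hf _ hz)

/-- The map on slash homology induced by a linear map commuting with the operators. -/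
def slashMap (p : ℕ) (f : M.carrier →ₗ[k] N.carrier) (hf : ∀ x, f (M.diff x) = N.diff (f x)) :
    (∀ j : Fin (p - 1), SlashPart p M j) →ₗ[k] (∀ j : Fin (p - 1), SlashPart p N j) :=
  LinearMap.pi fun j => Submodule.mapQ (slashRel p M j) (slashRel p N j) _
    (slashRel_le_comap hf j) ∘ₗ proj j

lemma slash_exists_rep (x : ∀ j : Fin (p - 1), SlashPart p M j) :
    ∃ y : ∀ j : Fin (p - 1), ker (M.diff ^ ((j : ℕ) + 1)),
      x = fun j : Fin (p - 1) => (slashRel p M j).mkQ (y j) := by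
  choose y hy using fun j : Fin (p - 1) => Submodule.mkQ_surjective (slashRel p M j) (x j)
  exact ⟨y, funext fun j => (hy j).symm⟩

lemma slashMap_mk {f : M.carrier →ₗ[k] N.carrier} (hf : ∀ x, f (M.diff x) = N.diff (f x))
    (y : ∀ j : Fin (p - 1), ker (M.diff ^ ((j : ℕ) + 1))) (j : Fin (p - 1)) :
    slashMap p f hf (fun j : Fin (p - 1) => (slashRel p M j).mkQ (y j)) j =
      (slashRel p N j).mkQ ⟨f (y j), ker_pow_of_comm hf _ (y j).2⟩ := rfl

lemma slashMap_congr {f g : M.carrier →ₗ[k] N.carrier} (hf : ∀ x, f (M.diff x) = N.diff (f x))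
    (hg : ∀ x, g (M.diff x) = N.diff (g x))
    (h : ∀ j < p - 1, ∀ x ∈ ker (M.diff ^ (j + 1)),
      f x - g x ∈ LinearMap.range (N.diff ^ (p - j - 1))) (x) :
    slashMap p f hf x = slashMap p g hg x := by
  obtain ⟨y, rfl⟩ := slash_exists_rep x
  funext j
  rw [slashMap_mk, slashMap_mk]
  refine (Submodule.Quotient.eq _).mpr ?_
  exact Submodule.mem_sup_left (h j j.isLt _ (y j).2)

lemma slash_diff_mk (y : ∀ j : Fin (p - 1), ker (M.diff ^ ((j : ℕ) + 1))) (j : Fin (p - 1)) :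
    ((slash p M).diff (fun j : Fin (p - 1) => (slashRel p M j).mkQ (y j)) :
      ∀ j : Fin (p - 1), SlashPart p M j) j =
      if h : (j : ℕ) + 1 < p - 1 then (slashRel p M j).mkQ (kerDiff M j (y ⟨j + 1, h⟩)) else 0 := by
  change (LinearMap.pi fun j : Fin (p - 1) =>
        if h : (j : ℕ) + 1 < p - 1 then
          slashDiff p M j h ∘ₗ proj (⟨(j : ℕ) + 1, h⟩ : Fin (p - 1))
        else 0 : (∀ j : Fin (p - 1), SlashPart p M j) →ₗ[k] ∀ j : Fin (p - 1), SlashPart p M j)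
        (fun j : Fin (p - 1) => (slashRel p M j).mkQ (y j)) j = _
  rw [LinearMap.pi_apply]
  split_ifs with h <;> rfl

lemma slashMap_isHom {f : M.carrier →ₗ[k] N.carrier} (hf : IsHom M N f) :
    IsHom (slash p M) (slash p N) (slashMap p f hf.comm) := by
  refine ⟨fun x => ?_, fun e x hx j _ => ?_⟩
  · obtain ⟨y, rfl⟩ := slash_exists_rep x
    funext j
    have h1 : (slash p M).diff (fun j : Fin (p - 1) => (slashRel p M j).mkQ (y j)) =
        fun j : Fin (p - 1) => (slashRel p M j).mkQ
          (if h : (j : ℕ) + 1 < p - 1 then kerDiff M j (y ⟨j + 1, h⟩) else 0) := by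
      funext j
      refine (slash_diff_mk y j).trans ?_
      split_ifs with h
      · rfl
      · exact (map_zero _).symm
    refine (congrArg (fun z => slashMap p f hf.comm z j) h1).trans ?_
    refine (slashMap_mk hf.comm _ j).trans ?_
    refine Eq.trans ?_ (slash_diff_mk (fun j => ⟨f (y j), ker_pow_of_comm hf.comm _ (y j).2⟩) j).symm
    split_ifs with h
    · exact congrArg _ (Subtype.ext (hf.comm _))
    · refine Eq.trans (congrArg _ ?_) (map_zero (slashRel p N j).mkQ)
      exact Subtype.ext (map_zero f)
  · obtain ⟨y, hy, hxy⟩ := hx j trivial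
    refine ⟨⟨f y, ker_pow_of_comm hf.comm _ y.2⟩, hf.map_mem _ _ hy, ?_⟩
    exact congrArg (Submodule.mapQ (slashRel p M j) (slashRel p N j) _ (slashRel_le_comap hf.comm j))
      hxy

lemma NullHomotopic.mem_range {f : M.carrier →ₗ[k] N.carrier} (h : NullHomotopic p M N f) {j : ℕ}
    (hj : j < p - 1) {x : M.carrier} (hx : x ∈ ker (M.diff ^ (j + 1))) :
    f x ∈ LinearMap.range (N.diff ^ (p - j - 1)) := by
  obtain ⟨s, -, rfl⟩ := h
  rw [LinearMap.sum_apply]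
  refine sum_mem fun i hi => ?_
  rw [Finset.mem_range] at hi
  by_cases h : j + 1 ≤ p - 1 - i
  · have : (M.diff ^ (p - 1 - i)) x = 0 := by
      rw [show p - 1 - i = (p - 1 - i - (j + 1)) + (j + 1) by omega, pow_add, Module.End.mul_apply,
        LinearMap.mem_ker.mp hx, map_zero]
    rw [LinearMap.comp_apply, LinearMap.comp_apply, this, map_zero, map_zero]
    exact zero_mem _
  · refine ⟨(N.diff ^ (i - (p - j - 1))) (s ((M.diff ^ (p - 1 - i)) x)), ?_⟩
    rw [← Module.End.mul_apply, ← pow_add, show p - j - 1 + (i - (p - j - 1)) = i by omega]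
    rfl

lemma HomotopyIso.slash (h : HomotopyIso p M N) : HomotopyIso p (slash p M) (slash p N) := by
  obtain ⟨f, g, hf, hg, h1, h2⟩ := h
  refine homotopyIso_of_inverse (slashMap_isHom hf) (slashMap_isHom hg) (fun x => ?_) fun x => ?_
  · have := slashMap_congr (hg.comp hf).comm (IsHom.id M).comm
      (fun j hj x hx => h1.mem_range hj hx) x
    obtain ⟨y, rfl⟩ := slash_exists_rep x
    exact this
  · have := slashMap_congr (hf.comp hg).comm (IsHom.id N).comm
      (fun j hj x hx => h2.mem_range hj hx) x
    obtain ⟨y, rfl⟩ := slash_exists_rep x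
    exact this

lemma slash_qShift (a : ℤ) (M : QComplex k) : slash p (M.qShift a) = (slash p M).qShift a := rfl

lemma slash_sum (M N : QComplex k) : HomotopyIso p (slash p (M.sum N)) ((slash p M).sum (slash p N)) := by
  have h1 : IsHom (M.sum N) M (fst k M.carrier N.carrier) := ⟨fun _ => rfl, fun _ _ h => h.1⟩
  have h2 : IsHom (M.sum N) N (snd k M.carrier N.carrier) := ⟨fun _ => rfl, fun _ _ h => h.2⟩
  have h3 : IsHom M (M.sum N) (LinearMap.inl k M.carrier N.carrier) :=
    ⟨fun _ => Prod.ext rfl (map_zero N.diff).symm, fun _ _ h => ⟨h, zero_mem _⟩⟩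
  have h4 : IsHom N (M.sum N) (LinearMap.inr k M.carrier N.carrier) :=
    ⟨fun _ => Prod.ext (map_zero M.diff).symm rfl, fun _ _ h => ⟨zero_mem _, h⟩⟩
  have k1 := slashMap_isHom (p := p) h1
  have k2 := slashMap_isHom (p := p) h2
  have k3 := slashMap_isHom (p := p) h3
  have k4 := slashMap_isHom (p := p) h4
  rw [sum_eq (slash p M)]
  refine homotopyIso_of_inverse (N := sumC (slash p M) (slash p N)) (f := (slashMap p _ h1.comm).prod (slashMap p _ h2.comm))
    (g := (slashMap p _ h3.comm).coprod (slashMap p _ h4.comm))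
    ⟨fun x => Prod.ext (k1.comm x) (k2.comm x), fun e x hx => ⟨k1.map_mem e x hx, k2.map_mem e x hx⟩⟩
    ⟨fun x => ?_, fun e x hx => add_mem (k3.map_mem e _ hx.1) (k4.map_mem e _ hx.2)⟩
    (fun x => ?_) fun x => ?_
  · refine Eq.trans (congrArg₂ (· + ·) (k3.comm x.1) (k4.comm x.2)) (map_add _ _ _).symm
  · obtain ⟨y, rfl⟩ := slash_exists_rep x
    funext j
    change (slashRel p (M.sum N) j).mkQ (_ + _) = _
    congr 1
    refine Subtype.ext (Prod.ext ?_ ?_)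
    · exact add_zero (y j).1.1
    · exact zero_add (y j).1.2
  · obtain ⟨x, x'⟩ := x
    obtain ⟨y, rfl⟩ := slash_exists_rep x
    obtain ⟨y', rfl⟩ := slash_exists_rep x'
    refine Prod.ext (funext fun j => ?_) (funext fun j => ?_)
    · change (slashRel p M j).mkQ _ = (slashRel p M j).mkQ _
      congr 1
      exact Subtype.ext (add_zero (y j).1)
    · change (slashRel p N j).mkQ _ = (slashRel p N j).mkQ _
      congr 1
      exact Subtype.ext (zero_add (y' j).1)

end Slash

/-! ### Complexes isomorphic to their slash homology -/

section Stable

variable {p : ℕ} {M N : QComplex k}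

/-- Complexes that are, together with their homological shifts, isomorphic to their slash
homology in the homotopy category. -/
structure SlashStable (p : ℕ) (M : QComplex k) : Prop where
  isPComplex : IsPComplex p M
  iso : HomotopyIso p (slash p M) M
  iso_Sm : HomotopyIso p (slash p (Sm p M)) (Sm p M)

lemma slash_of_contractible (h : Contractible p M) : HomotopyIso p (slash p M) M := by
  refine Contractible.homotopyIso ?_ h
  have : Subsingleton (slash p M).carrier := by
    refine ⟨fun x x' => ?_⟩
    obtain ⟨y, rfl⟩ := slash_exists_rep x
    obtain ⟨y', rfl⟩ := slash_exists_rep x'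
    funext j
    refine (Submodule.Quotient.eq _).mpr (Submodule.mem_sup_left ?_)
    exact NullHomotopic.mem_range h j.isLt (y j - y' j).2
  exact contractible_of_subsingleton _

lemma SlashStable.of_contractible [Fact p.Prime] [CharP k p] (hM : IsPComplex p M)
    (h : Contractible p M) : SlashStable p M :=
  ⟨hM, slash_of_contractible h, slash_of_contractible (h.blk _ _)⟩

lemma SlashStable.qShift (hM : SlashStable p M) (a : ℤ) : SlashStable p (M.qShift a) where
  isPComplex := hM.isPComplex.qShift a
  iso := hM.iso.qShift a
  iso_Sm := by
    have := hM.iso_Sm.qShift a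
    rw [← slash_qShift] at this
    rwa [show Sm p (M.qShift a) = (Sm p M).qShift a from blk_qShift _ _ _ _]

lemma SlashStable.sum [Fact p.Prime] [CharP k p] (hM : SlashStable p M) (hN : SlashStable p N) :
    SlashStable p (M.sum N) where
  isPComplex := hM.isPComplex.sum hN.isPComplex
  iso := (slash_sum M N).trans (hM.iso.sum hN.iso)
  iso_Sm := ((blk_sum _ _ _ _).slash.trans (slash_sum _ _)).trans
    ((hM.iso_Sm.sum hN.iso_Sm).trans (blk_sum _ _ _ _).symm)

lemma SlashStable.blk [Fact p.Prime] [CharP k p] (hp : 2 < p) (hM : SlashStable p M) :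
    SlashStable p (Sm p M) where
  isPComplex := hM.isPComplex.blk (Nat.sub_le p 1) 2
  iso := hM.iso_Sm
  iso_Sm := by
    have h := sm_sm hp hM.isPComplex
    have h2 := hM.iso.qShift (2 * (p : ℤ))
    rw [← slash_qShift] at h2
    exact (h.slash.trans h2).trans h.symm

lemma V_pow_apply (i m : ℕ) (v : Fin (i + 1) → k) (l : Fin (i + 1)) :
    (((V k i).diff ^ m) v : Fin (i + 1) → k) l =
      if h : m ≤ (l : ℕ) then v ⟨(l : ℕ) - m, by omega⟩ else 0 :=
  blkShift_pow_apply (k := k) (M := k) (i + 1) m v l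

lemma V_diff_apply (i : ℕ) (v : Fin (i + 1) → k) (l : Fin (i + 1)) :
    ((V k i).diff v : Fin (i + 1) → k) l =
      if h : (l : ℕ) = 0 then 0 else v ⟨(l : ℕ) - 1, by omega⟩ :=
  blkShift_apply (k := k) (M := k) (i + 1) v l

/-- The ground field, in degree zero. -/
abbrev unitC (k : Type u) [Field k] : QComplex k where
  carrier := k
  gr := fun e => if e = 0 then ⊤ else ⊥
  diff := 0

lemma unitC_isPComplex (hp : 0 < p) : IsPComplex p (unitC k) where
  internal := by
    have h : IsProj (unitC k).gr (fun e => if e = 0 then (LinearMap.id : k →ₗ[k] k) else 0) :=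
      { mem := fun e x => by
          by_cases h : e = 0 <;> simp [h]
        same := fun e x hx => by
          by_cases h : e = 0
          · simp [h]
          · simpa [h, eq_comm] using hx
        other := fun e e' he x hx => by
          by_cases h : e = 0
          · rw [if_neg (by omega)]; rfl
          · rw [show x = 0 by simpa [h] using hx, map_zero]
        fin := fun x => ⟨{0}, fun e he => by rw [if_neg (by simpa using he)]; rfl, by simp⟩ }
    exact h.isInternal
  diff_mem := fun e x _ => zero_mem _
  diff_pow := zero_pow hp.ne'

lemma V_eq (i : ℕ) : V k i = Blk (i + 1) (-(i : ℤ)) (unitC k) := by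
  have h1 : (V k i).gr = (Blk (i + 1) (-(i : ℤ)) (unitC k)).gr := by
    funext e
    ext v
    refine ⟨fun h j _ => ?_, fun h j hj => ?_⟩
    · change v j ∈ (if e - -(i : ℤ) - 2 * ((j : ℕ) : ℤ) = 0 then (⊤ : Submodule k k) else ⊥)
      split_ifs with h0
      · trivial
      · exact h j (by omega)
    · have : v j ∈ (if e - -(i : ℤ) - 2 * ((j : ℕ) : ℤ) = 0 then (⊤ : Submodule k k) else ⊥) :=
        h j trivial
      rwa [if_neg (by omega)] at this
  have h2 : (V k i).diff = (Blk (i + 1) (-(i : ℤ)) (unitC k)).diff := by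
    refine LinearMap.ext fun v => ?_
    exact (add_zero _).symm
  calc V k i = ⟨Fin (i + 1) → k, (V k i).gr, (V k i).diff⟩ := rfl
    _ = _ := by rw [h1, h2]; rfl

lemma V_isPComplex [Fact p.Prime] [CharP k p] {i : ℕ} (hi : i < p) : IsPComplex p (V k i) := by
  rw [V_eq]
  exact (unitC_isPComplex (by omega)).blk (by omega) _

lemma V_contractible [Fact p.Prime] [CharP k p] : Contractible p (V k (p - 1)) := by
  have : p - 1 + 1 = p := Nat.sub_add_cancel (Fact.out : p.Prime).one_le
  rw [V_eq, this]
  exact blk_contractible _ _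

/-- The balanced complexes are exchanged by the homological shift. -/
lemma Sm_V [Fact p.Prime] [CharP k p] (hp : 2 < p) {i j : ℕ} (hij : i + j + 2 = p) :
    HomotopyIso p (Sm p (V k i)) ((V k j).qShift p) := by
  have h := blk_rotate hp (unitC_isPComplex (k := k) (p := p) (by omega))
    (show (j + 1) + (i + 1) = p by omega)
  rw [show 2 * ((j + 1 : ℕ) : ℤ) = -(i : ℤ) + (2 * ((j + 1 : ℕ) : ℤ) + i) by ring, blk_add_shift,
    ← V_eq, show Sm p ((V k i).qShift _) = (Sm p (V k i)).qShift _ from blk_qShift _ _ _ _,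
    qShift_qShift] at h
  rw [show (0 : ℤ) = -(j : ℤ) + j by ring, blk_add_shift, ← V_eq] at h
  have h' := h.symm.qShift (p - j : ℤ)
  rw [qShift_qShift, qShift_qShift] at h'
  convert h' using 1
  · rw [show 2 * ((j + 1 : ℕ) : ℤ) + i + -2 * (p : ℤ) + (p - j) = 0 by subst hij; push_cast; ring, qShift_zero]
  · congr 1; ring

/-- The basis vector of degree `i - 2j` spans the `j`-th part of the slash homology of `V_i`. -/
lemma slash_V {i : ℕ} (hi : i + 1 < p) : HomotopyIso p (slash p (V k i)) (V k i) := by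
  -- the coordinate of index `i - j` identifies the `j`-th part of the slash homology with `k`
  have hpow : ∀ (m : ℕ) (v : Fin (i + 1) → k), v ∈ ker ((V k i).diff ^ m) ↔
      ∀ l : Fin (i + 1), (l : ℕ) + m < i + 1 → v l = 0 := by
    intro m v
    refine ⟨fun h l hl => ?_, fun h => (LinearMap.mem_ker (f := (V k i).diff ^ m) (y := v)).mpr (funext fun l => ?_)⟩
    · have := (V_pow_apply i m v ⟨l + m, hl⟩).symm.trans (congrFun ((LinearMap.mem_ker (f := (V k i).diff ^ m) (y := v)).mp h) ⟨l + m, hl⟩)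
      rw [dif_pos (by simp)] at this
      refine Eq.trans (congrArg v (Fin.ext ?_)) this
      simp
    · refine (V_pow_apply i m v l).trans ?_
      split_ifs with h1
      · exact h _ (by have := l.isLt; simp; omega)
      · rfl
  have hrel : ∀ (j : ℕ) (y : ker ((V k i).diff ^ (j + 1))), j < p - 1 →
      (y ∈ slashRel p (V k i) j ↔ ∀ l : Fin (i + 1), (l : ℕ) + j = i → (y.1 : Fin (i + 1) → k) l = 0) := by
    intro j y hj
    have hle : LinearMap.range ((V k i).diff ^ (p - j - 1)) ≤ ker ((V k i).diff ^ j) := by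
      rintro _ ⟨w, rfl⟩
      refine (hpow _ _).mpr fun l hl => ?_
      exact (V_pow_apply _ _ _ _).trans (dif_neg (by omega))
    have hy : y ∈ slashRel p (V k i) j ↔ y.1 ∈ ker ((V k i).diff ^ j) := by
      rw [← sup_eq_right.mpr hle]; rfl
    refine hy.trans ((hpow _ _).trans ?_)
    · refine ⟨fun h l hl => h l (by omega), fun h l hl => ?_⟩
      by_cases h1 : (l : ℕ) + j = i
      · exact h l h1
      · exact (hpow _ _).mp y.2 l (by omega)
  have hsingle : ∀ (v : Fin (i + 1) → k) (j : ℕ),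
      (fun l : Fin (i + 1) => if (l : ℕ) + j = i then v l else 0) ∈
        ker ((V k i).diff ^ (j + 1)) := by
    intro v j
    exact (hpow _ _).mpr fun l hl => if_neg (by omega)
  let F : (Fin (i + 1) → k) →ₗ[k] (∀ j : Fin (p - 1), SlashPart p (V k i) j) :=
    { toFun := fun v j => (slashRel p (V k i) j).mkQ ⟨_, hsingle v j⟩
      map_add' := fun v w => by
        funext j
        refine Eq.trans (congrArg _ (Subtype.ext (funext fun l => ?_))) (map_add (slashRel p (V k i) j).mkQ _ _)
        change (if (l : ℕ) + j = i then v l + w l else 0) = (if (l : ℕ) + j = i then v l else 0) +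
          (if (l : ℕ) + j = i then w l else 0)
        split_ifs <;> simp
      map_smul' := fun c v => by
        funext j
        refine Eq.trans (congrArg _ (Subtype.ext (funext fun l => ?_))) (map_smul (slashRel p (V k i) j).mkQ c _)
        change (if (l : ℕ) + j = i then c • v l else 0) = c • (if (l : ℕ) + j = i then v l else 0)
        split_ifs <;> simp }
  have hF : Function.Bijective F := by
    constructor
    · rw [injective_iff_map_eq_zero]
      intro v hv
      funext l
      have hl := l.isLt
      have h1 := congrFun hv ⟨i - l, by omega⟩
      have h2 := (hrel _ _ (by omega)).mp ((Submodule.Quotient.mk_eq_zero _).mp h1) l (by simp; omega)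
      refine Eq.trans (if_pos ?_).symm h2
      simp; omega
    · intro x
      obtain ⟨y, rfl⟩ := slash_exists_rep x
      refine ⟨fun l => if h : i - (l : ℕ) < p - 1 then ((y ⟨i - l, h⟩).1 : Fin (i + 1) → k) l else 0, ?_⟩
      funext j
      refine (Submodule.Quotient.eq _).mpr ((hrel _ _ j.isLt).mpr fun l hl => ?_)
      obtain ⟨j, hj⟩ := j
      obtain rfl : j = i - l := by simp at hl; omega
      change (if _ then (if h : i - (l : ℕ) < p - 1 then ((y ⟨i - l, h⟩).1 : Fin (i + 1) → k) l else 0) else 0) -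
        ((y ⟨i - l, _⟩).1 : Fin (i + 1) → k) l = 0
      rw [if_pos hl, dif_pos hj, sub_self]
  refine HomotopyIso.symm (homotopyIso_of_equiv (M := V k i) (N := slash p (V k i))
    (LinearEquiv.ofBijective F hF) (fun v => funext fun j => ?_) (fun d v hv j _ => ?_) fun d x hx => ?_)
  · refine Eq.trans ?_ (slash_diff_mk (fun j => ⟨_, hsingle v j⟩) j).symm
    split_ifs with h
    · refine congrArg _ (Subtype.ext (funext fun l => ?_))
      change (if (l : ℕ) + j = i then ((V k i).diff v : Fin (i + 1) → k) l else 0) =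
        ((V k i).diff (fun l : Fin (i + 1) => if (l : ℕ) + (j + 1) = i then v l else 0) :
          Fin (i + 1) → k) l
      refine Eq.trans (if_congr Iff.rfl (V_diff_apply i v l) rfl)
        (Eq.trans ?_ (V_diff_apply i _ l).symm)
      by_cases h0 : (l : ℕ) = 0
      · rw [dif_pos h0, dif_pos h0, ite_self]
      · rw [dif_neg h0, dif_neg h0]
        refine if_congr ?_ rfl rfl
        simp; omega
    · refine (Submodule.Quotient.mk_eq_zero _).mpr ((hrel _ _ j.isLt).mpr fun l hl => ?_)
      refine (if_pos hl).trans ((V_diff_apply _ _ _).trans (dif_pos ?_))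
      have := j.isLt
      omega
  · refine ⟨⟨_, hsingle v j⟩, fun l hl => ?_, rfl⟩
    change (if (l : ℕ) + j = i then v l else 0) = 0
    rw [hv l hl, ite_self]
  · obtain ⟨v, rfl⟩ := hF.2 x
    refine (congrArg (· ∈ (V k i).gr d) (LinearEquiv.ofBijective_symm_apply_apply F v)).mpr ?_
    intro l hl
    obtain ⟨y, hy, hxy⟩ := hx ⟨i - l, by omega⟩ trivial
    have h2 := (hrel _ _ (by omega)).mp ((Submodule.Quotient.eq _).mp hxy) l (by simp; omega)
    have h3 : (y.1 : Fin (i + 1) → k) l - (if (l : ℕ) + (i - l) = i then v l else 0) = 0 := h2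
    rw [if_pos (by omega), sub_eq_zero] at h3
    rw [← h3]
    exact hy l hl

lemma SlashStable.V [Fact p.Prime] [CharP k p] (hp : 2 < p) {i : ℕ} (hi : i < p) :
    SlashStable p (V k i) := by
  by_cases h : i + 1 < p
  · refine ⟨V_isPComplex hi, slash_V h, ?_⟩
    have h1 := Sm_V (k := k) hp (show i + (p - i - 2) + 2 = p by omega)
    have h2 := (slash_V (k := k) (p := p) (i := p - i - 2) (by omega)).qShift (p : ℤ)
    rw [← slash_qShift] at h2
    exact (h1.slash.trans h2).trans h1.symm
  · obtain rfl : i = p - 1 := by omega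
    exact SlashStable.of_contractible (V_isPComplex hi) V_contractible

lemma bigSum_empty_contractible (M : ℕ → QComplex k) : Contractible p (bigSum ∅ M) := by
  have : Subsingleton (bigSum ∅ M).carrier :=
    ⟨fun x y => funext fun i => absurd i.2 (Finset.notMem_empty _)⟩
  exact contractible_of_subsingleton _

lemma bigSum_insert (s : Finset ℕ) (a : ℕ) (ha : a ∉ s) (M : ℕ → QComplex k) :
    HomotopyIso p (bigSum (insert a s) M) ((M a).sum (bigSum s M)) := by
  rw [sum_eq]
  let f : (∀ i : (insert a s : Finset ℕ), (M i).carrier) →ₗ[k]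
      (M a).carrier × (∀ i : s, (M i).carrier) :=
    LinearMap.prod (proj (⟨a, Finset.mem_insert_self a s⟩ : (insert a s : Finset ℕ)))
      (LinearMap.pi fun i : s => proj
        (⟨i, Finset.mem_insert_of_mem i.2⟩ : (insert a s : Finset ℕ)))
  have hf : Function.Bijective f := by
    constructor
    · rw [injective_iff_map_eq_zero]
      intro x hx
      funext i
      obtain ⟨i, hi⟩ := i
      rcases Finset.mem_insert.mp hi with rfl | h
      · exact congrArg Prod.fst hx
      · exact congrFun (congrArg Prod.snd hx) ⟨i, h⟩
    · rintro ⟨x, y⟩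
      refine ⟨fun i => if h : i.1 = a then cast (congrArg (fun i => (M i).carrier) h.symm) x else y ⟨i.1, (Finset.mem_insert.mp i.2).resolve_left h⟩,
        Prod.ext ?_ (funext fun i => ?_)⟩
      · exact dif_pos rfl
      · exact dif_neg (fun h : (i : ℕ) = a => ha (h ▸ i.2))
  refine homotopyIso_of_equiv (M := bigSum (insert a s) M) (N := sumC (M a) (bigSum s M))
    (LinearEquiv.ofBijective f hf) (fun x => rfl) (fun d x hx => ⟨hx (⟨a, _⟩ : (insert a s : Finset ℕ)) trivial,
      fun i _ => hx (⟨i, Finset.mem_insert_of_mem i.2⟩ : (insert a s : Finset ℕ)) trivial⟩)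
    fun d y hy => ?_
  obtain ⟨x, rfl⟩ := hf.2 y
  refine (congrArg (· ∈ (bigSum (insert a s) M).gr d)
    (LinearEquiv.ofBijective_symm_apply_apply f x)).mpr ?_
  rintro ⟨i, hi⟩ -
  rcases Finset.mem_insert.mp hi with rfl | h
  · exact hy.1
  · exact hy.2 ⟨i, h⟩ trivial

end Stable

end QComplex

/-! ### Nilpotency of twisted derivations -/

section Twist

variable {E : Type*} [Ring E]

/-- If `[D, L] = L^2`, then `(D + L)^n = ∑ n (n - 1) ⋯ (n - j + 1) L^j D^(n - j)`. -/
lemma add_pow_of_commutator {D L : E} (h : D * L = L * D + L ^ 2) (n : ℕ) :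
    (D + L) ^ n = ∑ j ∈ range (n + 1), n.descFactorial j • (L ^ j * D ^ (n - j)) := by
  have hD : ∀ j : ℕ, D * L ^ j = L ^ j * D + j • L ^ (j + 1) := by
    intro j
    induction j with
    | zero => simp
    | succ j ih =>
      rw [pow_succ, ← mul_assoc, ih, add_mul, mul_assoc, h, mul_add, smul_mul_assoc]
      simp only [← pow_succ, ← mul_assoc, ← pow_add, add_smul, one_smul]
      abel
  induction n with
  | zero => simp
  | succ n ih =>
    rw [pow_succ', ih, mul_sum]
    have h1 : ∀ j ∈ range (n + 1), (D + L) * n.descFactorial j • (L ^ j * D ^ (n - j)) =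
        n.descFactorial j • (L ^ j * D ^ (n + 1 - j)) +
        ((j + 1) * n.descFactorial j) • (L ^ (j + 1) * D ^ (n + 1 - (j + 1))) := by
      intro j hj
      have hj' : j ≤ n := by simpa [Nat.lt_succ_iff] using hj
      rw [mul_smul_comm, ← mul_assoc, add_mul D L, hD, ← pow_succ', add_assoc, ← succ_nsmul, add_mul,
        smul_mul_assoc, smul_add, mul_assoc, ← pow_succ', show n - j + 1 = n + 1 - j by omega,
        show n + 1 - (j + 1) = n - j by omega, smul_smul, mul_comm (j + 1)]
    rw [sum_congr rfl h1, sum_add_distrib, sum_range_succ' _ (n + 1)]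
    have h2 : ∀ j ∈ range (n + 1), (n + 1).descFactorial (j + 1) • (L ^ (j + 1) * D ^ (n + 1 - (j + 1))) =
        n.descFactorial (j + 1) • (L ^ (j + 1) * D ^ (n + 1 - (j + 1))) +
        ((j + 1) * n.descFactorial j) • (L ^ (j + 1) * D ^ (n + 1 - (j + 1))) := by
      intro j hj
      have hj' : j ≤ n := by simpa [Nat.lt_succ_iff] using hj
      rw [← add_smul]
      congr 1
      rw [Nat.succ_descFactorial_succ, Nat.descFactorial_succ, ← add_mul]
      congr 1
      omega
    rw [sum_congr rfl h2, sum_add_distrib, sum_range_succ' (fun j => n.descFactorial j • (L ^ j * D ^ (n + 1 - j))),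
      sum_range_succ (fun j => n.descFactorial (j + 1) • (L ^ (j + 1) * D ^ (n + 1 - (j + 1)))) n,
      Nat.descFactorial_of_lt (Nat.lt_succ_self n)]
    simp
    abel

lemma add_pow_char_of_commutator (p : ℕ) [Fact p.Prime] [CharP E p] {D L : E}
    (h : D * L = L * D + L ^ 2) : (D + L) ^ p = D ^ p := by
  rw [add_pow_of_commutator h, sum_range_succ', sum_eq_zero]
  · simp
  · intro j hj
    rw [← Nat.cast_smul_eq_nsmul E, (CharP.cast_eq_zero_iff E p _).mpr, zero_smul]
    rw [Nat.descFactorial_eq_factorial_mul_choose]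
    rcases (show j + 1 ≤ p by simp at hj; omega).lt_or_eq with h | h
    · exact ((Fact.out : p.Prime).dvd_choose_self (by omega) h).mul_left _
    · rw [← h]; exact ((Nat.dvd_factorial (by omega) le_rfl)).mul_right _

end Twist

namespace HqBimod

/-! ### Functoriality of `p`-Hochschild homology -/

section Functor

variable {M N L : HqBimod k}

/-- Linear maps commuting with both actions of the generators `x_i`. -/
structure IsBi (M N : HqBimod k) (f : M.carrier →ₗ[k] N.carrier) : Prop where
  lft : ∀ i m, f (M.lft (X i) m) = N.lft (X i) (f m)
  rgt : ∀ i m, f (M.rgt (X i) m) = N.rgt (X i) (f m)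

lemma IsBi.id (M : HqBimod k) : IsBi M M LinearMap.id := ⟨fun _ _ => rfl, fun _ _ => rfl⟩

lemma IsBi.zero (M N : HqBimod k) : IsBi M N 0 :=
  ⟨fun _ _ => (map_zero _).symm, fun _ _ => (map_zero _).symm⟩

lemma IsBi.comp {f : M.carrier →ₗ[k] N.carrier} {g : N.carrier →ₗ[k] L.carrier} (hg : IsBi N L g)
    (hf : IsBi M N f) : IsBi M L (g ∘ₗ f) :=
  ⟨fun i m => by rw [LinearMap.comp_apply, hf.lft, hg.lft]; rfl,
    fun i m => by rw [LinearMap.comp_apply, hf.rgt, hg.rgt]; rfl⟩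

lemma IsBi.add {f g : M.carrier →ₗ[k] N.carrier} (hf : IsBi M N f) (hg : IsBi M N g) :
    IsBi M N (f + g) :=
  ⟨fun i m => by simp [hf.lft, hg.lft], fun i m => by simp [hf.rgt, hg.rgt]⟩

lemma IsBi.dt (M : HqBimod k) : IsBi M M M.dt := ⟨fun _ _ => M.dt_lft _ _, fun _ _ => M.dt_rgt _ _⟩

lemma IsBi.lft_all {f : M.carrier →ₗ[k] N.carrier} (hf : IsBi M N f) (a : Pol k) (m : M.carrier) :
    f (M.lft a m) = N.lft a (f m) := by
  induction a using MvPolynomial.induction_on generalizing m with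
  | C c => rw [← MvPolynomial.algebraMap_eq, AlgHom.commutes, AlgHom.commutes]; simp [Module.algebraMap_end_apply]
  | add a b ha hb => simp [ha, hb]
  | mul_X a i ha => simp [ha, hf.lft]

lemma IsBi.rgt_all {f : M.carrier →ₗ[k] N.carrier} (hf : IsBi M N f) (a : Pol k) (m : M.carrier) :
    f (M.rgt a m) = N.rgt a (f m) := by
  induction a using MvPolynomial.induction_on generalizing m with
  | C c => rw [← MvPolynomial.algebraMap_eq, AlgHom.commutes, AlgHom.commutes]; simp [Module.algebraMap_end_apply]
  | add a b ha hb => simp [ha, hb]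
  | mul_X a i ha => simp [ha, hf.rgt]

lemma IsBi.kos {f : M.carrier →ₗ[k] N.carrier} (hf : IsBi M N f) (i : Fin 2) (m : M.carrier) :
    f (kos M i m) = kos N i (f m) := by
  simp [HqBimod.kos, hf.lft, hf.rgt]

lemma IsBi.twist {f : M.carrier →ₗ[k] N.carrier} (hf : IsBi M N f) (i : Fin 2) (m : M.carrier) :
    f (twist M i m) = twist N i (f m) := by
  simp [HqBimod.twist, hf.lft, hf.rgt]

lemma IsBi.cau {f : M.carrier →ₗ[k] N.carrier} (hf : IsBi M N f) (i : Fin 2) (m : M.carrier) :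
    f (cau M i m) = cau N i (f m) := by
  simp only [HqBimod.cau, LinearMap.add_apply, map_add, hf.lft_all, hf.rgt_all]

lemma IsBi.kosD1 {f : M.carrier →ₗ[k] N.carrier} (hf : IsBi M N f) (v : M.carrier × M.carrier) :
    f (kosD1 M v) = kosD1 N (f.prodMap f v) := by
  simp [HqBimod.kosD1, hf.kos]

lemma IsBi.kosD2 {f : M.carrier →ₗ[k] N.carrier} (hf : IsBi M N f) (m : M.carrier) :
    f.prodMap f (kosD2 M m) = kosD2 N (f m) := by
  simp [HqBimod.kosD2, hf.kos]

/-- The map induced on `HH0`. -/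
noncomputable def hh0 {f : M.carrier →ₗ[k] N.carrier} (hf : IsBi M N f) : HH0 M →ₗ[k] HH0 N :=
  Submodule.mapQ _ _ f (by rintro _ ⟨v, rfl⟩; exact ⟨f.prodMap f v, (hf.kosD1 v).symm⟩)

/-- The map induced on `HH1`. -/
noncomputable def hh1 {f : M.carrier →ₗ[k] N.carrier} (hf : IsBi M N f) : HH1 M →ₗ[k] HH1 N :=
  Submodule.mapQ _ _
    ((f.prodMap f).restrict fun v hv => by
      rw [LinearMap.mem_ker] at hv ⊢
      rw [← hf.kosD1, hv, map_zero])
    (by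
      rintro v ⟨m, hm⟩
      exact ⟨f m, (hf.kosD2 m).symm.trans (congrArg (f.prodMap f) hm)⟩)

/-- The map induced on `HH2`. -/
noncomputable def hh2 {f : M.carrier →ₗ[k] N.carrier} (hf : IsBi M N f) : HH2 M →ₗ[k] HH2 N :=
  f.restrict fun m hm => by
    rw [LinearMap.mem_ker] at hm ⊢
    rw [← hf.kosD2, hm, map_zero]

/-- The class of a pair in `HH1`. -/
noncomputable abbrev mk1 (M : HqBimod k) (v : ker (HqBimod.kosD1 M)) : HH1 M :=
  Submodule.Quotient.mk v

/-- The map induced on `p`-Hochschild homology. -/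
noncomputable def tot (p : ℕ) {f : M.carrier →ₗ[k] N.carrier} (hf : IsBi M N f) :
    PHH p M →ₗ[k] PHH p N :=
  (hh2 hf).prodMap (((hh1 hf).compLeft (Fin (p - 1))).prodMap (hh0 hf))

lemma PHH_ext {p : ℕ} {z w : PHH p M} (h2 : z.1 = w.1) (h1 : ∀ s, z.2.1 s = w.2.1 s)
    (h0 : z.2.2 = w.2.2) : z = w := Prod.ext h2 (Prod.ext (funext h1) h0)

lemma PHH_rep {p : ℕ} (z : PHH p M) : ∃ (a : HH2 M)
    (v : Fin (p - 1) → ker (HqBimod.kosD1 M)) (m : M.carrier),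
    z = (a, fun s => mk1 M (v s), Submodule.Quotient.mk m) := by
  obtain ⟨a, b, c⟩ := z
  choose v hv using fun s => Submodule.Quotient.mk_surjective _ (b s)
  obtain ⟨m, rfl⟩ := Submodule.Quotient.mk_surjective _ c
  exact ⟨a, v, m, Prod.ext rfl (Prod.ext (funext fun s => (hv s).symm) rfl)⟩

lemma tot_id (p : ℕ) (z : PHH p M) : tot p (IsBi.id M) z = z := by
  obtain ⟨a, v, m, rfl⟩ := PHH_rep z
  rfl

lemma tot_comp (p : ℕ) {f : M.carrier →ₗ[k] N.carrier} {g : N.carrier →ₗ[k] L.carrier}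
    (hg : IsBi N L g) (hf : IsBi M N f) (z : PHH p M) :
    tot p (hg.comp hf) z = tot p hg (tot p hf z) := by
  obtain ⟨a, v, m, rfl⟩ := PHH_rep z
  rfl

lemma tot_add (p : ℕ) {f g : M.carrier →ₗ[k] N.carrier} (hf : IsBi M N f) (hg : IsBi M N g)
    (z : PHH p M) : tot p (hf.add hg) z = tot p hf z + tot p hg z := by
  obtain ⟨a, v, m, rfl⟩ := PHH_rep z
  rfl

lemma tot_congr (p : ℕ) {f g : M.carrier →ₗ[k] N.carrier} (hf : IsBi M N f) (hg : IsBi M N g)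
    (h : ∀ x, f x = g x) (z : PHH p M) : tot p hf z = tot p hg z := by
  obtain rfl : f = g := LinearMap.ext h
  rfl

/-- A bimodule map that is null-homotopic on the Koszul complexes induces zero. -/
lemma tot_eq_zero (p : ℕ) {f : M.carrier →ₗ[k] N.carrier} (hf : IsBi M N f)
    (h0 : ∀ m, f m ∈ LinearMap.range (HqBimod.kosD1 N))
    (h1 : ∀ v, HqBimod.kosD1 M v = 0 → (f v.1, f v.2) ∈ LinearMap.range (HqBimod.kosD2 N))
    (h2 : ∀ m, HqBimod.kosD2 M m = 0 → f m = 0) : tot p hf = 0 := by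
  refine LinearMap.ext fun z => ?_
  obtain ⟨a, v, m, rfl⟩ := PHH_rep z
  refine PHH_ext (Subtype.ext (h2 _ a.2)) (fun s => ?_) ?_
  · exact (Submodule.Quotient.mk_eq_zero _).mpr (h1 _ (v s).2)
  · exact (Submodule.Quotient.mk_eq_zero _).mpr (h0 m)

lemma dtPHH_eq (p : ℕ) (M : HqBimod k) : dtPHH p M = tot p (IsBi.dt M) := rfl

lemma dqPHH_mk (p : ℕ) (M : HqBimod k) (z : PHH p M) : dqPHH p M z =
    (mapHH2 (dq_kosD2 M) z.1, fun s => mapHH1 (dq_kosD1 M) (dq_kosD2 M) (z.2.1 s),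
      mapHH0 (dq_kosD1 M) z.2.2) := rfl

lemma tot_dqPHH (p : ℕ) {f : M.carrier →ₗ[k] N.carrier} (hf : IsBi M N f)
    (h : ∀ m, f (M.dq m) = N.dq (f m)) (z : PHH p M) :
    tot p hf (dqPHH p M z) = dqPHH p N (tot p hf z) := by
  obtain ⟨a, v, m, rfl⟩ := PHH_rep z
  refine PHH_ext (Subtype.ext ?_) (fun s => ?_) ?_
  · change f (dq2 M a) = dq2 N (f a)
    simp only [dq2, LinearMap.add_apply, map_add, h, hf.twist]
  · refine congrArg (mk1 N) (Subtype.ext ?_)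
    change f.prodMap f (dq1 M (v s)) = dq1 N (f.prodMap f (v s))
    simp only [dq1, LinearMap.prodMap_apply, LinearMap.add_apply, map_add, h, hf.twist]
  · exact congrArg (Submodule.Quotient.mk) (h m)

lemma dC_apply_two (p : ℕ) (M : HqBimod k) (z : PHH p M) : (dC p M z).1 = 0 := rfl

lemma dC_apply_one (p : ℕ) (M : HqBimod k) (z : PHH p M) (s : Fin (p - 1)) : (dC p M z).2.1 s =
    if h : (s : ℕ) + 1 < p - 1 then z.2.1 ⟨s + 1, h⟩ else cauHH2 M z.1 := by
  change (LinearMap.pi fun s : Fin (p - 1) =>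
      if h : (s : ℕ) + 1 < p - 1 then
        proj (⟨(s : ℕ) + 1, h⟩ : Fin (p - 1)) ∘ₗ fst k _ _ ∘ₗ
          snd k _ _
      else cauHH2 M ∘ₗ fst k _ _ : PHH p M →ₗ[k] Fin (p - 1) → HH1 M) z s = _
  rw [LinearMap.pi_apply]
  split_ifs <;> rfl

lemma dC_apply_zero (p : ℕ) (M : HqBimod k) (z : PHH p M) (h : 0 < p - 1) :
    (dC p M z).2.2 = cauHH1 M (z.2.1 ⟨0, h⟩) := by
  change (if h : 0 < p - 1 then
      cauHH1 M ∘ₗ proj (⟨0, h⟩ : Fin (p - 1)) ∘ₗ fst k _ _ ∘ₗ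
        snd k _ _
    else 0 : PHH p M →ₗ[k] HH0 M) z = _
  rw [dif_pos h]
  rfl

lemma tot_dC {p : ℕ} (hp : 2 < p) {f : M.carrier →ₗ[k] N.carrier} (hf : IsBi M N f) (z : PHH p M) :
    tot p hf (dC p M z) = dC p N (tot p hf z) := by
  refine PHH_ext ?_ (fun s => ?_) ?_
  · exact map_zero (hh2 hf)
  · rw [dC_apply_one]
    refine (congrArg (hh1 hf) (dC_apply_one p M z s)).trans ?_
    split_ifs with h
    · rfl
    · refine congrArg (Submodule.Quotient.mk) (Subtype.ext ?_)
      change f.prodMap f (cauD2 M z.1) = cauD2 N (f z.1)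
      simp [cauD2, hf.cau]
  · rw [dC_apply_zero _ _ _ (by omega)]
    refine (congrArg (hh0 hf) (dC_apply_zero _ _ _ (by omega))).trans ?_
    change _ = cauHH1 N (hh1 hf (z.2.1 ⟨0, _⟩))
    generalize z.2.1 ⟨0, _⟩ = x
    obtain ⟨x, rfl⟩ := Submodule.Quotient.mk_surjective _ x
    refine congrArg (Submodule.Quotient.mk) ?_
    change f (cauD1 M x) = cauD1 N (f.prodMap f x)
    simp [cauD1, hf.cau]

/-- The total complex, with reducible carrier. -/
noncomputable abbrev totC (p : ℕ) (M : HqBimod k) : QComplex k where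
  carrier := PHH p M
  gr := (total p M).gr
  diff := dtPHH p M + dC p M + dqPHH p M

/-- The degrees of elements of the total complex. -/
lemma mem_totC {p : ℕ} {e : ℤ} {z : PHH p M} : z ∈ (totC p M).gr e ↔
    (z.1 : M.carrier) ∈ M.gr (e - 8 + 2 * (p : ℤ)) ∧
    (∀ s : Fin (p - 1), ∃ v : ker (HqBimod.kosD1 M),
      v.1.1 ∈ M.gr (e - 4 + 2 * (((s : ℕ) : ℤ) + 1)) ∧
      v.1.2 ∈ M.gr (e - 4 + 2 * (((s : ℕ) : ℤ) + 1)) ∧ mk1 M v = z.2.1 s) ∧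
    (∃ m ∈ M.gr e, Submodule.Quotient.mk m = z.2.2) := by
  refine and_congr Iff.rfl (and_congr ⟨fun h s => ?_, fun h s _ => ?_⟩ Iff.rfl)
  · obtain ⟨v, hv, h⟩ := h s trivial
    exact ⟨v, hv.1, hv.2, h⟩
  · obtain ⟨v, hv, hv', h⟩ := h s
    exact ⟨v, ⟨hv, hv'⟩, h⟩

lemma tot_mem {p : ℕ} {f : M.carrier →ₗ[k] N.carrier} (hf : IsBi M N f) {d : ℤ}
    (h : ∀ e, ∀ m ∈ M.gr e, f m ∈ N.gr (e + d)) {e : ℤ} {z : PHH p M} (hz : z ∈ (totC p M).gr e) :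
    tot p hf z ∈ (totC p N).gr (e + d) := by
  rw [mem_totC] at hz ⊢
  obtain ⟨h2, h1, m, hm, h0⟩ := hz
  refine ⟨?_, fun s => ?_, f m, h _ _ hm, ?_⟩
  · have := h _ _ h2
    rwa [show e - 8 + 2 * (p : ℤ) + d = e + d - 8 + 2 * (p : ℤ) by ring] at this
  · obtain ⟨v, hv, hv', h1⟩ := h1 s
    refine ⟨⟨f.prodMap f v, ?_⟩, ?_, ?_, ?_⟩
    · exact LinearMap.mem_ker.mpr ((hf.kosD1 v.1).symm.trans
        ((congrArg f (LinearMap.mem_ker.mp v.2)).trans (map_zero f)))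
    · have := h _ _ hv
      rwa [show ∀ s : ℤ, e - 4 + s + d = e + d - 4 + s by intro s; ring] at this
    · have := h _ _ hv'
      rwa [show ∀ s : ℤ, e - 4 + s + d = e + d - 4 + s by intro s; ring] at this
    · exact congrArg (hh1 hf) h1
  · exact congrArg (hh0 hf) h0

lemma tot_isHom {p : ℕ} (hp : 2 < p) {f : M.carrier →ₗ[k] N.carrier} (hf : IsBi M N f)
    (hq : ∀ m, f (M.dq m) = N.dq (f m)) (ht : ∀ m, f (M.dt m) = N.dt (f m))
    (hd : ∀ e, ∀ m ∈ M.gr e, f m ∈ N.gr e) : IsHom (totC p M) (totC p N) (tot p hf) := by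
  refine ⟨fun z => ?_, fun e z hz => ?_⟩
  · change tot p hf (dtPHH p M z + dC p M z + dqPHH p M z) =
      dtPHH p N (tot p hf z) + dC p N (tot p hf z) + dqPHH p N (tot p hf z)
    rw [map_add, map_add, tot_dC hp, tot_dqPHH p hf hq, dtPHH_eq, dtPHH_eq, ← tot_comp, ← tot_comp]
    refine congrArg (· + _ + _) (tot_congr _ _ _ ht _)
  · have := tot_mem (p := p) hf (d := 0) (fun e m hm => by rw [add_zero]; exact hd e m hm) hz
    rwa [add_zero] at this

end Functor

/-! ### The total complex is a `p`-complex -/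

section Total

variable {M N : HqBimod k} {p : ℕ}

lemma polDer_X (i : Fin 2) : polDer k (X i) = X i ^ 2 := by simp [polDer]

lemma dq_cau (M : HqBimod k) (i : Fin 2) (m : M.carrier) :
    M.dq (cau M i m) = cau M i (M.dq m) + cau M i (twist M i m) + kos M i (kos M i (twist M i m)) := by
  have h : polDer k (X i) = X i * X i := by rw [polDer_X, pow_two]
  simp only [kos, twist, cau, LinearMap.sub_apply, LinearMap.add_apply, map_sub, map_add, M.dq_lft,
    M.dq_rgt, h, pow_two, map_mul, Module.End.mul_apply, M.lft_rgt]
  abel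

lemma cau_cau (M : HqBimod k) (i j : Fin 2) (m : M.carrier) :
    cau M i (cau M j m) = cau M j (cau M i m) := by
  simp only [cau, LinearMap.add_apply, map_add, M.lft_rgt]
  rw [M.lft_comm (X i ^ 2), M.rgt_comm (X i ^ 2)]
  abel

lemma tot_pow_eq_zero {f : M.carrier →ₗ[k] M.carrier} (hf : IsBi M M f) (h : f ^ p = 0) (q : ℕ) :
    tot q hf ^ p = 0 := by
  have key : ∀ n, ∃ hn : IsBi M M (f ^ n), ∀ z, (tot q hf ^ n) z = tot q hn z := by
    intro n
    induction n with
    | zero => exact ⟨IsBi.id M, fun z => (tot_id q z).symm⟩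
    | succ n ih =>
      obtain ⟨hn, ih⟩ := ih
      have h1 : f ^ (n + 1) = f ∘ₗ f ^ n := pow_succ' f n
      rw [h1]
      refine ⟨hf.comp hn, fun z => ?_⟩
      rw [tot_comp q hf hn, ← ih, pow_succ', Module.End.mul_apply]
  obtain ⟨hp, hz⟩ := key p
  refine LinearMap.ext fun z => (hz z).trans ?_
  obtain ⟨a, v, m, rfl⟩ := PHH_rep z
  have h0 : ∀ m, (f ^ p) m = 0 := fun m => by rw [h]; rfl
  refine PHH_ext (Subtype.ext (h0 a)) (fun s => ?_) ?_
  · exact (congrArg (mk1 M) (Subtype.ext (Prod.ext (h0 _) (h0 _)) :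
      _ = (0 : ker (HqBimod.kosD1 M)))).trans rfl
  · exact (congrArg (Submodule.Quotient.mk) (h0 m)).trans rfl

lemma dC_pow_apply_one (M : HqBimod k) (n : ℕ) (z : PHH p M) (s : Fin (p - 1)) :
    ((dC p M ^ n) z).2.1 s = if h : (s : ℕ) + n < p - 1 then z.2.1 ⟨s + n, h⟩ else
      if (s : ℕ) + n = p - 1 then cauHH2 M z.1 else 0 := by
  induction n generalizing s with
  | zero => rw [dif_pos (show (s : ℕ) + 0 < p - 1 from s.isLt)]; rfl
  | succ n ih =>
    rw [pow_succ', Module.End.mul_apply, dC_apply_one]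
    by_cases h : (s : ℕ) + 1 < p - 1
    · rw [dif_pos h, ih]
      by_cases h1 : (s : ℕ) + (n + 1) < p - 1
      · rw [dif_pos h1, dif_pos (by simp; omega)]
        exact congrArg z.2.1 (Fin.ext (by simp; omega))
      · rw [dif_neg h1, dif_neg (by simp; omega)]
        refine if_congr ?_ rfl rfl
        simp; omega
    · rw [dif_neg h, dif_neg (by omega)]
      have hs := s.isLt
      cases n with
      | zero => rw [if_pos (by omega)]; rfl
      | succ n =>
        rw [if_neg (by omega), pow_succ', Module.End.mul_apply, dC_apply_two, map_zero]

lemma cauHH1_cauHH2 (M : HqBimod k) (a : HH2 M) : cauHH1 M (cauHH2 M a) = 0 := by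
  refine (congrArg (Submodule.Quotient.mk) ?_).trans (Submodule.Quotient.mk_zero _)
  change cauD1 M (cauD2 M a) = 0
  simp only [cauD1, cauD2, LinearMap.prod_apply, Function.prod_apply, LinearMap.coprod_apply, LinearMap.neg_apply, map_neg,
    cau_cau M 0 1, add_neg_cancel]

lemma dC_pow (hp : 2 < p) (M : HqBimod k) : dC p M ^ p = 0 := by
  refine LinearMap.ext fun z => ?_
  have h1 : dC p M ^ p = dC p M * dC p M ^ (p - 1) := by
    rw [← pow_succ', Nat.sub_add_cancel (by omega)]
  refine PHH_ext ?_ (fun s => ?_) ?_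
  · rw [h1, Module.End.mul_apply, dC_apply_two]; rfl
  · rw [dC_pow_apply_one, dif_neg (by omega), if_neg (by have := s.isLt; omega)]; rfl
  · rw [h1, Module.End.mul_apply, dC_apply_zero _ _ _ (by omega), dC_pow_apply_one,
      dif_neg (by simp), if_pos (by simp), cauHH1_cauHH2]
    rfl

lemma dC_dqPHH (hp : 2 < p) (M : HqBimod k) (z : PHH p M) :
    dC p M (dqPHH p M z) = dqPHH p M (dC p M z) := by
  obtain ⟨a, v, m, rfl⟩ := PHH_rep z
  refine PHH_ext ?_ (fun s => ?_) ?_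
  · exact (map_zero (mapHH2 (dq_kosD2 M))).symm
  · rw [dC_apply_one]
    refine Eq.trans ?_ (congrArg (mapHH1 (dq_kosD1 M) (dq_kosD2 M)) (dC_apply_one p M _ s)).symm
    split_ifs with h
    · rfl
    · have ha : kosD2 M a = 0 := a.2
      have h1 : kos M 1 (a : M.carrier) = 0 := congrArg Prod.fst ha
      have h0 : kos M 0 (a : M.carrier) = 0 := neg_eq_zero.mp (congrArg Prod.snd ha)
      refine congrArg (mk1 M) (Subtype.ext ?_)
      change cauD2 M (dq2 M a) = dq1 M (cauD2 M a)
      have e : ∀ i j, twist M i (cau M j a) = cau M j (twist M i a) := by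
        intro i j
        simp only [twist, cau, LinearMap.add_apply, map_add, M.lft_rgt]
        rw [M.lft_comm (X i), M.rgt_comm (X i)]
        abel
      refine Prod.ext ?_ ?_
      · change cau M 1 (M.dq a + twist M 0 a + twist M 1 a) = M.dq (cau M 1 a) + twist M 0 (cau M 1 a)
        rw [dq_cau, e, kos_twist, h1, map_zero, map_zero, map_add, map_add]
        abel
      · change -cau M 0 (M.dq a + twist M 0 a + twist M 1 a) =
          M.dq (-cau M 0 a) + twist M 1 (-cau M 0 a)
        rw [map_neg, map_neg, dq_cau, e, kos_twist, h0, map_zero, map_zero, map_add, map_add]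
        abel
  · rw [dC_apply_zero _ _ _ (by omega)]
    refine Eq.trans ?_ (congrArg (mapHH0 (dq_kosD1 M)) (dC_apply_zero p M _ (by omega))).symm
    refine (Submodule.Quotient.eq _).mpr ?_
    generalize v _ = w
    refine ⟨(-kos M 0 (twist M 0 w.1.1), -kos M 1 (twist M 1 w.1.2)), ?_⟩
    change kosD1 M _ = cauD1 M (dq1 M w) - M.dq (cauD1 M w)
    simp only [kosD1, cauD1, dq1, LinearMap.coprod_apply, LinearMap.prodMap_apply,
      LinearMap.add_apply, map_add, map_neg, dq_cau]
    abel

/-- Bimodules graded compatibly with all structure maps, with `p`-nilpotent differentials. -/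
structure Good (p : ℕ) (M : HqBimod k) : Prop where
  internal : DirectSum.IsInternal M.gr
  lft_mem : ∀ i e, ∀ m ∈ M.gr e, M.lft (X i) m ∈ M.gr (e + 2)
  rgt_mem : ∀ i e, ∀ m ∈ M.gr e, M.rgt (X i) m ∈ M.gr (e + 2)
  dq_mem : ∀ e, ∀ m ∈ M.gr e, M.dq m ∈ M.gr (e + 2)
  dt_mem : ∀ e, ∀ m ∈ M.gr e, M.dt m ∈ M.gr (e + 2)
  dq_pow : M.dq ^ p = 0
  dt_pow : M.dt ^ p = 0

lemma Good.kos_mem (hM : Good p M) (i : Fin 2) {e : ℤ} {m : M.carrier} (hm : m ∈ M.gr e) :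
    kos M i m ∈ M.gr (e + 2) :=
  sub_mem (hM.lft_mem i e m hm) (hM.rgt_mem i e m hm)

lemma Good.twist_mem (hM : Good p M) (i : Fin 2) {e : ℤ} {m : M.carrier} (hm : m ∈ M.gr e) :
    twist M i m ∈ M.gr (e + 2) :=
  add_mem (hM.lft_mem i e m hm) (hM.rgt_mem i e m hm)

lemma Good.cau_mem (hM : Good p M) (i : Fin 2) {e : ℤ} {m : M.carrier} (hm : m ∈ M.gr e) :
    cau M i m ∈ M.gr (e + 4) := by
  simp only [cau, pow_two, map_mul, LinearMap.add_apply, Module.End.mul_apply]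
  have h1 := hM.lft_mem i _ _ (hM.lft_mem i e m hm)
  have h2 := hM.rgt_mem i _ _ (hM.rgt_mem i e m hm)
  rw [add_assoc] at h1 h2
  exact add_mem h1 h2

lemma dq_twist_pow [Fact p.Prime] [CharP k p] {D : Module.End k M.carrier} (hD : D ^ p = 0)
    (i : Fin 2) (h : ∀ m, D (M.lft (X i) m) = M.lft (X i ^ 2) m + M.lft (X i) (D m))
    (h' : ∀ m, D (M.rgt (X i) m) = M.rgt (X i ^ 2) m + M.rgt (X i) (D m)) :
    (D + twist M i) ^ p = 0 := by
  rcases subsingleton_or_nontrivial M.carrier with hs | hs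
  · exact LinearMap.ext fun _ => Subsingleton.elim _ _
  have : CharP (Module.End k M.carrier) p := charP_of_injective_algebraMap (algebraMap k _).injective p
  have h1 : (D + M.lft (X i)) ^ p = 0 := by
    rw [add_pow_char_of_commutator, hD]
    refine LinearMap.ext fun m => ?_
    rw [← map_pow]
    exact (h m).trans (add_comm _ _)
  rw [twist, ← add_assoc, add_pow_char_of_commutator, h1]
  refine LinearMap.ext fun m => ?_
  simp only [← map_pow, Module.End.mul_apply, LinearMap.add_apply, h', map_add, M.lft_rgt]
  abel

lemma restrict_pow_eq_zero {V : Type*} [AddCommGroup V] [Module k V] {f : Module.End k V}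
    {U : Submodule k V} (hU : ∀ x ∈ U, f x ∈ U) (h : f ^ p = 0) : f.restrict hU ^ p = 0 := by
  refine LinearMap.ext fun x => Subtype.ext ?_
  have := comp_pow_of_comm (D := f.restrict hU) (D' := f) (f := U.subtype) (fun x => rfl) p x
  refine this.trans ?_
  rw [h]; rfl

lemma mapQ_pow_eq_zero {V : Type*} [AddCommGroup V] [Module k V] {f : Module.End k V}
    {U : Submodule k V} (hU : U ≤ U.comap f) (h : f ^ p = 0) : U.mapQ U f hU ^ p = 0 := by
  refine LinearMap.ext fun x => ?_
  obtain ⟨x, rfl⟩ := U.mkQ_surjective x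
  have := comp_pow_of_comm (D := f) (D' := U.mapQ U f hU) (f := U.mkQ) (fun x => rfl) p x
  refine this.symm.trans ?_
  rw [h]; exact map_zero _

lemma Good.dqPHH_pow [Fact p.Prime] [CharP k p] (hM : Good p M) : dqPHH p M ^ p = 0 := by
  have hl : ∀ i m, M.dq (M.lft (X i) m) = M.lft (X i ^ 2) m + M.lft (X i) (M.dq m) := fun i m => by
    rw [M.dq_lft, polDer_X]
  have hr : ∀ i m, M.dq (M.rgt (X i) m) = M.rgt (X i ^ 2) m + M.rgt (X i) (M.dq m) := fun i m => by
    rw [M.dq_rgt, polDer_X]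
  have h0 := dq_twist_pow hM.dq_pow 0 (hl 0) (hr 0)
  have h1 := dq_twist_pow hM.dq_pow 1 (hl 1) (hr 1)
  have h2 : dq2 M ^ p = 0 := by
    refine dq_twist_pow h0 1 (fun m => ?_) fun m => ?_
    · simp only [twist, LinearMap.add_apply, hl, map_add, M.lft_rgt, M.lft_comm (X 0) (X 1)]
      abel
    · simp only [twist, LinearMap.add_apply, hr, map_add, M.lft_rgt, M.rgt_comm (X 0) (X 1)]
      abel
  have e2 : mapHH2 (dq_kosD2 M) ^ p = 0 := restrict_pow_eq_zero _ h2
  have e1 : mapHH1 (dq_kosD1 M) (dq_kosD2 M) ^ p = 0 := by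
    refine mapQ_pow_eq_zero _ (restrict_pow_eq_zero _ ?_)
    rw [dq1, prodMap_pow, h0, h1, LinearMap.prodMap_zero]
  have e0 : mapHH0 (dq_kosD1 M) ^ p = 0 := mapQ_pow_eq_zero _ hM.dq_pow
  rw [dqPHH, prodMap_pow, prodMap_pow, compLeft_pow, e2, e1, e0]
  rfl

lemma Good.isPComplex [Fact p.Prime] [CharP k p] (hp : 2 < p) (hM : Good p M) :
    IsPComplex p (totC p M) where
  internal := by
    obtain ⟨c, hc⟩ := exists_isProj hM.internal
    have hk : ∀ e i m, c (e + 2) (kos M i m) = kos M i (c e m) := fun e i m =>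
      hc.hom hc (f := kos M i) (fun e x hx => hM.kos_mem i hx) e m
    have hk' : ∀ e i m, c e (kos M i m) = kos M i (c (e - 2) m) := fun e i m => by
      rw [← hk, sub_add_cancel]
    have hc2 := isProj_prod hc hc
    have h2 := isProj_ker hc (U := ker (kosD2 M)) fun e m hm => by
      have h1 : kos M 1 m = 0 := congrArg Prod.fst (LinearMap.mem_ker.mp hm)
      have h0 : kos M 0 m = 0 := neg_eq_zero.mp (congrArg Prod.snd (LinearMap.mem_ker.mp hm))
      rw [LinearMap.mem_ker]
      exact Prod.ext (by simp [kosD2, ← hk, h1]) (by simp [kosD2, ← hk, h0])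
    have h0 := isProj_quot hc (U := LinearMap.range (kosD1 M)) fun e m hm => by
      obtain ⟨v, rfl⟩ := hm
      refine ⟨(c (e - 2) v.1, c (e - 2) v.2), ?_⟩
      simp [kosD1, hk']
    have hker : ∀ e, ∀ v ∈ ker (kosD1 M), (c e).prodMap (c e) v ∈ ker (kosD1 M) := by
      intro e v hv
      rw [LinearMap.mem_ker] at hv ⊢
      have : kosD1 M ((c e).prodMap (c e) v) = c (e + 2) (kosD1 M v) := by simp [kosD1, hk]
      rw [this, hv, map_zero]
    have h1 := isProj_quot (isProj_ker hc2 hker)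
      (U := (LinearMap.range (kosD2 M)).comap (ker (kosD1 M)).subtype) fun e v hv => by
        obtain ⟨m, hm⟩ := hv
        refine ⟨c (e - 2) m, ?_⟩
        have : (c e).prodMap (c e) (kosD2 M m) = kosD2 M (c (e - 2) m) := by
          simp [kosD2, hk']
        rw [← this, hm]; rfl
    have h := (isProj_prod (isProj_shift h2 (-8 + 2 * (p : ℤ))) (isProj_prod
      (isProj_pi fun s : Fin (p - 1) => isProj_shift h1 (-4 + 2 * (((s : ℕ) : ℤ) + 1))) h0)).isInternal
    simp only [← add_assoc, ← sub_eq_add_neg] at h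
    exact h
  diff_mem := fun e z hz => by
    have ht := tot_mem (p := p) (IsBi.dt M) hM.dt_mem hz
    refine add_mem (add_mem ht ?_) ?_
    · rw [mem_totC] at hz ⊢
      obtain ⟨g2, g1, m, hm, g0⟩ := hz
      refine ⟨zero_mem _, fun s => ?_, ?_⟩
      · rw [dC_apply_one]
        split_ifs with h
        · obtain ⟨v, hv, hv', g1⟩ := g1 ⟨s + 1, h⟩
          refine ⟨v, ?_, ?_, g1⟩
          · convert hv using 2; push_cast; ring
          · convert hv' using 2; push_cast; ring
        · have ha : kosD2 M z.1 = 0 := z.1.2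
          have hs : ((s : ℕ) : ℤ) + 1 = p - 1 := by have := s.isLt; omega
          refine ⟨_, ?_, ?_, rfl⟩
          · have := hM.cau_mem 1 g2
            change cau M 1 z.1 ∈ _
            convert this using 2; rw [hs]; ring
          · have := neg_mem (hM.cau_mem 0 g2)
            change -cau M 0 z.1 ∈ _
            convert this using 2; rw [hs]; ring
      · rw [dC_apply_zero _ _ _ (by omega)]
        obtain ⟨v, hv, hv', g1⟩ := g1 ⟨0, by omega⟩
        refine ⟨cauD1 M v, add_mem ?_ ?_, ?_⟩
        · have := hM.cau_mem 0 hv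
          change cau M 0 v.1.1 ∈ _
          convert this using 2; push_cast; ring
        · have := hM.cau_mem 1 hv'
          change cau M 1 v.1.2 ∈ _
          convert this using 2; push_cast; ring
        · rw [← g1]; rfl
    · rw [mem_totC] at hz ⊢
      obtain ⟨g2, g1, m, hm, g0⟩ := hz
      refine ⟨?_, fun s => ?_, M.dq m, hM.dq_mem _ _ hm, ?_⟩
      · have := add_mem (add_mem (hM.dq_mem _ _ g2) (hM.twist_mem 0 g2))
          (hM.twist_mem 1 g2)
        rwa [show e - 8 + 2 * (p : ℤ) + 2 = e + 2 - 8 + 2 * (p : ℤ) by ring] at this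
      · obtain ⟨v, hv, hv', g1⟩ := g1 s
        refine ⟨⟨dq1 M v, ?_⟩, ?_, ?_, ?_⟩
        · exact LinearMap.mem_ker.mpr ((dq_kosD1 M v.1).symm.trans
            ((congrArg M.dq (LinearMap.mem_ker.mp v.2)).trans (map_zero _)))
        · have := add_mem (hM.dq_mem _ _ hv) (hM.twist_mem 0 hv)
          rwa [show ∀ s : ℤ, e - 4 + s + 2 = e + 2 - 4 + s by intro s; ring] at this
        · have := add_mem (hM.dq_mem _ _ hv') (hM.twist_mem 1 hv')
          rwa [show ∀ s : ℤ, e - 4 + s + 2 = e + 2 - 4 + s by intro s; ring] at this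
        · exact congrArg (mapHH1 (dq_kosD1 M) (dq_kosD2 M)) g1
      · exact congrArg (mapHH0 (dq_kosD1 M)) g0
  diff_pow := by
    -- three commuting operators with vanishing `p`-th power
    have h1 : Commute (dtPHH p M) (dC p M) := LinearMap.ext fun z => tot_dC hp (IsBi.dt M) z
    have h2 : Commute (dtPHH p M) (dqPHH p M) := LinearMap.ext fun z =>
      tot_dqPHH p (IsBi.dt M) M.dt_dq z
    have h3 : Commute (dC p M) (dqPHH p M) := LinearMap.ext fun z => dC_dqPHH hp M z
    change (dtPHH p M + dC p M + dqPHH p M : Module.End k (PHH p M)) ^ p = 0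
    exact add_pow_of_commute_zero k p (h2.add_left h3)
      (add_pow_of_commute_zero k p h1 (tot_pow_eq_zero (IsBi.dt M) hM.dt_pow p) (dC_pow hp M)) hM.dqPHH_pow

end Total

/-! ### The bimodules `M ⊗_R B` and `M ⊗_R pT` -/

section Ind

variable {p : ℕ}

/-- The elementary symmetric polynomial `x_1 + x_2`. -/
noncomputable def e1 (k : Type u) [Field k] : Pol k := X 0 + X 1

/-- The elementary symmetric polynomial `x_1 x_2`. -/
noncomputable def e2 (k : Type u) [Field k] : Pol k := X 0 * X 1

lemma polDer_e1 : polDer k (e1 k) = e1 k * e1 k - (e2 k + e2 k) := by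
  rw [e1, e2, map_add, polDer_X, polDer_X]; ring

lemma polDer_e2 : polDer k (e2 k) = e1 k * e2 k := by
  rw [e1, e2, Derivation.leibniz, polDer_X, polDer_X, smul_eq_mul, smul_eq_mul]; ring

lemma map_e1 {E : Type*} [Ring E] [Algebra k E] (ρ : Pol k →ₐ[k] E) :
    ρ (e1 k) = ρ (X 0) + ρ (X 1) := map_add _ _ _

lemma map_e2 {E : Type*} [Ring E] [Algebra k E] (ρ : Pol k →ₐ[k] E) :
    ρ (e2 k) = ρ (X 0) * ρ (X 1) := map_mul _ _ _

/-- The Leibniz rule needs to be checked on the generators only. -/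
lemma leibniz_of_X {V : Type*} [AddCommGroup V] [Module k V] {ρ : Pol k →ₐ[k] Module.End k V}
    {D : Module.End k V} (h : ∀ i v, D (ρ (X i) v) = ρ (X i ^ 2) v + ρ (X i) (D v)) (a : Pol k) (v : V) :
    D (ρ a v) = ρ (polDer k a) v + ρ a (D v) := by
  induction a using MvPolynomial.induction_on generalizing v with
  | C c =>
    rw [← MvPolynomial.algebraMap_eq, AlgHom.commutes, Derivation.map_algebraMap]
    simp [Module.algebraMap_end_apply]
  | add a b ha hb => simp only [map_add, LinearMap.add_apply, ha, hb]; abel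
  | mul_X a i ha =>
    have hc : ρ (X i) (ρ (polDer k a) v) = ρ (polDer k a) (ρ (X i) v) := by
      rw [← Module.End.mul_apply, ← map_mul, mul_comm, map_mul, Module.End.mul_apply]
    rw [map_mul, Module.End.mul_apply, ha, h, Derivation.leibniz, polDer_X, smul_eq_mul, smul_eq_mul]
    simp only [map_add, map_mul, Module.End.mul_apply, LinearMap.add_apply]
    rw [hc]
    abel

lemma comm_of_X {V W : Type*} [AddCommGroup V] [Module k V] [AddCommGroup W] [Module k W]
    {ρ : Pol k →ₐ[k] Module.End k V} {σ : Pol k →ₐ[k] Module.End k W}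
    {f : V →ₗ[k] W} (h : ∀ i v, f (ρ (X i) v) = σ (X i) (f v)) (a : Pol k) (v : V) :
    f (ρ a v) = σ a (f v) := by
  induction a using MvPolynomial.induction_on generalizing v with
  | C c => rw [← MvPolynomial.algebraMap_eq, AlgHom.commutes, AlgHom.commutes]; simp [Module.algebraMap_end_apply]
  | add a b ha hb => simp only [map_add, LinearMap.add_apply, ha, hb]
  | mul_X a i ha => simp only [map_mul, Module.End.mul_apply, h, ha]

/-- Right multiplication by `y_1` on `M ⊗_R B = M ⊕ M y_1`, where `y_1^2 = e_1 y_1 - e_2`. -/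
noncomputable def indY (M : HqBimod k) : Module.End k (M.carrier × M.carrier) :=
  LinearMap.prod (-(M.rgt (e2 k)) ∘ₗ snd k _ _)
    (fst k _ _ + M.rgt (e1 k) ∘ₗ snd k _ _)

lemma indY_apply (M : HqBimod k) (v : M.carrier × M.carrier) :
    indY M v = (-M.rgt (e2 k) v.2, v.1 + M.rgt (e1 k) v.2) := rfl

/-- Right multiplication by `y_2 = e_1 - y_1` on `M ⊗_R B = M ⊕ M y_1`. -/
noncomputable def indZ (M : HqBimod k) : Module.End k (M.carrier × M.carrier) :=
  LinearMap.prod (M.rgt (e1 k) ∘ₗ fst k _ _ + M.rgt (e2 k) ∘ₗ snd k _ _)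
    (-fst k _ _)

lemma indZ_apply (M : HqBimod k) (v : M.carrier × M.carrier) :
    indZ M v = (M.rgt (e1 k) v.1 + M.rgt (e2 k) v.2, -v.1) := rfl

lemma indY_indZ (M : HqBimod k) (v : M.carrier × M.carrier) :
    indY M (indZ M v) = (M.rgt (e2 k) v.1, M.rgt (e2 k) v.2) := by
  simp [indY_apply, indZ_apply]

lemma indZ_indY (M : HqBimod k) (v : M.carrier × M.carrier) :
    indZ M (indY M v) = (M.rgt (e2 k) v.1, M.rgt (e2 k) v.2) := by
  rw [indY_apply, indZ_apply]
  refine Prod.ext ?_ (neg_neg _)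
  change M.rgt (e1 k) (-M.rgt (e2 k) v.2) + M.rgt (e2 k) (v.1 + M.rgt (e1 k) v.2) = _
  rw [map_neg, map_add, M.rgt_comm (e1 k) (e2 k)]
  abel

/-- `∂_q` on `M ⊗_R B = M ⊕ M y_1`. -/
noncomputable def indDq (M : HqBimod k) : Module.End k (M.carrier × M.carrier) :=
  LinearMap.prod (M.dq ∘ₗ fst k _ _ - M.rgt (e2 k) ∘ₗ snd k _ _)
    (M.dq ∘ₗ snd k _ _ + M.rgt (e1 k) ∘ₗ snd k _ _)

lemma indDq_apply (M : HqBimod k) (v : M.carrier × M.carrier) :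
    indDq M v = (M.dq v.1 - M.rgt (e2 k) v.2, M.dq v.2 + M.rgt (e1 k) v.2) := rfl

lemma indDq_indY (M : HqBimod k) (v : M.carrier × M.carrier) :
    indDq M (indY M v) = indY M (indY M v) + indY M (indDq M v) := by
  simp only [indDq_apply, indY_apply, map_add, map_neg, map_sub, M.dq_rgt, polDer_e1, polDer_e2,
    map_mul, Module.End.mul_apply, LinearMap.sub_apply, LinearMap.add_apply]
  rw [M.rgt_comm (e1 k) (e2 k)]
  refine Prod.ext ?_ ?_ <;> simp only [Prod.fst_add, Prod.snd_add] <;> abel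

lemma indDq_indZ (M : HqBimod k) (v : M.carrier × M.carrier) :
    indDq M (indZ M v) = indZ M (indZ M v) + indZ M (indDq M v) := by
  simp only [indDq_apply, indZ_apply, map_add, map_neg, map_sub, M.dq_rgt, polDer_e1, polDer_e2,
    map_mul, Module.End.mul_apply, LinearMap.sub_apply, LinearMap.add_apply]
  rw [M.rgt_comm (e1 k) (e2 k)]
  refine Prod.ext ?_ ?_ <;> simp only [Prod.fst_add, Prod.snd_add] <;> abel

/-- The right action on `M ⊗_R B = M ⊕ M y_1`. -/
noncomputable def indRgt (M : HqBimod k) : Pol k →ₐ[k] Module.End k (M.carrier × M.carrier) :=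
  polHom (indY M) (indZ M) (LinearMap.ext fun v => by
    rw [Module.End.mul_apply, Module.End.mul_apply, indY_indZ, indZ_indY])

lemma indRgt_X0 (M : HqBimod k) : indRgt M (X 0) = indY M := polHom_X0 _ _ _

lemma indRgt_X1 (M : HqBimod k) : indRgt M (X 1) = indZ M := polHom_X1 _ _ _

lemma indRgt_comm {M : HqBimod k} {N : HqBimod k} {f : M.carrier × M.carrier →ₗ[k] N.carrier × N.carrier}
    (h0 : ∀ v, f (indY M v) = indY N (f v)) (h1 : ∀ v, f (indZ M v) = indZ N (f v)) (a : Pol k)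
    (v : M.carrier × M.carrier) : f (indRgt M a v) = indRgt N a (f v) := by
  refine comm_of_X (fun i => ?_) a v
  revert i
  rw [Fin.forall_fin_two, indRgt_X0, indRgt_X1, indRgt_X0, indRgt_X1]
  exact ⟨h0, h1⟩

/-- The bimodule `M ⊗_R B = M ⊕ M y_1`. -/
noncomputable abbrev Ind (M : HqBimod k) : HqBimod k where
  carrier := M.carrier × M.carrier
  lft :=
    { toFun := fun a => (M.lft a).prodMap (M.lft a)
      map_one' := by ext <;> simp
      map_mul' := fun a b => by ext <;> simp
      map_zero' := by ext <;> simp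
      map_add' := fun a b => by ext <;> simp
      commutes' := fun c => by ext <;> simp [Module.algebraMap_end_apply] }
  rgt := indRgt M
  lft_rgt := fun a b m => indRgt_comm (f := (M.lft a).prodMap (M.lft a))
    (fun v => by simp [indY_apply, M.lft_rgt]) (fun v => by simp [indZ_apply, M.lft_rgt]) b m
  dq := indDq M
  dq_lft := fun a m => by
    refine Prod.ext ?_ ?_
    · simp [indDq_apply, M.dq_lft, M.lft_rgt]; abel
    · simp [indDq_apply, M.dq_lft, M.lft_rgt]; abel
  dq_rgt := fun a m => by
    refine leibniz_of_X (fun i => ?_) a m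
    revert i
    rw [Fin.forall_fin_two, map_pow, map_pow, indRgt_X0, indRgt_X1, pow_two, pow_two]
    exact ⟨indDq_indY M, indDq_indZ M⟩
  dt := M.dt.prodMap M.dt
  dt_lft := fun a m => Prod.ext (M.dt_lft a _) (M.dt_lft a _)
  dt_rgt := fun a m => indRgt_comm (f := M.dt.prodMap M.dt)
    (fun v => by simp [indY_apply, M.dt_rgt]) (fun v => by simp [indZ_apply, M.dt_rgt]) a m
  dt_dq := fun m => by
    refine Prod.ext ?_ ?_ <;> simp [indDq_apply, M.dt_dq, M.dt_rgt]
  gr := fun e => (M.gr e).prod (M.gr (e - 2))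

@[simp] lemma Ind_lft (M : HqBimod k) (a : Pol k) (v : M.carrier × M.carrier) :
    (Ind M).lft a v = (M.lft a v.1, M.lft a v.2) := rfl

@[simp] lemma Ind_rgt0 (M : HqBimod k) (v : M.carrier × M.carrier) :
    (Ind M).rgt (X 0) v = indY M v := by
  change indRgt M (X 0) v = _
  rw [indRgt_X0]

@[simp] lemma Ind_rgt1 (M : HqBimod k) (v : M.carrier × M.carrier) :
    (Ind M).rgt (X 1) v = indZ M v := by
  change indRgt M (X 1) v = _
  rw [indRgt_X1]

/-- The multiplication map `M ⊗_R B → M`. -/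
noncomputable def indMul (M : HqBimod k) : M.carrier × M.carrier →ₗ[k] M.carrier :=
  fst k _ _ + M.rgt (X 0) ∘ₗ snd k _ _

lemma indMul_apply (M : HqBimod k) (v : M.carrier × M.carrier) :
    indMul M v = v.1 + M.rgt (X 0) v.2 := rfl

lemma isBi_indMul (M : HqBimod k) : IsBi (Ind M) M (indMul M) := by
  refine ⟨fun i v => ?_, fun i => ?_⟩
  · simp [indMul_apply, M.lft_rgt]
  · revert i
    rw [Fin.forall_fin_two]
    constructor <;> intro v
    · simp only [indRgt_X0, indMul_apply, indY_apply, map_add, map_e1, map_e2, LinearMap.add_apply,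
        Module.End.mul_apply, M.rgt_comm (X 0) (X 1)]
      abel
    · simp only [indRgt_X1, indMul_apply, indZ_apply, map_add, map_neg, map_e1, map_e2, LinearMap.add_apply,
        Module.End.mul_apply, M.rgt_comm (X 0) (X 1)]
      abel

lemma indMul_dq (M : HqBimod k) (v : M.carrier × M.carrier) :
    indMul M (indDq M v) = M.dq (indMul M v) := by
  simp only [indMul_apply, indDq_apply, map_add, M.dq_rgt, polDer_X, pow_two, map_mul, map_e1, map_e2,
    LinearMap.add_apply, Module.End.mul_apply, M.rgt_comm (X 0) (X 1)]
  abel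

lemma Good.rgt_e1_mem {M : HqBimod k} (hM : Good p M) {e : ℤ} {m : M.carrier} (hm : m ∈ M.gr e) :
    M.rgt (e1 k) m ∈ M.gr (e + 2) := by
  rw [map_e1]
  exact add_mem (hM.rgt_mem _ _ _ hm) (hM.rgt_mem _ _ _ hm)

lemma Good.rgt_e2_mem {M : HqBimod k} (hM : Good p M) {e : ℤ} {m : M.carrier} (hm : m ∈ M.gr e) :
    M.rgt (e2 k) m ∈ M.gr (e + 4) := by
  rw [map_e2, show e + 4 = e + 2 + 2 by ring]
  exact hM.rgt_mem _ _ _ (hM.rgt_mem _ _ _ hm)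

lemma Good.indMul_mem {M : HqBimod k} (hM : Good p M) {e : ℤ} {v : M.carrier × M.carrier}
    (hv : v ∈ (Ind M).gr e) : indMul M v ∈ M.gr e := by
  refine add_mem hv.1 ?_
  have := hM.rgt_mem 0 _ _ hv.2
  rwa [sub_add_cancel] at this

lemma indDq_pow (M : HqBimod k) [Fact p.Prime] [CharP k p] (h : M.dq ^ p = 0) : indDq M ^ p = 0 := by
  rcases subsingleton_or_nontrivial M.carrier with hs | hs
  · exact LinearMap.ext fun _ => Subsingleton.elim _ _
  have : CharP (Module.End k (M.carrier × M.carrier)) p :=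
    charP_of_injective_algebraMap (algebraMap k _).injective p
  have h1 : ∀ m, (indDq M ^ p) (m, 0) = 0 := by
    intro m
    have := comp_pow_of_comm (D := M.dq) (D' := indDq M) (f := LinearMap.inl k _ _)
      (fun x => by simp [indDq_apply]) p m
    rw [h] at this
    exact this.symm.trans (map_zero (LinearMap.inl k _ _))
  have h2 : indDq M * indY M = indY M * (indDq M + indY M) := by
    refine LinearMap.ext fun v => ?_
    rw [Module.End.mul_apply, indDq_indY, Module.End.mul_apply, LinearMap.add_apply, map_add, add_comm]
  have h3 : ∀ n, indDq M ^ n * indY M = indY M * (indDq M + indY M) ^ n := by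
    intro n
    induction n with
    | zero => simp
    | succ n ih => rw [pow_succ, mul_assoc, h2, ← mul_assoc, ih, mul_assoc, ← pow_succ]
  refine LinearMap.ext fun v => ?_
  have h4 : v = (v.1, 0) + (0, v.2) := by simp
  have h6 := add_pow_char_of_commutator p (show indDq M * indY M = indY M * indDq M + indY M ^ 2 by
    rw [h2, mul_add, pow_two])
  have h5 : ((0, v.2) : M.carrier × M.carrier) = indY M (v.2, 0) := by simp [indY_apply]
  rw [h4, map_add, h1, h5, ← Module.End.mul_apply, h3, h6, Module.End.mul_apply, h1, map_zero, zero_add]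
  rfl

/-- The complex underlying a bimodule, with the topological differential. -/
abbrev topC (M : HqBimod k) : QComplex k where
  carrier := M.carrier
  gr := M.gr
  diff := M.dt

lemma Good.topC_isPComplex {M : HqBimod k} (hM : Good p M) : IsPComplex p (topC M) :=
  ⟨hM.internal, hM.dt_mem, hM.dt_pow⟩

lemma Good.ind [Fact p.Prime] [CharP k p] {M : HqBimod k} (hM : Good p M) : Good p (Ind M) where
  internal := by
    obtain ⟨c, hc⟩ := exists_isProj hM.internal
    exact (isProj_prod hc (isProj_shift hc (-2))).isInternal
  lft_mem := fun i e m hm => ⟨hM.lft_mem i _ _ hm.1, by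
    have := hM.lft_mem i _ _ hm.2
    rwa [show e - 2 + 2 = e + 2 - 2 by ring] at this⟩
  rgt_mem := fun i e => by
    revert i
    rw [Fin.forall_fin_two]
    constructor <;> intro m hm <;>
    have h1 := hm.1 <;>
    have h2 := hM.rgt_e1_mem hm.2 <;>
    have h3 := hM.rgt_e2_mem hm.2 <;>
    rw [sub_add_cancel] at h2 <;>
    rw [show e - 2 + 4 = e + 2 by ring] at h3
    · rw [Ind_rgt0, indY_apply]
      exact ⟨neg_mem h3, by
        rw [add_sub_cancel_right]; exact add_mem h1 h2⟩
    · rw [Ind_rgt1, indZ_apply]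
      exact ⟨add_mem (hM.rgt_e1_mem h1) h3, by
        rw [add_sub_cancel_right]; exact neg_mem h1⟩
  dq_mem := fun e m hm => by
    have h2 := hM.rgt_e1_mem hm.2
    have h3 := hM.rgt_e2_mem hm.2
    have h4 := hM.dq_mem _ _ hm.2
    rw [show e - 2 + 4 = e + 2 by ring] at h3
    rw [show e - 2 + 2 = e + 2 - 2 by ring] at h2 h4
    exact ⟨sub_mem (hM.dq_mem _ _ hm.1) h3, add_mem h4 h2⟩
  dt_mem := fun e m hm => ⟨hM.dt_mem _ _ hm.1, by
    have := hM.dt_mem _ _ hm.2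
    rwa [show e - 2 + 2 = e + 2 - 2 by ring] at this⟩
  dq_pow := indDq_pow M hM.dq_pow
  dt_pow := by
    change (M.dt.prodMap M.dt) ^ p = 0
    rw [prodMap_pow, hM.dt_pow, LinearMap.prodMap_zero]

lemma topC_isHom {M : HqBimod k} (hM : Good p M) :
    IsHom (topC (Ind M)) (topC M) (indMul M) :=
  ⟨fun v => by simp [indMul_apply, M.dt_rgt], fun e v hv => hM.indMul_mem hv⟩

/-- The bimodule `M ⊗_R pT = q^{-3} (M ⊗_R B → M = ⋯ = M)`. -/
noncomputable abbrev TwistB (p : ℕ) (M : HqBimod k) : HqBimod k where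
  carrier := (M.carrier × M.carrier) × (Fin (p - 1) → M.carrier)
  lft :=
    { toFun := fun a => ((Ind M).lft a).prodMap ((M.lft a).compLeft (Fin (p - 1)))
      map_one' := by ext <;> simp
      map_mul' := fun a b => by ext <;> simp
      map_zero' := by ext <;> simp
      map_add' := fun a b => by ext <;> simp
      commutes' := fun c => by ext <;> simp [Module.algebraMap_end_apply] }
  rgt :=
    { toFun := fun a => ((Ind M).rgt a).prodMap ((M.rgt a).compLeft (Fin (p - 1)))
      map_one' := by ext <;> simp
      map_mul' := fun a b => by ext <;> simp
      map_zero' := by ext <;> simp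
      map_add' := fun a b => by ext <;> simp
      commutes' := fun c => by ext <;> simp [Module.algebraMap_end_apply] }
  lft_rgt := fun a b m =>
    Prod.ext ((Ind M).lft_rgt a b m.1) (funext fun j => M.lft_rgt a b (m.2 j))
  dq := (indDq M).prodMap (M.dq.compLeft (Fin (p - 1)))
  dq_lft := fun a m =>
    Prod.ext ((Ind M).dq_lft a m.1) (funext fun j => M.dq_lft a (m.2 j))
  dq_rgt := fun a m =>
    Prod.ext ((Ind M).dq_rgt a m.1) (funext fun j => M.dq_rgt a (m.2 j))
  dt := (cone p (topC (Ind M)) (topC M) (indMul M)).diff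
  dt_lft := fun a m => by
    refine Prod.ext ((Ind M).dt_lft a m.1) (funext fun j => ?_)
    change blkDiff (p - 1) M.dt ((M.lft a).compLeft _ m.2) j +
      coneInj (p - 1) (indMul M) ((Ind M).lft a m.1) j =
      M.lft a (blkDiff (p - 1) M.dt m.2 j + coneInj (p - 1) (indMul M) m.1 j)
    rw [blkDiff_apply, blkDiff_apply, coneInj_apply, coneInj_apply]
    split_ifs <;> simp only [M.dt_lft, (isBi_indMul M).lft_all, map_add, map_zero, LinearMap.compLeft_apply, Function.comp_apply]
  dt_rgt := fun a m => by
    refine Prod.ext ((Ind M).dt_rgt a m.1) (funext fun j => ?_)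
    change blkDiff (p - 1) M.dt ((M.rgt a).compLeft _ m.2) j +
      coneInj (p - 1) (indMul M) ((Ind M).rgt a m.1) j =
      M.rgt a (blkDiff (p - 1) M.dt m.2 j + coneInj (p - 1) (indMul M) m.1 j)
    rw [blkDiff_apply, blkDiff_apply, coneInj_apply, coneInj_apply]
    split_ifs <;> simp only [M.dt_rgt, (isBi_indMul M).rgt_all, map_add, map_zero, LinearMap.compLeft_apply, Function.comp_apply]
  dt_dq := fun m => by
    refine Prod.ext ((Ind M).dt_dq m.1) (funext fun j => ?_)
    change blkDiff (p - 1) M.dt (M.dq.compLeft _ m.2) j +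
      coneInj (p - 1) (indMul M) (indDq M m.1) j =
      M.dq (blkDiff (p - 1) M.dt m.2 j + coneInj (p - 1) (indMul M) m.1 j)
    rw [blkDiff_apply, blkDiff_apply, coneInj_apply, coneInj_apply]
    split_ifs <;> simp [M.dt_dq, indMul_dq]
  gr := fun e => (cone p (topC (Ind M)) (topC M) (indMul M)).gr (e + 3)

lemma TwistB_dt_snd (M : HqBimod k) (z : (M.carrier × M.carrier) × (Fin (p - 1) → M.carrier))
    (j : Fin (p - 1)) : ((TwistB p M).dt z).2 j =
      ((if h : (j : ℕ) = 0 then 0 else z.2 ⟨(j : ℕ) - 1, by omega⟩) + M.dt (z.2 j)) +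
        if (j : ℕ) = 0 then indMul M z.1 else 0 := by
  change blkDiff (p - 1) M.dt z.2 j + coneInj (p - 1) (indMul M) z.1 j = _
  rw [blkDiff_apply, coneInj_apply]

lemma Good.twistB [Fact p.Prime] [CharP k p] {M : HqBimod k} (hM : Good p M) :
    Good p (TwistB p M) := by
  have hc := IsPComplex.cone hM.ind.topC_isPComplex hM.topC_isPComplex (topC_isHom hM)
  exact
  { internal := by
      obtain ⟨c, hc⟩ := exists_isProj hc.internal
      exact (isProj_shift hc 3).isInternal
    lft_mem := fun i e m hm => by
      change _ ∈ (cone p (topC (Ind M)) (topC M) (indMul M)).gr (e + 2 + 3)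
      rw [show e + 2 + 3 = e + 3 + 2 by ring]
      refine ⟨hM.ind.lft_mem i _ _ hm.1, fun j _ => ?_⟩
      have := hM.lft_mem i _ _ (hm.2 j trivial)
      rwa [show ∀ s : ℤ, e + 3 - 2 - s + 2 = e + 3 + 2 - 2 - s by intro s; ring] at this
    rgt_mem := fun i e m hm => by
      change _ ∈ (cone p (topC (Ind M)) (topC M) (indMul M)).gr (e + 2 + 3)
      rw [show e + 2 + 3 = e + 3 + 2 by ring]
      refine ⟨hM.ind.rgt_mem i _ _ hm.1, fun j _ => ?_⟩
      have := hM.rgt_mem i _ _ (hm.2 j trivial)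
      rwa [show ∀ s : ℤ, e + 3 - 2 - s + 2 = e + 3 + 2 - 2 - s by intro s; ring] at this
    dq_mem := fun e m hm => by
      change _ ∈ (cone p (topC (Ind M)) (topC M) (indMul M)).gr (e + 2 + 3)
      rw [show e + 2 + 3 = e + 3 + 2 by ring]
      refine ⟨hM.ind.dq_mem _ _ hm.1, fun j _ => ?_⟩
      have := hM.dq_mem _ _ (hm.2 j trivial)
      rwa [show ∀ s : ℤ, e + 3 - 2 - s + 2 = e + 3 + 2 - 2 - s by intro s; ring] at this
    dt_mem := fun e m hm => by
      change _ ∈ (cone p (topC (Ind M)) (topC M) (indMul M)).gr (e + 2 + 3)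
      rw [show e + 2 + 3 = e + 3 + 2 by ring]
      exact hc.diff_mem _ _ hm
    dq_pow := by
      change ((indDq M).prodMap (M.dq.compLeft (Fin (p - 1)))) ^ p = 0
      rw [prodMap_pow, indDq_pow M hM.dq_pow, compLeft_pow, hM.dq_pow]
      rfl
    dt_pow := hc.diff_pow }

end Ind

/-! ### The total complex of `M ⊗_R pT` is a cone -/

section TotalCone

variable {p : ℕ} {M N : HqBimod k}

lemma tot_zero (p : ℕ) (z : PHH p M) : tot p (IsBi.zero M N) z = 0 := by
  obtain ⟨a, v, m, rfl⟩ := PHH_rep z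
  rfl

lemma IsBi.sum {ι : Type*} {s : Finset ι} {f : ι → M.carrier →ₗ[k] N.carrier}
    (hf : ∀ i, IsBi M N (f i)) : IsBi M N (∑ i ∈ s, f i) :=
  ⟨fun i m => by simp [LinearMap.sum_apply, (hf _).lft], fun i m => by simp [LinearMap.sum_apply, (hf _).rgt]⟩

lemma tot_sum {ι : Type*} {s : Finset ι} {f : ι → M.carrier →ₗ[k] N.carrier}
    (hf : ∀ i, IsBi M N (f i)) (z : PHH p M) :
    tot p (IsBi.sum (s := s) hf) z = ∑ i ∈ s, tot p (hf i) z := by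
  classical
  induction s using Finset.induction_on with
  | empty => exact tot_zero p z
  | insert a s ha ih =>
    refine (tot_congr p (IsBi.sum hf) ((hf a).add (IsBi.sum (s := s) hf))
      (fun x => by rw [sum_insert ha]) z).trans ?_
    rw [tot_add p (hf a) (IsBi.sum (s := s) hf), ih]
    exact (sum_insert (f := fun i => tot p (hf i) z) ha).symm

lemma isBi_fst (M : HqBimod k) : IsBi (TwistB p M) (Ind M)
    (fst k (M.carrier × M.carrier) (Fin (p - 1) → M.carrier)) :=
  ⟨fun _ _ => rfl, fun _ _ => rfl⟩

lemma isBi_proj (M : HqBimod k) (j : Fin (p - 1)) : IsBi (TwistB p M) M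
    (proj j ∘ₗ snd k (M.carrier × M.carrier) (Fin (p - 1) → M.carrier)) :=
  ⟨fun _ _ => rfl, fun _ _ => rfl⟩

lemma isBi_inl (M : HqBimod k) : IsBi (Ind M) (TwistB p M)
    (LinearMap.inl k (M.carrier × M.carrier) (Fin (p - 1) → M.carrier)) :=
  ⟨fun i _ => Prod.ext rfl (funext fun _ => (map_zero (M.lft (X i))).symm),
    fun i _ => Prod.ext rfl (funext fun _ => (map_zero (M.rgt (X i))).symm)⟩

lemma isBi_single (M : HqBimod k) (j : Fin (p - 1)) : IsBi M (TwistB p M)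
    (LinearMap.inr k (M.carrier × M.carrier) (Fin (p - 1) → M.carrier) ∘ₗ
      LinearMap.single k (fun _ => M.carrier) j) := by
  refine ⟨fun i m => Prod.ext (map_zero ((Ind M).lft (X i))).symm (funext fun l => ?_),
    fun i m => Prod.ext (map_zero ((Ind M).rgt (X i))).symm (funext fun l => ?_)⟩
  · exact (Pi.apply_single (fun _ => M.lft (X i)) (fun _ => map_zero _) j m l).symm
  · exact (Pi.apply_single (fun _ => M.rgt (X i)) (fun _ => map_zero _) j m l).symm

/-- The `p`-Hochschild homology of `M ⊗_R pT`, decomposed. -/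
noncomputable def twistEquiv (p : ℕ) (M : HqBimod k) :
    PHH p (TwistB p M) ≃ₗ[k] PHH p (Ind M) × (Fin (p - 1) → PHH p M) :=
  { LinearMap.prod (tot p (isBi_fst M)) (LinearMap.pi fun j => tot p (isBi_proj M j)) with
    invFun := fun y => tot p (isBi_inl M) y.1 + ∑ j, tot p (isBi_single M j) (y.2 j)
    left_inv := fun z => by
      change tot p (isBi_inl M) (tot p (isBi_fst M) z) +
        ∑ j, tot p (isBi_single M j) (tot p (isBi_proj M j) z) = z
      simp only [← tot_comp]
      rw [← tot_sum (fun j => (isBi_single M j).comp (isBi_proj M j)), ← tot_add]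
      refine (tot_congr _ _ (IsBi.id _) (fun x => ?_) z).trans (tot_id p z)
      rw [LinearMap.add_apply, LinearMap.sum_apply]
      refine Prod.ext ?_ (funext fun l => ?_)
      · simp [Prod.fst_sum]
      · simp [Prod.snd_sum, Finset.sum_apply, Pi.single_apply]
    right_inv := fun y => by
      refine Prod.ext ?_ (funext fun l => ?_)
      · change tot p (isBi_fst M) (_ + _) = y.1
        have h (j) : tot p (isBi_fst M) (tot p (isBi_single M j) (y.2 j)) = 0 := by
          rw [← tot_comp]
          exact (tot_congr p _ (IsBi.zero M (Ind M)) (fun x => rfl) (y.2 j)).trans (tot_zero p _)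
        rw [map_add, map_sum, sum_eq_zero fun j _ => h j, add_zero, ← tot_comp]
        exact (tot_congr p _ (IsBi.id (Ind M)) (fun x => rfl) y.1).trans (tot_id p _)
      · change tot p (isBi_proj M l) (_ + _) = y.2 l
        have h (j) (hj : j ≠ l) : tot p (isBi_proj M l) (tot p (isBi_single M j) (y.2 j)) = 0 := by
          rw [← tot_comp]
          exact (tot_congr p _ (IsBi.zero M M)
            (fun x => by simp [Pi.single_apply, Ne.symm hj]) (y.2 j)).trans (tot_zero p _)
        have h0 : tot p (isBi_proj M l) (tot p (isBi_inl M) y.1) = 0 := by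
          rw [← tot_comp]
          exact (tot_congr p _ (IsBi.zero (Ind M) M) (fun x => rfl) y.1).trans (tot_zero p _)
        rw [map_add, map_sum, sum_eq_single_of_mem l (mem_univ l) fun j _ hj => h j hj, h0,
          zero_add, ← tot_comp]
        exact (tot_congr p _ (IsBi.id M) (fun x => by simp) (y.2 l)).trans (tot_id p _) }

lemma twistEquiv_fst (z : PHH p (TwistB p M)) : (twistEquiv p M z).1 = tot p (isBi_fst M) z := rfl

lemma twistEquiv_snd (z : PHH p (TwistB p M)) (j : Fin (p - 1)) :
    (twistEquiv p M z).2 j = tot p (isBi_proj M j) z := rfl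

lemma tot_proj_dtPHH (z : PHH p (TwistB p M)) (j : Fin (p - 1)) :
    tot p (isBi_proj M j) (dtPHH p (TwistB p M) z) =
      ((if h : (j : ℕ) = 0 then 0 else tot p (isBi_proj M ⟨(j : ℕ) - 1, by omega⟩) z) +
        dtPHH p M (tot p (isBi_proj M j) z)) +
        if (j : ℕ) = 0 then tot p (isBi_indMul M) (tot p (isBi_fst M) z) else 0 := by
  rw [dtPHH_eq, dtPHH_eq, ← tot_comp, ← tot_comp, ← tot_comp]
  by_cases h : (j : ℕ) = 0
  · rw [dif_pos h, if_pos h, zero_add, ← tot_add]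
    refine tot_congr _ _ _ (fun x => ?_) z
    refine (TwistB_dt_snd M x j).trans ?_
    rw [dif_pos h, if_pos h, zero_add]
    rfl
  · rw [dif_neg h, if_neg h, add_zero, ← tot_add]
    refine tot_congr _ _ _ (fun x => ?_) z
    refine (TwistB_dt_snd M x j).trans ?_
    rw [dif_neg h, if_neg h, add_zero]
    rfl

lemma twistEquiv_isHom (hp : 2 < p) (M : HqBimod k) : IsHom (totC p (TwistB p M))
    ((cone p (totC p (Ind M)) (totC p M) (tot p (isBi_indMul M))).qShift (-3))
    (twistEquiv p M : PHH p (TwistB p M) →ₗ[k] PHH p (Ind M) × (Fin (p - 1) → PHH p M)) := by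
  refine ⟨fun z => ?_, fun e z hz => ?_⟩
  · refine Prod.ext ?_ (funext fun j => ?_)
    · change tot p (isBi_fst M) (dtPHH p (TwistB p M) z + dC p (TwistB p M) z + dqPHH p (TwistB p M) z) =
        dtPHH p (Ind M) (tot p (isBi_fst M) z) + dC p (Ind M) (tot p (isBi_fst M) z) +
          dqPHH p (Ind M) (tot p (isBi_fst M) z)
      rw [map_add, map_add, tot_dC hp, tot_dqPHH p (isBi_fst M) (fun _ => rfl), dtPHH_eq, dtPHH_eq,
        ← tot_comp, ← tot_comp]
      rfl
    · change tot p (isBi_proj M j) (dtPHH p (TwistB p M) z + dC p (TwistB p M) z + dqPHH p (TwistB p M) z) =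
        blkDiff (p - 1) (dtPHH p M + dC p M + dqPHH p M) (fun j => tot p (isBi_proj M j) z) j +
        coneInj (p - 1) (tot p (isBi_indMul M)) (tot p (isBi_fst M) z) j
      rw [map_add, map_add, tot_dC hp, tot_dqPHH p (isBi_proj M j) (fun _ => rfl), tot_proj_dtPHH,
        blkDiff_apply, coneInj_apply]
      simp only [LinearMap.add_apply]
      abel
  · have hz' : z ∈ (totC p (TwistB p M)).gr e := hz
    change _ ∈ (cone p (totC p (Ind M)) (totC p M) (tot p (isBi_indMul M))).gr (e - -3)
    rw [sub_neg_eq_add]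
    refine ⟨tot_mem (isBi_fst M) (fun d m hm => hm.1) hz', fun j _ => ?_⟩
    have := tot_mem (isBi_proj M j) (d := 3 - 2 - 2 * ((j : ℕ) : ℤ)) (fun d m hm => ?_) hz'
    · change tot p (isBi_proj M j) z ∈ (totC p M).gr (e + 3 - 2 - 2 * ((j : ℕ) : ℤ))
      rwa [show e + (3 - 2 - 2 * ((j : ℕ) : ℤ)) = e + 3 - 2 - 2 * ((j : ℕ) : ℤ) by ring] at this
    · have := hm.2 j trivial
      change m.2 j ∈ M.gr _ at this
      change m.2 j ∈ M.gr _
      convert this using 2; ring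

/-- The total complex of `M ⊗_R pT` is the cone of `M ⊗_R B → M`, up to a shift. -/
lemma total_twistB (hp : 2 < p) (M : HqBimod k) : HomotopyIso p (totC p (TwistB p M))
    ((cone p (totC p (Ind M)) (totC p M) (tot p (isBi_indMul M))).qShift (-3)) := by
  refine homotopyIso_of_equiv (M := totC p (TwistB p M))
    (N := (cone p (totC p (Ind M)) (totC p M) (tot p (isBi_indMul M))).qShift (-3))
    (twistEquiv p M) (twistEquiv_isHom hp M).comm (twistEquiv_isHom hp M).map_mem fun e y hy => ?_
  · change y ∈ (cone p (totC p (Ind M)) (totC p M) (tot p (isBi_indMul M))).gr (e - -3) at hy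
    rw [sub_neg_eq_add] at hy
    refine add_mem ?_ (sum_mem fun j _ => ?_)
    · have := tot_mem (isBi_inl (p := p) M) (d := -3) (fun d m hm => ?_) hy.1
      · rwa [add_neg_cancel_right] at this
      · change _ ∈ (cone p (topC (Ind M)) (topC M) (indMul M)).gr (d + -3 + 3)
        rw [neg_add_cancel_right]
        exact ⟨hm, zero_mem _⟩
    · have h2 : y.2 j ∈ (totC p M).gr (e + 3 - 2 - 2 * ((j : ℕ) : ℤ)) := hy.2 j trivial
      have := tot_mem (isBi_single (p := p) M j) (d := -3 + 2 + 2 * ((j : ℕ) : ℤ)) (fun d m hm => ?_) h2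
      · rwa [show e + 3 - 2 - 2 * ((j : ℕ) : ℤ) + (-3 + 2 + 2 * ((j : ℕ) : ℤ)) = e by ring] at this
      · refine ⟨zero_mem _, fun l _ => ?_⟩
        change (Pi.single j m : Fin (p - 1) → M.carrier) l ∈ M.gr (d + (-3 + 2 + 2 * ((j : ℕ) : ℤ)) + 3 - 2 - 2 * ((l : ℕ) : ℤ))
        rw [Pi.single_apply]
        split_ifs with h
        · subst h
          convert hm using 2; ring
        · exact zero_mem _

end TotalCone

/-! ### Isomorphisms of bimodules -/

section BiEquiv

variable {p : ℕ} {M N L : HqBimod k}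

/-- Isomorphisms of graded bimodules compatible with both differentials. -/
structure BiEquiv (M N : HqBimod k) where
  e : M.carrier ≃ₗ[k] N.carrier
  isBi : IsBi M N e.toLinearMap
  dq : ∀ m, e (M.dq m) = N.dq (e m)
  dt : ∀ m, e (M.dt m) = N.dt (e m)
  gr : ∀ d m, m ∈ M.gr d ↔ e m ∈ N.gr d

/-- The identity. -/
def BiEquiv.refl (M : HqBimod k) : BiEquiv M M :=
  ⟨LinearEquiv.refl k _, IsBi.id M, fun _ => rfl, fun _ => rfl, fun _ _ => Iff.rfl⟩

/-- Composition of isomorphisms. -/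
def BiEquiv.trans (f : BiEquiv M N) (g : BiEquiv N L) : BiEquiv M L where
  e := f.e.trans g.e
  isBi := g.isBi.comp f.isBi
  dq m := by rw [LinearEquiv.trans_apply, f.dq, g.dq]; rfl
  dt m := by rw [LinearEquiv.trans_apply, f.dt, g.dt]; rfl
  gr d m := (f.gr d m).trans (g.gr d _)

lemma BiEquiv.isBi_symm (f : BiEquiv M N) : IsBi N M f.e.symm.toLinearMap := by
  refine ⟨fun i m => f.e.injective ?_, fun i m => f.e.injective ?_⟩
  · have := f.isBi.lft i (f.e.symm m)
    simp only [LinearEquiv.coe_coe, LinearEquiv.apply_symm_apply] at this ⊢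
    exact this.symm
  · have := f.isBi.rgt i (f.e.symm m)
    simp only [LinearEquiv.coe_coe, LinearEquiv.apply_symm_apply] at this ⊢
    exact this.symm

/-- The isomorphism `M ⊗_R pT → N ⊗_R pT` induced by an isomorphism `M → N`. -/
def BiEquiv.twistB (f : BiEquiv M N) : BiEquiv (TwistB p M) (TwistB p N) where
  e := LinearEquiv.prodCongr (LinearEquiv.prodCongr f.e f.e)
    (LinearEquiv.piCongrRight fun _ : Fin (p - 1) => f.e)
  isBi := by
    have hl := fun i m => f.isBi.lft i m
    have hr := fun a m => f.isBi.rgt_all a m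
    refine ⟨fun i m => Prod.ext (Prod.ext (hl i _) (hl i _)) (funext fun j => hl i _),
      fun i m => Prod.ext ?_ (funext fun j => hr (X i) _)⟩
    exact indRgt_comm (f := f.e.toLinearMap.prodMap f.e.toLinearMap)
      (fun v => by
        refine Prod.ext ?_ ?_
        · simpa [indY_apply] using hr (e2 k) v.2
        · simpa [indY_apply] using hr (e1 k) v.2)
      (fun v => by
        have h1 := hr (e1 k) v.1
        have h2 := hr (e2 k) v.2
        simp only [LinearEquiv.coe_coe] at h1 h2
        refine Prod.ext ?_ ?_
        · simp [indZ_apply, h1, h2]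
        · simp [indZ_apply]) (X i) m.1
  dq m := by
    have h1 := f.isBi.rgt_all (e1 k) m.1.2
    have h2 := f.isBi.rgt_all (e2 k) m.1.2
    simp only [LinearEquiv.coe_coe] at h1 h2
    refine Prod.ext (Prod.ext ?_ ?_) (funext fun j => f.dq _)
    · exact (map_sub f.e _ _).trans (congrArg₂ _ (f.dq _) h2)
    · exact (map_add f.e _ _).trans (congrArg₂ _ (f.dq _) h1)
  dt m := by
    refine Prod.ext (Prod.ext (f.dt _) (f.dt _)) (funext fun j => ?_)
    refine (congrArg f.e (TwistB_dt_snd M m j)).trans (Eq.trans ?_ (TwistB_dt_snd N _ j).symm)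
    have h1 := f.isBi.rgt_all (X 0) m.1.2
    simp only [LinearEquiv.coe_coe] at h1
    by_cases h : (j : ℕ) = 0
    · rw [dif_pos h, dif_pos h, if_pos h, if_pos h, map_add, map_add, map_zero, f.dt, indMul_apply,
        map_add, h1]
      rfl
    · rw [dif_neg h, dif_neg h, if_neg h, if_neg h, map_add, map_add, map_zero, f.dt]
      rfl
  gr d m := and_congr (and_congr (f.gr _ _) (f.gr _ _))
    (forall_congr' fun j => imp_congr Iff.rfl (f.gr _ _))

lemma _root_.TorusLink.QComplex.IsPComplex.of_equiv {A C : QComplex k} (hC : IsPComplex p C)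
    (e : A.carrier ≃ₗ[k] C.carrier) (he : ∀ x, e (A.diff x) = C.diff (e x))
    (hg : ∀ d x, x ∈ A.gr d ↔ e x ∈ C.gr d) : IsPComplex p A where
  internal := by
    obtain ⟨c, hc⟩ := exists_isProj hC.internal
    have : IsProj A.gr (fun d => e.symm.toLinearMap ∘ₗ c d ∘ₗ e.toLinearMap) :=
      { mem := fun d x => (hg _ _).mpr (by simpa using hc.mem d (e x))
        same := fun d x hx => by simp [hc.same d _ ((hg _ _).mp hx)]
        other := fun d d' hd x hx => by simp [hc.other d d' hd _ ((hg _ _).mp hx)]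
        fin := fun x => by
          obtain ⟨s, h0, hs⟩ := hc.fin (e x)
          refine ⟨s, fun d hd => by simp [h0 d hd], ?_⟩
          simp only [LinearMap.comp_apply, LinearEquiv.coe_coe, ← map_sum, hs,
            LinearEquiv.symm_apply_apply] }
    exact this.isInternal
  diff_mem d x hx := by
    rw [hg, he]
    exact hC.diff_mem _ _ ((hg _ _).mp hx)
  diff_pow := by
    refine LinearMap.ext fun x => e.injective ?_
    have := comp_pow_of_comm (f := e.toLinearMap) he p x
    simp only [LinearEquiv.coe_coe] at this
    rw [this, hC.diff_pow]
    exact (map_zero e).symm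

/-- The isomorphism of `p`-Hochschild homology induced by an isomorphism of bimodules. -/
noncomputable def BiEquiv.totEquiv (p : ℕ) (f : BiEquiv M N) : PHH p M ≃ₗ[k] PHH p N :=
  { tot p f.isBi with
    invFun := tot p f.isBi_symm
    left_inv := fun z => (tot_comp p f.isBi_symm f.isBi z).symm.trans
      ((tot_congr p _ (IsBi.id M) (fun x => f.e.symm_apply_apply x) z).trans (tot_id p z))
    right_inv := fun z => (tot_comp p f.isBi f.isBi_symm z).symm.trans
      ((tot_congr p _ (IsBi.id N) (fun x => f.e.apply_symm_apply x) z).trans (tot_id p z)) }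

lemma BiEquiv.totEquiv_isHom (hp : 2 < p) (f : BiEquiv M N) :
    IsHom (totC p M) (totC p N) (f.totEquiv p).toLinearMap :=
  tot_isHom hp f.isBi f.dq f.dt fun d m hm => (f.gr d m).mp hm

lemma BiEquiv.totEquiv_symm_mem (f : BiEquiv M N) {d : ℤ} {z : PHH p N}
    (hz : z ∈ (totC p N).gr d) : (f.totEquiv p).symm z ∈ (totC p M).gr d := by
  have := tot_mem (p := p) f.isBi_symm (d := 0) (fun e m hm => by
    rw [add_zero]; exact (f.gr e _).mpr (by simpa using hm)) hz
  rwa [add_zero] at this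

lemma BiEquiv.homotopyIso (hp : 2 < p) (f : BiEquiv M N) :
    HomotopyIso p (totC p M) (totC p N) :=
  homotopyIso_of_equiv (M := totC p M) (N := totC p N) (f.totEquiv p)
    (f.totEquiv_isHom hp).comm (f.totEquiv_isHom hp).map_mem fun _ _ hz => f.totEquiv_symm_mem hz

lemma BiEquiv.isPComplex (hp : 2 < p) (f : BiEquiv M N) (h : IsPComplex p (totC p N)) :
    IsPComplex p (totC p M) := by
  refine h.of_equiv (A := totC p M) (f.totEquiv p) (f.totEquiv_isHom hp).comm fun d x => ?_
  refine ⟨fun hx => (f.totEquiv_isHom hp).map_mem d x hx, fun hx => ?_⟩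
  have := f.totEquiv_symm_mem hx
  exact (congrArg (· ∈ (totC p M).gr d) ((f.totEquiv p).symm_apply_apply x)).mp this

end BiEquiv

/-! ### The isomorphism between `M ⊗_R pT` and its explicit model -/

section Model

variable {p : ℕ} (M : HqBimod k)

/-- The diagonal right action on `M ⊕ M`. -/
noncomputable def diagRgt : Pol k →ₐ[k] Module.End k (M.carrier × M.carrier) :=
  { toFun := fun a => (M.rgt a).prodMap (M.rgt a)
    map_one' := by ext <;> simp
    map_mul' := fun a b => by ext <;> simp
    map_zero' := by ext <;> simp
    map_add' := fun a b => by ext <;> simp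
    commutes' := fun c => by ext <;> simp [Module.algebraMap_end_apply] }

/-- Symmetric polynomials act diagonally on `M ⊗_R B = M ⊕ M y_1`. -/
lemma indRgt_symm {a : Pol k} (ha : a ∈ symmetricSubalgebra (Fin 2) k)
    (v : M.carrier × M.carrier) : indRgt M a v = (M.rgt a v.1, M.rgt a v.2) := by
  obtain ⟨P, hP⟩ := MvPolynomial.esymmAlgHom_fin_surjective k (n := 2) (m := 2) le_rfl ⟨a, ha⟩
  have key : (indRgt M).comp ((symmetricSubalgebra (Fin 2) k).val.comp
      (MvPolynomial.esymmAlgHom (Fin 2) k 2)) = (diagRgt M).comp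
      ((symmetricSubalgebra (Fin 2) k).val.comp (MvPolynomial.esymmAlgHom (Fin 2) k 2)) := by
    refine MvPolynomial.algHom_ext fun i => ?_
    have h1 : esymm (Fin 2) k 1 = e1 k := by
      rw [MvPolynomial.esymm_one, Fin.sum_univ_two]; rfl
    have h2 : esymm (Fin 2) k 2 = e2 k := by
      have h : Finset.powersetCard 2 (Finset.univ : Finset (Fin 2)) = {Finset.univ} :=
        Finset.powersetCard_self _
      rw [esymm, h, Finset.sum_singleton, Fin.prod_univ_two]; rfl
    have h : ∀ i : Fin 2, indRgt M (esymm (Fin 2) k (i + 1)) =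
        diagRgt M (esymm (Fin 2) k (i + 1)) := by
      rw [Fin.forall_fin_two]
      change indRgt M (esymm (Fin 2) k 1) = diagRgt M (esymm (Fin 2) k 1) ∧
        indRgt M (esymm (Fin 2) k 2) = diagRgt M (esymm (Fin 2) k 2)
      rw [h1, h2]
      constructor <;> refine LinearMap.ext fun v => ?_
      · rw [map_e1 (indRgt M), indRgt_X0, indRgt_X1, LinearMap.add_apply, indY_apply, indZ_apply]
        refine Prod.ext ?_ ?_
        · change -M.rgt (e2 k) v.2 + (M.rgt (e1 k) v.1 + M.rgt (e2 k) v.2) = M.rgt (e1 k) v.1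
          abel
        · change v.1 + M.rgt (e1 k) v.2 + -v.1 = M.rgt (e1 k) v.2
          abel
      · rw [map_e2 (indRgt M), indRgt_X0, indRgt_X1, Module.End.mul_apply, indY_indZ]
        rfl
    have := h i
    simpa [MvPolynomial.esymmAlgHom_apply] using this
  have h1 := DFunLike.congr_fun key P
  have h2 : (symmetricSubalgebra (Fin 2) k).val (MvPolynomial.esymmAlgHom (Fin 2) k 2 P) = a := by
    rw [hP]; rfl
  simp only [AlgHom.comp_apply, h2] at h1
  exact LinearMap.congr_fun h1 v

/-- The class of `f ⊗ g` in `B`. -/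
noncomputable abbrev bmk (f g : Pol k) : (B k).carrier :=
  Submodule.Quotient.mk (p := tensorRel (symmetricSubalgebra (Fin 2) k) (reg k) (reg k))
    (TensorProduct.tmul k f g)

/-- The bilinear map `(f, g) ↦ (m ↦ (m f ⊗ 1) g)`. -/
noncomputable def bActPre : Pol k →ₗ[k] Pol k →ₗ[k] (M.carrier →ₗ[k] M.carrier × M.carrier) :=
  LinearMap.mk₂ k (fun f g => indRgt M g ∘ₗ LinearMap.inl k _ _ ∘ₗ M.rgt f)
    (fun f f' g => by rw [map_add, LinearMap.comp_add, LinearMap.comp_add])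
    (fun c f g => by rw [map_smul, LinearMap.comp_smul, LinearMap.comp_smul])
    (fun f g g' => LinearMap.ext fun m => by simp)
    (fun c f g => LinearMap.ext fun m => by simp)

/-- The action `m ↦ m ⊗ b` of an element `b` of `B`, valued in `M ⊗_R B = M ⊕ M y_1`. -/
noncomputable def bAct : (B k).carrier →ₗ[k] (M.carrier →ₗ[k] M.carrier × M.carrier) :=
  Submodule.liftQ (tensorRel (symmetricSubalgebra (Fin 2) k) (reg k) (reg k))
    (TensorProduct.lift (bActPre M)) <| Submodule.span_le.mpr <| by
      rintro z ⟨f, g, a, ha, rfl⟩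
      have key : ∀ f g : Pol k, TensorProduct.lift (bActPre M) (TensorProduct.tmul k (a * f) g -
          TensorProduct.tmul k f (a * g)) = 0 := fun f g => by
        rw [map_sub, sub_eq_zero]
        refine LinearMap.ext fun m => ?_
        change indRgt M g (M.rgt (a * f) m, 0) = indRgt M (a * g) (M.rgt f m, 0)
        rw [mul_comm a g, map_mul (indRgt M), Module.End.mul_apply, indRgt_symm M ha, map_mul]
        simp
      exact key f g

lemma bAct_mk (f g : Pol k) (m : M.carrier) :
    bAct M (bmk f g) m = indRgt M g (M.rgt f m, 0) := rfl

lemma bmk_induction {P : (B k).carrier → Prop} (h0 : ∀ f g, P (bmk f g))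
    (hadd : ∀ x y, P x → P y → P (x + y)) (b : (B k).carrier) : P b :=
  tensor_induction (A := symmetricSubalgebra (Fin 2) k) (M := reg k) (N := reg k)
    (P := P) h0 hadd b

lemma bAct_lft (a : Pol k) (b : (B k).carrier) (m : M.carrier) :
    bAct M b (M.lft a m) = (Ind M).lft a (bAct M b m) := by
  induction b using bmk_induction with
  | h0 f g =>
    rw [bAct_mk, bAct_mk, (Ind M).lft_rgt, Ind_lft, ← M.lft_rgt, map_zero]
  | hadd x y hx hy => rw [map_add, LinearMap.add_apply, LinearMap.add_apply, hx, hy, map_add]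

lemma bAct_rgt_left (a : Pol k) (b : (B k).carrier) (m : M.carrier) :
    bAct M b (M.rgt a m) = bAct M ((B k).lft a b) m := by
  induction b using bmk_induction with
  | h0 f g =>
    change indRgt M g (M.rgt f (M.rgt a m), 0) = indRgt M g (M.rgt (a * f) m, 0)
    rw [mul_comm a f, map_mul, Module.End.mul_apply]
  | hadd x y hx hy => rw [map_add, map_add, map_add, LinearMap.add_apply, LinearMap.add_apply, hx, hy]

lemma bAct_rgt (a : Pol k) (b : (B k).carrier) (m : M.carrier) :
    bAct M ((B k).rgt a b) m = indRgt M a (bAct M b m) := by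
  induction b using bmk_induction with
  | h0 f g =>
    change indRgt M (a * g) (M.rgt f m, 0) = indRgt M a (indRgt M g (M.rgt f m, 0))
    rw [map_mul, Module.End.mul_apply]
  | hadd x y hx hy =>
    rw [map_add, map_add, map_add, LinearMap.add_apply, LinearMap.add_apply, hx, hy, map_add]

lemma bAct_dq (b : (B k).carrier) (m : M.carrier) :
    bAct M b (M.dq m) + bAct M ((B k).dq b) m = indDq M (bAct M b m) := by
  induction b using bmk_induction with
  | h0 f g =>
    have h : bAct M ((B k).dq (bmk f g)) m = indRgt M g (M.rgt (polDer k f) m, 0) +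
        indRgt M (polDer k g) (M.rgt f m, 0) := by
      change bAct M (bmk (polDer k f) g + bmk f (polDer k g)) m = _
      rw [map_add]; rfl
    rw [h, bAct_mk, bAct_mk]
    refine Eq.trans ?_ ((Ind M).dq_rgt g (M.rgt f m, 0)).symm
    have h2 : (Ind M).dq (M.rgt f m, 0) = (M.rgt (polDer k f) m, 0) + (M.rgt f (M.dq m), 0) := by
      simp [indDq_apply, M.dq_rgt]
    rw [h2, map_add]
    abel
  | hadd x y hx hy =>
    rw [map_add, map_add, map_add, LinearMap.add_apply, LinearMap.add_apply, LinearMap.add_apply,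
      map_add, ← hx, ← hy]
    abel

lemma bAct_dt (b : (B k).carrier) (m : M.carrier) :
    bAct M b (M.dt m) = (Ind M).dt (bAct M b m) := by
  induction b using bmk_induction with
  | h0 f g =>
    rw [bAct_mk, bAct_mk]
    refine Eq.trans ?_ ((Ind M).dt_rgt g (M.rgt f m, 0)).symm
    simp [M.dt_rgt]
  | hadd x y hx hy => rw [map_add, LinearMap.add_apply, LinearMap.add_apply, map_add, hx, hy]

lemma indMul_bAct (b : (B k).carrier) (m : M.carrier) :
    indMul M (bAct M b m) = M.rgt (br k b) m := by
  induction b using bmk_induction with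
  | h0 f g =>
    refine ((isBi_indMul M).rgt_all g (M.rgt f m, 0)).trans ?_
    change M.rgt g (indMul M (M.rgt f m, 0)) = M.rgt (f * g) m
    rw [indMul_apply, map_zero, add_zero, mul_comm, map_mul, Module.End.mul_apply]
  | hadd x y hx hy =>
    rw [map_add, LinearMap.add_apply, map_add, hx, hy, map_add]
    exact (LinearMap.congr_fun (map_add M.rgt (br k x) (br k y)) m).symm

lemma mem_of_weightedHomogeneous {T : Type*} [AddCommGroup T] [Module k T] {gr : ℤ → Submodule k T}
    {ρ : Pol k →ₐ[k] Module.End k T} (hM : ∀ i e, ∀ m ∈ gr e, ρ (X i) m ∈ gr (e + 2)) {a : Pol k} {d : ℤ}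
    (ha : a ∈ polGr(k) d) {e : ℤ}
    {m : T} (hm : m ∈ gr e) : ρ a m ∈ gr (e + d) := by
  have hpow : ∀ (i : Fin 2) (n : ℕ) (e : ℤ) (m : T), m ∈ gr e →
      ρ (X i ^ n) m ∈ gr (e + 2 * n) := by
    intro i n
    induction n with
    | zero => intro e m hm; simpa using hm
    | succ n ih =>
      intro e m hm
      rw [pow_succ, map_mul, Module.End.mul_apply]
      have := ih _ _ (hM i e m hm)
      rwa [show e + 2 + 2 * (n : ℤ) = e + 2 * ((n + 1 : ℕ) : ℤ) by push_cast; ring] at this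
  rw [MvPolynomial.as_sum a, map_sum, LinearMap.sum_apply]
  refine sum_mem fun s hs => ?_
  have hd : 2 * (s 0 : ℤ) + 2 * (s 1 : ℤ) = d := by
    have := ha (MvPolynomial.mem_support_iff.mp hs)
    rw [← this, Finsupp.weight_apply, Finsupp.sum_fintype _ _ (fun _ => by simp), Fin.sum_univ_two]
    simp [mul_comm]
  rw [MvPolynomial.monomial_eq, Finsupp.prod_fintype _ _ (fun _ => pow_zero _), Fin.prod_univ_two,
    ← MvPolynomial.algebraMap_eq, map_mul, AlgHom.commutes, map_mul, Module.End.mul_apply,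
    Module.End.mul_apply, Module.algebraMap_end_apply]
  refine Submodule.smul_mem _ _ ?_
  have := hpow 0 (s 0) _ _ (hpow 1 (s 1) e m hm)
  rwa [show e + 2 * ((s 1 : ℕ) : ℤ) + 2 * ((s 0 : ℕ) : ℤ) = e + d by rw [← hd]; ring] at this

end Model

section ModelIso

variable (p : ℕ) (M : HqBimod k)

/-- The space underlying `pT`. -/
abbrev PTc (k : Type u) [Field k] (p : ℕ) : Type u := (B k).carrier × (Fin (p - 1) → Pol k)

/-- The class of `m ⊗ n` in `M ⊗_R pT`, as a bilinear map. -/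
noncomputable def tmk : M.carrier →ₗ[k] PTc k p →ₗ[k] (tensorR M (pT k p)).carrier :=
  (TensorProduct.mk k M.carrier (pT k p).carrier).compr₂ (tensorRel ⊤ M (pT k p)).mkQ

lemma tmk_induction {P : (tensorR M (pT k p)).carrier → Prop} (h0 : ∀ m n, P (tmk p M m n))
    (hadd : ∀ x y, P x → P y → P (x + y)) (b : (tensorR M (pT k p)).carrier) : P b :=
  tensor_induction (A := ⊤) (M := M) (N := pT k p) (P := P) h0 hadd b

/-- Elements of `R` slide through the tensor sign. -/
lemma tmk_slide (a : Pol k) (m : M.carrier) (n : PTc k p) :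
    tmk p M (M.rgt a m) n = tmk p M m ((B k).lft a n.1, fun j => a * n.2 j) := by
  refine sub_eq_zero.mp ?_
  exact (Submodule.Quotient.mk_eq_zero _).mpr (mem_tensorRel (N := pT k p) m n Algebra.mem_top)

/-- The bilinear map `M × pT → M ⊗_R pT = T(M)`. -/
noncomputable def modelPre : M.carrier →ₗ[k] (PTc k p) →ₗ[k]
    (M.carrier × M.carrier) × (Fin (p - 1) → M.carrier) :=
  LinearMap.flip <| LinearMap.mk₂ k (fun n m => (bAct M n.1 m, fun j => M.rgt (n.2 j) m))
    (fun n n' m => Prod.ext (by simp) (funext fun j => by simp))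
    (fun c n m => Prod.ext (by simp) (funext fun j => by simp))
    (fun n m m' => Prod.ext (by simp) (funext fun j => by simp))
    (fun c n m => Prod.ext (by simp) (funext fun j => by simp))

/-- The map `M ⊗_R pT → T(M)`. -/
noncomputable def model : (tensorR M (pT k p)).carrier →ₗ[k] (TwistB p M).carrier :=
  Submodule.liftQ (tensorRel ⊤ M (pT k p)) (TensorProduct.lift (modelPre p M)) <|
    Submodule.span_le.mpr <| by
      rintro z ⟨m, n, a, -, rfl⟩
      have key : ∀ (n : PTc k p),
          modelPre p M (M.rgt a m) n = modelPre p M m ((B k).lft a n.1, fun j => a * n.2 j) := fun n => by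
        refine Prod.ext (bAct_rgt_left M a n.1 m) (funext fun j => ?_)
        change M.rgt (n.2 j) (M.rgt a m) = M.rgt (a * n.2 j) m
        rw [mul_comm, map_mul, Module.End.mul_apply]
      refine (map_sub (TensorProduct.lift (modelPre p M)) _ _).trans (sub_eq_zero.mpr (key n))

/-- The inverse map `T(M) → M ⊗_R pT`. -/
noncomputable def modelInv : (TwistB p M).carrier →ₗ[k] (tensorR M (pT k p)).carrier :=
  ((tmk p M).flip ((bmk 1 1, 0) : PTc k p) ∘ₗ fst k _ _ +
    (tmk p M).flip ((bmk 1 (X 0), 0) : PTc k p) ∘ₗ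
      snd k _ _) ∘ₗ fst k _ _ +
  ∑ j : Fin (p - 1), (tmk p M).flip ((0, Pi.single j 1) : PTc k p) ∘ₗ
    proj j ∘ₗ snd k _ _

/-- The part of `modelInv` on `M ⊗_R B`. -/
noncomputable def modelInvB : M.carrier × M.carrier →ₗ[k] (tensorR M (pT k p)).carrier :=
  (tmk p M).flip ((bmk 1 1, 0) : PTc k p) ∘ₗ fst k _ _ +
    (tmk p M).flip ((bmk 1 (X 0), 0) : PTc k p) ∘ₗ snd k _ _

lemma modelInvB_apply (v : M.carrier × M.carrier) : modelInvB p M v =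
    tmk p M v.1 ((bmk 1 1, 0) : PTc k p) +
    tmk p M v.2 ((bmk 1 (X 0), 0) : PTc k p) := rfl

lemma modelInv_apply (z : (M.carrier × M.carrier) × (Fin (p - 1) → M.carrier)) :
    modelInv p M z = modelInvB p M z.1 + ∑ j : Fin (p - 1),
      tmk p M (z.2 j) ((0, Pi.single j 1) : PTc k p) := by
  change modelInvB p M z.1 + (∑ j : Fin (p - 1), (tmk p M).flip
    ((0, Pi.single j 1) : PTc k p) ∘ₗ
    proj j ∘ₗ snd k (M.carrier × M.carrier) _) z = _
  rw [LinearMap.sum_apply]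
  rfl

lemma model_modelInv (z : (M.carrier × M.carrier) × (Fin (p - 1) → M.carrier)) :
    model p M (modelInv p M z) = z := by
  rw [modelInv_apply, modelInvB_apply, map_add, map_add, map_sum]
  change (bAct M (bmk 1 1) z.1.1, fun j => M.rgt ((0 : Fin (p - 1) → Pol k) j) z.1.1) +
    (bAct M (bmk 1 (X 0)) z.1.2, fun j => M.rgt ((0 : Fin (p - 1) → Pol k) j) z.1.2) +
    ∑ l, (bAct M 0 (z.2 l), fun j => M.rgt ((Pi.single l 1 : Fin (p - 1) → Pol k) j) (z.2 l)) = z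
  have h1 : bAct M (bmk 1 1) z.1.1 = (z.1.1, 0) := by simp [bAct_mk]
  have h2 : bAct M (bmk 1 (X 0)) z.1.2 = (0, z.1.2) := by
    rw [bAct_mk, indRgt_X0]; simp [indY_apply]
  rw [h1, h2]
  refine Prod.ext ?_ (funext fun l => ?_)
  · simp [Prod.fst_sum]
  · simp only [Prod.snd_add, Prod.snd_sum, Pi.add_apply, Finset.sum_apply, Pi.zero_apply, map_zero,
      LinearMap.zero_apply, zero_add]
    rw [Finset.sum_eq_single_of_mem l (Finset.mem_univ l)]
    · simp
    · intro j _ hj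
      simp [Pi.single_apply, Ne.symm hj]

/-- Symmetric polynomials move from the right factor of `B` to `M`. -/
lemma tmk_symm {a : Pol k} (ha : a ∈ symmetricSubalgebra (Fin 2) k) (g : Pol k)
    (m : M.carrier) : tmk p M (M.rgt a m) ((bmk 1 g, 0) : PTc k p) =
      tmk p M m ((bmk 1 (a * g), 0) : PTc k p) := by
  rw [tmk_slide]
  refine congrArg (tmk p M m) (Prod.ext ?_ (funext fun j => mul_zero a))
  refine sub_eq_zero.mp ((Submodule.Quotient.mk_eq_zero _).mpr ?_)
  exact mem_tensorRel (M := reg k) (N := reg k) (1 : Pol k) g ha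

lemma e1_mem : e1 k ∈ symmetricSubalgebra (Fin 2) k := by
  intro s
  rw [e1, map_add, MvPolynomial.rename_X, MvPolynomial.rename_X]
  have := Equiv.sum_comp s (fun i : Fin 2 => (X i : Pol k))
  rwa [Fin.sum_univ_two, Fin.sum_univ_two] at this

lemma e2_mem : e2 k ∈ symmetricSubalgebra (Fin 2) k := by
  intro s
  rw [e2, map_mul, MvPolynomial.rename_X, MvPolynomial.rename_X]
  have := Equiv.prod_comp s (fun i : Fin 2 => (X i : Pol k))
  rwa [Fin.prod_univ_two, Fin.prod_univ_two] at this

lemma bmk_add (f g g' : Pol k) : bmk f (g + g') = bmk f g + bmk f g' := by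
  have : bmk f (g + g') = Submodule.Quotient.mk
      (p := tensorRel (symmetricSubalgebra (Fin 2) k) (reg k) (reg k))
      (TensorProduct.tmul k f g + TensorProduct.tmul k f g') :=
    congrArg (Submodule.Quotient.mk
      (p := tensorRel (symmetricSubalgebra (Fin 2) k) (reg k) (reg k)))
      (TensorProduct.tmul_add (R := k) f g g')
  exact this

lemma tmk_bmk_add (m : M.carrier) (g g' : Pol k) :
    tmk p M m ((bmk 1 (g + g'), 0) : PTc k p) =
      tmk p M m ((bmk 1 g, 0) : PTc k p) +
      tmk p M m ((bmk 1 g', 0) : PTc k p) := by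
  refine Eq.trans (congrArg (tmk p M m) (?_ : _ = ((bmk 1 g, 0) : PTc k p) +
    ((bmk 1 g', 0) : PTc k p))) (map_add (tmk p M m) _ _)
  exact Prod.ext (bmk_add 1 g g') (add_zero _).symm

lemma tmk_rgt (a : Pol k) (m : M.carrier) (n : PTc k p) :
    (tensorR M (pT k p)).rgt a (tmk p M m n) = tmk p M m ((B k).rgt a n.1, fun j => a * n.2 j) := rfl

lemma tmk_rgt_bmk (a : Pol k) (m : M.carrier) (g : Pol k) :
    (tensorR M (pT k p)).rgt a (tmk p M m ((bmk 1 g, 0) : PTc k p)) =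
      tmk p M m ((bmk 1 (a * g), 0) : PTc k p) := by
  rw [tmk_rgt]
  exact congrArg (tmk p M m) (Prod.ext rfl (funext fun j => mul_zero a))

lemma modelInvB_indRgt (a : Pol k) (v : M.carrier × M.carrier) :
    modelInvB p M (indRgt M a v) = (tensorR M (pT k p)).rgt a (modelInvB p M v) := by
  refine comm_of_X (ρ := indRgt M) (σ := (tensorR M (pT k p)).rgt) (f := modelInvB p M) (fun i => ?_) a v
  revert i
  rw [Fin.forall_fin_two, indRgt_X0, indRgt_X1]
  constructor <;> intro v
  · rw [modelInvB_apply, modelInvB_apply, map_add, tmk_rgt_bmk, tmk_rgt_bmk, indY_apply]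
    dsimp only
    rw [map_neg, map_add, LinearMap.neg_apply, LinearMap.add_apply, tmk_symm p M e1_mem,
      tmk_symm p M e2_mem, show e1 k * X 0 = X 0 * X 0 + e2 k * 1 by rw [e1, e2]; ring, tmk_bmk_add,
      mul_one (e2 k), mul_one (X 0 : Pol k)]
    abel
  · rw [modelInvB_apply, modelInvB_apply, map_add, tmk_rgt_bmk, tmk_rgt_bmk, indZ_apply]
    dsimp only
    rw [map_neg, map_add, LinearMap.neg_apply, LinearMap.add_apply, tmk_symm p M e1_mem,
      tmk_symm p M e2_mem, show e1 k * 1 = X 0 + X 1 * 1 by rw [e1]; ring, tmk_bmk_add,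
      show e2 k * 1 = X 1 * X 0 by rw [e2]; ring]
    abel

lemma modelInv_model (z : (tensorR M (pT k p)).carrier) : modelInv p M (model p M z) = z := by
  induction z using tmk_induction with
  | h0 m n =>
    have key : ∀ n : PTc k p,
        modelInv p M (bAct M n.1 m, fun j => M.rgt (n.2 j) m) = tmk p M m n := fun n => by
      have hB : ∀ b : (B k).carrier, modelInvB p M (bAct M b m) =
          tmk p M m ((b, 0) : PTc k p) := fun b => by
        induction b using bmk_induction with
        | h0 f g =>
          have h1 : modelInvB p M (M.rgt f m, 0) =
              tmk p M m ((bmk f 1, 0) : PTc k p) := by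
            rw [modelInvB_apply]
            dsimp only
            rw [map_zero, LinearMap.zero_apply, add_zero, tmk_slide]
            refine congrArg (tmk p M m) (Prod.ext ?_ (funext fun j => mul_zero f))
            change bmk (f * 1) 1 = bmk f 1
            rw [mul_one]
          rw [bAct_mk, modelInvB_indRgt, h1, tmk_rgt]
          refine congrArg (tmk p M m) (Prod.ext ?_ (funext fun j => mul_zero g))
          change bmk f (g * 1) = bmk f g
          rw [mul_one]
        | hadd x y hx hy =>
          rw [map_add, LinearMap.add_apply, map_add, hx, hy]
          refine (map_add (tmk p M m) _ _).symm.trans (congrArg (tmk p M m) ?_)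
          exact Prod.ext rfl (add_zero (0 : Fin (p - 1) → Pol k))
      rw [modelInv_apply]
      dsimp only
      rw [hB]
      have hS : ∀ j, tmk p M (M.rgt (n.2 j) m) ((0, Pi.single j 1) : PTc k p) =
          tmk p M m ((0, Pi.single j (n.2 j)) : PTc k p) := fun j => by
        rw [tmk_slide]
        refine congrArg (tmk p M m) (Prod.ext (map_zero _) (funext fun l => ?_))
        change n.2 j * (Pi.single j 1 : Fin (p - 1) → Pol k) l = (Pi.single j (n.2 j) : Fin (p - 1) → Pol k) l
        rw [Pi.single_apply, Pi.single_apply]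
        split_ifs <;> simp
      rw [Finset.sum_congr rfl fun j _ => hS j]
      refine (congrArg _ (map_sum (tmk p M m) (fun j => ((0, Pi.single j (n.2 j)) :
        PTc k p)) univ).symm).trans ?_
      refine (map_add (tmk p M m) _ _).symm.trans (congrArg (tmk p M m) ?_)
      have : ((n.1, 0) : PTc k p) + ∑ j, ((0, Pi.single j (n.2 j)) :
          PTc k p) = n := by
        refine Prod.ext ?_ ?_
        · simp [Prod.fst_sum]
        · rw [Prod.snd_add, Prod.snd_sum, zero_add]
          exact Finset.univ_sum_single n.2
      exact this
    exact key n
  | hadd x y hx hy => rw [map_add, map_add, hx, hy]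

end ModelIso

section ModelEquiv

variable {p : ℕ} {M : HqBimod k}

lemma bmk_mem {f g : Pol k} {d e : ℤ}
    (hf : f ∈ polGr(k) d)
    (hg : g ∈ polGr(k) e) :
    bmk f g ∈ (B k).gr (d + e) := by
  refine ⟨TensorProduct.tmul k f g, Submodule.mem_iSup_of_mem d ?_, rfl⟩
  refine Submodule.apply_mem_map₂ _ hf ?_
  rw [add_sub_cancel_left]
  exact hg

lemma tmk_mem {m : M.carrier} {n : PTc k p} {d e : ℤ} (hm : m ∈ M.gr d) (hn : n ∈ (pT k p).gr e) :
    tmk p M m n ∈ (tensorR M (pT k p)).gr (d + e) := by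
  refine ⟨TensorProduct.tmul k m n, Submodule.mem_iSup_of_mem d ?_, rfl⟩
  refine Submodule.apply_mem_map₂ (TensorProduct.mk k M.carrier (pT k p).carrier) hm ?_
  rw [add_sub_cancel_left]
  exact hn

lemma bAct_mem [Fact p.Prime] [CharP k p] (hM : Good p M) {b : (B k).carrier} {m : M.carrier} {d e : ℤ}
    (hb : b ∈ (B k).gr d) (hm : m ∈ M.gr e) : bAct M b m ∈ (Ind M).gr (e + d) := by
  have key : (B k).gr d ≤ ((Ind M).gr (e + d)).comap ((bAct M).flip m) := by
    refine Submodule.map_le_iff_le_comap.mpr (iSup_le fun i => Submodule.map₂_le.mpr ?_)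
    intro f hf g hg
    change indRgt M g (M.rgt f m, 0) ∈ (Ind M).gr (e + d)
    have h1 := mem_of_weightedHomogeneous (gr := M.gr) (ρ := M.rgt) hM.rgt_mem hf hm
    have h2 : ((M.rgt f m, 0) : M.carrier × M.carrier) ∈ (Ind M).gr (e + i) := ⟨h1, zero_mem _⟩
    have := mem_of_weightedHomogeneous (gr := (Ind M).gr) (ρ := (Ind M).rgt) hM.ind.rgt_mem hg h2
    rwa [show e + i + (d - i) = e + d by ring] at this
  exact key hb

lemma model_mem [Fact p.Prime] [CharP k p] (hM : Good p M) {e : ℤ} {z : (tensorR M (pT k p)).carrier}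
    (hz : z ∈ (tensorR M (pT k p)).gr e) : model p M z ∈ (TwistB p M).gr e := by
  have key : (tensorR M (pT k p)).gr e ≤ ((TwistB p M).gr e).comap (model p M) := by
    refine Submodule.map_le_iff_le_comap.mpr (iSup_le fun i => Submodule.map₂_le.mpr ?_)
    intro m hm n hn
    have hn1 : n.1 ∈ (B k).gr (e - i + 3) := hn.1
    have hn2 : ∀ j : Fin (p - 1), n.2 j ∈ polGr(k) (e - i + 3 - 2 * (((j : ℕ) : ℤ) + 1)) := fun j => hn.2 j trivial
    refine ⟨?_, fun j _ => ?_⟩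
    · have := bAct_mem hM hn1 hm
      rw [show i + (e - i + 3) = e + 3 by ring] at this
      exact this
    · have := mem_of_weightedHomogeneous (gr := M.gr) (ρ := M.rgt) hM.rgt_mem (hn2 j) hm
      rw [show i + (e - i + 3 - 2 * (((j : ℕ) : ℤ) + 1)) = e + 3 - 2 - 2 * ((j : ℕ) : ℤ) by ring] at this
      exact this
  exact key hz

lemma modelInv_mem {e : ℤ} {z : (TwistB p M).carrier} (hz : z ∈ (TwistB p M).gr e) :
    modelInv p M z ∈ (tensorR M (pT k p)).gr e := by
  have h0 : (1 : Pol k) ∈ polGr(k) 0 :=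
    MvPolynomial.isWeightedHomogeneous_one _ _
  have h1 : (X 0 : Pol k) ∈ polGr(k) 2 :=
    MvPolynomial.isWeightedHomogeneous_X _ _ _
  rw [modelInv_apply, modelInvB_apply]
  refine add_mem (add_mem ?_ ?_) (sum_mem fun j _ => ?_)
  · have hv : z.1.1 ∈ M.gr (e + 3) := hz.1.1
    have := tmk_mem (p := p) (n := (bmk 1 1, 0)) (e := -3) hv
      ⟨by have := bmk_mem h0 h0; exact this, zero_mem _⟩
    rwa [add_neg_cancel_right] at this
  · have hv : z.1.2 ∈ M.gr (e + 3 - 2) := hz.1.2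
    have := tmk_mem (p := p) (n := (bmk 1 (X 0), 0)) (e := -1) hv
      ⟨by have := bmk_mem h0 h1; exact this, zero_mem _⟩
    rwa [show e + 3 - 2 + -1 = e by ring] at this
  · have hv : z.2 j ∈ M.gr (e + 3 - 2 - 2 * ((j : ℕ) : ℤ)) := hz.2 j trivial
    have := tmk_mem (p := p) (n := (0, Pi.single j 1)) (e := -1 + 2 * ((j : ℕ) : ℤ)) hv
      ⟨zero_mem _, fun l _ => ?_⟩
    · rwa [show e + 3 - 2 - 2 * ((j : ℕ) : ℤ) + (-1 + 2 * ((j : ℕ) : ℤ)) = e by ring] at this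
    · change (Pi.single j 1 : Fin (p - 1) → Pol k) l ∈ polGr(k) (-1 + 2 * ((j : ℕ) : ℤ) + 3 - 2 * (((l : ℕ) : ℤ) + 1))
      rw [Pi.single_apply]
      split_ifs with h
      · subst h
        rw [show -1 + 2 * ((l : ℕ) : ℤ) + 3 - 2 * (((l : ℕ) : ℤ) + 1) = 0 by ring]
        exact h0
      · exact zero_mem _

lemma model_comm {f : (tensorR M (pT k p)).carrier →ₗ[k] (tensorR M (pT k p)).carrier}
    {g : (TwistB p M).carrier →ₗ[k] (TwistB p M).carrier}
    (h : ∀ m n, model p M (f (tmk p M m n)) = g (model p M (tmk p M m n)))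
    (z : (tensorR M (pT k p)).carrier) : model p M (f z) = g (model p M z) := by
  induction z using tmk_induction with
  | h0 m n => exact h m n
  | hadd x y hx hy => rw [map_add, map_add, map_add, map_add, hx, hy]

lemma pT_dt_zero (n : PTc k p) {j : Fin (p - 1)} (h : (j : ℕ) = 0) :
    ((pT k p).dt n).2 j = br k n.1 := by
  change (if h : (j : ℕ) = 0 then br k ∘ₗ fst k _ _
    else proj (⟨(j : ℕ) - 1, by omega⟩ : Fin (p - 1)) ∘ₗ
      snd k (B k).carrier (Fin (p - 1) → (reg k).carrier)) n = _
  split_ifs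
  rfl

lemma pT_dt_succ (n : PTc k p) {j : Fin (p - 1)} (h : ¬ (j : ℕ) = 0) :
    ((pT k p).dt n).2 j = n.2 ⟨(j : ℕ) - 1, by omega⟩ := by
  change (if h : (j : ℕ) = 0 then br k ∘ₗ fst k _ _
    else proj (⟨(j : ℕ) - 1, by omega⟩ : Fin (p - 1)) ∘ₗ
      snd k (B k).carrier (Fin (p - 1) → (reg k).carrier)) n = _
  split_ifs
  rfl

/-- `M ⊗_R pT` is isomorphic to its explicit model. -/
noncomputable def modelEquiv [Fact p.Prime] [CharP k p] (hM : Good p M) :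
    BiEquiv (tensorR M (pT k p)) (TwistB p M) where
  e := { model p M with
    invFun := modelInv p M
    left_inv := modelInv_model p M
    right_inv := model_modelInv p M }
  isBi := by
    refine ⟨fun i z => model_comm (f := (tensorR M (pT k p)).lft (X i)) (g := (TwistB p M).lft (X i))
      (fun m n => ?_) z, fun i z => model_comm (f := (tensorR M (pT k p)).rgt (X i))
      (g := (TwistB p M).rgt (X i)) (fun m n => ?_) z⟩
    · exact Prod.ext (bAct_lft M (X i) n.1 m) (funext fun j => (M.lft_rgt (X i) (n.2 j) m).symm)
    · refine Prod.ext (bAct_rgt M (X i) n.1 m) (funext fun j => ?_)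
      change M.rgt (X i * n.2 j) m = M.rgt (X i) (M.rgt (n.2 j) m)
      rw [map_mul, Module.End.mul_apply]
  dq z := model_comm (f := (tensorR M (pT k p)).dq) (g := (TwistB p M).dq) (fun m n => by
    refine Prod.ext (bAct_dq M n.1 m) (funext fun j => ?_)
    change M.rgt (n.2 j) (M.dq m) + M.rgt (polDer k (n.2 j)) m = M.dq (M.rgt (n.2 j) m)
    rw [M.dq_rgt, add_comm]) z
  dt z := model_comm (f := (tensorR M (pT k p)).dt) (g := (TwistB p M).dt) (fun m n => by
    refine Prod.ext ?_ (funext fun j => ?_)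
    · change bAct M n.1 (M.dt m) + bAct M 0 m = _
      rw [map_zero, LinearMap.zero_apply, add_zero]
      exact bAct_dt M n.1 m
    · refine Eq.trans ?_ (TwistB_dt_snd M _ j).symm
      change M.rgt (n.2 j) (M.dt m) + M.rgt (((pT k p).dt n).2 j) m =
        ((if h : (j : ℕ) = 0 then 0 else M.rgt (n.2 ⟨(j : ℕ) - 1, by omega⟩) m) + M.dt (M.rgt (n.2 j) m)) +
        if (j : ℕ) = 0 then indMul M (bAct M n.1 m) else 0
      by_cases h : (j : ℕ) = 0
      · refine (congrArg (fun a => M.rgt (n.2 j) (M.dt m) + M.rgt a m) (pT_dt_zero n h)).trans ?_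
        rw [dif_pos h, if_pos h, M.dt_rgt, indMul_bAct, zero_add]
      · refine (congrArg (fun a => M.rgt (n.2 j) (M.dt m) + M.rgt a m) (pT_dt_succ n h)).trans ?_
        rw [dif_neg h, if_neg h, M.dt_rgt, add_zero, add_comm]) z
  gr d z := ⟨fun hz => model_mem hM hz, fun hz => by
    have := modelInv_mem (M := M) hz
    exact (congrArg (· ∈ (tensorR M (pT k p)).gr d) (modelInv_model p M z)).mp this⟩

/-- An explicit model of the complex of bimodules of the braid `σ_1^n`. -/
noncomputable def Mn (k : Type u) [Field k] (p : ℕ) : ℕ → HqBimod k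
  | 0 => reg k
  | n + 1 => TwistB p (Mn k p n)

lemma pow_char_mul_comm {E : Type*} [Ring E] [Fact p.Prime] [CharP E p] {D L : E}
    (h : D * L = L * D + L ^ 2) : D ^ p * L = L * D ^ p := by
  have h2 : D * L = L * (D + L) := by rw [h, mul_add, pow_two]
  have h3 : ∀ n, D ^ n * L = L * (D + L) ^ n := by
    intro n
    induction n with
    | zero => simp
    | succ n ih => rw [pow_succ, mul_assoc, h2, ← mul_assoc, ih, mul_assoc, ← pow_succ]
  rw [h3, add_pow_char_of_commutator p h]

lemma pow_char_mul_X_comm [Fact p.Prime] [CharP k p] {D : Module.End k (Pol k)}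
    (hD : ∀ f, D f = polDer k f) (i : Fin 2) (f : Pol k) : (D ^ p) (X i * f) = X i * (D ^ p) f := by
  have : CharP (Module.End k (Pol k)) p :=
    charP_of_injective_algebraMap (algebraMap k _).injective p
  have h : D * LinearMap.mulLeft k (X i) = LinearMap.mulLeft k (X i) * D +
      LinearMap.mulLeft k (X i) ^ 2 := by
    refine LinearMap.ext fun f => ?_
    rw [pow_two, LinearMap.add_apply, Module.End.mul_apply, Module.End.mul_apply, Module.End.mul_apply,
      LinearMap.mulLeft_apply, LinearMap.mulLeft_apply, LinearMap.mulLeft_apply, hD, hD,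
      Derivation.leibniz, polDer_X, smul_eq_mul, smul_eq_mul]
    ring
  have := LinearMap.congr_fun (pow_char_mul_comm h) f
  rwa [Module.End.mul_apply, Module.End.mul_apply, LinearMap.mulLeft_apply, LinearMap.mulLeft_apply] at this

lemma pow_char_eq_zero [Fact p.Prime] [CharP k p] {D : Module.End k (Pol k)}
    (hD : ∀ f, D f = polDer k f) : D ^ p = 0 := by
  refine LinearMap.ext fun f => ?_
  have h := comm_of_X (ρ := Algebra.lmul k (Pol k)) (σ := Algebra.lmul k (Pol k))
    (f := D ^ p) (fun i f => pow_char_mul_X_comm hD i f) f 1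
  have h1 : (D ^ p) 1 = 0 := by
    obtain ⟨q, hq⟩ := Nat.exists_eq_succ_of_ne_zero (Fact.out : p.Prime).ne_zero
    rw [hq, pow_succ, Module.End.mul_apply, hD, Derivation.map_one_eq_zero, map_zero]
  rw [h1, map_zero] at h
  simpa using h

lemma polDer_pow [Fact p.Prime] [CharP k p] : (polDer k : Pol k →ₗ[k] Pol k) ^ p = 0 :=
  pow_char_eq_zero fun _ => rfl

lemma polDer_apply (f : Pol k) : polDer k f =
    X 0 ^ 2 * MvPolynomial.pderiv 0 f + X 1 ^ 2 * MvPolynomial.pderiv 1 f := by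
  have : polDer k = (X 0 ^ 2 : Pol k) • MvPolynomial.pderiv 0 + (X 1 ^ 2 : Pol k) • MvPolynomial.pderiv 1 := by
    refine MvPolynomial.derivation_ext fun i => ?_
    revert i
    rw [Fin.forall_fin_two]
    constructor <;> simp [polDer_X, MvPolynomial.pderiv_X, Pi.single_apply]
  rw [this]
  rfl

lemma polDer_mem {f : Pol k} {d : ℤ}
    (hf : f ∈ polGr(k) d) :
    polDer k f ∈ polGr(k) (d + 2) := by
  have h (i : Fin 2) : X i ^ 2 * MvPolynomial.pderiv i f ∈
      polGr(k) (d + 2) := by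
    have h1 := (MvPolynomial.isWeightedHomogeneous_X k (fun _ : Fin 2 => (2 : ℤ)) i).pow 2
    have hf' : MvPolynomial.IsWeightedHomogeneous (fun _ : Fin 2 => (2 : ℤ)) f (d - 2 + 2) := by
      rw [sub_add_cancel]; exact hf
    have h2 := h1.mul (hf'.pderiv (i := i) (n' := d - 2) rfl)
    rw [show (2 : ℕ) • (2 : ℤ) + (d - 2) = d + 2 by rw [two_smul]; ring] at h2
    exact h2
  rw [polDer_apply]
  exact add_mem (h 0) (h 1)

lemma X_mul_mem (i : Fin 2) {f : Pol k} {d : ℤ}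
    (hf : f ∈ polGr(k) d) :
    X i * f ∈ polGr(k) (d + 2) := by
  rw [add_comm]
  exact (MvPolynomial.isWeightedHomogeneous_X k (fun _ : Fin 2 => (2 : ℤ)) i).mul hf

lemma pol_internal : DirectSum.IsInternal
    (polGr(k)) :=
  letI := MvPolynomial.weightedDecomposition k (fun _ : Fin 2 => (2 : ℤ))
  DirectSum.Decomposition.isInternal _

lemma good_reg [Fact p.Prime] [CharP k p] : Good p (reg k) where
  internal := pol_internal
  lft_mem i e m hm := X_mul_mem i hm
  rgt_mem i e m hm := X_mul_mem i hm
  dq_mem e m hm := polDer_mem hm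
  dt_mem e m _ := zero_mem _
  dq_pow := polDer_pow
  dt_pow := zero_pow (Fact.out : p.Prime).ne_zero

lemma good_Mn [Fact p.Prime] [CharP k p] (n : ℕ) : Good p (Mn k p n) := by
  induction n with
  | zero => exact good_reg
  | succ n ih => exact ih.twistB

lemma Good.of_biEquiv {M N : HqBimod k} (f : BiEquiv M N) (hN : Good p N) : Good p M := by
  have h1 : IsPComplex p (topC M) := IsPComplex.of_equiv (A := topC M) (C := topC N)
    hN.topC_isPComplex f.e f.dt f.gr
  have h2 : IsPComplex p ⟨M.carrier, M.gr, M.dq⟩ :=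
    IsPComplex.of_equiv (A := ⟨M.carrier, M.gr, M.dq⟩) (C := ⟨N.carrier, N.gr, N.dq⟩)
    ⟨hN.internal, hN.dq_mem, hN.dq_pow⟩ f.e f.dq f.gr
  exact
  { internal := h1.internal
    lft_mem := fun i e m hm => (f.gr _ _).mpr ((congrArg (· ∈ N.gr (e + 2)) (f.isBi.lft i m)).mpr
      (hN.lft_mem i _ _ ((f.gr _ _).mp hm)))
    rgt_mem := fun i e m hm => (f.gr _ _).mpr ((congrArg (· ∈ N.gr (e + 2)) (f.isBi.rgt i m)).mpr
      (hN.rgt_mem i _ _ ((f.gr _ _).mp hm)))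
    dq_mem := h2.diff_mem
    dt_mem := h1.diff_mem
    dq_pow := h2.diff_pow
    dt_pow := h1.diff_pow }

/-- The complex of bimodules of the braid `σ_1^n` is isomorphic to its explicit model. -/
lemma exists_braidEquiv [Fact p.Prime] [CharP k p] (n : ℕ) :
    Nonempty (BiEquiv (braidComplex k p n) (Mn k p n)) := by
  induction n with
  | zero => exact ⟨BiEquiv.refl _⟩
  | succ n ih =>
    obtain ⟨f⟩ := ih
    exact ⟨(modelEquiv ((good_Mn n).of_biEquiv f)).trans f.twistB⟩

lemma torusComplex_isPComplex [Fact p.Prime] [CharP k p] (hp : 2 < p) (n : ℕ) :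
    IsPComplex p (torusComplex k p n) := by
  obtain ⟨f⟩ := exists_braidEquiv (k := k) (p := p) n
  exact f.isPComplex hp ((good_Mn n).isPComplex hp)

lemma torusComplex_iso [Fact p.Prime] [CharP k p] (hp : 2 < p) (n : ℕ) :
    HomotopyIso p (torusComplex k p n) (totC p (Mn k p n)) := by
  obtain ⟨f⟩ := exists_braidEquiv (k := k) (p := p) n
  exact f.homotopyIso hp

end ModelEquiv

/-! ### Deformation retraction of the braid complex onto a twisted copy of `R` -/

section Retract

variable {p : ℕ}

/-- The image of `x_1` under the `n`-th power of the transposition. -/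
noncomputable def swapX (k : Type u) [Field k] : ℕ → Pol k
  | 0 => X 0
  | n + 1 => e1 k - swapX k n

lemma swapX_even (m : ℕ) : swapX k (2 * m) = X 0 ∧ swapX k (2 * m + 1) = X 1 := by
  induction m with
  | zero => exact ⟨rfl, by rw [swapX, swapX, e1]; ring⟩
  | succ m ih =>
    have h : swapX k (2 * (m + 1)) = X 0 := by
      rw [show 2 * (m + 1) = 2 * m + 1 + 1 by ring, swapX, ih.2, e1]; ring
    exact ⟨h, by rw [swapX, h, e1]; ring⟩

/-- A deformation retraction, compatible with the left `R`-action, the right action of symmetric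
polynomials and `∂_q`, of a complex of bimodules onto a copy of `R` generated in degree `-n` by an
element `u` with `u x_1 = s^n(x_1) u` and `∂_q u = n e_1 u`. -/
structure PolRetract (p : ℕ) (M : HqBimod k) (n : ℕ) where
  j : Pol k →ₗ[k] M.carrier
  r : M.carrier →ₗ[k] Pol k
  η : M.carrier →ₗ[k] M.carrier
  j_lft : ∀ i f, j (X i * f) = M.lft (X i) (j f)
  j_e1 : ∀ f, j (e1 k * f) = M.rgt (e1 k) (j f)
  j_e2 : ∀ f, j (e2 k * f) = M.rgt (e2 k) (j f)
  j_x : ∀ f, M.rgt (X 0) (j f) = j (swapX k n * f)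
  j_dt : ∀ f, M.dt (j f) = 0
  j_dq : ∀ f, M.dq (j f) = j (polDer k f + n • (e1 k * f))
  j_mem : ∀ e : ℤ, ∀ f ∈ (reg k).gr (e + n), j f ∈ M.gr e
  r_lft : ∀ i m, r (M.lft (X i) m) = X i * r m
  r_e1 : ∀ m, r (M.rgt (e1 k) m) = e1 k * r m
  r_e2 : ∀ m, r (M.rgt (e2 k) m) = e2 k * r m
  r_dt : ∀ m, r (M.dt m) = 0
  r_dq : ∀ m, r (M.dq m) = polDer k (r m) + n • (e1 k * r m)
  r_mem : ∀ e : ℤ, ∀ m ∈ M.gr e, r m ∈ (reg k).gr (e + n)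
  r_j : ∀ f, r (j f) = f
  η_lft : ∀ i m, η (M.lft (X i) m) = M.lft (X i) (η m)
  η_e1 : ∀ m, η (M.rgt (e1 k) m) = M.rgt (e1 k) (η m)
  η_e2 : ∀ m, η (M.rgt (e2 k) m) = M.rgt (e2 k) (η m)
  η_dq : ∀ m, η (M.dq m) = M.dq (η m)
  η_mem : ∀ e : ℤ, ∀ m ∈ M.gr e, η m ∈ M.gr (e + 2 - 2 * (p : ℤ))
  η_j : ∀ f, η (j f) = 0
  homotopy : ∀ m, homotopySum p M.dt M.dt η m = m - j (r m)

/-- The regular bimodule retracts onto itself. -/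
noncomputable def PolRetract.zero [Fact p.Prime] : PolRetract p (reg k) 0 where
  j := LinearMap.id
  r := LinearMap.id
  η := 0
  j_lft _ _ := rfl
  j_e1 _ := rfl
  j_e2 _ := rfl
  j_x _ := rfl
  j_dt _ := rfl
  j_dq f := by rw [zero_smul, add_zero]; rfl
  j_mem e f hf := (congrArg (fun d => f ∈ (reg k).gr d) (by simp : e + ((0 : ℕ) : ℤ) = e)).mp hf
  r_lft _ _ := rfl
  r_e1 _ := rfl
  r_e2 _ := rfl
  r_dt _ := rfl
  r_dq f := by rw [zero_smul, add_zero]; rfl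
  r_mem e f hf := (congrArg (fun d => f ∈ (reg k).gr d) (by simp : e + ((0 : ℕ) : ℤ) = e)).mpr hf
  r_j _ := rfl
  η_lft _ m := (map_zero _).symm
  η_e1 m := (map_zero _).symm
  η_e2 m := (map_zero _).symm
  η_dq m := (map_zero _).symm
  η_mem _ _ _ := zero_mem _
  η_j _ := rfl
  homotopy m := by
    refine Eq.trans ?_ (sub_self (m : Pol k)).symm
    rw [homotopySum, LinearMap.sum_apply]
    exact sum_eq_zero fun i _ => map_zero ((reg k).dt ^ i)

/-- The bimodule map `m ↦ -m x_1 ⊗ 1 + m ⊗ y_1` onto the kernel of `M ⊗_R B → M`. -/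
noncomputable def twistEps (p : ℕ) (M : HqBimod k) :
    M.carrier →ₗ[k] (M.carrier × M.carrier) × (Fin (p - 1) → M.carrier) :=
  LinearMap.inl k _ _ ∘ₗ LinearMap.prod (-M.rgt (X 0)) LinearMap.id

lemma twistEps_apply (M : HqBimod k) (m : M.carrier) : twistEps p M m = ((-M.rgt (X 0) m, m), 0) := rfl

lemma twistEps_lft (M : HqBimod k) (a : Pol k) (m : M.carrier) :
    twistEps p M (M.lft a m) = (TwistB p M).lft a (twistEps p M m) := by
  rw [twistEps_apply, twistEps_apply]
  refine Prod.ext (Prod.ext ?_ rfl) (funext fun l => (map_zero (M.lft a)).symm)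
  change -M.rgt (X 0) (M.lft a m) = M.lft a (-M.rgt (X 0) m)
  rw [map_neg, M.lft_rgt]

lemma TwistB_rgt_symm (M : HqBimod k) {a : Pol k} (ha : a ∈ symmetricSubalgebra (Fin 2) k)
    (z : (M.carrier × M.carrier) × (Fin (p - 1) → M.carrier)) :
    (TwistB p M).rgt a z = ((M.rgt a z.1.1, M.rgt a z.1.2), fun l => M.rgt a (z.2 l)) :=
  Prod.ext (indRgt_symm M ha z.1) rfl

lemma twistEps_rgt (M : HqBimod k) {a : Pol k} (ha : a ∈ symmetricSubalgebra (Fin 2) k)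
    (m : M.carrier) : twistEps p M (M.rgt a m) = (TwistB p M).rgt a (twistEps p M m) := by
  rw [TwistB_rgt_symm M ha, twistEps_apply, twistEps_apply]
  refine Prod.ext (Prod.ext ?_ rfl) (funext fun l => (map_zero (M.rgt a)).symm)
  change -M.rgt (X 0) (M.rgt a m) = M.rgt a (-M.rgt (X 0) m)
  rw [map_neg, M.rgt_comm]

lemma twistEps_rgt_X0 (M : HqBimod k) (m : M.carrier) :
    (TwistB p M).rgt (X 0) (twistEps p M m) = twistEps p M (M.rgt (X 1) m) := by
  refine Prod.ext ?_ (funext fun l => map_zero (M.rgt (X 0)))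
  change indRgt M (X 0) (-M.rgt (X 0) m, m) = (-M.rgt (X 0) (M.rgt (X 1) m), M.rgt (X 1) m)
  rw [indRgt_X0, indY_apply, map_e1, map_e2]
  refine Prod.ext rfl ?_
  change -M.rgt (X 0) m + (M.rgt (X 0) m + M.rgt (X 1) m) = _
  abel

lemma twistEps_dt (M : HqBimod k) (m : M.carrier) :
    (TwistB p M).dt (twistEps p M m) = twistEps p M (M.dt m) := by
  refine Prod.ext (Prod.ext ?_ rfl) (funext fun l => ?_)
  · change M.dt (-M.rgt (X 0) m) = -M.rgt (X 0) (M.dt m)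
    rw [map_neg, M.dt_rgt]
  · refine (TwistB_dt_snd M (twistEps p M m) l).trans ?_
    rw [twistEps_apply, twistEps_apply, indMul_apply]
    simp

lemma twistEps_dq (M : HqBimod k) (m : M.carrier) :
    (TwistB p M).dq (twistEps p M m) = twistEps p M (M.dq m + M.rgt (e1 k) m) := by
  refine Prod.ext ?_ (funext fun l => map_zero M.dq)
  change indDq M (-M.rgt (X 0) m, m) = (-M.rgt (X 0) (M.dq m + M.rgt (e1 k) m), M.dq m + M.rgt (e1 k) m)
  rw [indDq_apply]
  refine Prod.ext ?_ rfl
  change M.dq (-M.rgt (X 0) m) - M.rgt (e2 k) m = -M.rgt (X 0) (M.dq m + M.rgt (e1 k) m)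
  rw [map_neg, M.dq_rgt, polDer_X, map_add, map_e1, map_e2, pow_two, map_mul]
  simp only [LinearMap.add_apply, Module.End.mul_apply, map_add]
  abel

lemma twistEps_mem {M : HqBimod k} (hM : Good p M) {e : ℤ} {m : M.carrier} (hm : m ∈ M.gr (e + 1)) :
    twistEps p M m ∈ (TwistB p M).gr e := by
  refine ⟨⟨neg_mem ?_, ?_⟩, fun l _ => zero_mem _⟩
  · have := hM.rgt_mem 0 _ _ hm
    rwa [show e + 1 + 2 = e + 3 by ring] at this
  · change m ∈ M.gr (e + 3 - 2)
    rwa [show e + 3 - 2 = e + 1 by ring]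

/-- The map `M^p → M ⊗_R pT` that is `m ↦ m ⊗ 1` on the first copy of `M`. -/
noncomputable def blkToTwist (p : ℕ) [Fact p.Prime] (M : HqBimod k) :
    (Fin p → M.carrier) →ₗ[k] (M.carrier × M.carrier) × (Fin (p - 1) → M.carrier) :=
  LinearMap.prod (LinearMap.inl k _ _ ∘ₗ proj (⟨0, (Fact.out : p.Prime).pos⟩ : Fin p))
    (LinearMap.pi fun l : Fin (p - 1) => proj (⟨(l : ℕ) + 1, by have := l.isLt; omega⟩ : Fin p))

lemma blkToTwist_apply [Fact p.Prime] (M : HqBimod k) (w : Fin p → M.carrier) :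
    blkToTwist p M w = ((w ⟨0, (Fact.out : p.Prime).pos⟩, 0), fun l : Fin (p - 1) => w ⟨(l : ℕ) + 1, by have := l.isLt; omega⟩) := rfl

lemma blkToTwist_dt [Fact p.Prime] (M : HqBimod k) (w : Fin p → M.carrier) :
    blkToTwist p M (blkDiff p M.dt w) = (TwistB p M).dt (blkToTwist p M w) := by
  refine Prod.ext (Prod.ext ?_ (map_zero M.dt).symm) (funext fun l => ?_)
  · change blkDiff p M.dt w _ = M.dt (w _)
    rw [blkDiff_apply, dif_pos rfl, zero_add]
  · refine Eq.trans ?_ (TwistB_dt_snd M _ l).symm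
    change blkDiff p M.dt w _ = _
    rw [blkDiff_apply, dif_neg (by simp), blkToTwist_apply, indMul_apply]
    by_cases h : (l : ℕ) = 0
    · rw [dif_pos h, if_pos h]
      simp [h, add_comm]
    · rw [dif_neg h, if_neg h, add_zero]
      congr 3
      simp; omega

lemma twistEps_sum [Fact p.Prime] [CharP k p] {M : HqBimod k} (hM : Good p M)
    (z : (M.carrier × M.carrier) × (Fin (p - 1) → M.carrier)) :
    twistEps p M z.1.2 + homotopySum p (TwistB p M).dt (TwistB p M).dt
      (blkToTwist p M ∘ₗ blkHomotopy k p (Fact.out : p.Prime).pos M.carrier ∘ₗ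
        coneToBlk p (X := topC (Ind M)) (Y := topC M) (indMul M)) z = z := by
  have hc : ∀ z, coneToBlk p (X := topC (Ind M)) (Y := topC M) (indMul M) ((TwistB p M).dt z) =
      blkDiff p M.dt (coneToBlk p (X := topC (Ind M)) (Y := topC M) (indMul M) z) :=
    fun z => coneToBlk_comm (topC_isHom hM) z
  rw [← homotopySum_comp_left (blkToTwist_dt M), ← homotopySum_comp_right hc, blkDiff_homotopySum]
  change twistEps p M z.1.2 + blkToTwist p M (coneToBlk p (X := topC (Ind M)) (Y := topC M) (indMul M) z) = z
  rw [twistEps_apply, blkToTwist_apply]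
  refine Prod.ext (Prod.ext ?_ (add_zero _)) (funext fun l => ?_)
  · change -M.rgt (X 0) z.1.2 + coneToBlk p (X := topC (Ind M)) (Y := topC M) (indMul M) z _ = z.1.1
    rw [coneToBlk_apply, dif_pos rfl, indMul_apply]
    abel
  · change 0 + coneToBlk p (X := topC (Ind M)) (Y := topC M) (indMul M) z _ = z.2 l
    rw [coneToBlk_apply, dif_neg (by simp), zero_add]
    rfl

/-- The homotopy `blkToTwist ∘ blkHomotopy ∘ coneToBlk` moves the last copy of `M` to `M ⊗ 1`. -/
lemma blkToTwist_homotopy [Fact p.Prime] (hp : 2 < p) (M : HqBimod k)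
    (z : (M.carrier × M.carrier) × (Fin (p - 1) → M.carrier)) :
    blkToTwist p M (blkHomotopy k p (Fact.out : p.Prime).pos M.carrier
        (coneToBlk p (X := topC (Ind M)) (Y := topC M) (indMul M) z)) =
      ((z.2 ⟨p - 2, by omega⟩, 0), 0) := by
  have h : coneToBlk p (X := topC (Ind M)) (Y := topC M) (indMul M) z ⟨p - 1, by omega⟩ =
      z.2 ⟨p - 2, by omega⟩ := by
    rw [coneToBlk_apply, dif_neg (by simp; omega)]
    congr 1
  rw [blkToTwist_apply]
  refine Prod.ext (Prod.ext ?_ rfl) (funext fun l => ?_)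
  · refine Eq.trans ?_ h
    exact Pi.single_eq_same (M := fun _ => M.carrier) (⟨0, (Fact.out : p.Prime).pos⟩ : Fin p) _
  · refine Pi.single_eq_of_ne (M := fun _ => M.carrier) (i := (⟨0, (Fact.out : p.Prime).pos⟩ : Fin p))
      (i' := ⟨(l : ℕ) + 1, by have := l.isLt; omega⟩) ?_
      (coneToBlk p (X := topC (Ind M)) (Y := topC M) (indMul M) z ⟨p - 1, by omega⟩)
    exact Fin.ne_of_val_ne (Nat.succ_ne_zero _)

/-- The retraction for `M ⊗_R pT` obtained from one for `M`. -/
noncomputable def PolRetract.succ [Fact p.Prime] [CharP k p] (hp : 2 < p) {M : HqBimod k} (hM : Good p M) {n : ℕ}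
    (P : PolRetract p M n) : PolRetract p (TwistB p M) (n + 1) where
  j := twistEps p M ∘ₗ P.j
  r := P.r ∘ₗ snd k _ _ ∘ₗ fst k _ _
  η := twistEps p M ∘ₗ P.η ∘ₗ snd k _ _ ∘ₗ fst k _ _ +
    blkToTwist p M ∘ₗ blkHomotopy k p (Fact.out : p.Prime).pos M.carrier ∘ₗ
        coneToBlk p (X := topC (Ind M)) (Y := topC M) (indMul M)
  j_lft i f := (congrArg (twistEps p M) (P.j_lft i f)).trans (twistEps_lft M _ _)
  j_e1 f := (congrArg (twistEps p M) (P.j_e1 f)).trans (twistEps_rgt M e1_mem _)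
  j_e2 f := (congrArg (twistEps p M) (P.j_e2 f)).trans (twistEps_rgt M e2_mem _)
  j_x f := by
    refine (twistEps_rgt_X0 M _).trans (congrArg (twistEps p M) ?_)
    rw [swapX, sub_mul, map_sub, P.j_e1, ← P.j_x, map_e1]
    simp
  j_dt f := (twistEps_dt M _).trans ((congrArg (twistEps p M) (P.j_dt f)).trans (map_zero _))
  j_dq f := by
    refine (twistEps_dq M _).trans (congrArg (twistEps p M) ?_)
    rw [P.j_dq, ← P.j_e1, ← map_add]
    congr 1
    rw [succ_nsmul]
    abel
  j_mem e f hf := twistEps_mem hM (P.j_mem _ _ (by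
    rwa [show e + 1 + (n : ℤ) = e + ((n + 1 : ℕ) : ℤ) by push_cast; ring]))
  r_lft i m := P.r_lft i _
  r_e1 m := (congrArg P.r (congrArg (fun z => z.1.2) (TwistB_rgt_symm M e1_mem m))).trans (P.r_e1 _)
  r_e2 m := (congrArg P.r (congrArg (fun z => z.1.2) (TwistB_rgt_symm M e2_mem m))).trans (P.r_e2 _)
  r_dt m := P.r_dt _
  r_dq m := by
    change P.r (M.dq m.1.2 + M.rgt (e1 k) m.1.2) = _
    rw [map_add, P.r_dq, P.r_e1, succ_nsmul, add_assoc]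
    rfl
  r_mem e m hm := by
    have := P.r_mem _ _ hm.1.2
    rw [show e + 3 - 2 + (n : ℤ) = e + ((n + 1 : ℕ) : ℤ) by push_cast; ring] at this
    exact this
  r_j f := P.r_j f
  η_lft i m := by
    refine Eq.trans ?_ (map_add ((TwistB p M).lft (X i)) _ _).symm
    refine congrArg₂ (· + ·) ((congrArg (twistEps p M) (P.η_lft i m.1.2)).trans (twistEps_lft M _ _)) ?_
    refine (blkToTwist_homotopy hp M _).trans (Eq.trans ?_
      (congrArg ((TwistB p M).lft (X i)) (blkToTwist_homotopy hp M m)).symm)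
    exact Prod.ext (Prod.ext rfl (map_zero (M.lft (X i))).symm) (funext fun l => (map_zero (M.lft (X i))).symm)
  η_e1 m := by
    refine Eq.trans ?_ (map_add ((TwistB p M).rgt (e1 k)) _ _).symm
    rw [TwistB_rgt_symm M e1_mem m]
    refine congrArg₂ (· + ·) ((congrArg (twistEps p M) (P.η_e1 m.1.2)).trans (twistEps_rgt M e1_mem _)) ?_
    refine (blkToTwist_homotopy hp M _).trans (Eq.trans ?_
      (congrArg ((TwistB p M).rgt (e1 k)) (blkToTwist_homotopy hp M m)).symm)
    rw [TwistB_rgt_symm M e1_mem]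
    exact Prod.ext (Prod.ext rfl (map_zero (M.rgt (e1 k))).symm) (funext fun l => (map_zero (M.rgt (e1 k))).symm)
  η_e2 m := by
    refine Eq.trans ?_ (map_add ((TwistB p M).rgt (e2 k)) _ _).symm
    rw [TwistB_rgt_symm M e2_mem m]
    refine congrArg₂ (· + ·) ((congrArg (twistEps p M) (P.η_e2 m.1.2)).trans (twistEps_rgt M e2_mem _)) ?_
    refine (blkToTwist_homotopy hp M _).trans (Eq.trans ?_
      (congrArg ((TwistB p M).rgt (e2 k)) (blkToTwist_homotopy hp M m)).symm)
    rw [TwistB_rgt_symm M e2_mem]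
    exact Prod.ext (Prod.ext rfl (map_zero (M.rgt (e2 k))).symm) (funext fun l => (map_zero (M.rgt (e2 k))).symm)
  η_dq m := by
    refine Eq.trans ?_ (map_add (TwistB p M).dq _ _).symm
    refine congrArg₂ (HAdd.hAdd (α := (M.carrier × M.carrier) × (Fin (p - 1) → M.carrier))) ?_ ?_
    · refine Eq.trans (congrArg (twistEps p M) ?_) (twistEps_dq M (P.η m.1.2)).symm
      change P.η (M.dq m.1.2 + M.rgt (e1 k) m.1.2) = _
      rw [map_add, P.η_dq, P.η_e1]
    · refine (blkToTwist_homotopy hp M _).trans (Eq.trans ?_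
        (congrArg (TwistB p M).dq (blkToTwist_homotopy hp M m)).symm)
      refine Prod.ext (Prod.ext ?_ ?_) (funext fun l => (map_zero M.dq).symm)
      · change M.dq _ = M.dq _ - M.rgt (e2 k) 0
        rw [map_zero, sub_zero]
        rfl
      · change 0 = M.dq 0 + M.rgt (e1 k) 0
        rw [map_zero, map_zero, add_zero]
  η_mem e m hm := by
    refine add_mem (twistEps_mem hM ?_) ?_
    · have := P.η_mem _ _ hm.1.2
      rw [show e + 3 - 2 + 2 - 2 * (p : ℤ) = e + 2 - 2 * (p : ℤ) + 1 by ring] at this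
      exact this
    · refine (congrArg (· ∈ (TwistB p M).gr (e + 2 - 2 * (p : ℤ))) (blkToTwist_homotopy hp M m)).mpr ?_
      refine ⟨⟨?_, zero_mem _⟩, fun l _ => zero_mem _⟩
      have := hm.2 ⟨p - 2, by omega⟩ trivial
      change m.2 ⟨p - 2, by omega⟩ ∈ M.gr (e + 3 - 2 - 2 * ((p - 2 : ℕ) : ℤ)) at this
      rw [show e + 3 - 2 - 2 * ((p - 2 : ℕ) : ℤ) = e + 2 - 2 * (p : ℤ) + 3 by omega] at this
      exact this
  η_j f := by
    have h1 : twistEps p M (P.η (P.j f)) = 0 := by rw [P.η_j, map_zero]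
    have h2 := blkToTwist_homotopy hp M (twistEps p M (P.j f))
    have h3 : (((twistEps p M (P.j f)).2 ⟨p - 2, by omega⟩, 0), 0) =
      (0 : (M.carrier × M.carrier) × (Fin (p - 1) → M.carrier)) := rfl
    refine Eq.trans ?_ (add_zero (0 : (M.carrier × M.carrier) × (Fin (p - 1) → M.carrier)))
    refine congrArg₂ (HAdd.hAdd (α := (M.carrier × M.carrier) × (Fin (p - 1) → M.carrier))) h1 (h2.trans h3)
  homotopy m := by
    have hc : ∀ z, (snd k M.carrier M.carrier ∘ₗ fst k _ (Fin (p - 1) → M.carrier))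
        ((TwistB p M).dt z) = M.dt (z.1.2) := fun _ => rfl
    have h1 : homotopySum p (TwistB p M).dt (TwistB p M).dt (twistEps p M ∘ₗ P.η ∘ₗ
        snd k _ _ ∘ₗ fst k _ _) m = twistEps p M (m.1.2 - P.j (P.r m.1.2)) := by
      rw [← P.homotopy]
      rw [← homotopySum_comp_left (D' := M.dt) (fun x => (twistEps_dt M x).symm), 
        ← homotopySum_comp_right (D := M.dt) hc]
      rfl
    have h2 := twistEps_sum hM m
    rw [← sub_eq_zero] at h2 ⊢
    rw [← h2]
    have h3 : ∀ h h' : (M.carrier × M.carrier) × (Fin (p - 1) → M.carrier) →ₗ[k] _,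
        homotopySum p (TwistB p M).dt (TwistB p M).dt (h + h') m =
        (homotopySum p (TwistB p M).dt (TwistB p M).dt h m : (M.carrier × M.carrier) × (Fin (p - 1) → M.carrier)) + homotopySum p (TwistB p M).dt (TwistB p M).dt h' m := by
      intro h h'
      simp only [homotopySum, LinearMap.sum_apply, ← sum_add_distrib]
      refine sum_congr rfl fun i _ => ?_
      exact map_add (((TwistB p M).dt) ^ i) _ _
    rw [h3, h1, map_sub]
    change _ - (m - twistEps p M (P.j (P.r m.1.2))) = _
    abel

end Retract

/-! ### Reduction of the cone to the bimodules `B_n` -/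

section Reduction

variable {p : ℕ}

/-- The regular bimodule generated in degree `-n` by an element `u` with `∂_q u = n e_1 u`. -/
noncomputable abbrev Npol (k : Type u) [Field k] (n : ℕ) : HqBimod k where
  carrier := Pol k
  lft := Algebra.lmul k (Pol k)
  rgt := Algebra.lmul k (Pol k)
  lft_rgt := fun a b m => by simp [mul_left_comm]
  dq := (polDer k : Pol k →ₗ[k] Pol k) + n • LinearMap.mulLeft k (e1 k)
  dq_lft := fun a m => by simp [Derivation.leibniz]; ring
  dq_rgt := fun a m => by simp [Derivation.leibniz]; ring
  dt := 0
  dt_lft := fun a m => by simp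
  dt_rgt := fun a m => by simp
  dt_dq := fun m => by simp
  gr := fun e => polGr(k) (e + n)

/-- The bimodule `B`, twisted. -/
noncomputable abbrev Bn (k : Type u) [Field k] (n : ℕ) : HqBimod k := Ind (Npol k n)

lemma e1_mul_mem {f : Pol k} {d : ℤ}
    (hf : f ∈ polGr(k) d) :
    e1 k * f ∈ polGr(k) (d + 2) := by
  rw [e1, add_mul]
  exact add_mem (X_mul_mem 0 hf) (X_mul_mem 1 hf)

lemma good_Npol [Fact p.Prime] [CharP k p] {M : HqBimod k} (hM : Good p M) {n : ℕ}
    (P : PolRetract p M n) : Good p (Npol k n) where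
  internal := by
    obtain ⟨c, hc⟩ := exists_isProj (pol_internal (k := k))
    exact (isProj_shift hc n).isInternal
  lft_mem i e m hm := by
    have := X_mul_mem i hm
    rwa [add_right_comm] at this
  rgt_mem i e m hm := by
    have := X_mul_mem i hm
    rwa [add_right_comm] at this
  dq_mem e m hm := by
    have h1 := polDer_mem hm
    have h2 := e1_mul_mem hm
    rw [add_right_comm] at h1 h2
    exact add_mem h1 (Submodule.smul_of_tower_mem _ n h2)
  dt_mem e m _ := zero_mem _
  dq_pow := by
    refine LinearMap.ext fun f => ?_
    have h := comp_pow_of_comm (D := (Npol k n).dq) (D' := M.dq) (f := P.j) (fun f => (P.j_dq f).symm) p f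
    rw [hM.dq_pow] at h
    have h2 := congrArg P.r h
    rw [P.r_j] at h2
    exact h2.trans (map_zero P.r)
  dt_pow := zero_pow (Fact.out : p.Prime).ne_zero

lemma isBi_prodMap {M N : HqBimod k} {f : M.carrier →ₗ[k] N.carrier}
    (hl : ∀ i m, f (M.lft (X i) m) = N.lft (X i) (f m))
    (h1 : ∀ m, f (M.rgt (e1 k) m) = N.rgt (e1 k) (f m))
    (h2 : ∀ m, f (M.rgt (e2 k) m) = N.rgt (e2 k) (f m)) : IsBi (Ind M) (Ind N) (f.prodMap f) :=
  ⟨fun i v => Prod.ext (hl i _) (hl i _), fun i v => indRgt_comm (f := f.prodMap f)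
    (fun v => by simp [indY_apply, h1, h2]) (fun v => by simp [indZ_apply, h1, h2]) (X i) v⟩

lemma prodMap_indDq {M N : HqBimod k} {f : M.carrier →ₗ[k] N.carrier}
    (hd : ∀ m, f (M.dq m) = N.dq (f m))
    (h1 : ∀ m, f (M.rgt (e1 k) m) = N.rgt (e1 k) (f m))
    (h2 : ∀ m, f (M.rgt (e2 k) m) = N.rgt (e2 k) (f m)) (v : M.carrier × M.carrier) :
    f.prodMap f ((Ind M).dq v) = (Ind N).dq (f.prodMap f v) := by
  simp [indDq_apply, hd, h1, h2]

lemma IsBi.pow {M : HqBimod k} {f : M.carrier →ₗ[k] M.carrier} (hf : IsBi M M f) (n : ℕ) :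
    IsBi M M (f ^ n) := by
  induction n with
  | zero => exact IsBi.id M
  | succ n ih => rw [pow_succ]; exact ih.comp hf

lemma tot_pow {M : HqBimod k} {f : M.carrier →ₗ[k] M.carrier} (hf : IsBi M M f) (n : ℕ) (z : PHH p M) :
    (tot p hf ^ n) z = tot p (hf.pow n) z := by
  induction n generalizing z with
  | zero => exact (tot_id p z).symm
  | succ n ih =>
    rw [pow_succ, Module.End.mul_apply, ih, ← tot_comp]
    exact tot_congr p _ _ (fun x => by rw [pow_succ]; rfl) z

/-- A homotopy of bimodules for `∂_t`, commuting with `∂_q`, induces one of total complexes. -/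
lemma homotopySum_tot [Fact p.Prime] [CharP k p] (hp : 2 < p) {M : HqBimod k}
    {η : M.carrier →ₗ[k] M.carrier} (hη : IsBi M M η) (hd : ∀ m, η (M.dq m) = M.dq (η m))
    (hs : IsBi M M (homotopySum p M.dt M.dt η)) (z : PHH p M) :
    homotopySum p (totC p M).diff (totC p M).diff (tot p hη) z = tot p hs z := by
  have h1 : homotopySum p (totC p M).diff (totC p M).diff (tot p hη) =
      homotopySum p (dtPHH p M) (dtPHH p M) (tot p hη) := by
    have h0 : ∀ x, dtPHH p M ((dC p M + dqPHH p M) x) = (dC p M + dqPHH p M) (dtPHH p M x) := fun x => by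
      rw [LinearMap.add_apply, LinearMap.add_apply, map_add, dtPHH_eq, tot_dC hp,
        tot_dqPHH p _ fun m => M.dt_dq m]
    change homotopySum p (dtPHH p M + dC p M + dqPHH p M) (dtPHH p M + dC p M + dqPHH p M) _ = _
    rw [add_assoc, homotopySum_add (fun x => ?_) h0 h0]
    rw [LinearMap.add_apply, LinearMap.add_apply, map_add, tot_dC hp, tot_dqPHH p _ hd]
  have h2 : ∀ i, IsBi M M ((M.dt ^ i) ∘ₗ η ∘ₗ M.dt ^ (p - 1 - i)) := fun i =>
    ((IsBi.dt M).pow i).comp (hη.comp ((IsBi.dt M).pow (p - 1 - i)))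
  suffices h3 : homotopySum p (dtPHH p M) (dtPHH p M) (tot p hη) z = tot p hs z from
    (LinearMap.congr_fun h1 z).trans h3
  rw [homotopySum, LinearMap.sum_apply]
  refine Eq.trans ?_ (tot_sum (s := range p) h2 z).symm
  refine sum_congr rfl fun i _ => ?_
  rw [LinearMap.comp_apply, LinearMap.comp_apply, dtPHH_eq, tot_pow, tot_pow, ← tot_comp, ← tot_comp]

lemma homotopySum_prodMap {M : HqBimod k} {η : M.carrier →ₗ[k] M.carrier} (v : M.carrier × M.carrier) :
    homotopySum p (Ind M).dt (Ind M).dt (η.prodMap η) v =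
      (homotopySum p M.dt M.dt η v.1, homotopySum p M.dt M.dt η v.2) := by
  have h : ∀ i, ((M.dt.prodMap M.dt) ^ i) (η.prodMap η (((M.dt.prodMap M.dt) ^ (p - 1 - i)) v)) =
      ((M.dt ^ i) (η ((M.dt ^ (p - 1 - i)) v.1)), (M.dt ^ i) (η ((M.dt ^ (p - 1 - i)) v.2))) := fun i => by
    rw [prodMap_pow, prodMap_pow]
    rfl
  simp only [homotopySum, LinearMap.sum_apply, LinearMap.comp_apply, h]
  exact Prod.ext (Prod.fst_sum ..) (Prod.snd_sum ..)

namespace PolRetract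

variable {M : HqBimod k} {n : ℕ} (P : PolRetract p M n)

lemma isBi_j : IsBi (Bn k n) (Ind M) (P.j.prodMap P.j) := isBi_prodMap (M := Npol k n) P.j_lft P.j_e1 P.j_e2

lemma isBi_r : IsBi (Ind M) (Bn k n) (P.r.prodMap P.r) := isBi_prodMap (N := Npol k n) P.r_lft P.r_e1 P.r_e2

lemma isBi_η : IsBi (Ind M) (Ind M) (P.η.prodMap P.η) := isBi_prodMap P.η_lft P.η_e1 P.η_e2

/-- The composite `B_n → M ⊗_R B → M`. -/
noncomputable def mulJ : Pol k × Pol k →ₗ[k] M.carrier := indMul M ∘ₗ P.j.prodMap P.j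

lemma mulJ_apply (b : Pol k × Pol k) : P.mulJ b = P.j (b.1 + swapX k n * b.2) := by
  change P.j b.1 + M.rgt (X 0) (P.j b.2) = _
  rw [P.j_x, map_add]

lemma isBi_mulJ : IsBi (Bn k n) M P.mulJ := (isBi_indMul M).comp P.isBi_j

lemma tot_j_isHom (hp : 2 < p) : IsHom (totC p (Bn k n)) (totC p (Ind M)) (tot p P.isBi_j) :=
  tot_isHom hp P.isBi_j (prodMap_indDq (M := Npol k n) (fun m => (P.j_dq m).symm) P.j_e1 P.j_e2)
    (fun v => Prod.ext ((map_zero P.j).trans (P.j_dt _).symm) ((map_zero P.j).trans (P.j_dt _).symm))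
    fun e v hv => ⟨P.j_mem _ _ hv.1, P.j_mem _ _ hv.2⟩

lemma tot_r_isHom (hp : 2 < p) : IsHom (totC p (Ind M)) (totC p (Bn k n)) (tot p P.isBi_r) :=
  tot_isHom hp P.isBi_r (prodMap_indDq (N := Npol k n) P.r_dq P.r_e1 P.r_e2)
    (fun v => Prod.ext (P.r_dt _) (P.r_dt _))
    fun e v hv => ⟨P.r_mem _ _ hv.1, P.r_mem _ _ hv.2⟩

lemma tot_indMul_isHom (hp : 2 < p) (hM : Good p M) :
    IsHom (totC p (Ind M)) (totC p M) (tot p (isBi_indMul M)) :=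
  tot_isHom hp (isBi_indMul M) (indMul_dq M) (topC_isHom hM).comm (topC_isHom hM).map_mem

/-- The cone of `M ⊗_R B → M` retracts onto the cone of `B_n → M`. -/
lemma exists_cone [Fact p.Prime] [CharP k p] (hp : 2 < p) (hM : Good p M) :
    ∃ F : (PHH p (Ind M) × (Fin (p - 1) → PHH p M)) →ₗ[k] (PHH p (Bn k n) × (Fin (p - 1) → PHH p M)),
      IsHom (cone p (totC p (Ind M)) (totC p M) (tot p (isBi_indMul M)))
        (cone p (totC p (Bn k n)) (totC p M) (tot p P.isBi_mulJ)) F ∧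
      Function.Surjective F ∧
      AcyclicOn p (cone p (totC p (Ind M)) (totC p M) (tot p (isBi_indMul M))).diff
        (ker F) ∧
      ∀ x, F (tot p P.isBi_j x, 0) = (x, 0) := by
  have hc : tot p (isBi_indMul M) ∘ₗ tot p P.isBi_j = tot p P.isBi_mulJ :=
    LinearMap.ext fun z => (tot_comp p _ _ z).symm
  have hH : ∀ v, homotopySum p (Ind M).dt (Ind M).dt (P.η.prodMap P.η) v =
      v - P.j.prodMap P.j (P.r.prodMap P.r v) := fun v => by
    rw [homotopySum_prodMap, P.homotopy, P.homotopy]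
    rfl
  have hs : IsBi (Ind M) (Ind M) (homotopySum p (Ind M).dt (Ind M).dt (P.η.prodMap P.η)) := by
    have h1 := P.isBi_j.comp P.isBi_r
    exact ⟨fun i v => by rw [hH, hH, map_sub]; exact congrArg _ (h1.lft i v),
      fun i v => by rw [hH, hH, map_sub]; exact congrArg _ (h1.rgt i v)⟩
  have h1 : ∀ x : PHH p (Bn k n), tot p P.isBi_r (tot p P.isBi_j x) = x := fun x => by
    rw [← tot_comp]
    exact (tot_congr p _ (IsBi.id _) (fun b => Prod.ext (P.r_j _) (P.r_j _)) x).trans (tot_id p x)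
  have h2 : ∀ x : PHH p (Bn k n), tot p P.isBi_η (tot p P.isBi_j x) = 0 := fun x => by
    rw [← tot_comp]
    exact (tot_congr p _ (IsBi.zero _ _) (fun b => Prod.ext (P.η_j _) (P.η_j _)) x).trans (tot_zero p x)
  have h3 : ∀ x : PHH p (Ind M), tot p hs x = x - tot p P.isBi_j (tot p P.isBi_r x) := fun x => by
    rw [eq_sub_iff_add_eq, ← tot_comp, ← tot_add]
    refine (tot_congr p _ (IsBi.id _) (fun v => ?_) x).trans (tot_id p x)
    rw [LinearMap.add_apply, hH]
    exact sub_add_cancel _ _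
  rw [← hc]
  refine exists_cone_retract hp (X := totC p (Ind M)) (Y := totC p M) (X' := totC p (Bn k n))
    (hM.ind.isPComplex hp) (hM.isPComplex hp)
    (tot_indMul_isHom hp hM) (P.tot_j_isHom hp) (P.tot_r_isHom hp) h1 (η := tot p P.isBi_η)
    (fun e x hx => ?_) h2 (fun x => (homotopySum_tot hp P.isBi_η
      (prodMap_indDq P.η_dq P.η_e1 P.η_e2) hs x).trans (h3 x))
  have := tot_mem (p := p) P.isBi_η (d := 2 - 2 * (p : ℤ)) (fun e v hv => ?_) hx
  · rwa [show e + (2 - 2 * (p : ℤ)) = e + 2 - 2 * (p : ℤ) by ring] at this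
  · have h1 := P.η_mem _ _ hv.1
    have h2 := P.η_mem _ _ hv.2
    rw [show e + 2 - 2 * (p : ℤ) = e + (2 - 2 * (p : ℤ)) by ring] at h1
    rw [show e - 2 + 2 - 2 * (p : ℤ) = e + (2 - 2 * (p : ℤ)) - 2 by ring] at h2
    exact ⟨h1, h2⟩

lemma tot_mulJ_isHom (hp : 2 < p) (hM : Good p M) :
    IsHom (totC p (Bn k n)) (totC p M) (tot p P.isBi_mulJ) := by
  have hc : tot p (isBi_indMul M) ∘ₗ tot p P.isBi_j = tot p P.isBi_mulJ :=
    LinearMap.ext fun z => (tot_comp p _ _ z).symm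
  rw [← hc]
  exact (tot_indMul_isHom hp hM).comp (P.tot_j_isHom hp)

/-- A further crossing replaces the total complex of `M` by the cone of `B_n → M`, up to a shift. -/
lemma cone_iso [Fact p.Prime] [CharP k p] (hp : 2 < p) (hM : Good p M) :
    HomotopyIso p (totC p (TwistB p M))
      ((cone p (totC p (Bn k n)) (totC p M) (tot p P.isBi_mulJ)).qShift (-3)) := by
  obtain ⟨F, hF, hs, ha, -⟩ := P.exists_cone hp hM
  have hB := (good_Npol hM P).ind.isPComplex hp
  refine (total_twistB hp M).trans (HomotopyIso.qShift ?_ (-3))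
  exact homotopyIso_of_surjective (Fact.out : p.Prime).pos
    (IsPComplex.cone (hM.ind.isPComplex hp) (hM.isPComplex hp) (tot_indMul_isHom hp hM))
    (IsPComplex.cone hB (hM.isPComplex hp) (P.tot_mulJ_isHom hp hM)) hF hs ha

end PolRetract

end Reduction

end HqBimod

lemma QComplex.cone_zero_diff {k : Type u} [Field k] {p : ℕ} (X Y : QComplex k) :
    (cone p X Y 0).diff = (sumC X (Sm p Y)).diff := by
  refine LinearMap.ext fun z => Prod.ext rfl ?_
  refine Eq.trans ?_ (add_zero (blkDiff (p - 1) Y.diff z.2))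
  refine congrArg (blkDiff (p - 1) Y.diff z.2 + ·) (funext fun j => ?_)
  change coneInj (p - 1) (0 : X.carrier →ₗ[k] Y.carrier) z.1 j = 0
  rw [coneInj_apply]; split_ifs <;> rfl

namespace HqBimod

/-! ### The connecting maps between the bimodules `B_n` -/

section Connecting

variable {p : ℕ}

lemma swapX_mul (n : ℕ) : swapX k n * swapX k (n + 1) = e2 k := by
  rcases Nat.even_or_odd' n with ⟨m, rfl | rfl⟩
  · rw [(swapX_even m).1, (swapX_even m).2, e2]
  · have := (swapX_even (k := k) (m + 1)).1
    rw [(swapX_even m).2, show 2 * m + 1 + 1 = 2 * (m + 1) by ring, this, e2, mul_comm]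

lemma polDer_swapX (n : ℕ) : polDer k (swapX k n) = swapX k n ^ 2 := by
  rcases Nat.even_or_odd' n with ⟨m, rfl | rfl⟩
  · rw [(swapX_even m).1, polDer_X]
  · rw [(swapX_even m).2, polDer_X]

lemma swapX_mul_mem (n : ℕ) {f : Pol k} {d : ℤ}
    (hf : f ∈ polGr(k) d) :
    swapX k n * f ∈ polGr(k) (d + 2) := by
  rcases Nat.even_or_odd' n with ⟨m, rfl | rfl⟩
  · rw [(swapX_even m).1]; exact X_mul_mem 0 hf
  · rw [(swapX_even m).2]; exact X_mul_mem 1 hf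

/-- The evaluation `B_n → R`, `f ⊗ g ↦ f s^n(g)`. -/
noncomputable def evB (k : Type u) [Field k] (n : ℕ) : Pol k × Pol k →ₗ[k] Pol k :=
  fst k _ _ + LinearMap.mulLeft k (swapX k n) ∘ₗ snd k _ _

/-- The bimodule map `B_{n+1} → B_n`, `b ↦ ev(b) (y_1 - s^n(x_1))`. -/
noncomputable def psi (k : Type u) [Field k] (n : ℕ) : Pol k × Pol k →ₗ[k] Pol k × Pol k :=
  LinearMap.prod (-LinearMap.mulLeft k (swapX k n)) LinearMap.id ∘ₗ evB k (n + 1)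

lemma psi_apply (n : ℕ) (b : Pol k × Pol k) :
    psi k n b = (-(swapX k n * (b.1 + swapX k (n + 1) * b.2)), b.1 + swapX k (n + 1) * b.2) := rfl

lemma Bn_Y (n : ℕ) (b : Pol k × Pol k) : indY (Npol k n) b = (-(e2 k * b.2), b.1 + e1 k * b.2) := rfl

lemma Bn_Z (n : ℕ) (b : Pol k × Pol k) : indZ (Npol k n) b = (e1 k * b.1 + e2 k * b.2, -b.1) := rfl

lemma psi_lft (n : ℕ) (f : Pol k) (b : Pol k × Pol k) :
    psi k n (f * b.1, f * b.2) = (f * (psi k n b).1, f * (psi k n b).2) := by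
  rw [psi_apply, psi_apply]
  generalize swapX k n = s; generalize swapX k (n + 1) = t
  refine Prod.ext ?_ ?_ <;> dsimp only <;> ring

lemma psi_Y (n : ℕ) (b : Pol k × Pol k) : psi k n (-(e2 k * b.2), b.1 + e1 k * b.2) =
    (-(e2 k * (psi k n b).2), (psi k n b).1 + e1 k * (psi k n b).2) := by
  have hs := swapX_mul (k := k) n
  have ht : swapX k (n + 1) = e1 k - swapX k n := rfl
  rw [psi_apply, psi_apply, ← hs, ht]
  generalize swapX k n = s; generalize e1 k = t
  refine Prod.ext ?_ ?_ <;> dsimp only <;> ring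

lemma psi_Z (n : ℕ) (b : Pol k × Pol k) : psi k n (e1 k * b.1 + e2 k * b.2, -b.1) =
    (e1 k * (psi k n b).1 + e2 k * (psi k n b).2, -(psi k n b).1) := by
  have hs := swapX_mul (k := k) n
  have ht : swapX k (n + 1) = e1 k - swapX k n := rfl
  rw [psi_apply, psi_apply, ← hs, ht]
  generalize swapX k n = s; generalize e1 k = t
  refine Prod.ext ?_ ?_ <;> dsimp only <;> ring

lemma isBi_psi (n : ℕ) : IsBi (Bn k (n + 1)) (Bn k n) (psi k n) :=
  ⟨fun i b => psi_lft n (X i) b, fun i b => indRgt_comm (M := Npol k (n + 1)) (N := Npol k n)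
    (f := psi k n) (psi_Y n) (psi_Z n) (X i) b⟩

lemma Bn_dq (n : ℕ) (b : Pol k × Pol k) : (Bn k n).dq b =
    (polDer k b.1 + (n : Pol k) * (e1 k * b.1) - e2 k * b.2,
      polDer k b.2 + (n : Pol k) * (e1 k * b.2) + e1 k * b.2) := by
  change (polDer k b.1 + n • (e1 k * b.1) - e2 k * b.2, polDer k b.2 + n • (e1 k * b.2) + e1 k * b.2) = _
  rw [nsmul_eq_mul, nsmul_eq_mul]

lemma psi_dq (n : ℕ) (b : Pol k × Pol k) : psi k n ((Bn k (n + 1)).dq b) = (Bn k n).dq (psi k n b) := by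
  have hs := swapX_mul (k := k) n
  have ht : swapX k (n + 1) = e1 k - swapX k n := rfl
  have hd1 := polDer_swapX (k := k) n
  have hd2 := polDer_swapX (k := k) (n + 1)
  rw [Bn_dq, Bn_dq, psi_apply, psi_apply]
  dsimp only
  simp only [map_neg, map_add, Derivation.leibniz, hd1, hd2, smul_eq_mul]
  rw [← hs, ht]
  push_cast
  refine Prod.ext ?_ ?_ <;> dsimp only <;> ring

lemma psi_mem (n : ℕ) (e : ℤ) (b : Pol k × Pol k) (hb : b ∈ (Bn k (n + 1)).gr e) :
    psi k n b ∈ (Bn k n).gr (e + 3) := by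
  have h1 : b.1 ∈ polGr(k)
    (e + ((n + 1 : ℕ) : ℤ)) := hb.1
  have h2 : b.2 ∈ polGr(k)
    (e - 2 + ((n + 1 : ℕ) : ℤ)) := hb.2
  have h3 := swapX_mul_mem (n + 1) h2
  rw [show e - 2 + ((n + 1 : ℕ) : ℤ) + 2 = e + ((n + 1 : ℕ) : ℤ) by ring] at h3
  have h4 := add_mem h1 h3
  have h5 := swapX_mul_mem n h4
  rw [show e + ((n + 1 : ℕ) : ℤ) + 2 = e + 3 + (n : ℤ) by push_cast; ring] at h5
  rw [show e + ((n + 1 : ℕ) : ℤ) = e + 3 - 2 + (n : ℤ) by push_cast; ring] at h4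
  exact ⟨neg_mem h5, h4⟩

lemma Bn_kos0 (n : ℕ) (b : Pol k × Pol k) : kos (Bn k n) 0 b =
    (X 0 * (b.1 + X 1 * b.2), -(b.1 + X 1 * b.2)) := by
  change (X 0 * b.1, X 0 * b.2) - indRgt (Npol k n) (X 0) b = _
  rw [indRgt_X0, Bn_Y]
  refine Prod.ext ?_ ?_ <;> simp only [Prod.fst_sub, Prod.snd_sub, e1, e2] <;> ring

lemma Bn_kos1 (n : ℕ) (b : Pol k × Pol k) : kos (Bn k n) 1 b = -kos (Bn k n) 0 b := by
  rw [Bn_kos0]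
  change (X 1 * b.1, X 1 * b.2) - indRgt (Npol k n) (X 1) b = _
  rw [indRgt_X1, Bn_Z]
  refine Prod.ext ?_ ?_ <;> simp only [Prod.fst_sub, Prod.snd_sub, Prod.fst_neg, Prod.snd_neg, e1, e2] <;> ring

/-- For `n` even, `B_{n+1} → B_n` vanishes on Hochschild homology: it is `kos_0` composed with
the evaluation, up to sign. -/
lemma tot_psi_even (m : ℕ) : tot p (isBi_psi (k := k) (2 * m)) = 0 := by
  have hpsi : ∀ b : Pol k × Pol k, psi k (2 * m) b = -kos (Bn k (2 * m)) 0 (b.1 + X 1 * b.2, 0) := fun b => by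
    rw [Bn_kos0, psi_apply, (swapX_even m).1, (swapX_even m).2]
    refine Prod.ext ?_ ?_ <;> simp only [Prod.fst_neg, Prod.snd_neg] <;> ring
  refine tot_eq_zero p _ (fun b => ?_) (fun v hv => ?_) fun b hb => ?_
  · refine ⟨(-(b.1 + X 1 * b.2, 0), 0), ?_⟩
    change kos (Bn k (2 * m)) 0 (-(b.1 + X 1 * b.2, 0)) + kos (Bn k (2 * m)) 1 0 = _
    rw [map_zero, add_zero, hpsi, map_neg]
  · have hv' : kos (Bn k (2 * m + 1)) 0 v.1 + kos (Bn k (2 * m + 1)) 1 v.2 = 0 := hv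
    rw [Bn_kos1, Bn_kos0, Bn_kos0] at hv'
    have h2 : -(v.1.1 + X 1 * v.1.2) + - -(v.2.1 + X 1 * v.2.2) = 0 := congrArg Prod.snd hv'
    have h3 : v.1.1 + X 1 * v.1.2 = v.2.1 + X 1 * v.2.2 := by linear_combination -h2
    refine ⟨(v.1.1 + X 1 * v.1.2, 0), ?_⟩
    refine Prod.ext ?_ ?_
    · change kos (Bn k (2 * m)) 1 _ = psi k (2 * m) v.1
      rw [Bn_kos1, hpsi]
    · change -kos (Bn k (2 * m)) 0 _ = psi k (2 * m) v.2
      rw [hpsi, h3]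
  · have hb' : kos (Bn k (2 * m + 1)) 1 b = 0 := congrArg Prod.fst hb
    rw [Bn_kos1, neg_eq_zero, Bn_kos0] at hb'
    have h2 : -(b.1 + X 1 * b.2) = 0 := congrArg Prod.snd hb'
    rw [psi_apply, (swapX_even m).2, neg_eq_zero.mp h2]
    simp

namespace PolRetract

variable {M : HqBimod k} {n : ℕ}

lemma succ_j [Fact p.Prime] [CharP k p] (hp : 2 < p) (hM : Good p M) (P : PolRetract p M n) (f : Pol k) :
    (P.succ hp hM).j f = twistEps p M (P.j f) := by
  unfold succ
  rfl

lemma twistEps_j (P : PolRetract p M n) (f : Pol k) :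
    twistEps p M (P.j f) = ((P.j (-(swapX k n * f)), P.j f), 0) := by
  rw [map_neg, ← P.j_x, twistEps_apply]

lemma mulJ_succ [Fact p.Prime] [CharP k p] (hp : 2 < p) (hM : Good p M) (P : PolRetract p M n)
    (b : Pol k × Pol k) : (P.succ hp hM).mulJ b = (P.j.prodMap P.j (psi k n b), 0) :=
  ((P.succ hp hM).mulJ_apply b).trans ((P.succ_j hp hM _).trans (P.twistEps_j _))

/-- The map `B_{n+1} → M ⊗_R pT` factors through `ψ` and the retract `B_n` of `M ⊗_R B`. -/
lemma tot_mulJ_succ [Fact p.Prime] [CharP k p] (hp : 2 < p) (hM : Good p M) (P : PolRetract p M n)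
    (x : PHH p (Bn k (n + 1))) : tot p (P.succ hp hM).isBi_mulJ x =
      tot p (isBi_inl M) (tot p P.isBi_j (tot p (isBi_psi n) x)) := by
  rw [← tot_comp, ← tot_comp]
  exact tot_congr p _ _ (P.mulJ_succ hp hM) x

/-- For `n` even, `B_{n+1} → M ⊗_R pT` vanishes on Hochschild homology, as it factors through `ψ`. -/
lemma tot_mulJ_eq_zero [Fact p.Prime] [CharP k p] (hp : 2 < p) (hM : Good p M) {m : ℕ}
    (P : PolRetract p M (2 * m)) : tot p (P.succ hp hM).isBi_mulJ = 0 := LinearMap.ext fun x => by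
  refine (P.tot_mulJ_succ hp hM x).trans ?_
  have h1 : tot p (isBi_psi (2 * m)) x = 0 := LinearMap.congr_fun (tot_psi_even (p := p) m) x
  rw [h1]
  exact (congrArg _ (map_zero (tot p P.isBi_j))).trans (map_zero _)

/-- The recursion step from an even number of crossings. -/
lemma cone_iso_even [Fact p.Prime] [CharP k p] (hp : 2 < p) (hM : Good p M) {m : ℕ}
    (P : PolRetract p M (2 * m)) : HomotopyIso p (totC p (TwistB p (TwistB p M)))
      (((totC p (Bn k (2 * m + 1))).sum (Sm p (totC p (TwistB p M)))).qShift (-3)) := by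
  have := (P.succ hp hM).cone_iso hp hM.twistB
  rw [P.tot_mulJ_eq_zero hp hM] at this
  exact this.trans (HomotopyIso.qShift (cone_zero _ _) _)

end PolRetract

end Connecting

end HqBimod

namespace QComplex

variable {p : ℕ} {M N L : QComplex k}

/-! ### Morphisms with acyclic kernel -/

/-- A surjective morphism with acyclic kernel. -/
structure AcyclicSurj (p : ℕ) (M N : QComplex k) (f : M.carrier →ₗ[k] N.carrier) : Prop where
  isHom : IsHom M N f
  surjective : Function.Surjective f
  acyclic : AcyclicOn p M.diff (ker f)

lemma AcyclicSurj.homotopyIso (hp : 0 < p) (hM : IsPComplex p M) (hN : IsPComplex p N)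
    {f : M.carrier →ₗ[k] N.carrier} (h : AcyclicSurj p M N f) : HomotopyIso p M N :=
  homotopyIso_of_surjective hp hM hN h.isHom h.surjective h.acyclic

lemma AcyclicSurj.id (M : QComplex k) : AcyclicSurj p M M LinearMap.id :=
  ⟨IsHom.id M, Function.surjective_id, by
    rw [show ker (LinearMap.id : M.carrier →ₗ[k] M.carrier) = ⊥ from LinearMap.ker_id]
    exact acyclicOn_bot _ _⟩

lemma AcyclicSurj.qShift {f : M.carrier →ₗ[k] N.carrier} (h : AcyclicSurj p M N f) (a : ℤ) :
    AcyclicSurj p (M.qShift a) (N.qShift a) f :=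
  ⟨h.isHom.qShift a, h.surjective, h.acyclic⟩

lemma AcyclicSurj.comp (hp : 0 < p) (hM : IsPComplex p M) {f : M.carrier →ₗ[k] N.carrier}
    {g : N.carrier →ₗ[k] L.carrier} (hf : AcyclicSurj p M N f) (hg : AcyclicSurj p N L g) :
    AcyclicSurj p M L (g ∘ₗ f) := by
  refine ⟨hg.isHom.comp hf.isHom, hg.surjective.comp hf.surjective, ?_⟩
  refine AcyclicOn.of_map (D' := N.diff) hp (fun x hx => ?_) (fun x _ => ?_) f
    (fun x _ => hf.isHom.comm x) ?_ ?_
  · have hx' : g (f x) = 0 := hx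
    change g (f (M.diff x)) = 0
    rw [hf.isHom.comm, hg.isHom.comm, hx', map_zero]
  · rw [hM.diff_pow]; rfl
  · have : ker (g ∘ₗ f) ⊓ ker f = ker f :=
      inf_eq_right.mpr fun x hx => by
        have hx' : f x = 0 := hx
        change g (f x) = 0
        rw [hx', map_zero]
    rw [this]; exact hf.acyclic
  · have : (ker (g ∘ₗ f)).map f = ker g := by
      ext y
      constructor
      · rintro ⟨x, hx, rfl⟩; exact hx
      · intro hy
        obtain ⟨x, rfl⟩ := hf.surjective y
        exact ⟨x, hy, rfl⟩
    rw [this]; exact hg.acyclic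

lemma AcyclicSurj.of_equiv {e : M.carrier ≃ₗ[k] N.carrier}
    (h : IsHom M N (e : M.carrier →ₗ[k] N.carrier)) :
    AcyclicSurj p M N (e : M.carrier →ₗ[k] N.carrier) :=
  ⟨h, e.surjective, by rw [LinearEquiv.ker]; exact acyclicOn_bot _ _⟩

/-- An acyclic surjection of both ends induces an isomorphism of cones. -/
lemma AcyclicSurj.cone_iso [Fact p.Prime] [CharP k p] {X Y X' Y' : QComplex k}
    (hX : IsPComplex p X) (hY : IsPComplex p Y)
    (hX' : IsPComplex p X') (hY' : IsPComplex p Y') {f : X.carrier →ₗ[k] Y.carrier}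
    {f' : X'.carrier →ₗ[k] Y'.carrier} (hf : IsHom X Y f) (hf' : IsHom X' Y' f')
    {a : X.carrier →ₗ[k] X'.carrier} {b : Y.carrier →ₗ[k] Y'.carrier} (ha : AcyclicSurj p X X' a)
    (hb : AcyclicSurj p Y Y' b) (hab : ∀ x, f' (a x) = b (f x)) :
    HomotopyIso p (cone p X Y f) (cone p X' Y' f') :=
  cone_surjective hX hY hX' hY' hf hf' ha.isHom hb.isHom hab ha.surjective hb.surjective ha.acyclic
    hb.acyclic

lemma IsHom.inl (M N : QComplex k) : IsHom M (sumC M N) (LinearMap.inl k _ _) :=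
  ⟨fun x => Prod.ext rfl (map_zero N.diff).symm, fun _ _ h => ⟨h, zero_mem _⟩⟩

lemma IsHom.to_cone_zero {X Y : QComplex k} {f : X.carrier →ₗ[k] Y.carrier} (hf : f = 0)
    {F : M.carrier →ₗ[k] X.carrier × (Fin (p - 1) → Y.carrier)} (h : IsHom M (cone p X Y f) F) :
    IsHom M (sumC X (Sm p Y)) F := by
  subst hf
  have hd : (cone p X Y 0).diff = (sumC X (Sm p Y)).diff :=
    cone_zero_diff X Y
  exact ⟨fun x => (h.comm x).trans (LinearMap.congr_fun hd _), h.map_mem⟩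

lemma IsPComplex.sumC (hM : IsPComplex p M) (hN : IsPComplex p N) : IsPComplex p (sumC M N) := by
  rw [← sum_eq]; exact hM.sum hN

/-- A cone depends on its target only through a summand up to an acyclic surjection. -/
lemma AcyclicSurj.cone_inl_iso [Fact p.Prime] [CharP k p] {X Y Y' S : QComplex k}
    (hX : IsPComplex p X) (hY : IsPComplex p Y) (hY' : IsPComplex p Y') (hS : IsPComplex p S)
    {f : X.carrier →ₗ[k] Y.carrier} {g : X.carrier →ₗ[k] Y'.carrier} (hf : IsHom X Y f)
    (hg : IsHom X Y' g) {b : Y.carrier →ₗ[k] Y'.carrier × S.carrier}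
    (hb : AcyclicSurj p Y (sumC Y' S) b) (h : ∀ x, b (f x) = (g x, 0)) :
    HomotopyIso p (cone p X Y f) ((cone p X Y' g).sum (Sm p S)) :=
  (AcyclicSurj.cone_iso hX hY hX (hY'.sumC hS) hf ((IsHom.inl Y' S).comp hg) (AcyclicSurj.id X) hb
    fun x => (h x).symm).trans (cone_inl X Y' S g)

end QComplex

namespace HqBimod

variable {p : ℕ}

lemma tot_psi_isHom (hp : 2 < p) (n : ℕ) :
    IsHom (totC p (Bn k (n + 1))) ((totC p (Bn k n)).qShift (-3)) (tot p (isBi_psi n)) := by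
  refine ⟨fun z => ?_, fun e z hz => ?_⟩
  · change tot p (isBi_psi n) (dtPHH p _ z + dC p _ z + dqPHH p _ z) =
      dtPHH p _ (tot p (isBi_psi n) z) + dC p _ (tot p (isBi_psi n) z) + dqPHH p _ (tot p (isBi_psi n) z)
    rw [map_add, map_add, tot_dC hp, tot_dqPHH p (isBi_psi n) (psi_dq n), dtPHH_eq, dtPHH_eq, ← tot_comp,
      ← tot_comp]
    refine congrArg (· + _ + _) (tot_congr _ _ _ (fun b => ?_) _)
    exact map_zero (psi k n)
  · have := tot_mem (p := p) (isBi_psi n) (d := 3) (fun e m hm => psi_mem n e m hm) hz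
    change _ ∈ (totC p (Bn k n)).gr (e - -3)
    rwa [sub_neg_eq_add]

lemma twistEquiv_inl {M : HqBimod k} (z : PHH p (Ind M)) :
    twistEquiv p M (tot p (isBi_inl M) z) = (z, 0) := by
  refine Prod.ext ?_ (funext fun j => ?_)
  · rw [twistEquiv_fst, ← tot_comp]
    exact (tot_congr p _ (IsBi.id _) (fun _ => rfl) z).trans (tot_id p z)
  · rw [twistEquiv_snd, ← tot_comp]
    exact (tot_congr p _ (IsBi.zero _ _) (fun _ => rfl) z).trans (tot_zero p z)

namespace PolRetract

variable {M : HqBimod k} {n : ℕ}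

/-- When `B_n → M` vanishes on Hochschild homology, the total complex of `M ⊗_R pT` splits. -/
lemma exists_acyclicSurj [Fact p.Prime] [CharP k p] (hp : 2 < p) (hM : Good p M)
    (P : PolRetract p M n) (h0 : tot p P.isBi_mulJ = 0) :
    ∃ b : PHH p (TwistB p M) →ₗ[k] PHH p (Bn k n) × (Fin (p - 1) → PHH p M),
      AcyclicSurj p (totC p (TwistB p M)) ((sumC (totC p (Bn k n))
        (Sm p (totC p M))).qShift (-3)) b ∧
      ∀ x, b (tot p (isBi_inl M) (tot p P.isBi_j x)) = (x, 0) := by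
  obtain ⟨F, hF, hs, ha, hFj⟩ := P.exists_cone hp hM
  have hA : AcyclicSurj p (cone p (totC p (Ind M)) (totC p M)
      (tot p (isBi_indMul M))) (sumC (totC p (Bn k n))
        (Sm p (totC p M))) F := ⟨hF.to_cone_zero h0, hs, ha⟩
  refine ⟨F ∘ₗ (twistEquiv p M).toLinearMap, ?_, fun x => ?_⟩
  · exact (AcyclicSurj.of_equiv (e := twistEquiv p M)
      (twistEquiv_isHom hp M)).comp (by omega) (hM.twistB.isPComplex hp) (hA.qShift (-3))
  · exact (congrArg F (twistEquiv_inl _)).trans (hFj x)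

/-- The recursion step from an odd number of crossings: once the total complex of `M ⊗_R pT` splits,
the map from `B_{n+1}` only meets the summand `B_n`, through `ψ`. -/
lemma cone_iso_of_eq_zero [Fact p.Prime] [CharP k p] (hp : 2 < p) (hM : Good p M)
    (P : PolRetract p M n) (h0 : tot p P.isBi_mulJ = 0) :
    HomotopyIso p (totC p (TwistB p (TwistB p M)))
      (((cone p (totC p (Bn k (n + 1))) ((totC p (Bn k n)).qShift (-3))
        (tot p (isBi_psi n))).sum (Sm p ((Sm p (totC p M)).qShift (-3)))).qShift (-3)) := by
  obtain ⟨b, hb, hbj⟩ := P.exists_acyclicSurj hp hM h0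
  have hN := (good_Npol hM P).ind.isPComplex hp
  have hN' := (good_Npol hM.twistB (P.succ hp hM)).ind.isPComplex hp
  have hS := (hM.isPComplex hp).blk (m := p - 1) (by omega) 2
  have hx : ∀ x : PHH p (Bn k (n + 1)), b (tot p (P.succ hp hM).isBi_mulJ x) = (tot p (isBi_psi n) x, 0) :=
    fun x => (congrArg b (P.tot_mulJ_succ hp hM x)).trans (hbj _)
  have hf := (P.succ hp hM).tot_mulJ_isHom hp hM.twistB
  have hg := tot_psi_isHom (k := k) hp n
  have hY := hM.twistB.isPComplex hp
  have hiso := (P.succ hp hM).cone_iso hp hM.twistB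
  have hN0 := hN.qShift (-3)
  have hS0 := hS.qShift (-3)
  generalize (tot p (P.succ hp hM).isBi_mulJ) = f at hx hf hiso
  generalize (tot p (isBi_psi (k := k) n)) = g at hx hg ⊢
  have h := AcyclicSurj.cone_inl_iso (X := totC p (Bn k (n + 1))) (Y := totC p (TwistB p M))
    (Y' := (totC p (Bn k n)).qShift (-3)) (S := (Sm p (totC p M)).qShift (-3))
    (f := f) (g := g) (b := b) hN' hY hN0 hS0 hf hg hb hx
  exact HomotopyIso.trans hiso (HomotopyIso.qShift h (-3))

end PolRetract

end HqBimod

/-! ### Two-step resolutions as `p`-complexes -/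

section PExtension

variable {A B C : Type*} [AddCommGroup A] [Module k A] [AddCommGroup B]
  [Module k B] [AddCommGroup C] [Module k C]

lemma acyclicOn_blkDiff_pi {p : ℕ} [Fact p.Prime] [CharP k p] (D : C →ₗ[k] C) (U : Submodule k C) :
    AcyclicOn p (blkDiff p D) (Submodule.pi Set.univ fun _ => U) := by
  have hp : 0 < p := (Fact.out : p.Prime).pos
  intro x hx hx'
  refine ⟨blkHomotopy k p hp C x, fun j _ => ?_, ?_⟩
  · change Pi.single (M := fun _ => C) _ _ j ∈ U
    by_cases hj : j = ⟨0, hp⟩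
    · subst hj; rw [Pi.single_eq_same]; exact hx _ trivial
    · rw [Pi.single_eq_of_ne hj]; exact U.zero_mem
  · rw [← homotopySum_apply_of_diff_eq_zero hp hx', blkDiff_homotopySum]; rfl

/-- Let `A → B → C` be exact at `A` and `B`. In the `p`-complex `A → B = ⋯ = B → C` the preimage of
the image of `B → C` is acyclic: it is an extension of `p` copies of that image by `p` copies of
`A`. -/
lemma acyclicOn_pExtension {p : ℕ} [Fact p.Prime] [CharP k p] (hp : 2 < p)
    {a : A →ₗ[k] B} {b : B →ₗ[k] C} {dA : A →ₗ[k] A} {dB : B →ₗ[k] B} {dC : C →ₗ[k] C}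
    {D : A × (Fin (p - 1) → B) × C →ₗ[k] A × (Fin (p - 1) → B) × C}
    (hA : ∀ z, (D z).1 = dA z.1)
    (hB : ∀ z (s : Fin (p - 1)), (D z).2.1 s =
      dB (z.2.1 s) + if h : (s : ℕ) + 1 < p - 1 then z.2.1 ⟨s + 1, h⟩ else a z.1)
    (hC : ∀ z, (D z).2.2 = dC z.2.2 + b (z.2.1 ⟨0, by omega⟩))
    (ha : ∀ x, a (dA x) = dB (a x)) (hb : ∀ x, b (dB x) = dC (b x)) (hD : D ^ p = 0)
    (hinj : Function.Injective a) (hex : ∀ x, b x = 0 ↔ ∃ y, a y = x) :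
    AcyclicOn p D ((LinearMap.range b).comap (snd k _ _ ∘ₗ snd k _ _)) := by
  have hp0 : 0 < p := by omega
  have hba : ∀ y, b (a y) = 0 := fun y => (hex _).mpr ⟨y, rfl⟩
  -- the quotient: `b` on the copies of `B`, the identity on `C`
  let g : A × (Fin (p - 1) → B) × C →ₗ[k] (Fin p → C) := LinearMap.pi fun j =>
    if h : (j : ℕ) < p - 1 then
      b ∘ₗ proj (⟨p - 2 - j, by omega⟩ : Fin (p - 1)) ∘ₗ fst k _ _ ∘ₗ snd k _ _
    else snd k _ _ ∘ₗ snd k _ _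
  have hg : ∀ z j, g z j = if h : (j : ℕ) < p - 1 then b (z.2.1 ⟨p - 2 - j, by omega⟩) else z.2.2 := by
    intro z j
    simp only [g, LinearMap.pi_apply]
    split_ifs <;> rfl
  -- the kernel: the identity on the first copy of `A`, `a` on the others
  let E : (Fin p → A) →ₗ[k] A × (Fin (p - 1) → B) × C := LinearMap.prod (proj ⟨0, hp0⟩)
    (LinearMap.prod (LinearMap.pi fun s => a ∘ₗ proj ⟨p - 1 - s, by omega⟩) 0)
  have hE1 : ∀ y, (E y).1 = y ⟨0, hp0⟩ := fun _ => rfl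
  have hE2 : ∀ y s, (E y).2.1 s = a (y ⟨p - 1 - s, by omega⟩) := fun _ _ => rfl
  have hE3 : ∀ y, (E y).2.2 = 0 := fun _ => rfl
  refine AcyclicOn.of_map (D' := blkDiff p dC) hp0 (fun z hz => ?_) (fun z _ => by rw [hD]; rfl) g
    (fun z _ => funext fun j => ?_) ?_ ?_
  · obtain ⟨x, hx⟩ := hz
    refine ⟨dB x + z.2.1 ⟨0, by omega⟩, ?_⟩
    change _ = (D z).2.2
    rw [hC, map_add, hb, hx]; rfl
  · rw [hg, blkDiff_apply]
    by_cases h : (j : ℕ) < p - 1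
    · rw [dif_pos h, hg z j, dif_pos h, hB, map_add, hb, add_comm]
      congr 1
      by_cases h0 : (j : ℕ) = 0
      · rw [dif_pos h0, dif_neg (by dsimp only; omega), hba]
      · rw [dif_neg h0, dif_pos (by dsimp only; omega), hg, dif_pos (by dsimp only; omega)]
        refine congrArg (fun i => b (z.2.1 i)) (Fin.ext ?_)
        dsimp only; omega
    · rw [dif_neg h, hg z j, dif_neg h, hC, add_comm, dif_neg (by omega), hg, dif_pos (by dsimp only; omega)]
      congr 1
      refine congrArg (fun i => b (z.2.1 i)) (Fin.ext ?_)
      dsimp only; omega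
  · have hk : (LinearMap.range b).comap (snd k A ((Fin (p - 1) → B) × C) |> (snd k (Fin (p - 1) → B) C ∘ₗ ·)) ⊓
        ker g = (⊤ : Submodule k (Fin p → A)).map E := by
      ext z
      constructor
      · rintro ⟨-, hz⟩
        have hz' : ∀ j, g z j = 0 := fun j => congrFun hz j
        have h0 : z.2.2 = 0 := by
          have := hz' ⟨p - 1, by omega⟩
          rwa [hg, dif_neg (by simp)] at this
        have h1 : ∀ s : Fin (p - 1), ∃ y, a y = z.2.1 s := fun s => by
          have := hz' ⟨p - 2 - s, by omega⟩
          rw [hg, dif_pos (by dsimp only; omega)] at this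
          rw [← hex, ← this]
          refine congrArg (fun i => b (z.2.1 i)) (Fin.ext ?_)
          dsimp only; omega
        choose y hy using h1
        refine ⟨fun j => if h : (j : ℕ) = 0 then z.1 else y ⟨p - 1 - j, by omega⟩, trivial, ?_⟩
        refine Prod.ext ?_ (Prod.ext (funext fun s => ?_) ?_)
        · rw [hE1, dif_pos rfl]
        · rw [hE2, dif_neg (by dsimp only; omega), hy]
          refine congrArg z.2.1 (Fin.ext ?_)
          dsimp only; omega
        · rw [hE3, h0]
      · rintro ⟨y, -, rfl⟩
        refine ⟨⟨0, ?_⟩, funext fun j => ?_⟩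
        · rw [map_zero]; exact (hE3 y).symm
        · rw [hg]
          split_ifs
          · rw [hE2, hba]; rfl
          · rw [hE3]; rfl
    refine hk ▸ AcyclicOn.map (D := blkDiff p dA) ?_ (fun y => ?_) (fun y y' h => funext fun j => ?_)
    · have := acyclicOn_blkDiff_pi (p := p) dA ⊤
      rwa [Submodule.pi_top] at this
    · refine Prod.ext ?_ (Prod.ext (funext fun s => ?_) ?_)
      · rw [hE1, hA, hE1, blkDiff_apply, dif_pos rfl, zero_add]
      · rw [hE2, hB, hE2, hE1, blkDiff_apply, map_add, ha, add_comm, dif_neg (by dsimp only; omega)]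
        congr 1
        split_ifs with h
        · rw [hE2]
          refine congrArg (fun i => a (y i)) (Fin.ext ?_)
          dsimp only; omega
        · refine congrArg (fun i => a (y i)) (Fin.ext ?_)
          dsimp only; omega
      · rw [hE3, hC, hE3, hE2, hba, map_zero, zero_add]
    · by_cases hj : (j : ℕ) = 0
      · have := congrArg Prod.fst h
        rw [hE1, hE1] at this
        rwa [show j = ⟨0, hp0⟩ from Fin.ext hj]
      · have := congrFun (congrArg (fun z => z.2.1) h) (⟨p - 1 - j, by omega⟩ : Fin (p - 1))
        simp only [hE2] at this
        have := hinj this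
        rwa [show (⟨p - 1 - (p - 1 - (j : ℕ)), by omega⟩ : Fin p) = j from Fin.ext (by dsimp only; omega)] at this
  · have hk : ((LinearMap.range b).comap (snd k A ((Fin (p - 1) → B) × C) |> (snd k (Fin (p - 1) → B) C ∘ₗ ·))).map g =
        Submodule.pi Set.univ fun _ => LinearMap.range b := by
      ext y
      constructor
      · rintro ⟨z, hz, rfl⟩ j -
        rw [hg]
        split_ifs
        · exact ⟨_, rfl⟩
        · exact hz
      · intro hy
        choose x hx using fun j => hy j trivial
        refine ⟨(0, fun s => x ⟨p - 2 - s, by omega⟩, y ⟨p - 1, by omega⟩), hy _ trivial, funext fun j => ?_⟩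
        rw [hg]
        split_ifs with h
        · rw [hx]
          refine congrArg y (Fin.ext ?_)
          dsimp only; omega
        · refine congrArg y (Fin.ext ?_)
          dsimp only; omega
    exact hk ▸ acyclicOn_blkDiff_pi dC _

end PExtension

namespace HqBimod

variable {p : ℕ} {M : HqBimod k}

lemma cauHH1_mapHH1 (hp : 2 < p) (x : HH1 M) : cauHH1 M (mapHH1 (dq_kosD1 M) (dq_kosD2 M) x) =
    mapHH0 (dq_kosD1 M) (cauHH1 M x) := by
  have := congrArg (fun z => z.2.2) (dC_dqPHH hp M (0, fun _ => x, 0))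
  rwa [dC_apply_zero _ _ _ (by omega), dqPHH_mk, dqPHH_mk, dC_apply_zero _ _ _ (by omega)] at this

lemma cauHH2_mapHH2 (hp : 2 < p) (x : HH2 M) : cauHH2 M (mapHH2 (dq_kosD2 M) x) =
    mapHH1 (dq_kosD1 M) (dq_kosD2 M) (cauHH2 M x) := by
  have h : ∀ z : PHH p M, (dC p M z).2.1 ⟨p - 2, by omega⟩ = cauHH2 M z.1 := fun z =>
    (dC_apply_one p M z _).trans (dif_neg (by dsimp only; omega))
  exact (h _).symm.trans ((congrArg (fun z => z.2.1 ⟨p - 2, by omega⟩) (dC_dqPHH hp M (x, 0, 0))).trans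
    (congrArg (mapHH1 (dq_kosD1 M) (dq_kosD2 M)) (h _)))

/-- If the topological differential is zero and `HH_2 → HH_1 → HH_0` is a resolution of `T`, the
total complex is isomorphic to `T`. -/
lemma acyclicSurj_of_resolution [Fact p.Prime] [CharP k p] (hp : 2 < p) (hM : Good p M)
    (ht : M.dt = 0) {T : QComplex k} {φ : HH0 M →ₗ[k] T.carrier}
    (hinj : Function.Injective (cauHH2 M)) (hex : ∀ x, cauHH1 M x = 0 → ∃ y, cauHH2 M y = x)
    (hφ : Function.Surjective φ) (hker : ∀ z, φ z = 0 ↔ ∃ x, cauHH1 M x = z)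
    (hdq : ∀ m : M.carrier, φ (Submodule.Quotient.mk (M.dq m)) = T.diff (φ (Submodule.Quotient.mk m)))
    (hgr : ∀ e, ∀ m ∈ M.gr e, φ (Submodule.Quotient.mk m) ∈ T.gr e) :
    AcyclicSurj p (totC p M) T (φ ∘ₗ snd k _ _ ∘ₗ snd k _ _) := by
  have hdt : ∀ z, dtPHH p M z = 0 := fun z =>
    (tot_congr p (IsBi.dt M) (IsBi.zero M M) (fun m => by rw [ht]) z).trans (tot_zero p z)
  have hD : ∀ z : PHH p M, (totC p M).diff z = dC p M z + dqPHH p M z := fun z => by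
    change dtPHH p M z + dC p M z + dqPHH p M z = _
    rw [hdt, zero_add]
  have h0 : ∀ z : PHH p M, ((totC p M).diff z : PHH p M).2.2 = mapHH0 (dq_kosD1 M) z.2.2 +
      cauHH1 M (z.2.1 ⟨0, by omega⟩) := fun z => by
    refine (congrArg (fun z => z.2.2) (hD z)).trans ((add_comm _ _).trans ?_)
    exact congrArg _ (dC_apply_zero p M z _)
  refine ⟨⟨fun z => ?_, fun e z hz => ?_⟩, fun t => ?_, ?_⟩
  · refine (congrArg φ (h0 z)).trans ?_
    rw [map_add, (hker (cauHH1 M _)).mpr ⟨_, rfl⟩, add_zero]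
    obtain ⟨a, v, m, rfl⟩ := PHH_rep z
    exact hdq m
  · obtain ⟨-, -, m, hm, h⟩ := mem_totC.mp hz
    change φ z.2.2 ∈ _
    rw [← h]; exact hgr e m hm
  · obtain ⟨x, rfl⟩ := hφ t
    exact ⟨(0, 0, x), rfl⟩
  · have hk : ker (φ ∘ₗ snd k (Fin (p - 1) → HH1 M) (HH0 M) ∘ₗ snd k (HH2 M) _) =
        (LinearMap.range (cauHH1 M)).comap (snd k _ _ ∘ₗ snd k _ _) :=
      Submodule.ext fun z => hker z.2.2
    refine hk ▸ acyclicOn_pExtension hp (a := cauHH2 M) (b := cauHH1 M) (dA := mapHH2 (dq_kosD2 M))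
      (dB := mapHH1 (dq_kosD1 M) (dq_kosD2 M)) (dC := mapHH0 (dq_kosD1 M)) (fun z => ?_) (fun z s => ?_) h0
      (cauHH2_mapHH2 hp) (cauHH1_mapHH1 hp) (hM.isPComplex hp).diff_pow hinj
      (fun x => ⟨hex x, ?_⟩)
    · exact (congrArg Prod.fst (hD z)).trans (zero_add _)
    · refine (congrArg (fun z => z.2.1 s) (hD z)).trans ((add_comm _ _).trans ?_)
      exact congrArg _ (dC_apply_one p M z s)
    · rintro ⟨y, rfl⟩; exact cauHH1_cauHH2 M y

/-! ### Hochschild homology of `B_n` and `R` -/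

section Resolution

variable {p : ℕ}

lemma two_ne_zero_of_charP [CharP k p] (hp : 2 < p) : (2 : k) ≠ 0 := by
  intro h
  have := (CharP.cast_eq_zero_iff k p 2).mp (by exact_mod_cast h)
  exact absurd (Nat.le_of_dvd (by norm_num) this) (by omega)

lemma exists_half (h2 : (2 : k) ≠ 0) : ∃ c : Pol k, 2 * c = 1 :=
  ⟨C 2⁻¹, by
    rw [show (2 : Pol k) = C 2 from (map_ofNat _ 2).symm, ← map_mul, mul_inv_cancel₀ h2, map_one]⟩

lemma not_X_dvd {i : Fin 2} {f : Pol k} (v : Fin 2 → k) (hi : v i = 0) (hf : MvPolynomial.eval v f ≠ 0) :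
    ¬ X i ∣ f := by
  rintro ⟨g, rfl⟩
  simp [hi] at hf

lemma isRelPrime_X {i : Fin 2} {f : Pol k} (v : Fin 2 → k) (hi : v i = 0)
    (hf : MvPolynomial.eval v f ≠ 0) : IsRelPrime (X i) f :=
  (MvPolynomial.X_prime (R := k) (i := i)).irreducible.isRelPrime_iff_not_dvd.mpr (not_X_dvd v hi hf)

/-- The polynomials `x_1² + x_2²` and `x_1² (x_1 - x_2)` are coprime when `2` is invertible. -/
lemma isRelPrime_koszul (h2 : (2 : k) ≠ 0) :
    IsRelPrime (X 0 ^ 2 + X 1 ^ 2 : Pol k) (X 0 ^ 2 * (X 0 - X 1)) := by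
  have h1 : IsRelPrime (X 0 ^ 2 + X 1 ^ 2 : Pol k) (X 0) :=
    (isRelPrime_X ![0, 1] (by simp) (by simp)).symm
  have h3 : IsRelPrime (X 0 - X 1 : Pol k) (X 0 ^ 2 + X 1 ^ 2) := by
    have h4 : IsRelPrime (X 0 - X 1 : Pol k) (X 1) :=
      (isRelPrime_X ![1, 0] (by simp) (by simp)).symm
    have h5 : IsRelPrime (X 0 - X 1 : Pol k) (C 2 * X 1 ^ 2) :=
      IsRelPrime.mul_right (((isUnit_iff_ne_zero.mpr h2).map C).isRelPrime_right) h4.pow_right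
    have := h5.mul_add_left_right (X 0 + X 1)
    convert this using 1
    rw [show (C 2 : Pol k) = 2 from map_ofNat _ 2]
    ring
  exact IsRelPrime.mul_right h1.pow_right h3.symm

lemma isRelPrime_sq : IsRelPrime (X 0 ^ 2 : Pol k) (X 1 ^ 2) :=
  ((isRelPrime_X ![0, 1] (by simp) (by simp) : IsRelPrime (X 0 : Pol k) (X 1)).pow_left).pow_right

/-- The syzygies of a regular sequence of length two. -/
lemma exists_of_isRelPrime {a b f g : Pol k} (hab : IsRelPrime a b) (ha : a ≠ 0)
    (h : a * g + b * f = 0) : ∃ c, f = a * c ∧ g = -(b * c) := by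
  obtain ⟨c, rfl⟩ : a ∣ f := hab.dvd_of_dvd_mul_left ⟨-g, by linear_combination h⟩
  refine ⟨c, rfl, mul_left_cancel₀ ha ?_⟩
  linear_combination h

lemma cau_of_kos {M : HqBimod k} {i : Fin 2} {m : M.carrier} (h : kos M i m = 0) :
    cau M i m = M.lft (X i ^ 2) m + M.lft (X i ^ 2) m := by
  have h1 : M.lft (X i) m = M.rgt (X i) m := sub_eq_zero.mp h
  change M.lft (X i ^ 2) m + M.rgt (X i ^ 2) m = _
  rw [pow_two, map_mul, map_mul, Module.End.mul_apply, Module.End.mul_apply, ← h1, ← M.lft_rgt, ← h1]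

/-- The identification of `HH_0(B_n)` with `R`. -/
noncomputable def evHH0 (k : Type u) [Field k] (n : ℕ) : HH0 (Bn k n) →ₗ[k] Pol k :=
  (LinearMap.range (kosD1 (Bn k n))).liftQ (indMul (Npol k n)) <| by
    rintro _ ⟨v, rfl⟩
    refine LinearMap.mem_ker.mpr (((isBi_indMul (Npol k n)).kosD1 v).trans ?_)
    have h : ∀ i (f : Pol k), kos (Npol k n) i f = 0 := fun i f => sub_self _
    change kos (Npol k n) 0 _ + kos (Npol k n) 1 _ = 0
    rw [h, h, add_zero]

lemma evHH0_mk (n : ℕ) (b : Pol k × Pol k) :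
    evHH0 k n (Submodule.Quotient.mk b) = b.1 + X 0 * b.2 := rfl

lemma evHH0_dq (n : ℕ) (b : Pol k × Pol k) : evHH0 k n (Submodule.Quotient.mk ((Bn k n).dq b)) =
    polDer k (b.1 + X 0 * b.2) + n • (e1 k * (b.1 + X 0 * b.2)) :=
  indMul_dq (Npol k n) b

lemma Bn_cauD2 (n : ℕ) (b : HH2 (Bn k n)) : cauD2 (Bn k n) b.1 =
    ((X 1 ^ 2 * b.1.1 + X 1 ^ 2 * b.1.1, X 1 ^ 2 * b.1.2 + X 1 ^ 2 * b.1.2),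
      (-(X 0 ^ 2 * b.1.1 + X 0 ^ 2 * b.1.1), -(X 0 ^ 2 * b.1.2 + X 0 ^ 2 * b.1.2))) := by
  have hb : kosD2 (Bn k n) b.1 = 0 := b.2
  have h1 : kos (Bn k n) 1 b.1 = 0 := congrArg Prod.fst hb
  have h0 : kos (Bn k n) 0 b.1 = 0 := neg_eq_zero.mp (congrArg Prod.snd hb)
  exact Prod.ext (cau_of_kos h1) (congrArg Neg.neg (cau_of_kos h0))

lemma Bn_HH2 (n : ℕ) (b : HH2 (Bn k n)) : b.1.1 = -(X 1 * b.1.2) := by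
  have hb : kosD2 (Bn k n) b.1 = 0 := b.2
  have h0 : kos (Bn k n) 0 b.1 = 0 := neg_eq_zero.mp (congrArg Prod.snd hb)
  rw [Bn_kos0] at h0
  have h : -(b.1.1 + X 1 * b.1.2) = 0 := congrArg Prod.snd h0
  linear_combination -h

lemma Bn_mem_HH2 (n : ℕ) (f : Pol k) :
    (-(X 1 * f), f) ∈ ker (kosD2 (Bn k n)) := by
  have h : kos (Bn k n) 0 (-(X 1 * f), f) = 0 := by
    rw [Bn_kos0]
    refine Prod.ext ?_ ?_ <;> dsimp only <;> simp
  have h' : kos (Bn k n) 1 (-(X 1 * f), f) = 0 := by rw [Bn_kos1, h, neg_zero]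
  exact Prod.ext h' ((congrArg Neg.neg h).trans neg_zero)

lemma Bn_kosD1 (n : ℕ) (v : (Pol k × Pol k) × (Pol k × Pol k)) : kosD1 (Bn k n) v =
    (X 0 * ((v.1.1 + X 1 * v.1.2) - (v.2.1 + X 1 * v.2.2)),
      -((v.1.1 + X 1 * v.1.2) - (v.2.1 + X 1 * v.2.2))) := by
  change kos (Bn k n) 0 v.1 + kos (Bn k n) 1 v.2 = _
  rw [Bn_kos1, Bn_kos0, Bn_kos0]
  refine Prod.ext ?_ ?_ <;> simp only [Prod.fst_add, Prod.snd_add, Prod.fst_neg, Prod.snd_neg] <;> ring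

lemma Bn_kosD2 (n : ℕ) (b : Pol k × Pol k) : kosD2 (Bn k n) b =
    ((-(X 0 * (b.1 + X 1 * b.2)), b.1 + X 1 * b.2), (-(X 0 * (b.1 + X 1 * b.2)), b.1 + X 1 * b.2)) := by
  have h : -kos (Bn k n) 0 b = (-(X 0 * (b.1 + X 1 * b.2)), b.1 + X 1 * b.2) := by
    rw [Bn_kos0]
    refine Prod.ext ?_ ?_ <;> simp only [Prod.fst_neg, Prod.snd_neg, neg_neg]
  exact Prod.ext ((Bn_kos1 n b).trans h) h

/-- The image of `d_C` on `HH_1(B_n)`. -/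
lemma evHH0_cauHH1 (n : ℕ) (v : ker (kosD1 (Bn k n))) :
    evHH0 k n (cauHH1 (Bn k n) (mk1 (Bn k n) v)) =
      2 * (X 0 ^ 2 * (v.1.1.1 + X 0 * v.1.1.2) + X 1 ^ 2 * (v.1.2.1 + X 0 * v.1.2.2)) := by
  have h (i : Fin 2) (b : Pol k × Pol k) : indMul (Npol k n) (cau (Bn k n) i b) =
      2 * (X i ^ 2 * (b.1 + X 0 * b.2)) := by
    rw [(isBi_indMul (Npol k n)).cau i b]
    change X i ^ 2 * _ + X i ^ 2 * _ = _
    rw [two_mul]; rfl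
  change indMul (Npol k n) (cau (Bn k n) 0 v.1.1 + cau (Bn k n) 1 v.1.2) = _
  rw [map_add, h, h, ← mul_add]

lemma Bn_mem_ker (n : ℕ) (v : ker (kosD1 (Bn k n))) :
    v.1.1.1 + X 1 * v.1.1.2 = v.1.2.1 + X 1 * v.1.2.2 := by
  have h := LinearMap.mem_ker.mp v.2
  rw [Bn_kosD1] at h
  have h' := congrArg Prod.snd h
  exact sub_eq_zero.mp (neg_eq_zero.mp h')

/-- `HH_2(B_n) → HH_1(B_n) → HH_0(B_n)` is the Koszul complex of the regular sequence
`x_1² + x_2²`, `x_1² (x_1 - x_2)`. -/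
lemma Bn_acyclicSurj [Fact p.Prime] [CharP k p] (hp : 2 < p) {n : ℕ} (hB : Good p (Bn k n))
    {T : QComplex k} {φ : Pol k →ₗ[k] T.carrier} (hs : Function.Surjective φ)
    (hk : ∀ f, φ f = 0 ↔ ∃ g h, f = (X 0 ^ 2 + X 1 ^ 2) * g + X 0 ^ 2 * (X 0 - X 1) * h)
    (hdq : ∀ f, φ (polDer k f + n • (e1 k * f)) = T.diff (φ f))
    (hgr : ∀ e, ∀ f ∈ polGr(k) e,
      φ f ∈ T.gr e) :
    AcyclicSurj p (totC p (Bn k n)) (T.qShift (-n))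
      ((φ ∘ₗ evHH0 k n) ∘ₗ snd k _ _ ∘ₗ snd k _ _) := by
  have h2 := two_ne_zero_of_charP (k := k) hp
  have h2P : (2 : Pol k) ≠ 0 := by
    rw [show (2 : Pol k) = C 2 from (map_ofNat _ 2).symm]
    simpa using h2
  obtain ⟨c2, hc2⟩ := exists_half h2
  have hA : (X 0 ^ 2 + X 1 ^ 2 : Pol k) ≠ 0 := fun h => by
    have := congrArg (MvPolynomial.eval ![1, 0]) h
    simp at this
  -- an element of `HH_1` is determined by two polynomials
  have hmk : ∀ v : ker (kosD1 (Bn k n)), v.1.1.2 = v.1.2.2 → v.1.2.1 + X 0 * v.1.2.2 = 0 →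
      mk1 (Bn k n) v = 0 := fun v h h' => by
    have hv := Bn_mem_ker n v
    refine (Submodule.Quotient.mk_eq_zero _).mpr ⟨(v.1.2.2, 0), ?_⟩
    rw [Bn_kosD2]
    refine Prod.ext (Prod.ext ?_ ?_) (Prod.ext ?_ ?_)
    · change -(X 0 * (v.1.2.2 + X 1 * 0)) = v.1.1.1
      linear_combination -hv + X 1 * h - h'
    · change v.1.2.2 + X 1 * 0 = v.1.1.2
      linear_combination -h
    · change -(X 0 * (v.1.2.2 + X 1 * 0)) = v.1.2.1
      linear_combination -h'
    · change v.1.2.2 + X 1 * 0 = v.1.2.2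
      ring
  have hmk0 : ∀ m : Pol k × Pol k, m.1 + X 0 * m.2 = 0 →
      m ∈ LinearMap.range (kosD1 (Bn k n)) := fun m h => by
    refine ⟨((-m.2, 0), 0), ?_⟩
    rw [Bn_kosD1]
    refine Prod.ext ?_ ?_
    · change X 0 * ((-m.2 + X 1 * 0) - (0 + X 1 * 0)) = m.1
      linear_combination -h
    · change -((-m.2 + X 1 * 0) - (0 + X 1 * 0)) = m.2
      ring
  refine acyclicSurj_of_resolution hp hB rfl (T := T.qShift (-n)) ?_ ?_ ?_ ?_ ?_ ?_
  · refine (injective_iff_map_eq_zero _).mpr fun b hb => ?_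
    obtain ⟨c, hc⟩ := (Submodule.Quotient.mk_eq_zero _).mp hb
    have hc' : kosD2 (Bn k n) c = cauD2 (Bn k n) b.1 := hc
    rw [Bn_kosD2, Bn_cauD2] at hc'
    have e1 := congrArg (fun v => v.1.2) hc'
    have e2 := congrArg (fun v => v.2.2) hc'
    dsimp only at e1 e2
    have h3 : 2 * ((X 0 ^ 2 + X 1 ^ 2) * b.1.2) = 0 := by linear_combination e2 - e1
    have h4 : b.1.2 = 0 := by simpa [h2P, hA] using h3
    refine Subtype.ext (Prod.ext ?_ h4)
    rw [Bn_HH2, h4]; simp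
  · intro x hx
    obtain ⟨v, rfl⟩ := Submodule.Quotient.mk_surjective _ x
    have hx' := congrArg (evHH0 k n) hx
    rw [map_zero] at hx'
    have hx2 := (evHH0_cauHH1 n v).symm.trans hx'
    have hv := Bn_mem_ker n v
    have h3 : (X 0 ^ 2 + X 1 ^ 2) * (v.1.2.1 + X 0 * v.1.2.2) +
        (X 0 ^ 2 * (X 0 - X 1)) * (v.1.1.2 - v.1.2.2) = 0 := by
      refine mul_left_cancel₀ h2P ?_
      linear_combination hx2 - 2 * X 0 ^ 2 * hv
    obtain ⟨c, hf, hg⟩ := exists_of_isRelPrime (isRelPrime_koszul h2) hA h3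
    obtain ⟨w, hw, hw'⟩ : ∃ w : ker (kosD1 (Bn k n)),
        w.1 = cauD2 (Bn k n) (-(X 1 * (c2 * c)), c2 * c) ∧
        cauHH2 (Bn k n) ⟨_, Bn_mem_HH2 n (c2 * c)⟩ = mk1 (Bn k n) w := ⟨_, rfl, rfl⟩
    refine ⟨⟨_, Bn_mem_HH2 n (c2 * c)⟩, hw'.trans (sub_eq_zero.mp ?_)⟩
    have hw2 := hw.trans (Bn_cauD2 n ⟨_, Bn_mem_HH2 n (c2 * c)⟩)
    have w1 := congrArg (fun v => v.1.2) hw2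
    have w2 := congrArg (fun v => v.2.1) hw2
    have w3 := congrArg (fun v => v.2.2) hw2
    dsimp only at w1 w2 w3
    refine hmk (w - v) ?_ ?_
    · change w.1.1.2 - v.1.1.2 = w.1.2.2 - v.1.2.2
      linear_combination w1 - w3 - hf + (X 0 ^ 2 + X 1 ^ 2) * c * hc2
    · change (w.1.2.1 - v.1.2.1) + X 0 * (w.1.2.2 - v.1.2.2) = 0
      linear_combination w2 + X 0 * w3 - hg - (X 0 ^ 2 * (X 0 - X 1)) * c * hc2
  · intro t
    obtain ⟨f, rfl⟩ := hs t
    refine ⟨Submodule.Quotient.mk (f, 0), congrArg φ ?_⟩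
    rw [evHH0_mk, mul_zero, add_zero]
  · intro z
    obtain ⟨m, rfl⟩ := Submodule.Quotient.mk_surjective _ z
    refine (hk (m.1 + X 0 * m.2)).trans ⟨?_, ?_⟩
    · rintro ⟨g, h, e⟩
      let v : (Pol k × Pol k) × (Pol k × Pol k) := ((c2 * g - X 1 * (c2 * h), c2 * h), (c2 * g, 0))
      have hv : v ∈ ker (kosD1 (Bn k n)) := by
        rw [LinearMap.mem_ker, Bn_kosD1]
        refine Prod.ext ?_ ?_
        · change X 0 * ((c2 * g - X 1 * (c2 * h) + X 1 * (c2 * h)) - (c2 * g + X 1 * 0)) = 0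
          ring
        · change -((c2 * g - X 1 * (c2 * h) + X 1 * (c2 * h)) - (c2 * g + X 1 * 0)) = 0
          ring
      refine ⟨mk1 (Bn k n) ⟨v, hv⟩, ?_⟩
      have h4 := evHH0_cauHH1 n ⟨v, hv⟩
      obtain ⟨m', hm'⟩ := Submodule.Quotient.mk_surjective _ (cauHH1 (Bn k n) (mk1 (Bn k n) ⟨v, hv⟩))
      rw [← hm']
      rw [← hm', evHH0_mk] at h4
      refine (Submodule.Quotient.eq _).mpr (hmk0 _ ?_)
      have h5 : m'.1 + X 0 * m'.2 = 2 * (X 0 ^ 2 * (c2 * g - X 1 * (c2 * h) + X 0 * (c2 * h)) +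
        X 1 ^ 2 * (c2 * g + X 0 * 0)) := h4
      change (m'.1 - m.1) + X 0 * (m'.2 - m.2) = 0
      linear_combination h5 - e + ((X 0 ^ 2 + X 1 ^ 2) * g + X 0 ^ 2 * (X 0 - X 1) * h) * hc2
    · rintro ⟨x, hx⟩
      obtain ⟨v, rfl⟩ := Submodule.Quotient.mk_surjective _ x
      have hx2 := (evHH0_cauHH1 n v).symm.trans (congrArg (evHH0 k n) hx)
      rw [evHH0_mk] at hx2
      have hv := Bn_mem_ker n v
      refine ⟨2 * (v.1.2.1 + X 0 * v.1.2.2), 2 * (v.1.1.2 - v.1.2.2), ?_⟩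
      linear_combination -hx2 + 2 * X 0 ^ 2 * hv
  · intro m
    refine (congrArg φ (evHH0_dq n m)).trans (hdq _)
  · intro e m hm
    change φ (m.1 + X 0 * m.2) ∈ T.gr (e - -n)
    rw [sub_neg_eq_add]
    refine hgr _ _ (add_mem hm.1 ?_)
    have := X_mul_mem 0 hm.2
    rwa [show e - 2 + (n : ℤ) + 2 = e + n by ring] at this

lemma reg_kos (i : Fin 2) (f : Pol k) : kos (reg k) i f = 0 := sub_self _

lemma reg_kosD1 (v : Pol k × Pol k) : kosD1 (reg k) v = 0 := by
  change kos (reg k) 0 v.1 + kos (reg k) 1 v.2 = 0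
  rw [reg_kos, reg_kos]; exact add_zero (0 : Pol k)

lemma reg_kosD2 (f : Pol k) : kosD2 (reg k) f = 0 :=
  Prod.ext (reg_kos 1 f) ((congrArg Neg.neg (reg_kos 0 f)).trans (neg_zero (G := Pol k)))

/-- The identification of `HH_0(R)` with `R`. -/
noncomputable def regHH0 (k : Type u) [Field k] : HH0 (reg k) →ₗ[k] Pol k :=
  (LinearMap.range (kosD1 (reg k))).liftQ (LinearMap.id : Pol k →ₗ[k] Pol k) <| by
    rintro _ ⟨v, rfl⟩
    exact reg_kosD1 v

lemma regHH0_injective : Function.Injective (regHH0 k) := by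
  refine (injective_iff_map_eq_zero _).mpr fun z hz => ?_
  obtain ⟨f, rfl⟩ := Submodule.Quotient.mk_surjective _ z
  have hf : f = 0 := hz
  rw [hf]; rfl

lemma regHH0_cauHH1 (f g : Pol k) : regHH0 k (cauHH1 (reg k) (mk1 (reg k) ⟨(f, g), reg_kosD1 (f, g)⟩)) =
    2 * (X 0 ^ 2 * f + X 1 ^ 2 * g) := by
  change (X 0 ^ 2 * f + X 0 ^ 2 * f) + (X 1 ^ 2 * g + X 1 ^ 2 * g) = _
  ring

lemma reg_cauHH2 (f : Pol k) : cauHH2 (reg k) ⟨f, reg_kosD2 f⟩ =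
    mk1 (reg k) ⟨(2 * (X 1 ^ 2 * f), -(2 * (X 0 ^ 2 * f))), reg_kosD1 _⟩ := by
  refine congrArg (mk1 (reg k)) (Subtype.ext ?_)
  exact Prod.ext (two_mul (X 1 ^ 2 * f)).symm (congrArg Neg.neg (two_mul (X 0 ^ 2 * f)).symm)

/-- `HH_2(R) → HH_1(R) → HH_0(R)` is the Koszul complex of the regular sequence `x_1²`, `x_2²`. -/
lemma reg_acyclicSurj [Fact p.Prime] [CharP k p] (hp : 2 < p)
    {T : QComplex k} {φ : Pol k →ₗ[k] T.carrier} (hs : Function.Surjective φ)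
    (hk : ∀ f, φ f = 0 ↔ ∃ g h, f = X 0 ^ 2 * g + X 1 ^ 2 * h)
    (hdq : ∀ f, φ (polDer k f) = T.diff (φ f))
    (hgr : ∀ e, ∀ f ∈ polGr(k) e,
      φ f ∈ T.gr e) :
    AcyclicSurj p (totC p (reg k)) T
      ((φ ∘ₗ regHH0 k) ∘ₗ snd k _ _ ∘ₗ snd k _ _) := by
  have h2 := two_ne_zero_of_charP (k := k) hp
  obtain ⟨c2, hc2⟩ := exists_half h2
  have hX : (X 0 ^ 2 : Pol k) ≠ 0 := pow_ne_zero _ (MvPolynomial.X_ne_zero 0)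
  have hmk' : ∀ v : ker (kosD1 (reg k)), mk1 (reg k) v = 0 → v.1 = 0 := fun v h => by
    obtain ⟨c, hc⟩ := (Submodule.Quotient.mk_eq_zero _).mp h
    exact Eq.trans (Eq.symm hc) (reg_kosD2 c)
  refine acyclicSurj_of_resolution hp (good_reg) rfl ?_ ?_ ?_ ?_ ?_ ?_
  · refine (injective_iff_map_eq_zero _).mpr ?_
    rintro ⟨f, hf⟩ h
    change Pol k at f
    have h3 : -(2 * (X 0 ^ 2 * (f : Pol k))) = 0 := congrArg Prod.snd (hmk' _ ((reg_cauHH2 f).symm.trans h))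
    have h4 : X 0 ^ 2 * (f : Pol k) = 0 := by
      linear_combination -c2 * h3 - X 0 ^ 2 * (f : Pol k) * hc2
    exact Subtype.ext ((mul_eq_zero.mp h4).resolve_left hX)
  · intro x hx
    obtain ⟨⟨⟨f, g⟩, hv⟩, rfl⟩ := Submodule.Quotient.mk_surjective _ x
    change Pol k at f g
    have hx2 := (regHH0_cauHH1 f g).symm.trans ((congrArg (regHH0 k) hx).trans (map_zero _))
    have h3 : X 0 ^ 2 * f + X 1 ^ 2 * g = 0 := by
      linear_combination c2 * hx2 - (X 0 ^ 2 * f + X 1 ^ 2 * g) * hc2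
    obtain ⟨c, hf, hg⟩ := exists_of_isRelPrime isRelPrime_sq hX h3
    refine ⟨⟨-(c2 * c), reg_kosD2 _⟩, (reg_cauHH2 _).trans (congrArg (mk1 (reg k)) (Subtype.ext (Prod.ext ?_ ?_)))⟩
    · change 2 * (X 1 ^ 2 * -(c2 * c)) = f
      linear_combination -hg - X 1 ^ 2 * c * hc2
    · change -(2 * (X 0 ^ 2 * -(c2 * c))) = g
      linear_combination -hf + X 0 ^ 2 * c * hc2
  · intro t
    obtain ⟨f, rfl⟩ := hs t
    exact ⟨Submodule.Quotient.mk f, rfl⟩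
  · intro z
    obtain ⟨m, rfl⟩ := Submodule.Quotient.mk_surjective _ z
    change Pol k at m
    refine (hk m).trans ⟨?_, ?_⟩
    · rintro ⟨g, h, e⟩
      refine ⟨mk1 (reg k) ⟨(c2 * g, c2 * h), reg_kosD1 _⟩, regHH0_injective ?_⟩
      refine (regHH0_cauHH1 _ _).trans ?_
      change 2 * (X 0 ^ 2 * (c2 * g) + X 1 ^ 2 * (c2 * h)) = m
      linear_combination -e + (X 0 ^ 2 * g + X 1 ^ 2 * h) * hc2
    · rintro ⟨x, hx⟩
      obtain ⟨⟨⟨f, g⟩, hv⟩, rfl⟩ := Submodule.Quotient.mk_surjective _ x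
      change Pol k at f g
      have hx2 : _ = (m : Pol k) := (regHH0_cauHH1 f g).symm.trans (congrArg (regHH0 k) hx)
      refine ⟨(2 : Pol k) * f, (2 : Pol k) * g, Eq.trans hx2.symm ?_⟩
      ring
  · exact hdq
  · exact hgr

end Resolution

end HqBimod

/-! ### Finite-dimensional models -/

section Models

/-- A complex with basis `e_0, …, e_{n-1}`, where `e_j` has degree `s + 2j`, `∂ e_j = c e_{j+1}` and
`∂ e_{n-1} = 0`. -/
abbrev Wd (k : Type u) [Field k] (n : ℕ) (s : ℤ) (c : k) : QComplex k where
  carrier := Fin n → k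
  gr := (Blk n s (unitC k)).gr
  diff := c • blkShift k n k

lemma mem_Wd {n : ℕ} {s e : ℤ} {c : k} {v : Fin n → k} :
    v ∈ (Wd k n s c).gr e ↔ ∀ j : Fin n, s + 2 * ((j : ℕ) : ℤ) ≠ e → v j = 0 := by
  refine mem_Blk.trans (forall_congr' fun j => ?_)
  change v j ∈ (if e - s - 2 * ((j : ℕ) : ℤ) = 0 then (⊤ : Submodule k k) else ⊥) ↔ _
  split_ifs with h
  · exact ⟨fun _ h' => absurd (by omega) h', fun _ => trivial⟩
  · exact ⟨fun h' _ => h', fun h' => h' (by omega)⟩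

lemma Wd_diff_apply {n : ℕ} {s : ℤ} {c : k} (v : Fin n → k) (j : Fin n) :
    (Wd k n s c).diff v j = c * if h : (j : ℕ) = 0 then 0 else v ⟨(j : ℕ) - 1, by omega⟩ := by
  change c * blkShift k n k v j = _
  rw [blkShift_apply]

lemma Wd_isPComplex {p : ℕ} [Fact p.Prime] [CharP k p] {n : ℕ} (hn : n ≤ p) (s : ℤ) (c : k) :
    IsPComplex p (Wd k n s c) := by
  have h := (unitC_isPComplex (k := k) (p := p) (Fact.out : p.Prime).pos).blk hn s
  have hd : (Blk n s (unitC k)).diff = blkShift k n k :=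
    LinearMap.ext fun v => add_zero (blkShift k n k v)
  refine ⟨h.internal, fun e v hv => Submodule.smul_mem _ c ?_, ?_⟩
  · have := h.diff_mem e v hv
    rwa [hd] at this
  · have := h.diff_pow
    rw [hd] at this
    change (c • blkShift k n k) ^ p = 0
    rw [smul_pow, this, smul_zero]

section ModelMap

variable {T : Type*} [AddCommGroup T] [Module k T] {P Q : Module.End k T} {h : Commute P Q}

/-- The `R`-linear map `R → T` sending `1` to `u`, where `x_1`, `x_2` act on `T` by `P`, `Q`. -/
noncomputable def modelMap (P Q : Module.End k T) (h : Commute P Q) (u : T) : Pol k →ₗ[k] T :=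
  LinearMap.applyₗ u ∘ₗ (polHom P Q h).toLinearMap

lemma modelMap_apply (u : T) (f : Pol k) : modelMap P Q h u f = polHom P Q h f u := rfl

lemma modelMap_mul (u : T) (f g : Pol k) : modelMap P Q h u (f * g) = polHom P Q h f (modelMap P Q h u g) := by
  rw [modelMap_apply, map_mul]; rfl

lemma modelMap_mem {gr : ℤ → Submodule k T} (hP : ∀ e, ∀ t ∈ gr e, P t ∈ gr (e + 2))
    (hQ : ∀ e, ∀ t ∈ gr e, Q t ∈ gr (e + 2)) {u : T} (hu : u ∈ gr 0) {e : ℤ} {f : Pol k}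
    (hf : f ∈ polGr(k) e) :
    modelMap P Q h u f ∈ gr e := by
  have := HqBimod.mem_of_weightedHomogeneous (ρ := polHom P Q h) (gr := gr) (fun i => ?_) hf hu
  · rwa [zero_add] at this
  · revert i
    rw [Fin.forall_fin_two, polHom_X0, polHom_X1]
    exact ⟨hP, hQ⟩

/-- The model map intertwines `∂_q` with `δ` if `δ` satisfies the Leibniz rule on the generators. -/
lemma modelMap_polDer {δ : Module.End k T} {u : T} (hu : δ u = 0)
    (hP : ∀ t, δ (P t) = P (P t) + P (δ t)) (hQ : ∀ t, δ (Q t) = Q (Q t) + Q (δ t)) (f : Pol k) :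
    modelMap P Q h u (polDer k f) = δ (modelMap P Q h u f) := by
  induction f using MvPolynomial.induction_on with
  | C c =>
    rw [← MvPolynomial.algebraMap_eq, Derivation.map_algebraMap, map_zero, modelMap_apply,
      AlgHom.commutes, Module.algebraMap_end_apply, map_smul, hu, smul_zero]
  | add f g hf hg => rw [map_add, map_add, map_add, map_add, hf, hg]
  | mul_X f i hf =>
    rw [Derivation.leibniz, HqBimod.polDer_X, smul_eq_mul, smul_eq_mul, map_add, mul_comm f (X i ^ 2), pow_two,
      mul_assoc, modelMap_mul, modelMap_mul, modelMap_mul, hf, mul_comm f (X i), modelMap_mul]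
    revert i
    rw [Fin.forall_fin_two, polHom_X0, polHom_X1]
    exact ⟨(hP _).symm, (hQ _).symm⟩

/-- The kernel of the model map, computed by a section up to elements of the kernel. -/
lemma modelMap_eq_zero_iff {u : T} {σ : T →ₗ[k] Pol k} {a b : Pol k}
    (ha : polHom P Q h a = 0) (hb : polHom P Q h b = 0)
    (hu : σ u - 1 ∈ Ideal.span {a, b}) (hP : ∀ t, σ (P t) - X 0 * σ t ∈ Ideal.span {a, b})
    (hQ : ∀ t, σ (Q t) - X 1 * σ t ∈ Ideal.span {a, b}) (f : Pol k) :
    modelMap P Q h u f = 0 ↔ ∃ g h, f = a * g + b * h := by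
  have key : σ (modelMap P Q h u f) - f ∈ Ideal.span {a, b} := by
    induction f using MvPolynomial.induction_on with
    | C c =>
      have : σ (modelMap P Q h u (C c)) - C c = C c * (σ u - 1) := by
        rw [← MvPolynomial.algebraMap_eq, modelMap_apply, AlgHom.commutes, Module.algebraMap_end_apply,
          map_smul, Algebra.smul_def]
        ring
      rw [this]
      exact Ideal.mul_mem_left _ _ hu
    | add f g hf hg =>
      rw [map_add, map_add, add_sub_add_comm]
      exact Ideal.add_mem _ hf hg
    | mul_X f i hf =>
      have h2 : σ (polHom P Q h (X i : Pol k) (modelMap P Q h u f)) - (X i : Pol k) * σ (modelMap P Q h u f) ∈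
          Ideal.span {a, b} := by
        revert i
        rw [Fin.forall_fin_two, polHom_X0, polHom_X1]
        exact ⟨hP _, hQ _⟩
      have h1 := Ideal.mul_mem_left _ (X i : Pol k) hf
      have h3 := Ideal.add_mem _ h1 h2
      rw [mul_comm f, modelMap_mul]
      convert h3 using 1
      ring
  constructor
  · intro hf
    rw [hf, map_zero, zero_sub, neg_mem_iff, Ideal.mem_span_pair] at key
    obtain ⟨g, h, e⟩ := key
    exact ⟨g, h, by rw [← e]; ring⟩
  · rintro ⟨g, h', rfl⟩
    rw [map_add, modelMap_mul, modelMap_mul, ha, hb]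
    exact add_zero _

end ModelMap

section Concrete

/-- Multiplication by `e = x_1 + x_2` on `k[e, d]/(e³, d² + e²)` with basis `e^i`, `e^i d`. -/
def opE (k : Type u) [Field k] : Module.End k ((Fin 3 → k) × (Fin 3 → k)) :=
  (blkShift k 3 k).prodMap (blkShift k 3 k)

/-- Multiplication by `d = x_1 - x_2` on `k[e, d]/(e³, d² + e²)`. -/
def opD (k : Type u) [Field k] : Module.End k ((Fin 3 → k) × (Fin 3 → k)) :=
  LinearMap.prod (-(blkShift k 3 k ∘ₗ blkShift k 3 k ∘ₗ snd k _ _)) (fst k _ _)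

/-- Multiplication by `e` on `k[x_1, x_2]/(x_1², x_2²)` with basis `1, e, e²; d`. -/
def opE' (k : Type u) [Field k] : Module.End k ((Fin 3 → k) × (Fin 1 → k)) :=
  (blkShift k 3 k).prodMap 0

/-- Multiplication by `d` on `k[x_1, x_2]/(x_1², x_2²)`. -/
def opD' (k : Type u) [Field k] : Module.End k ((Fin 3 → k) × (Fin 1 → k)) :=
  LinearMap.prod (-(LinearMap.single k (fun _ : Fin 3 => k) 2 ∘ₗ proj 0 ∘ₗ snd k _ _))
    (LinearMap.pi fun _ => proj 0 ∘ₗ fst k _ _)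

lemma blkShift_three (v : Fin 3 → k) : blkShift k 3 k v = ![0, v 0, v 1] := by
  funext i
  rw [blkShift_apply]
  fin_cases i <;> rfl

lemma opE_apply (t : (Fin 3 → k) × (Fin 3 → k)) :
    opE k t = (![0, t.1 0, t.1 1], ![0, t.2 0, t.2 1]) :=
  Prod.ext (blkShift_three t.1) (blkShift_three t.2)

lemma opD_apply (t : (Fin 3 → k) × (Fin 3 → k)) : opD k t = (![0, 0, -t.2 0], t.1) := by
  refine Prod.ext ?_ rfl
  change -(blkShift k 3 k (blkShift k 3 k t.2)) = _
  rw [blkShift_three, blkShift_three]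
  simp

lemma opE'_apply (t : (Fin 3 → k) × (Fin 1 → k)) : opE' k t = (![0, t.1 0, t.1 1], 0) :=
  Prod.ext (blkShift_three t.1) rfl

lemma opD'_apply (t : (Fin 3 → k) × (Fin 1 → k)) : opD' k t = (![0, 0, -t.2 0], ![t.1 0]) := by
  refine Prod.ext ?_ ?_
  · change -(Pi.single 2 (t.2 0) : Fin 3 → k) = _
    funext i; fin_cases i <;> simp
  · funext i; fin_cases i; rfl

lemma opE_opD : Commute (opE k) (opD k) := by
  refine LinearMap.ext fun t => ?_
  change opE k (opD k t) = opD k (opE k t)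
  simp [opE_apply, opD_apply]

lemma opE'_opD' : Commute (opE' k) (opD' k) := by
  refine LinearMap.ext fun t => ?_
  change opE' k (opD' k t) = opD' k (opE' k t)
  rw [opE'_apply, opD'_apply, opD'_apply, opE'_apply]
  refine Prod.ext ?_ (funext fun i => ?_)
  · simp
  · fin_cases i; rfl

lemma commute_half {E : Type*} [Ring E] [Algebra k E] {a b : E} (h : Commute a b) (c : k) :
    Commute (c • (a + b)) (c • (a - b)) := by
  have : Commute (a + b) (a - b) := by
    have := h.eq
    change (a + b) * (a - b) = (a - b) * (a + b)
    rw [add_mul, sub_mul, mul_add, mul_add, mul_sub, mul_sub, this]; abel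
  exact (this.smul_left c).smul_right c

/-- The quotient map `R → k[e, d]/(e³, d² + e²)`. -/
noncomputable def toA (k : Type u) [Field k] : Pol k →ₗ[k] (Fin 3 → k) × (Fin 3 → k) :=
  modelMap ((2 : k)⁻¹ • (opE k + opD k)) ((2 : k)⁻¹ • (opE k - opD k)) (commute_half opE_opD _) (![1, 0, 0], 0)

/-- The quotient map `R → k[x_1, x_2]/(x_1², x_2²)`. -/
noncomputable def toS (k : Type u) [Field k] : Pol k →ₗ[k] (Fin 3 → k) × (Fin 1 → k) :=
  modelMap ((2 : k)⁻¹ • (opE' k + opD' k)) ((2 : k)⁻¹ • (opE' k - opD' k)) (commute_half opE'_opD' _)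
    (![1, 0, 0], 0)

/-- The `p`-complex of Hochschild homology of `B_n`, up to homotopy and shift. -/
abbrev Acx (k : Type u) [Field k] (n : ℕ) : QComplex k :=
  sumC (Wd k 3 0 (n : k)) (Wd k 3 2 ((n + 1 : ℕ) : k))

/-- The `p`-complex of Hochschild homology of `R`, up to homotopy. -/
abbrev Scx (k : Type u) [Field k] : QComplex k := sumC (Wd k 3 0 (0 : k)) (Wd k 1 2 (0 : k))

lemma half_add {T : Type*} [AddCommGroup T] [Module k T] (h2 : (2 : k) ≠ 0) (a b : T) :
    (2 : k)⁻¹ • (a + b) + (2 : k)⁻¹ • (a - b) = a := by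
  rw [← smul_add, add_add_sub_cancel, ← two_smul k, smul_smul, inv_mul_cancel₀ h2, one_smul]

lemma half_sub {T : Type*} [AddCommGroup T] [Module k T] (h2 : (2 : k) ≠ 0) (a b : T) :
    (2 : k)⁻¹ • (a + b) - (2 : k)⁻¹ • (a - b) = b := by
  rw [← smul_sub, add_sub_sub_cancel, ← two_smul k, smul_smul, inv_mul_cancel₀ h2, one_smul]

lemma toA_X0_mul (f : Pol k) : toA k (X 0 * f) = (2 : k)⁻¹ • (opE k (toA k f) + opD k (toA k f)) := by
  rw [toA, modelMap_mul, polHom_X0]; rfl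

lemma toA_X1_mul (f : Pol k) : toA k (X 1 * f) = (2 : k)⁻¹ • (opE k (toA k f) - opD k (toA k f)) := by
  rw [toA, modelMap_mul, polHom_X1]; rfl

lemma toS_X0_mul (f : Pol k) : toS k (X 0 * f) = (2 : k)⁻¹ • (opE' k (toS k f) + opD' k (toS k f)) := by
  rw [toS, modelMap_mul, polHom_X0]; rfl

lemma toS_X1_mul (f : Pol k) : toS k (X 1 * f) = (2 : k)⁻¹ • (opE' k (toS k f) - opD' k (toS k f)) := by
  rw [toS, modelMap_mul, polHom_X1]; rfl

lemma toA_e (h2 : (2 : k) ≠ 0) (f : Pol k) : toA k ((X 0 + X 1) * f) = opE k (toA k f) := by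
  rw [add_mul, map_add, toA_X0_mul, toA_X1_mul, half_add h2]

lemma toA_d (h2 : (2 : k) ≠ 0) (f : Pol k) : toA k ((X 0 - X 1) * f) = opD k (toA k f) := by
  rw [sub_mul, map_sub, toA_X0_mul, toA_X1_mul, half_sub h2]

lemma toS_e (h2 : (2 : k) ≠ 0) (f : Pol k) : toS k ((X 0 + X 1) * f) = opE' k (toS k f) := by
  rw [add_mul, map_add, toS_X0_mul, toS_X1_mul, half_add h2]

lemma toS_d (h2 : (2 : k) ≠ 0) (f : Pol k) : toS k ((X 0 - X 1) * f) = opD' k (toS k f) := by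
  rw [sub_mul, map_sub, toS_X0_mul, toS_X1_mul, half_sub h2]

lemma toA_one : toA k 1 = (![1, 0, 0], 0) := by
  rw [toA, modelMap_apply, map_one]; rfl

lemma toS_one : toS k 1 = (![1, 0, 0], 0) := by
  rw [toS, modelMap_apply, map_one]; rfl

/-- The section of the quotient map given by the basis. -/
noncomputable def secA (k : Type u) [Field k] : (Fin 3 → k) × (Fin 3 → k) →ₗ[k] Pol k :=
  LinearMap.coprod (∑ i : Fin 3, (LinearMap.toSpanSingleton k (Pol k) ((X 0 + X 1) ^ (i : ℕ))) ∘ₗ proj i)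
    (∑ i : Fin 3, (LinearMap.toSpanSingleton k (Pol k) ((X 0 + X 1) ^ (i : ℕ) * (X 0 - X 1))) ∘ₗ proj i)

lemma secA_apply (t : (Fin 3 → k) × (Fin 3 → k)) : secA k t =
    (C (t.1 0) + C (t.1 1) * (X 0 + X 1) + C (t.1 2) * (X 0 + X 1) ^ 2) +
    (C (t.2 0) + C (t.2 1) * (X 0 + X 1) + C (t.2 2) * (X 0 + X 1) ^ 2) *
      (X 0 - X 1) := by
  rw [secA, LinearMap.coprod_apply, Fin.sum_univ_three, Fin.sum_univ_three]
  simp [MvPolynomial.smul_eq_C_mul]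
  ring

/-- The section of the quotient map given by the basis. -/
noncomputable def secS (k : Type u) [Field k] : (Fin 3 → k) × (Fin 1 → k) →ₗ[k] Pol k :=
  LinearMap.coprod (∑ i : Fin 3, (LinearMap.toSpanSingleton k (Pol k) ((X 0 + X 1) ^ (i : ℕ))) ∘ₗ proj i)
    ((LinearMap.toSpanSingleton k (Pol k) (X 0 - X 1)) ∘ₗ proj 0)

lemma secS_apply (t : (Fin 3 → k) × (Fin 1 → k)) : secS k t =
    (C (t.1 0) + C (t.1 1) * (X 0 + X 1) + C (t.1 2) * (X 0 + X 1) ^ 2) +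
    C (t.2 0) * (X 0 - X 1) := by
  rw [secS, LinearMap.coprod_apply, Fin.sum_univ_three]
  simp [MvPolynomial.smul_eq_C_mul]
  ring

lemma toA_C_mul (c : k) (f : Pol k) : toA k (C c * f) = c • toA k f := by
  rw [← MvPolynomial.smul_eq_C_mul, map_smul]

lemma toS_C_mul (c : k) (f : Pol k) : toS k (C c * f) = c • toS k f := by
  rw [← MvPolynomial.smul_eq_C_mul, map_smul]

lemma toA_secA (h2 : (2 : k) ≠ 0) (t : (Fin 3 → k) × (Fin 3 → k)) : toA k (secA k t) = t := by
  have h : secA k t = C (t.1 0) * 1 + C (t.1 1) * ((X 0 + X 1) * 1) +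
      C (t.1 2) * ((X 0 + X 1) * ((X 0 + X 1) * 1)) + C (t.2 0) * ((X 0 - X 1) * 1) +
      C (t.2 1) * ((X 0 + X 1) * ((X 0 - X 1) * 1)) +
      C (t.2 2) * ((X 0 + X 1) * ((X 0 + X 1) * ((X 0 - X 1) * 1))) := by
    rw [secA_apply]; ring
  rw [h]
  simp only [map_add, toA_C_mul, toA_e h2, toA_d h2, toA_one, opE_apply, opD_apply]
  refine Prod.ext (funext fun i => ?_) (funext fun i => ?_) <;> fin_cases i <;> simp

lemma toS_secS (h2 : (2 : k) ≠ 0) (t : (Fin 3 → k) × (Fin 1 → k)) : toS k (secS k t) = t := by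
  have h : secS k t = C (t.1 0) * 1 + C (t.1 1) * ((X 0 + X 1) * 1) +
      C (t.1 2) * ((X 0 + X 1) * ((X 0 + X 1) * 1)) + C (t.2 0) * ((X 0 - X 1) * 1) := by
    rw [secS_apply]; ring
  rw [h]
  simp only [map_add, toS_C_mul, toS_e h2, toS_d h2, toS_one, opE'_apply, opD'_apply]
  refine Prod.ext (funext fun i => ?_) (funext fun i => ?_) <;> fin_cases i <;> simp

lemma toA_surjective (h2 : (2 : k) ≠ 0) : Function.Surjective (toA k) := fun t => ⟨_, toA_secA h2 t⟩

lemma toS_surjective (h2 : (2 : k) ≠ 0) : Function.Surjective (toS k) := fun t => ⟨_, toS_secS h2 t⟩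

lemma C_half (h2 : (2 : k) ≠ 0) : (2 : Pol k) * C (2 : k)⁻¹ = 1 := by
  rw [show (2 : Pol k) = C 2 from (map_ofNat _ 2).symm, ← map_mul, mul_inv_cancel₀ h2, map_one]

/-- A section which is linear for `e` and `d` modulo an ideal is so for `x_1` and `x_2`. -/
lemma section_half_mem (h2 : (2 : k) ≠ 0) {T : Type*} [AddCommGroup T] [Module k T] {σ : T →ₗ[k] Pol k}
    {E D : Module.End k T} {I : Ideal (Pol k)} {t : T} (hE : σ (E t) - (X 0 + X 1) * σ t ∈ I)
    (hD : σ (D t) - (X 0 - X 1) * σ t ∈ I) :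
    σ (((2 : k)⁻¹ • (E + D)) t) - X 0 * σ t ∈ I ∧ σ (((2 : k)⁻¹ • (E - D)) t) - X 1 * σ t ∈ I := by
  have hc := C_half h2
  rw [LinearMap.smul_apply, LinearMap.smul_apply, map_smul, map_smul, LinearMap.add_apply, LinearMap.sub_apply,
    map_add, map_sub, MvPolynomial.smul_eq_C_mul, MvPolynomial.smul_eq_C_mul]
  constructor
  · convert I.mul_mem_left (C (2 : k)⁻¹) (I.add_mem hE hD) using 1
    linear_combination X 0 * σ t * hc
  · convert I.mul_mem_left (C (2 : k)⁻¹) (I.sub_mem hE hD) using 1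
    linear_combination X 1 * σ t * hc

lemma toA_eq_zero_iff (h2 : (2 : k) ≠ 0) (f : Pol k) :
    toA k f = 0 ↔ ∃ g h, f = (X 0 ^ 2 + X 1 ^ 2) * g + X 0 ^ 2 * (X 0 - X 1) * h := by
  have hc := C_half h2
  have key : ∀ t, _ ∧ _ := fun t => section_half_mem (σ := secA k) (E := opE k) (D := opD k) (t := t)
      (I := Ideal.span {X 0 ^ 2 + X 1 ^ 2, X 0 ^ 2 * (X 0 - X 1)}) h2
    (Ideal.mem_span_pair.mpr ⟨-(C (t.1 2) + C (t.2 2) * (X 0 - X 1)) * (3 * X 0 + X 1),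
      2 * (C (t.1 2) + C (t.2 2) * (X 0 - X 1)), by
        rw [secA_apply, secA_apply, opE_apply]
        simp only [Matrix.cons_val, map_zero]
        ring⟩)
    (Ideal.mem_span_pair.mpr ⟨-2 * C (t.2 0) + (C (t.2 1) + C (t.2 2) * (X 0 + X 1)) * (X 0 - X 1),
      -2 * (C (t.2 1) + C (t.2 2) * (X 0 + X 1)), by
        rw [secA_apply, secA_apply, opD_apply]
        simp only [Matrix.cons_val, map_zero, map_neg]
        ring⟩)
  refine modelMap_eq_zero_iff (σ := secA k) ?_ ?_ ?_ (fun t => (key t).1) (fun t => (key t).2) f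
  · refine LinearMap.ext fun t => ?_
    obtain ⟨f, rfl⟩ := toA_surjective h2 t
    refine (modelMap_mul _ _ _).symm.trans ?_
    change toA k _ = 0
    have : (X 0 ^ 2 + X 1 ^ 2) * f = C (2 : k)⁻¹ * ((X 0 + X 1) * ((X 0 + X 1) * f) +
        (X 0 - X 1) * ((X 0 - X 1) * f)) := by
      linear_combination -((X 0 ^ 2 + X 1 ^ 2) * f) * hc
    rw [this, toA_C_mul, map_add, toA_e h2, toA_e h2, toA_d h2, toA_d h2]
    simp [opE_apply, opD_apply]
  · refine LinearMap.ext fun t => ?_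
    obtain ⟨f, rfl⟩ := toA_surjective h2 t
    refine (modelMap_mul _ _ _).symm.trans ?_
    change toA k _ = 0
    have : X 0 ^ 2 * (X 0 - X 1) * f = C (2 : k)⁻¹ * (C (2 : k)⁻¹ *
        ((X 0 + X 1) * ((X 0 + X 1) * ((X 0 - X 1) * f)) + (X 0 - X 1) * ((X 0 - X 1) * ((X 0 - X 1) * f)) +
          ((X 0 + X 1) * ((X 0 - X 1) * ((X 0 - X 1) * f)) + (X 0 + X 1) * ((X 0 - X 1) * ((X 0 - X 1) * f))))) := by
      linear_combination -(X 0 ^ 2 * (X 0 - X 1) * f) * (2 * C (2 : k)⁻¹ + 1) * hc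
    rw [this, toA_C_mul, toA_C_mul]
    simp only [map_add, toA_e h2, toA_d h2]
    simp [opE_apply, opD_apply]
  · rw [secA_apply]
    convert Ideal.zero_mem _ using 1
    simp

lemma toS_eq_zero_iff (h2 : (2 : k) ≠ 0) (f : Pol k) :
    toS k f = 0 ↔ ∃ g h, f = X 0 ^ 2 * g + X 1 ^ 2 * h := by
  have key : ∀ t, _ ∧ _ := fun t => section_half_mem (σ := secS k) (E := opE' k) (D := opD' k) (t := t)
      (I := Ideal.span {X 0 ^ 2, X 1 ^ 2}) h2
    (Ideal.mem_span_pair.mpr ⟨-C (t.1 2) * (X 0 + 3 * X 1) - C (t.2 0), -C (t.1 2) * (3 * X 0 + X 1) + C (t.2 0), by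
        rw [secS_apply, secS_apply, opE'_apply]
        simp only [Matrix.cons_val, Pi.zero_apply, map_zero]
        ring⟩)
    (Ideal.mem_span_pair.mpr ⟨-2 * C (t.2 0) - C (t.1 1) - C (t.1 2) * (X 0 + X 1),
      -2 * C (t.2 0) + C (t.1 1) + C (t.1 2) * (X 0 + X 1), by
        rw [secS_apply, secS_apply, opD'_apply]
        simp only [Matrix.cons_val, map_zero, map_neg]
        ring⟩)
  refine modelMap_eq_zero_iff (σ := secS k) ?_ ?_ ?_ (fun t => (key t).1) (fun t => (key t).2) f
  · refine LinearMap.ext fun t => ?_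
    obtain ⟨f, rfl⟩ := toS_surjective h2 t
    refine (modelMap_mul _ _ _).symm.trans ?_
    change toS k _ = 0
    rw [pow_two, mul_assoc, toS_X0_mul, toS_X0_mul]
    refine Prod.ext (funext fun i => ?_) (funext fun i => ?_) <;> fin_cases i <;> simp [opE'_apply, opD'_apply]
  · refine LinearMap.ext fun t => ?_
    obtain ⟨f, rfl⟩ := toS_surjective h2 t
    refine (modelMap_mul _ _ _).symm.trans ?_
    change toS k _ = 0
    rw [pow_two, mul_assoc, toS_X1_mul, toS_X1_mul]
    refine Prod.ext (funext fun i => ?_) (funext fun i => ?_) <;> fin_cases i <;> simp [opE'_apply, opD'_apply]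
  · rw [secS_apply]
    convert Ideal.zero_mem _ using 1
    simp

end Concrete

end Models

/-! ### Differentials and maps on the finite-dimensional models -/

section Differentials

lemma Acx_diff_apply (n : ℕ) (t : (Fin 3 → k) × (Fin 3 → k)) : (Acx k n).diff t =
    (![0, n * t.1 0, n * t.1 1], ![0, (n + 1) * t.2 0, (n + 1) * t.2 1]) := by
  refine Prod.ext ?_ ?_
  · change (n : k) • blkShift k 3 k t.1 = _
    rw [blkShift_three]; simp
  · change ((n + 1 : ℕ) : k) • blkShift k 3 k t.2 = _
    rw [blkShift_three]; simp

lemma toA_polDer (h2 : (2 : k) ≠ 0) (f : Pol k) : toA k (polDer k f) = (Acx k 0).diff (toA k f) := by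
  have h4 : (2 : k)⁻¹ * (2 : k)⁻¹ + (2 : k)⁻¹ * (2 : k)⁻¹ = (2 : k)⁻¹ := by field_simp; norm_num
  have h5 : (2 : k)⁻¹ + (2 : k)⁻¹ = 1 := by field_simp; norm_num
  have hd := Acx_diff_apply (k := k) 0
  generalize (Acx k 0).diff = δ at hd ⊢
  refine modelMap_polDer (T := (Fin 3 → k) × (Fin 3 → k)) (δ := δ) ?_ (fun t => ?_) (fun t => ?_) f
  · rw [hd]
    refine Prod.ext (funext fun i => ?_) (funext fun i => ?_) <;> fin_cases i <;> simp
  · rw [hd, hd]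
    simp only [LinearMap.smul_apply, LinearMap.add_apply, map_smul, map_add, opE_apply, opD_apply]
    refine Prod.ext (funext fun i => ?_) (funext fun i => ?_) <;> fin_cases i <;> simp
    · left; change t.1 0 = _; linear_combination (t.1 0) * -h5
    · change 2⁻¹ * (t.2 0 + t.1 1) = _; linear_combination (t.1 1) * -h4
  · rw [hd, hd]
    simp only [LinearMap.smul_apply, LinearMap.sub_apply, map_smul, map_sub, opE_apply, opD_apply]
    refine Prod.ext (funext fun i => ?_) (funext fun i => ?_) <;> fin_cases i <;> simp
    · change -(2⁻¹ * t.1 0) = _; linear_combination (t.1 0) * h4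
    · change 2⁻¹ * (t.2 0 - t.1 1) = _; linear_combination (t.1 1) * h4

lemma toA_dq (h2 : (2 : k) ≠ 0) (n : ℕ) (f : Pol k) :
    toA k (polDer k f + n • (HqBimod.e1 k * f)) = (Acx k n).diff (toA k f) := by
  rw [map_add, map_nsmul, toA_polDer h2, HqBimod.e1, toA_e h2, Acx_diff_apply, Acx_diff_apply, opE_apply]
  refine Prod.ext (funext fun i => ?_) (funext fun i => ?_) <;> fin_cases i <;> simp <;> ring

lemma opE_mem {n : ℕ} {e : ℤ} {t : (Fin 3 → k) × (Fin 3 → k)} (ht : t ∈ (Acx k n).gr e) :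
    opE k t ∈ (Acx k n).gr (e + 2) := by
  have h1 := mem_Wd.mp ht.1
  have h2 := mem_Wd.mp ht.2
  rw [opE_apply]
  refine ⟨mem_Wd.mpr fun j => ?_, mem_Wd.mpr fun j => ?_⟩ <;> fin_cases j <;> intro hj <;> simp at hj ⊢
  · exact h1 0 (by simp; omega)
  · exact h1 1 (by simp; omega)
  · exact h2 0 (by simp; omega)
  · exact h2 1 (by simp; omega)

lemma opD_mem {n : ℕ} {e : ℤ} {t : (Fin 3 → k) × (Fin 3 → k)} (ht : t ∈ (Acx k n).gr e) :
    opD k t ∈ (Acx k n).gr (e + 2) := by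
  have h1 := mem_Wd.mp ht.1
  have h2 := mem_Wd.mp ht.2
  rw [opD_apply]
  refine ⟨mem_Wd.mpr fun j => ?_, mem_Wd.mpr fun j => ?_⟩ <;> fin_cases j <;> intro hj <;> simp at hj ⊢
  · exact h2 0 (by simp; omega)
  · exact h1 0 (by simp; omega)
  · exact h1 1 (by simp; omega)
  · exact h1 2 (by simp; omega)

lemma opE'_mem {e : ℤ} {t : (Fin 3 → k) × (Fin 1 → k)} (ht : t ∈ (Scx k).gr e) :
    opE' k t ∈ (Scx k).gr (e + 2) := by
  have h1 := mem_Wd.mp ht.1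
  rw [opE'_apply]
  refine ⟨mem_Wd.mpr fun j => ?_, zero_mem _⟩
  fin_cases j <;> intro hj <;> simp at hj ⊢
  · exact h1 0 (by simp; omega)
  · exact h1 1 (by simp; omega)

lemma opD'_mem {e : ℤ} {t : (Fin 3 → k) × (Fin 1 → k)} (ht : t ∈ (Scx k).gr e) :
    opD' k t ∈ (Scx k).gr (e + 2) := by
  have h1 := mem_Wd.mp ht.1
  have h2 := mem_Wd.mp ht.2
  rw [opD'_apply]
  refine ⟨mem_Wd.mpr fun j => ?_, mem_Wd.mpr fun j => ?_⟩ <;> fin_cases j <;> intro hj <;> simp at hj ⊢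
  · exact h2 0 (by simp; omega)
  · exact h1 0 (by simp; omega)

lemma one_mem_Wd {s : ℤ} {c : k} : (![1, 0, 0] : Fin 3 → k) ∈ (Wd k 3 s c).gr s := by
  refine mem_Wd.mpr fun j => ?_
  fin_cases j <;> simp

lemma toA_mem (n : ℕ) {e : ℤ} {f : Pol k}
    (hf : f ∈ polGr(k) e) :
    toA k f ∈ (Acx k n).gr e :=
  modelMap_mem (gr := (Acx k n).gr)
    (fun _ _ h => Submodule.smul_mem _ _ (add_mem (opE_mem h) (opD_mem h)))
    (fun _ _ h => Submodule.smul_mem _ _ (sub_mem (opE_mem h) (opD_mem h)))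
    ⟨one_mem_Wd, zero_mem _⟩ hf

lemma toS_mem {e : ℤ} {f : Pol k}
    (hf : f ∈ polGr(k) e) :
    toS k f ∈ (Scx k).gr e :=
  modelMap_mem (gr := (Scx k).gr)
    (fun _ _ h => Submodule.smul_mem _ _ (add_mem (opE'_mem h) (opD'_mem h)))
    (fun _ _ h => Submodule.smul_mem _ _ (sub_mem (opE'_mem h) (opD'_mem h)))
    ⟨one_mem_Wd, zero_mem _⟩ hf

lemma Scx_diff : (Scx k).diff = 0 := by
  refine LinearMap.ext fun t => Prod.ext ?_ ?_
  · exact zero_smul k (blkShift k 3 k t.1)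
  · exact zero_smul k (blkShift k 1 k t.2)

lemma toS_polDer (f : Pol k) : toS k (polDer k f) = (Scx k).diff (toS k f) := by
  refine modelMap_polDer (T := (Fin 3 → k) × (Fin 1 → k)) (δ := (Scx k).diff) ?_ (fun t => ?_) (fun t => ?_) f
  · rw [Scx_diff]; rfl
  · rw [Scx_diff]
    simp only [LinearMap.smul_apply, LinearMap.add_apply, map_smul, map_add, opE'_apply, opD'_apply]
    refine Prod.ext (funext fun i => ?_) (funext fun i => ?_) <;> fin_cases i <;> simp
  · rw [Scx_diff]
    simp only [LinearMap.smul_apply, LinearMap.sub_apply, map_smul, map_sub, opE'_apply, opD'_apply]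
    refine Prod.ext (funext fun i => ?_) (funext fun i => ?_) <;> fin_cases i <;> simp

/-- The quotient map `k[e, d]/(e³, d² + e²) → k[x_1, x_2]/(x_1², x_2²)`. -/
def projAS (k : Type u) [Field k] : (Fin 3 → k) × (Fin 3 → k) →ₗ[k] (Fin 3 → k) × (Fin 1 → k) :=
  LinearMap.id.prodMap (LinearMap.pi fun _ => proj 0)

lemma projAS_apply (t : (Fin 3 → k) × (Fin 3 → k)) : projAS k t = (t.1, ![t.2 0]) :=
  Prod.ext rfl (funext fun i => by fin_cases i; rfl)

lemma projAS_toA (f : Pol k) : projAS k (toA k f) = toS k f := by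
  induction f using MvPolynomial.induction_on with
  | C c =>
    have h : (C c : Pol k) = c • 1 := by rw [MvPolynomial.smul_eq_C_mul, mul_one]
    rw [h, map_smul, map_smul, map_smul, toA_one, toS_one, projAS_apply]
    refine congrArg _ (Prod.ext rfl (funext fun i => ?_))
    fin_cases i; rfl
  | add f g hf hg => rw [map_add, map_add, map_add, hf, hg]
  | mul_X f i hf =>
    have h1 : ∀ t, projAS k (opE k t) = opE' k (projAS k t) := fun t => by
      rw [opE_apply, projAS_apply, projAS_apply, opE'_apply]
      refine Prod.ext rfl (funext fun i => ?_)
      fin_cases i; rfl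
    have h2 : ∀ t, projAS k (opD k t) = opD' k (projAS k t) := fun t => by
      rw [opD_apply, projAS_apply, projAS_apply, opD'_apply]
      rfl
    rw [mul_comm]
    revert i
    rw [Fin.forall_fin_two, toA_X0_mul, toA_X1_mul, toS_X0_mul, toS_X1_mul, ← hf, map_smul, map_smul,
      map_add, map_sub, h1, h2]
    exact ⟨rfl, rfl⟩

variable {p : ℕ} [Fact p.Prime] [CharP k p]

lemma Acx_isPComplex (hp : 2 < p) (n : ℕ) : IsPComplex p (Acx k n) :=
  (Wd_isPComplex (by omega) _ _).sumC (Wd_isPComplex (by omega) _ _)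

lemma Scx_isPComplex (hp : 2 < p) : IsPComplex p (Scx k) :=
  (Wd_isPComplex (by omega) _ _).sumC (Wd_isPComplex (by omega) _ _)

end Differentials

namespace HqBimod

variable {p : ℕ} [Fact p.Prime] [CharP k p]

lemma good_Bn_of_retract {M : HqBimod k} (hM : Good p M) {n : ℕ} (P : PolRetract p M n) : Good p (Bn k n) :=
  (good_Npol hM P).ind

lemma Bn_acyclicSurj_Acx (hp : 2 < p) {n : ℕ} (hB : Good p (Bn k n)) :
    AcyclicSurj p (totC p (Bn k n)) ((Acx k n).qShift (-n))
      ((toA k ∘ₗ evHH0 k n) ∘ₗ snd k _ _ ∘ₗ snd k _ _) :=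
  have h2 := two_ne_zero_of_charP (k := k) hp
  Bn_acyclicSurj hp hB (T := Acx k n) (toA_surjective h2) (toA_eq_zero_iff h2) (toA_dq h2 n)
    fun _ _ hf => toA_mem n hf

/-- The `p`-complex `pHH(B_n)` is finite-dimensional up to homotopy. -/
lemma Bn_iso (hp : 2 < p) {n : ℕ} (hB : Good p (Bn k n)) :
    HomotopyIso p (totC p (Bn k n)) ((Acx k n).qShift (-n)) :=
  (Bn_acyclicSurj_Acx hp hB).homotopyIso (by omega) (hB.isPComplex hp) ((Acx_isPComplex hp n).qShift _)

lemma opD_isHom (n : ℕ) : IsHom (Acx k (n + 1)) ((Acx k n).qShift (-2)) (opD k) := by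
  refine ⟨fun t => ?_, fun e t ht => ?_⟩
  · change opD k ((Acx k (n + 1)).diff t) = (Acx k n).diff (opD k t)
    rw [Acx_diff_apply, opD_apply, opD_apply, Acx_diff_apply]
    refine Prod.ext (funext fun i => ?_) (funext fun i => ?_) <;> fin_cases i <;> simp
  · change opD k t ∈ (Acx k n).gr (e - -2)
    rw [sub_neg_eq_add]
    exact opD_mem ht

lemma projAS_isHom : IsHom (Acx k 0) (Scx k) (projAS k) := by
  refine ⟨fun t => ?_, fun e t ht => ?_⟩
  · rw [Scx_diff, Acx_diff_apply, projAS_apply]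
    refine Prod.ext (funext fun i => ?_) (funext fun i => ?_) <;> fin_cases i <;> simp
  · rw [projAS_apply]
    refine ⟨ht.1, mem_Wd.mpr fun j hj => ?_⟩
    have h2 := mem_Wd.mp ht.2
    fin_cases j
    exact h2 0 (by simpa using hj)

/-- For odd `n` the map `ψ : B_{n+1} → B_n` is multiplication by `d = x_1 - x_2` on `HH_0`. -/
lemma evHH0_psi (m : ℕ) (c : HH0 (Bn k (2 * m + 1 + 1))) :
    evHH0 k (2 * m + 1) (hh0 (isBi_psi (2 * m + 1)) c) = (X 0 - X 1) * evHH0 k (2 * m + 1 + 1) c := by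
  obtain ⟨b, rfl⟩ := Submodule.Quotient.mk_surjective _ c
  change (psi k (2 * m + 1) b).1 + X 0 * (psi k (2 * m + 1) b).2 = (X 0 - X 1) * (b.1 + X 0 * b.2)
  rw [psi_apply, show swapX k (2 * m + 1 + 1) = X 0 from (swapX_even (m + 1)).1, (swapX_even m).2]
  change -(X 1 * (b.1 + X 0 * b.2)) + X 0 * (b.1 + X 0 * b.2) = _
  ring

/-- The cone of `ψ` for odd `n` is the cone of multiplication by `d` on the finite models. -/
lemma cone_Bn_iso (hp : 2 < p) (m : ℕ) (hB : Good p (Bn k (2 * m + 1 + 1))) (hB' : Good p (Bn k (2 * m + 1))) :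
    HomotopyIso p (cone p (totC p (Bn k (2 * m + 1 + 1)))
      ((totC p (Bn k (2 * m + 1))).qShift (-3)) (tot p (isBi_psi (2 * m + 1))))
      ((cone p (Acx k (2 * m + 1 + 1)) ((Acx k (2 * m + 1)).qShift (-2)) (opD k)).qShift
        (-(2 * m + 1 + 1 : ℕ))) := by
  have h2 := two_ne_zero_of_charP (k := k) hp
  have hA := (Acx_isPComplex (k := k) hp (2 * m + 1 + 1)).qShift (-(2 * m + 1 + 1 : ℕ))
  have hA' := ((Acx_isPComplex (k := k) hp (2 * m + 1)).qShift (-(2 * m + 1 : ℕ))).qShift (-3)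
  have hs : ∀ e : ℤ, (((Acx k (2 * m + 1)).qShift (-(2 * m + 1 : ℕ))).qShift (-3)).gr e =
      (((Acx k (2 * m + 1)).qShift (-2)).qShift (-(2 * m + 1 + 1 : ℕ))).gr e := fun e =>
    congrArg (Acx k (2 * m + 1)).gr (by push_cast; ring)
  have hd0 := (opD_isHom (k := k) (2 * m + 1)).qShift (-(2 * m + 1 + 1 : ℕ))
  have hd : IsHom ((Acx k (2 * m + 1 + 1)).qShift (-(2 * m + 1 + 1 : ℕ)))
      (((Acx k (2 * m + 1)).qShift (-(2 * m + 1 : ℕ))).qShift (-3)) (opD k) :=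
    ⟨hd0.comm, fun e x hx => (hs e).ge (hd0.map_mem e x hx)⟩
  have key := AcyclicSurj.cone_iso (X := totC p (Bn k (2 * m + 1 + 1)))
    (Y := (totC p (Bn k (2 * m + 1))).qShift (-3)) (X' := (Acx k (2 * m + 1 + 1)).qShift (-(2 * m + 1 + 1 : ℕ)))
    (Y' := ((Acx k (2 * m + 1)).qShift (-(2 * m + 1 : ℕ))).qShift (-3))
    (f := tot p (isBi_psi (k := k) (2 * m + 1))) (f' := opD k) (hB.isPComplex hp) ((hB'.isPComplex hp).qShift _)
    hA hA' (tot_psi_isHom hp _) hd (Bn_acyclicSurj_Acx hp hB) ((Bn_acyclicSurj_Acx hp hB').qShift (-3))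
    (fun z => ?_)
  · have hS : ∀ e, (Sm p (((Acx k (2 * m + 1)).qShift (-(2 * m + 1 : ℕ))).qShift (-3))).gr e =
        (Sm p ((Acx k (2 * m + 1)).qShift (-2))).gr (e - -(2 * m + 1 + 1 : ℕ)) := fun e =>
      congrArg (Submodule.pi Set.univ) (funext fun j => congrArg (Acx k (2 * m + 1)).gr (by push_cast; ring))
    refine key.trans (homotopyIso_of_equiv (LinearEquiv.refl k _) (fun _ => rfl) ?_ ?_)
    · exact fun e x hx => ⟨hx.1, (hS e).le hx.2⟩
    · exact fun e x hx => ⟨hx.1, (hS e).ge hx.2⟩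
  · exact (toA_d h2 _).symm.trans (congrArg (toA k) (evHH0_psi m z.2.2).symm)

/-- The cone of the multiplication `B → R` is the cone of the quotient map of the finite models. -/
lemma cone_reg_iso (hp : 2 < p) (hB : Good p (Bn k 0)) (hR : Good p (reg k)) :
    HomotopyIso p (cone p (totC p (Bn k 0)) (totC p (reg k))
      (tot p (PolRetract.zero (p := p) (k := k)).isBi_mulJ)) (cone p (Acx k 0) (Scx k) (projAS k)) := by
  have h2 := two_ne_zero_of_charP (k := k) hp
  have h0 : ∀ e : ℤ, (Acx k 0).gr (e - -(0 : ℕ)) = (Acx k 0).gr e := fun e => congrArg _ (by simp)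
  have ha := Bn_acyclicSurj_Acx hp hB
  have ha' : AcyclicSurj p (totC p (Bn k 0)) (Acx k 0)
      ((toA k ∘ₗ evHH0 k 0) ∘ₗ snd k _ _ ∘ₗ snd k _ _) :=
    ⟨⟨ha.isHom.comm, fun e x hx => (h0 e).le (ha.isHom.map_mem e x hx)⟩,
      ha.surjective, ha.acyclic⟩
  refine AcyclicSurj.cone_iso (X := totC p (Bn k 0)) (Y := totC p (reg k)) (X' := Acx k 0) (Y' := Scx k)
    (f := tot p (PolRetract.zero (p := p) (k := k)).isBi_mulJ) (f' := projAS k) (hB.isPComplex hp)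
    (hR.isPComplex hp) (Acx_isPComplex hp 0) (Scx_isPComplex hp) (PolRetract.zero.tot_mulJ_isHom hp hR)
    projAS_isHom ha' (reg_acyclicSurj hp (T := Scx k) (toS_surjective h2) (toS_eq_zero_iff h2) toS_polDer
      fun _ _ hf => toS_mem hf) (fun z => ?_)
  obtain ⟨m0, hm0⟩ := Submodule.Quotient.mk_surjective _ z.2.2
  change projAS k (toA k (evHH0 k _ z.2.2)) = toS k (regHH0 k (hh0 PolRetract.zero.isBi_mulJ z.2.2))
  rw [← hm0]
  exact projAS_toA _

end HqBimod

namespace QComplex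

variable {p : ℕ}

/-- The cone of an isomorphism is contractible. -/
lemma cone_contractible [Fact p.Prime] [CharP k p] {X Y : QComplex k} (hX : IsPComplex p X)
    (hY : IsPComplex p Y) {f : X.carrier →ₗ[k] Y.carrier} (hf : IsHom X Y f) (hb : Function.Bijective f) :
    Contractible p (cone p X Y f) := by
  have hp : 0 < p := (Fact.out : p.Prime).pos
  have hC := hX.cone hY hf
  refine IsPComplex.contractible hp hC ?_
  refine AcyclicOn.of_map (D' := blkDiff p Y.diff) hp (fun _ _ => trivial)
    (fun x _ => LinearMap.congr_fun hC.diff_pow x) (coneToBlk p f) (fun x _ => coneToBlk_comm hf x) ?_ ?_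
  · rintro ⟨x, y⟩ ⟨-, h⟩ -
    have h' : ∀ j : Fin p, coneToBlk p f (x, y) j = 0 := fun j => congrFun h j
    have hx : f x = 0 := by
      have := h' ⟨0, hp⟩
      rwa [coneToBlk_apply, dif_pos rfl] at this
    have hx' : x = 0 := hb.1 (hx.trans (map_zero f).symm)
    have hy : y = 0 := funext fun j => by
      have := h' ⟨j + 1, by omega⟩
      rwa [coneToBlk_apply, dif_neg (by simp)] at this
    subst hx' hy
    exact ⟨0, zero_mem _, map_zero _⟩
  · have : Submodule.map (coneToBlk p f) ⊤ = ⊤ := by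
      refine Submodule.map_top _ |>.trans (LinearMap.range_eq_top.mpr fun v => ?_)
      obtain ⟨x, hx⟩ := hb.2 (v ⟨0, hp⟩)
      refine ⟨(x, fun j => v ⟨j + 1, by omega⟩), funext fun j => ?_⟩
      rw [coneToBlk_apply]
      split_ifs with h
      · exact hx.trans (congrArg v (Fin.ext h.symm))
      · exact congrArg v (Fin.ext (by simp; omega))
    rw [this]
    exact acyclicOn_top_of_homotopy hp (blkDiff_homotopySum p hp Y.diff)

/-- The cone of a morphism which is diagonal for decompositions of its source and target. -/
lemma cone_iso_sum_cone {X A B C D : QComplex k} (u : X.carrier ≃ₗ[k] A.carrier × B.carrier)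
    (hu : ∀ x, u (X.diff x) = (A.diff (u x).1, B.diff (u x).2))
    (hd : ∀ d x, x ∈ X.gr d ↔ (u x).1 ∈ A.gr d ∧ (u x).2 ∈ B.gr d)
    (f : A.carrier →ₗ[k] C.carrier) (g : B.carrier →ₗ[k] D.carrier) :
    HomotopyIso p (cone p X (sumC C D) (f.prodMap g ∘ₗ u)) ((cone p A C f).sum (cone p B D g)) := by
  let e : (X.carrier × (Fin (p - 1) → C.carrier × D.carrier)) ≃ₗ[k]
      (A.carrier × (Fin (p - 1) → C.carrier)) × (B.carrier × (Fin (p - 1) → D.carrier)) :=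
    { toFun := fun z => (((u z.1).1, fun j => (z.2 j).1), ((u z.1).2, fun j => (z.2 j).2))
      invFun := fun z => (u.symm (z.1.1, z.2.1), fun j => (z.1.2 j, z.2.2 j))
      map_add' := fun z z' => by rw [Prod.fst_add, map_add]; rfl
      map_smul' := fun c z => by rw [Prod.smul_fst, map_smul]; rfl
      left_inv := fun z => Prod.ext (u.symm_apply_apply z.1) rfl
      right_inv := fun z => by dsimp only; rw [u.apply_symm_apply] }
  have hs : ∀ w d, w.1 ∈ A.gr d → w.2 ∈ B.gr d → u.symm w ∈ X.gr d := fun w d h1 h2 =>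
    (hd d _).mpr (by rw [u.apply_symm_apply]; exact ⟨h1, h2⟩)
  refine homotopyIso_of_equiv (M := cone p X (sumC C D) (f.prodMap g ∘ₗ u))
    (N := (cone p A C f).sum (cone p B D g)) e (fun z => ?_) (fun d z hz => ?_) (fun d z hz => ?_)
  · have h : ∀ j, (blkDiff (p - 1) (sumC C D).diff z.2 j + coneInj (p - 1) (f.prodMap g ∘ₗ u) z.1 j) =
        (blkDiff (p - 1) C.diff (fun j => (z.2 j).1) j + coneInj (p - 1) f (u z.1).1 j,
          blkDiff (p - 1) D.diff (fun j => (z.2 j).2) j + coneInj (p - 1) g (u z.1).2 j) := fun j => by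
      simp only [blkDiff_apply, coneInj_apply]
      split_ifs <;> rfl
    refine Prod.ext (Prod.ext ?_ (funext fun j => congrArg Prod.fst (h j)))
      (Prod.ext ?_ (funext fun j => congrArg Prod.snd (h j)))
    exacts [(Prod.ext_iff.mp (hu z.1)).1, (Prod.ext_iff.mp (hu z.1)).2]
  · have h := (hd d _).mp hz.1
    exact ⟨⟨h.1, fun j hj => (hz.2 j hj).1⟩, ⟨h.2, fun j hj => (hz.2 j hj).2⟩⟩
  · exact ⟨hs _ _ hz.1.1 hz.2.1, fun j hj => ⟨hz.1.2 j hj, hz.2.2 j hj⟩⟩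

end QComplex

/-! ### Cones of the finite-dimensional models -/

section FiniteCones

variable {p : ℕ}

/-- The bottom coefficient of `w` times `u`. -/
def botMap (k : Type u) [Field k] {U : Type*} [AddCommGroup U] [Module k U] (u : U) : (Fin 3 → k) →ₗ[k] U :=
  LinearMap.toSpanSingleton k U u ∘ₗ proj 0

lemma botMap_apply {U : Type*} [AddCommGroup U] [Module k U] (u : U) (w : Fin 3 → k) :
    botMap k u w = w 0 • u := rfl

lemma botMap_isHom {s : ℤ} {c : k} {U : QComplex k} {u : U.carrier} (hu : U.diff u = 0) (hu' : u ∈ U.gr s) :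
    IsHom (Wd k 3 s c) U (botMap k u) := by
  refine ⟨fun w => ?_, fun e w hw => ?_⟩
  · rw [botMap_apply, botMap_apply, map_smul, hu, smul_zero, Wd_diff_apply, dif_pos (by simp), mul_zero, zero_smul]
  · rw [botMap_apply]
    by_cases he : s = e
    · subst he; exact Submodule.smul_mem _ _ hu'
    · rw [mem_Wd.mp hw 0 (by simpa using he), zero_smul]; exact zero_mem _

lemma Wd_top_diff (s : ℤ) (m : k) : (Wd k 3 s m).diff ![0, 0, -1] = 0 := by
  refine funext fun i => ?_
  rw [Wd_diff_apply]
  fin_cases i <;> simp <;> rfl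

lemma Wd_top_mem (m : k) : (![0, 0, -1] : Fin 3 → k) ∈ (Wd k 3 (-2) m).gr 2 := by
  refine mem_Wd.mpr fun j hj => ?_
  fin_cases j <;> simp at hj ⊢

/-- In the cone of `w ↦ w_0 u`, `∂ u = 0`, the free `H_q`-module generated by the bottom vector. -/
def coneLine (hp : 2 < p) (c : k) {U : Type*} [AddCommGroup U] [Module k U] (u : U) :
    (Fin p → k) →ₗ[k] (Fin 3 → k) × (Fin (p - 1) → U) :=
  LinearMap.prod (LinearMap.pi fun i => c ^ (i : ℕ) • proj (⟨i, by omega⟩ : Fin p))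
    (LinearMap.pi fun j => LinearMap.toSpanSingleton k U u ∘ₗ proj (⟨j + 1, by omega⟩ : Fin p))

lemma coneLine_fst (hp : 2 < p) (c : k) {U : Type*} [AddCommGroup U] [Module k U] (u : U) (v : Fin p → k)
    (i : Fin 3) : (coneLine hp c u v).1 i = c ^ (i : ℕ) * v ⟨i, by omega⟩ := rfl

lemma coneLine_snd (hp : 2 < p) (c : k) {U : Type*} [AddCommGroup U] [Module k U] (u : U) (v : Fin p → k)
    (j : Fin (p - 1)) : (coneLine hp c u v).2 j = v ⟨j + 1, by omega⟩ • u := rfl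

/-- The quotient of the cone of `w ↦ w_0 u` by the free module generated by the bottom vector. -/
lemma cone_iso_of_ker_eq_coneLine [Fact p.Prime] [CharP k p] (hp : 2 < p) {s : ℤ} {c : k} {U T : QComplex k} (hU : IsPComplex p U)
    (hT : IsPComplex p T) {u : U.carrier} (hu0 : u ≠ 0) (hu : U.diff u = 0) (hu' : u ∈ U.gr s)
    {F : ((Fin 3 → k) × (Fin (p - 1) → U.carrier)) →ₗ[k] T.carrier}
    (hF : IsHom (cone p (Wd k 3 s c) U (botMap k u)) T F) (hs : Function.Surjective F)
    (hk : ∀ v, F (coneLine hp c u v) = 0) (hk' : ∀ z, F z = 0 → ∃ v, coneLine hp c u v = z) :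
    HomotopyIso p (cone p (Wd k 3 s c) U (botMap k u)) T := by
  have hp0 : 0 < p := by omega
  have hg : IsHom (Wd k 3 s c) U (botMap k u) := botMap_isHom hu hu'
  refine homotopyIso_of_surjective hp0 ((Wd_isPComplex (by omega) s c).cone hU hg) hT hF hs ?_
  have hker : ker F = Submodule.map (coneLine hp c u) ⊤ := by
    ext z
    constructor
    · intro hz
      obtain ⟨v, rfl⟩ := hk' z hz
      exact ⟨v, trivial, rfl⟩
    · rintro ⟨v, -, rfl⟩
      exact hk v
  rw [hker]
  refine AcyclicOn.map (D := blkDiff p (0 : k →ₗ[k] k))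
    (acyclicOn_top_of_homotopy hp0 (blkDiff_homotopySum p hp0 0)) (fun v => ?_) ?_
  · refine Prod.ext (funext fun i => ?_) (funext fun j => ?_)
    · change _ = (Wd k 3 s c).diff (coneLine hp c u v).1 i
      rw [coneLine_fst, Wd_diff_apply, blkDiff_apply, LinearMap.zero_apply, add_zero]
      fin_cases i
      · simp
      · simp [coneLine_fst]
      · simp [coneLine_fst]; ring
    · change _ = blkDiff (p - 1) U.diff (coneLine hp c u v).2 j + coneInj (p - 1) (botMap k u) (coneLine hp c u v).1 j
      rw [coneLine_snd, blkDiff_apply, blkDiff_apply, coneInj_apply, coneLine_snd, coneLine_snd, U.diff.map_smul, hu, smul_zero, add_zero,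
        LinearMap.zero_apply, add_zero, dif_neg (by simp)]
      by_cases h : (j : ℕ) = 0
      · rw [dif_pos h, if_pos h, botMap_apply, coneLine_fst, zero_add]
        simp [h]
      · rw [dif_neg h, if_neg h, add_zero]
        exact congrArg (fun i => v i • u) (Fin.ext (by simp; omega))
  · refine (injective_iff_map_eq_zero _).mpr fun v hv => funext fun j => ?_
    by_cases h : (j : ℕ) = 0
    · have := congrFun (congrArg Prod.fst hv) 0
      rw [coneLine_fst] at this
      have h' : j = ⟨((0 : Fin 3) : ℕ), by simp; omega⟩ := Fin.ext h
      rw [h']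
      simpa using this
    · have := congrFun (congrArg Prod.snd hv) ⟨j - 1, by omega⟩
      rw [coneLine_snd] at this
      have h' : j = ⟨((⟨j - 1, by omega⟩ : Fin (p - 1)) : ℕ) + 1, by simp; omega⟩ := Fin.ext (by simp; omega)
      rw [h']
      exact (smul_eq_zero.mp this).resolve_right hu0

/-- The quotient of the cone of `w ↦ w_0` by the free module generated by the bottom vector. -/
def coneBotMap (hp : 2 < p) (c : k) : ((Fin 3 → k) × (Fin (p - 1) → Fin 1 → k)) →ₗ[k] (Fin 2 → k) where
  toFun z := ![z.1 1 - c * z.2 ⟨0, by omega⟩ 0, z.1 2 - c ^ 2 * z.2 ⟨1, by omega⟩ 0]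
  map_add' z z' := by
    funext i; fin_cases i <;> simp <;> ring
  map_smul' a z := by
    funext i; fin_cases i <;> simp <;> ring

lemma coneBotMap_apply (hp : 2 < p) (c : k) (z : (Fin 3 → k) × (Fin (p - 1) → Fin 1 → k)) :
    coneBotMap hp c z = ![z.1 1 - c * z.2 ⟨0, by omega⟩ 0, z.1 2 - c ^ 2 * z.2 ⟨1, by omega⟩ 0] := rfl

lemma cone_Wd_diff {n : ℕ} {s s' : ℤ} {c m : k} (u : Fin n → k) (z : (Fin 3 → k) × (Fin (p - 1) → Fin n → k)) :
    (cone p (Wd k 3 s c) (Wd k n s' m) (botMap k u)).diff z =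
      ((fun i : Fin 3 => c * if h : (i : ℕ) = 0 then 0 else z.1 ⟨i - 1, by omega⟩),
        fun (j : Fin (p - 1)) (i : Fin n) =>
        (if h : (j : ℕ) = 0 then z.1 0 * u i else z.2 ⟨j - 1, by omega⟩ i) +
          m * if h : (i : ℕ) = 0 then 0 else z.2 j ⟨i - 1, by omega⟩) := by
  refine Prod.ext (funext fun i => Wd_diff_apply (s := s) z.1 i) (funext fun j => funext fun i => ?_)
  change (blkDiff (p - 1) (Wd k n s' m).diff z.2 j + coneInj (p - 1) (botMap k u) z.1 j) i = _
  rw [blkDiff_apply, coneInj_apply]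
  refine (congrArg₂ (· + ·) (congrArg₂ (· + ·) rfl (Wd_diff_apply (s := s') (z.2 j) i)) rfl).trans ?_
  by_cases h : (j : ℕ) = 0
  · simp only [dif_pos h, if_pos h]
    exact (congrArg (· + _) (zero_add _)).trans (add_comm _ _)
  · simp only [dif_neg h, if_neg h]
    exact add_zero _

lemma mem_cone_Wd {n : ℕ} {s s' e : ℤ} {c m : k} {u : Fin n → k} {z : (Fin 3 → k) × (Fin (p - 1) → Fin n → k)}
    (hz : z ∈ (cone p (Wd k 3 s c) (Wd k n s' m) (botMap k u)).gr e) :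
    (∀ i : Fin 3, s + 2 * ((i : ℕ) : ℤ) ≠ e → z.1 i = 0) ∧
      ∀ (j : Fin (p - 1)) (i : Fin n), s' + 2 * ((i : ℕ) : ℤ) + 2 * ((j : ℕ) + 1) ≠ e → z.2 j i = 0 :=
  ⟨mem_Wd.mp hz.1, fun j i h => mem_Wd.mp (hz.2 j trivial) i (by omega)⟩

lemma coneBotMap_coneLine (hp : 2 < p) (c : k) (v : Fin p → k) :
    coneBotMap hp c (coneLine hp c (![1] : Fin 1 → k) v) = 0 := by
  rw [coneBotMap_apply]
  simp only [coneLine_fst, coneLine_snd]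
  funext i; fin_cases i <;> simp

lemma exists_coneLine_of_coneBotMap (hp : 2 < p) (c : k) (z : (Fin 3 → k) × (Fin (p - 1) → Fin 1 → k))
    (hz : coneBotMap hp c z = 0) : ∃ v, coneLine hp c (![1] : Fin 1 → k) v = z := by
  rw [coneBotMap_apply] at hz
  have h1 := congrFun hz 0
  have h2 := congrFun hz 1
  refine ⟨fun j => if h : (j : ℕ) = 0 then z.1 0 else z.2 ⟨j - 1, by omega⟩ 0, ?_⟩
  refine Prod.ext (funext fun i => ?_) (funext fun j => funext fun i => ?_)
  · rw [coneLine_fst]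
    fin_cases i
    · simp
    · simp at h1 ⊢; linear_combination -h1
    · simp at h2 ⊢; linear_combination -h2
  · rw [coneLine_snd]
    fin_cases i
    simp

/-- The cone of `w ↦ w_0`, with values in a line. -/
lemma cone_bot_iso [Fact p.Prime] [CharP k p] (hp : 2 < p) (c : k) :
    HomotopyIso p (cone p (Wd k 3 2 c) (Wd k 1 2 0) (botMap k ![1])) (Wd k 2 4 c) := by
  have hU : IsPComplex p (Wd k 1 2 (0 : k)) := Wd_isPComplex (by omega) _ _
  refine cone_iso_of_ker_eq_coneLine hp hU (Wd_isPComplex (by omega) _ _) (u := ![1]) ?_ ?_ ?_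
    (F := coneBotMap hp c) ⟨fun z => ?_, fun e z hz => ?_⟩ (fun t => ?_) (coneBotMap_coneLine hp c)
    (exists_coneLine_of_coneBotMap hp c)
  · exact fun h => one_ne_zero (congrFun h 0)
  · exact zero_smul k (blkShift k 1 k ![1])
  · refine mem_Wd.mpr fun j hj => ?_
    fin_cases j
    simp at hj
  · rw [cone_Wd_diff]
    refine funext fun i => ?_
    rw [Wd_diff_apply, coneBotMap_apply, coneBotMap_apply]
    fin_cases i
    · simp
    · simp; ring
  · obtain ⟨h1, h2⟩ := mem_cone_Wd hz
    refine mem_Wd.mpr fun j hj => ?_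
    rw [coneBotMap_apply]
    fin_cases j
    · simp at hj ⊢
      rw [h1 1 (by simpa using hj), h2 _ _ (by simpa using hj)]; simp
    · simp at hj ⊢
      rw [h1 2 (by simpa using hj), h2 _ _ (by simp; omega)]; simp
  · refine ⟨(![0, t 0, t 1], (0 : Fin (p - 1) → Fin 1 → k)), ?_⟩
    rw [coneBotMap_apply]
    funext i; fin_cases i <;> simp

/-- The quotient of the cone of `w ↦ -w_0 e_2` by the free module generated by the bottom vector. -/
def coneTopMap (hp : 2 < p) (c m : k) : ((Fin 3 → k) × (Fin (p - 1) → Fin 3 → k)) →ₗ[k]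
    (Fin 2 → k) × (Fin (p - 1) → Fin 2 → k) :=
  LinearMap.prod
    { toFun := fun z => ![z.1 1 + c * z.2 ⟨0, by omega⟩ 2 - c * m * z.2 ⟨1, by omega⟩ 1 +
          c * m ^ 2 * (if h : 2 < p - 1 then z.2 ⟨2, h⟩ 0 else 0),
        z.1 2 + c ^ 2 * z.2 ⟨1, by omega⟩ 2 - 2 * c ^ 2 * m * (if h : 2 < p - 1 then z.2 ⟨2, h⟩ 1 else 0) +
          3 * c ^ 2 * m ^ 2 * (if h : 3 < p - 1 then z.2 ⟨3, h⟩ 0 else 0)]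
      map_add' := fun z z' => by
        by_cases h2 : 2 < p - 1 <;> by_cases h3 : 3 < p - 1 <;> simp only [h2, h3, dif_pos, dif_neg] <;>
          funext i <;> fin_cases i <;> simp <;> ring
      map_smul' := fun a z => by
        by_cases h2 : 2 < p - 1 <;> by_cases h3 : 3 < p - 1 <;> simp only [h2, h3, dif_pos, dif_neg] <;>
          funext i <;> fin_cases i <;> simp <;> ring }
    (LinearMap.pi fun j => LinearMap.pi fun i => proj (⟨i, by omega⟩ : Fin 3) ∘ₗ
      proj j ∘ₗ snd k _ _)

lemma coneTopMap_fst (hp : 2 < p) (c m : k) (z : (Fin 3 → k) × (Fin (p - 1) → Fin 3 → k)) :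
    (coneTopMap hp c m z).1 = ![z.1 1 + c * z.2 ⟨0, by omega⟩ 2 - c * m * z.2 ⟨1, by omega⟩ 1 +
          c * m ^ 2 * (if h : 2 < p - 1 then z.2 ⟨2, h⟩ 0 else 0),
        z.1 2 + c ^ 2 * z.2 ⟨1, by omega⟩ 2 - 2 * c ^ 2 * m * (if h : 2 < p - 1 then z.2 ⟨2, h⟩ 1 else 0) +
          3 * c ^ 2 * m ^ 2 * (if h : 3 < p - 1 then z.2 ⟨3, h⟩ 0 else 0)] := rfl

lemma coneTopMap_snd (hp : 2 < p) (c m : k) (z : (Fin 3 → k) × (Fin (p - 1) → Fin 3 → k)) (j : Fin (p - 1))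
    (i : Fin 2) : (coneTopMap hp c m z).2 j i = z.2 j ⟨i, by omega⟩ := rfl

lemma coneTopMap_coneLine (hp : 2 < p) {c m : k} (h : m * c = 0 ∨ 5 ≤ p) (v : Fin p → k) :
    coneTopMap hp c m (coneLine hp c (![0, 0, -1] : Fin 3 → k) v) = 0 := by
  refine Prod.ext ?_ (funext fun j => funext fun i => ?_)
  · rw [coneTopMap_fst]
    simp only [coneLine_fst, coneLine_snd]
    funext i; fin_cases i <;> simp
  · rw [coneTopMap_snd, coneLine_snd]
    fin_cases i <;> simp

lemma exists_coneLine_of_coneTopMap (hp : 2 < p) (c m : k) (z : (Fin 3 → k) × (Fin (p - 1) → Fin 3 → k))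
    (hz : coneTopMap hp c m z = 0) : ∃ v, coneLine hp c (![0, 0, -1] : Fin 3 → k) v = z := by
  have h2 : ∀ j i, _ := fun j i => (coneTopMap_snd hp c m z j i).symm.trans (congrFun (congrFun (congrArg Prod.snd hz) j) i)
  have h0 : ∀ j, z.2 j 0 = 0 := fun j => h2 j 0
  have h1 : ∀ j, z.2 j 1 = 0 := fun j => h2 j 1
  have h3 := (coneTopMap_fst hp c m z).symm.trans (congrArg Prod.fst hz)
  simp only [h0, h1, dite_eq_ite, ite_self, mul_zero, sub_zero, add_zero] at h3
  have h4 := congrFun h3 0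
  have h5 := congrFun h3 1
  refine ⟨fun j => if h : (j : ℕ) = 0 then z.1 0 else -z.2 ⟨j - 1, by omega⟩ 2, ?_⟩
  refine Prod.ext (funext fun i => ?_) (funext fun j => funext fun i => ?_)
  · rw [coneLine_fst]
    fin_cases i
    · simp
    · simp at h4 ⊢; linear_combination -h4
    · simp at h5 ⊢; linear_combination -h5
  · rw [coneLine_snd]
    fin_cases i
    · simp [h0]
    · simp [h1]
    · simp

lemma coneTopMap_diff (hp : 2 < p) {c m : k} (h : m * c = 0 ∨ 5 ≤ p)
    (z : (Fin 3 → k) × (Fin (p - 1) → Fin 3 → k)) (i : Fin 2) :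
    (coneTopMap hp c m ((cone p (Wd k 3 2 c) (Wd k 3 (-2) m) (botMap k ![0, 0, -1])).diff z)).1 i =
      c * if h : (i : ℕ) = 0 then 0 else (coneTopMap hp c m z).1 ⟨i - 1, by omega⟩ := by
  rw [cone_Wd_diff, coneTopMap_fst, coneTopMap_fst]
  rcases h with h | h
  · have e1 : c * m = 0 := by rw [mul_comm, h]
    have e2 : c * m ^ 2 = 0 := by rw [pow_two, ← mul_assoc, e1, zero_mul]
    have e3 : 2 * c ^ 2 * m = 0 := by linear_combination 2 * c * e1
    have e4 : 3 * c ^ 2 * m ^ 2 = 0 := by linear_combination 3 * c * m * e1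
    simp only [e1, e2, e3, e4, zero_mul, add_zero, sub_zero]
    fin_cases i
    · simp; linear_combination z.2 ⟨0, by omega⟩ 1 * e1
    · simp; linear_combination c * z.2 ⟨1, by omega⟩ 1 * e1
  · have h2 : 2 < p - 1 := by omega
    have h3 : 3 < p - 1 := by omega
    simp only [h2, h3, dif_pos]
    fin_cases i
    · simp; ring
    · simp; ring

/-- The cone of `w ↦ -w_0 e_2`. The hypothesis makes `coneTopMap` a morphism: for `p = 3` the target has
too few copies for its correction terms unless these vanish. -/
lemma cone_top_iso [Fact p.Prime] [CharP k p] (hp : 2 < p) (c m : k) (h : m * c = 0 ∨ 5 ≤ p) :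
    HomotopyIso p (cone p (Wd k 3 2 c) (Wd k 3 (-2) m) (botMap k ![0, 0, -1]))
      (sumC (Wd k 2 4 c) (Sm p (Wd k 2 (-2) m))) := by
  have hU : IsPComplex p (Wd k 3 (-2) m) := Wd_isPComplex (by omega) _ _
  have hT : IsPComplex p (sumC (Wd k 2 4 c) (Sm p (Wd k 2 (-2) m))) :=
    (Wd_isPComplex (by omega) _ _).sumC ((Wd_isPComplex (by omega) _ _).blk (Nat.sub_le p 1) 2)
  refine cone_iso_of_ker_eq_coneLine hp hU hT (u := ![0, 0, -1]) ?_ (Wd_top_diff _ _) (Wd_top_mem m)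
    (F := coneTopMap hp c m) ⟨fun z => ?_, fun e z hz => ?_⟩ (fun t => ?_) (coneTopMap_coneLine hp h)
    (exists_coneLine_of_coneTopMap hp c m)
  · exact fun h => neg_ne_zero.mpr one_ne_zero (congrFun h 2)
  · refine Prod.ext (funext fun i => ?_) (funext fun j => funext fun i => ?_)
    · exact (coneTopMap_diff hp h z i).trans (Wd_diff_apply (s := 4) (coneTopMap hp c m z).1 i).symm
    · rw [coneTopMap_snd, cone_Wd_diff]
      refine Eq.trans ?_ (congrFun (blkDiff_apply (p - 1) (Wd k 2 (-2) m).diff (coneTopMap hp c m z).2 j) i).symm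
      refine Eq.trans ?_ (congrArg₂ (· + ·) rfl (Wd_diff_apply (s := -2) ((coneTopMap hp c m z).2 j) i)).symm
      by_cases hj : (j : ℕ) = 0
      · simp only [dif_pos hj]
        fin_cases i
        · simp; rfl
        · simp; exact (zero_add _).symm
      · simp only [dif_neg hj]
        fin_cases i <;> simp [coneTopMap_snd]
  · obtain ⟨h1, h2⟩ := mem_cone_Wd hz
    refine ⟨mem_Wd.mpr fun i hi => ?_, fun j _ => mem_Wd.mpr fun i hi => ?_⟩
    · rw [coneTopMap_fst]
      fin_cases i
      · simp at hi
        simp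
        rw [h1 1 (by simpa using hi), h2 _ 2 (by simpa using hi), h2 _ 1 (by simpa using hi)]
        have : ∀ h : 2 < p - 1, z.2 ⟨2, h⟩ 0 = 0 := fun h => h2 _ 0 (by simpa using hi)
        simp [this]
      · simp at hi
        simp
        rw [h1 2 (by simpa using hi), h2 _ 2 (by simp; omega)]
        have h3 : ∀ h : 2 < p - 1, z.2 ⟨2, h⟩ 1 = 0 := fun h => h2 _ 1 (by simp; omega)
        have h4 : ∀ h : 3 < p - 1, z.2 ⟨3, h⟩ 0 = 0 := fun h => h2 _ 0 (by simp; omega)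
        simp [h3, h4]
    · rw [coneTopMap_snd]
      exact h2 _ _ (by simp; omega)
  · let y : Fin (p - 1) → Fin 3 → k := fun j => ![t.2 j 0, t.2 j 1, 0]
    let z0 := coneTopMap hp c m (0, y)
    refine ⟨(![0, t.1 0 - z0.1 0, t.1 1 - z0.1 1], y), ?_⟩
    refine Prod.ext (funext fun i => ?_) (funext fun j => funext fun i => ?_)
    · simp only [z0, coneTopMap_fst]
      fin_cases i <;> simp <;> ring
    · rw [coneTopMap_snd]
      fin_cases i <;> rfl

/-- In characteristic three the cone of `w ↦ -w_0 e_2` is acyclic if both operators are nonzero. -/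
lemma cone_top_contractible [Fact p.Prime] [CharP k p] (hp : p = 3) {c m : k} (hc : c ≠ 0) (hm : m ≠ 0) :
    Contractible p (cone p (Wd k 3 2 c) (Wd k 3 (-2) m) (botMap k ![0, 0, -1])) := by
  subst hp
  have h3 : (3 : k) = 0 := by exact_mod_cast CharP.cast_eq_zero k 3
  have h2 : (2 : k) ≠ 0 := fun h => one_ne_zero (α := k) (by linear_combination h3 - h)
  have hg : IsHom (Wd k 3 2 c) (Wd k 3 (-2) m) (botMap k ![0, 0, -1]) :=
    botMap_isHom (Wd_top_diff _ _) (Wd_top_mem m)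
  have hC := (Wd_isPComplex (p := 3) (by omega) 2 c).cone (Wd_isPComplex (by omega) (-2) m) hg
  refine IsPComplex.contractible (by omega) hC ?_
  rintro ⟨w, y⟩ - hz
  have hd := cone_Wd_diff (p := 3) (s := 2) (s' := -2) (c := c) (m := m) ![0, 0, -1]
  generalize (cone 3 (Wd k 3 2 c) (Wd k 3 (-2) m) (botMap k ![0, 0, -1])).diff = D at hd hz ⊢
  rw [hd] at hz
  have e1 := fun i => congrFun (congrArg Prod.fst hz) i
  have e2 := fun (j : Fin 2) i => congrFun (congrFun (congrArg Prod.snd hz) j) i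
  have w0 := e1 1
  have w1 := e1 2
  have y00 := e2 1 0
  have y01 := e2 1 1
  have y02 := e2 1 2
  have y0 := e2 0 2
  simp [hc] at w0 w1 y00 y01 y02 y0
  have y01' : y 0 1 = 0 := by
    rw [w0, neg_zero, zero_add] at y0
    exact (mul_eq_zero.mp y0).resolve_left hm
  have y10 : y 1 0 = 0 := by
    rw [y01', zero_add] at y01
    exact (mul_eq_zero.mp y01).resolve_left hm
  let a : k := y 1 1 / (2 * m)
  let b : k := (y 1 2 + w 2 / c ^ 2) / m ^ 2
  have ha : 2 * m * a = y 1 1 := mul_div_cancel₀ _ (mul_ne_zero h2 hm)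
  have hb : m ^ 2 * b = y 1 2 + w 2 / c ^ 2 := mul_div_cancel₀ _ (pow_ne_zero 2 hm)
  have hw : c ^ 2 * (w 2 / c ^ 2) = w 2 := mul_div_cancel₀ _ (pow_ne_zero 2 hc)
  refine ⟨(![w 2 / c ^ 2, 0, 0], ![![a, 0, 0], ![b, 0, 0]]), trivial, ?_⟩
  generalize w 2 / c ^ 2 = w' at hb hw ⊢
  generalize a = a at ha ⊢
  generalize b = b at hb ⊢
  change D (D _) = _
  rw [hd, hd]
  refine Prod.ext (funext fun i => ?_) (funext fun j => funext fun i => ?_)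
  · fin_cases i
    · simp [w0]
    · simp [w1]
    · simp; linear_combination hw
  · fin_cases j <;> fin_cases i
    · simp [y00]
    · simp [y01']
    · simp; linear_combination m * m * a * h3 - m * ha - y02
    · simp [y10]
    · simp; linear_combination ha
    · simp; linear_combination hb

lemma opD_eq_prodMap : opD k = (botMap k ![0, 0, -1]).prodMap LinearMap.id ∘ₗ (LinearEquiv.prodComm k _ _).toLinearMap := by
  refine LinearMap.ext fun t => (opD_apply t).trans (Prod.ext (funext fun i => ?_) rfl)
  change _ = t.2 0 * (![0, 0, -1] : Fin 3 → k) i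
  fin_cases i <;> simp

lemma projAS_eq_prodMap : projAS k = LinearMap.id.prodMap (botMap k ![1]) := by
  refine LinearMap.ext fun t => (projAS_apply t).trans (Prod.ext rfl (funext fun i => ?_))
  change _ = t.2 0 * (![1] : Fin 1 → k) i
  fin_cases i; simp

lemma cone_projAS_iso [Fact p.Prime] [CharP k p] (hp : 2 < p) :
    HomotopyIso p (cone p (Acx k 0) (Scx k) (projAS k)) (Wd k 2 4 1) := by
  rw [projAS_eq_prodMap]
  have hW : IsPComplex p (Wd k 3 0 ((0 : ℕ) : k)) := Wd_isPComplex (by omega) _ _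
  have h0 : Contractible p (cone p (Wd k 3 0 ((0 : ℕ) : k)) (Wd k 3 0 0) LinearMap.id) := by
    have := cone_contractible (p := p) hW hW (IsHom.id _) Function.bijective_id
    rwa [Nat.cast_zero] at this ⊢
  have h1 := cone_bot_iso (k := k) hp ((0 + 1 : ℕ) : k)
  rw [zero_add, Nat.cast_one] at h1
  refine (cone_iso_sum_cone (p := p) (X := Acx k 0) (A := Wd k 3 0 ((0 : ℕ) : k)) (B := Wd k 3 2 ((0 + 1 : ℕ) : k))
    (C := Wd k 3 0 0) (D := Wd k 1 2 0) (LinearEquiv.refl k _) (fun _ => rfl) (fun _ _ => Iff.rfl)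
    LinearMap.id (botMap k ![1])).trans ((sum_comm_iso _ _).trans ((sum_contractible _ h0).trans ?_))
  rw [zero_add, Nat.cast_one]
  exact h1

lemma cone_id_contractible [Fact p.Prime] [CharP k p] (hp : 2 < p) (c : k) :
    Contractible p (cone p (Wd k 3 0 c) ((Wd k 3 2 c).qShift (-2)) (LinearMap.id : (Fin 3 → k) →ₗ[k] (Fin 3 → k))) := by
  refine cone_contractible (Wd_isPComplex (by omega) _ _) ((Wd_isPComplex (by omega) _ _).qShift _)
    ⟨fun _ => rfl, fun e x hx => (mem_Wd (s := 2) (c := c)).mpr fun j hj => ?_⟩ Function.bijective_id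
  exact mem_Wd.mp hx j (by omega)

/-- The component of `d` sending powers of `e` to their multiples by `d` is an isomorphism, so only the
component given by `d² = -e²` contributes to the cone. -/
lemma cone_opD_iso [Fact p.Prime] [CharP k p] (hp : 2 < p) (n : ℕ) :
    HomotopyIso p (cone p (Acx k (n + 1)) ((Acx k n).qShift (-2)) (opD k))
      (cone p (Wd k 3 2 ((n + 2 : ℕ) : k)) (Wd k 3 (-2) (n : k)) (botMap k ![0, 0, -1])) := by
  have h1 : ∀ e, ((Wd k 3 0 (n : k)).qShift (-2)).gr e = (Wd k 3 (-2) (n : k)).gr e := fun e =>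
    Submodule.ext fun v => (mem_Wd (s := 0) (c := (n : k))).trans
      (Iff.trans (forall_congr' fun j => imp_congr (by omega) Iff.rfl) (mem_Wd (s := -2) (c := (n : k))).symm)
  have hS : ∀ e, (Sm p ((Wd k 3 0 (n : k)).qShift (-2))).gr e = (Sm p (Wd k 3 (-2) (n : k))).gr e := fun e =>
    congrArg (Submodule.pi Set.univ) (funext fun j => h1 _)
  have h0 := cone_id_contractible (p := p) hp ((n + 1 : ℕ) : k)
  rw [opD_eq_prodMap]
  refine (cone_iso_sum_cone (p := p) (X := Acx k (n + 1)) (A := Wd k 3 2 ((n + 1 + 1 : ℕ) : k))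
    (B := Wd k 3 0 ((n + 1 : ℕ) : k)) (C := (Wd k 3 0 (n : k)).qShift (-2))
    (D := (Wd k 3 2 ((n + 1 : ℕ) : k)).qShift (-2)) (LinearEquiv.prodComm k _ _) (fun _ => rfl)
    (fun _ _ => and_comm) (botMap k ![0, 0, -1]) (LinearMap.id : (Fin 3 → k) →ₗ[k] (Fin 3 → k))).trans ((sum_contractible _ h0).trans ?_)
  refine homotopyIso_of_equiv (M := cone p (Wd k 3 2 ((n + 1 + 1 : ℕ) : k)) ((Wd k 3 0 (n : k)).qShift (-2))
    (botMap k ![0, 0, -1])) (N := cone p (Wd k 3 2 ((n + 2 : ℕ) : k)) (Wd k 3 (-2) (n : k)) (botMap k ![0, 0, -1]))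
    (LinearEquiv.refl k _) (fun _ => rfl) ?_ ?_
  · exact fun e x hx => ⟨hx.1, (hS e).le hx.2⟩
  · exact fun e x hx => ⟨hx.1, (hS e).ge hx.2⟩

lemma cone_opD_iso_sum [Fact p.Prime] [CharP k p] (hp : 2 < p) (n : ℕ) (h : (n : k) * (n + 2 : ℕ) = 0 ∨ 5 ≤ p) :
    HomotopyIso p (cone p (Acx k (n + 1)) ((Acx k n).qShift (-2)) (opD k))
      ((Wd k 2 4 ((n + 2 : ℕ) : k)).sum (Sm p (Wd k 2 (-2) (n : k)))) :=
  (cone_opD_iso hp n).trans (cone_top_iso hp _ _ h)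

lemma cone_opD_contractible [Fact p.Prime] [CharP k p] (hp : p = 3) (n : ℕ) (h : (n : k) * (n + 2 : ℕ) ≠ 0) :
    Contractible p (cone p (Acx k (n + 1)) ((Acx k n).qShift (-2)) (opD k)) :=
  Contractible.of_homotopyIso (cone_opD_iso (by omega) n)
    (cone_top_contractible hp (right_ne_zero_of_mul h) (left_ne_zero_of_mul h))

end FiniteCones

/-! ### Decomposition into balanced complexes -/

section Balanced

variable {p : ℕ}

/-- With nonzero operator the model complex is a shift of a balanced complex. -/
lemma Wd_iso_V (n : ℕ) (s : ℤ) {c : k} (hc : c ≠ 0) :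
    HomotopyIso p (Wd k (n + 1) s c) ((V k n).qShift (s + n)) := by
  let e : (Fin (n + 1) → k) ≃ₗ[k] (Fin (n + 1) → k) :=
    LinearEquiv.piCongrRight fun j => LinearEquiv.smulOfNeZero k k ((c ^ (j : ℕ))⁻¹) (inv_ne_zero (pow_ne_zero _ hc))
  have he : ∀ v j, e v j = (c ^ (j : ℕ))⁻¹ * v j := fun _ _ => rfl
  have he' : ∀ v j, v j = 0 ↔ e v j = 0 := fun v j => by
    rw [he, mul_eq_zero]
    exact ⟨Or.inr, fun h => h.resolve_left (inv_ne_zero (pow_ne_zero _ hc))⟩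
  refine homotopyIso_of_equiv (M := Wd k (n + 1) s c) (N := (V k n).qShift (s + n)) e (fun v => funext fun j => ?_)
    (fun d v hv j hj => ?_) (fun d v hv => mem_Wd.mpr fun j hj => ?_)
  · change e ((Wd k (n + 1) s c).diff v) j = (V k n).diff (e v) j
    rw [he, Wd_diff_apply, V_diff_apply]
    split_ifs with h
    · rw [mul_zero, mul_zero]
    · rw [he]
      obtain ⟨i, hi⟩ : ∃ i, (j : ℕ) = i + 1 := ⟨j - 1, by omega⟩
      have : (c ^ (j : ℕ))⁻¹ * c = (c ^ ((j : ℕ) - 1))⁻¹ := by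
        rw [hi, Nat.add_sub_cancel, pow_succ, mul_inv_rev, mul_comm, ← mul_assoc, mul_inv_cancel₀ hc, one_mul]
      rw [← mul_assoc, this]
  · exact (he' v j).mp (mem_Wd.mp hv j (by omega))
  · refine (he' _ _).mpr ?_
    exact (congrFun (e.apply_symm_apply v) j).trans (hv j (by omega))

lemma Wd_one_iso (s : ℤ) (c : k) : HomotopyIso p (Wd k 1 s c) ((V k 0).qShift s) := by
  refine homotopyIso_of_equiv (M := Wd k 1 s c) (N := (V k 0).qShift s) (LinearEquiv.refl k _)
    (fun v => funext fun j => ?_) (fun d v hv j hj => mem_Wd.mp hv j ?_) (fun d v hv => mem_Wd.mpr fun j hj => hv j ?_)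
  · change (Wd k 1 s c).diff v j = (V k 0).diff v j
    have h0 : (j : ℕ) = 0 := by have := j.isLt; omega
    rw [Wd_diff_apply, V_diff_apply, dif_pos h0, mul_zero]
  · simp at hj ⊢; omega
  · simp at hj ⊢; omega

lemma Wd_succ_zero_iso (n : ℕ) (s : ℤ) :
    HomotopyIso p (Wd k (n + 1) s 0) ((Wd k 1 s 0).sum (Wd k n (s + 2) 0)) := by
  have hd : ∀ n s (v : Fin n → k), (Wd k n s 0).diff v = 0 := fun n s v => zero_smul k (blkShift k n k v)
  let e : (Fin (n + 1) → k) ≃ₗ[k] (Fin 1 → k) × (Fin n → k) :=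
    { toFun := fun v => (fun _ => v 0, fun j => v j.succ)
      invFun := fun w => Fin.cons (w.1 0) w.2
      map_add' := fun _ _ => rfl
      map_smul' := fun _ _ => rfl
      left_inv := fun v => Fin.cons_self_tail v
      right_inv := fun w => Prod.ext (funext fun i => by fin_cases i; rfl) rfl }
  refine homotopyIso_of_equiv (M := Wd k (n + 1) s 0) (N := (Wd k 1 s 0).sum (Wd k n (s + 2) 0)) e (fun v => ?_)
    (fun d v hv => ⟨mem_Wd.mpr fun j hj => ?_, mem_Wd.mpr fun j hj => ?_⟩) (fun d v hv => mem_Wd.mpr fun j hj => ?_)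
  · refine Eq.trans (congrArg e (hd (n + 1) s v)) (Eq.trans (map_zero e) ?_)
    exact (Prod.ext (hd 1 s _) (hd n (s + 2) _)).symm
  · exact mem_Wd.mp hv 0 (by simp at hj ⊢; omega)
  · exact mem_Wd.mp hv j.succ (by simp at hj ⊢; omega)
  · change (Fin.cons (v.1 0) v.2 : Fin (n + 1) → k) j = 0
    refine Fin.cases (fun hj => ?_) (fun j hj => ?_) j hj
    · exact mem_Wd.mp hv.1 0 (by simpa using hj)
    · exact mem_Wd.mp hv.2 j (by simp at hj ⊢; omega)

lemma qShift_twoV (a : ℤ) : (twoV k).qShift a = ((V k 0).qShift a).sum ((V k 0).qShift (2 + a)) := by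
  rw [← qShift_qShift]; rfl

lemma qShift_threeV (a : ℤ) : (threeV k).qShift a =
    ((V k 0).qShift a).sum (((V k 0).qShift (2 + a)).sum ((V k 0).qShift (4 + a))) := by
  rw [← qShift_qShift, ← qShift_qShift]; rfl

lemma Wd_two_zero_iso (s : ℤ) : HomotopyIso p (Wd k 2 s 0) ((twoV k).qShift s) := by
  rw [qShift_twoV, add_comm]
  exact (Wd_succ_zero_iso 1 s).trans ((Wd_one_iso _ _).sum (Wd_one_iso _ _))

lemma Wd_three_zero_iso (s : ℤ) : HomotopyIso p (Wd k 3 s 0) ((threeV k).qShift s) := by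
  rw [qShift_threeV, add_comm, show (4 : ℤ) + s = s + 2 + 2 by ring]
  exact (Wd_succ_zero_iso 2 s).trans ((Wd_one_iso _ _).sum
    ((Wd_succ_zero_iso 1 (s + 2)).trans ((Wd_one_iso _ _).sum (Wd_one_iso _ _))))

lemma Wd_two_iso_of_ne {c : k} (hc : c ≠ 0) {s a b : ℤ} (h : s + 1 = a + b) :
    HomotopyIso p (Wd k 2 s c) (((V k 1).qShift a).qShift b) := by
  rw [qShift_qShift, ← h]
  exact Wd_iso_V 1 s hc

lemma Wd_two_iso_of_eq {c : k} (hc : c = 0) {s a b : ℤ} (h : s = a + b) :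
    HomotopyIso p (Wd k 2 s c) (((twoV k).qShift a).qShift b) := by
  rw [qShift_qShift, ← h, hc]
  exact Wd_two_zero_iso s

lemma Wd_three_iso_of_ne {c : k} (hc : c ≠ 0) {s a b : ℤ} (h : s + 2 = a + b) :
    HomotopyIso p (Wd k 3 s c) (((V k 2).qShift a).qShift b) := by
  rw [qShift_qShift, ← h]
  exact Wd_iso_V 2 s hc

lemma Wd_three_iso_of_eq {c : k} (hc : c = 0) {s a b : ℤ} (h : s = a + b) :
    HomotopyIso p (Wd k 3 s c) (((threeV k).qShift a).qShift b) := by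
  rw [qShift_qShift, ← h, hc]
  exact Wd_three_zero_iso s

end Balanced

namespace QComplex

variable {p : ℕ} [Fact p.Prime] [CharP k p] {M N : QComplex k}

lemma Sm_qShift (a : ℤ) (M : QComplex k) : Sm p (M.qShift a) = (Sm p M).qShift a := blk_qShift _ _ _ _

lemma HomotopyIso.shiftNegOne (hp : 2 < p) (h : HomotopyIso p M N) :
    HomotopyIso p (shiftNegOne p M) (Sm p N) := (shiftNegOne_iso hp M).trans (h.blk _ _)

lemma HomotopyIso.shiftOne (hp : 2 < p) (h : HomotopyIso p M N) :
    HomotopyIso p (shiftOne p M) ((Sm p N).qShift (-2 * (p : ℤ))) :=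
  (shiftOne_iso hp M).trans ((h.blk _ _).qShift _)

lemma shift_even_iso (hp : 2 < p) (hM : IsPComplex p M) (i : ℕ) :
    HomotopyIso p (shift p (2 * i) M) (M.qShift (-2 * p * i)) := by
  induction i with
  | zero =>
    refine HomotopyIso.of_eq ?_
    change M = _
    rw [Nat.cast_zero, mul_zero, qShift_zero]
  | succ i ih =>
    have h : shift p (2 * (i + 1)) M = shiftOne p (shiftOne p (shift p (2 * i) M)) :=
      (Function.iterate_succ_apply' _ (2 * i + 1) _).trans
        (congrArg (shiftOne p) (Function.iterate_succ_apply' _ (2 * i) _))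
    rw [h]
    refine ((ih.shiftOne hp).shiftOne hp).trans ?_
    rw [Sm_qShift, Sm_qShift, Sm_qShift, qShift_qShift, qShift_qShift]
    refine ((sm_sm hp hM).qShift _).trans (HomotopyIso.of_eq ?_)
    rw [qShift_qShift]
    congr 1; push_cast; ring

lemma shift_odd_iso (hp : 2 < p) (hM : IsPComplex p M) (i : ℕ) :
    HomotopyIso p (shift p (2 * i + 1) M) ((Sm p M).qShift (-2 * p * (i + 1))) := by
  have h : shift p (2 * i + 1) M = shiftOne p (shift p (2 * i) M) := Function.iterate_succ_apply' _ _ _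
  rw [h]
  refine ((shift_even_iso hp hM i).shiftOne hp).trans (HomotopyIso.of_eq ?_)
  rw [Sm_qShift, qShift_qShift]
  congr 1; ring

lemma shiftNeg_even_iso (hp : 2 < p) (hN : IsPComplex p N) (i : ℕ) (h : HomotopyIso p M N) :
    HomotopyIso p (shiftNeg p (2 * i) M) (N.qShift (2 * p * i)) := by
  induction i with
  | zero =>
    refine h.trans (HomotopyIso.of_eq ?_)
    rw [Nat.cast_zero, mul_zero, qShift_zero]
  | succ i ih =>
    have h : shiftNeg p (2 * (i + 1)) M = shiftNegOne p (shiftNegOne p (shiftNeg p (2 * i) M)) :=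
      (Function.iterate_succ_apply' _ (2 * i + 1) _).trans
        (congrArg (shiftNegOne p) (Function.iterate_succ_apply' _ (2 * i) _))
    rw [h]
    refine ((ih.shiftNegOne hp).shiftNegOne hp).trans ?_
    rw [Sm_qShift, Sm_qShift]
    refine ((sm_sm hp hN).qShift _).trans (HomotopyIso.of_eq ?_)
    rw [qShift_qShift]
    congr 1; push_cast; ring

lemma shiftNeg_odd_iso (hp : 2 < p) (hN : IsPComplex p N) (i : ℕ) (h : HomotopyIso p M N) :
    HomotopyIso p (shiftNeg p (2 * i + 1) M) ((Sm p N).qShift (2 * p * i)) := by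
  have h' : shiftNeg p (2 * i + 1) M = shiftNegOne p (shiftNeg p (2 * i) M) := Function.iterate_succ_apply' _ _ _
  rw [h']
  refine ((shiftNeg_even_iso hp hN i h).shiftNegOne hp).trans (HomotopyIso.of_eq ?_)
  rw [Sm_qShift]

end QComplex

/-! ### The summands `X_i` and `Y_{n/2}` -/

section Summands

variable {p : ℕ} [Fact p.Prime] [CharP k p]

lemma stable_V (hp : 2 < p) {i : ℕ} (hi : i < p) (a : ℤ) : SlashStable p ((V k i).qShift a) :=
  (SlashStable.V hp hi).qShift a

lemma stable_twoV (hp : 2 < p) (a : ℤ) : SlashStable p ((twoV k).qShift a) := by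
  rw [qShift_twoV]
  exact (stable_V hp (by omega) _).sum (stable_V hp (by omega) _)

lemma stable_threeV (hp : 2 < p) (a : ℤ) : SlashStable p ((threeV k).qShift a) := by
  rw [qShift_threeV]
  exact (stable_V hp (by omega) _).sum ((stable_V hp (by omega) _).sum (stable_V hp (by omega) _))

lemma Sm_sum_qShift_iso (A B : QComplex k) (c : ℤ) :
    HomotopyIso p ((Sm p (A.sum B)).qShift c) (((Sm p A).qShift c).sum ((Sm p B).qShift c)) :=
  (blk_sum (p - 1) 2 A B).qShift c

/-- A sum `A[2i+1] ⊕ B[2i]`, written as a slash-stable complex without iterated shifts. -/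
lemma exists_stable_shift_sum (hp : 2 < p) (i : ℕ) {A B A' B' : QComplex k} (hA : SlashStable p A)
    (hB : SlashStable p B) (h : HomotopyIso p A' (A.qShift (-4 * i))) (h' : HomotopyIso p B' (B.qShift (-4 * i))) :
    ∃ X, SlashStable p X ∧ HomotopyIso p ((A.shift p (2 * i + 1)).sum (B.shift p (2 * i))) X ∧
      HomotopyIso p (A'.sum (Sm p B')) ((Sm p X).qShift ((2 * p - 4) * i)) := by
  have h1 : HomotopyIso p A' ((Sm p ((Sm p A).qShift (-2 * p * (i + 1)))).qShift ((2 * p - 4) * i)) := by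
    have e := (sm_sm hp hA.isPComplex).qShift (-4 * i - 2 * p)
    rw [qShift_qShift, show 2 * (p : ℤ) + (-4 * i - 2 * p) = -4 * i by ring] at e
    rw [Sm_qShift, qShift_qShift, show -2 * (p : ℤ) * (i + 1) + (2 * p - 4) * i = -4 * i - 2 * p by ring]
    exact h.trans e.symm
  have h2 : HomotopyIso p (Sm p B') ((Sm p (B.qShift (-2 * p * i))).qShift ((2 * p - 4) * i)) := by
    rw [Sm_qShift, qShift_qShift, show -2 * (p : ℤ) * i + (2 * p - 4) * i = -4 * i by ring, ← Sm_qShift]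
    exact h'.blk _ _
  have h3 := shift_odd_iso hp hA.isPComplex i
  have h4 := shift_even_iso hp hB.isPComplex i
  have h5 := (hA.blk hp).qShift (-2 * p * (i + 1))
  have h6 := hB.qShift (-2 * p * i)
  generalize (Sm p A).qShift (-2 * p * (i + 1)) = P at *
  generalize B.qShift (-2 * p * i) = Q at *
  exact ⟨P.sum Q, h5.sum h6, h3.sum h4, (h1.sum h2).trans (Sm_sum_qShift_iso P Q _).symm⟩

/-- The cone of `ψ : B_{2i+2} → B_{2i+1}` is a shift of `X_{i+1}[-1]`, which is slash-stable. -/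
lemma exists_stable_XComplex (hp : 2 < p) (i : ℕ) : ∃ X, SlashStable p X ∧
    HomotopyIso p (XComplex k p (i + 1)) X ∧
    HomotopyIso p ((Wd k 2 4 ((2 * i + 3 : ℕ) : k)).sum (Sm p (Wd k 2 (-2) ((2 * i + 1 : ℕ) : k))))
      ((Sm p X).qShift ((2 * p - 4) * (i + 1 : ℕ))) := by
  have h1 : ((2 * i + 3 : ℕ) : k) = 0 ↔ (p : ℤ) ∣ 2 * ((i + 1 : ℕ) : ℤ) + 1 := by
    rw [CharP.cast_eq_zero_iff k p, ← Int.natCast_dvd_natCast]; push_cast; ring_nf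
  have h2 : ((2 * i + 1 : ℕ) : k) = 0 ↔ (p : ℤ) ∣ 2 * ((i + 1 : ℕ) : ℤ) - 1 := by
    rw [CharP.cast_eq_zero_iff k p, ← Int.natCast_dvd_natCast]; push_cast; ring_nf
  have h3 : ((2 * i + 3 : ℕ) : k) = 0 → ((2 * i + 1 : ℕ) : k) ≠ 0 := fun h h' => by
    refine HqBimod.two_ne_zero_of_charP (k := k) hp ?_
    push_cast at h h'
    linear_combination h - h'
  unfold XComplex
  split_ifs with h4 h5
  · exact exists_stable_shift_sum hp (i + 1) (stable_twoV hp _) (stable_V hp (by omega) _)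
      (Wd_two_iso_of_eq (h1.mpr h4) (by push_cast; ring)) (Wd_two_iso_of_ne (h3 (h1.mpr h4)) (by push_cast; ring))
  · exact exists_stable_shift_sum hp (i + 1) (stable_V hp (by omega) _) (stable_twoV hp _)
      (Wd_two_iso_of_ne (mt h1.mp h4) (by push_cast; ring)) (Wd_two_iso_of_eq (h2.mpr h5) (by push_cast; ring))
  · exact exists_stable_shift_sum hp (i + 1) (stable_V hp (by omega) _) (stable_V hp (by omega) _)
      (Wd_two_iso_of_ne (mt h1.mp h4) (by push_cast; ring)) (Wd_two_iso_of_ne (mt h2.mp h5) (by push_cast; ring))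

/-- The complex of `B_{2m+1}` is a shift of `Y_{m+1}`, which is slash-stable. -/
lemma exists_stable_YComplex (hp : 2 < p) (m : ℕ) : ∃ Y, SlashStable p Y ∧
    HomotopyIso p (YComplex k p (2 * (m + 1))) Y ∧
    HomotopyIso p (Acx k (2 * m + 1)) (Y.qShift (2 * p * (m + 1) - 4 * m - 2)) := by
  have h1 : ((2 * m + 1 : ℕ) : k) = 0 ↔ (p : ℤ) ∣ ((2 * (m + 1) : ℕ) : ℤ) - 1 := by
    rw [CharP.cast_eq_zero_iff k p, ← Int.natCast_dvd_natCast]; push_cast; ring_nf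
  have h2 : ((2 * m + 1 + 1 : ℕ) : k) = 0 ↔ (p : ℤ) ∣ ((2 * (m + 1) : ℕ) : ℤ) := by
    rw [CharP.cast_eq_zero_iff k p, ← Int.natCast_dvd_natCast]; push_cast; ring_nf
  have h3 : ((2 * m + 1 : ℕ) : k) = 0 → ((2 * m + 1 + 1 : ℕ) : k) ≠ 0 := fun h h' => by
    refine one_ne_zero (α := k) ?_
    push_cast at h h'
    linear_combination h' - h
  have key : ∀ A B : QComplex k, SlashStable p A → SlashStable p B →
      HomotopyIso p (Wd k 3 0 ((2 * m + 1 : ℕ) : k)) (A.qShift (-4 * m - 2)) →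
      HomotopyIso p (Wd k 3 2 ((2 * m + 1 + 1 : ℕ) : k)) (B.qShift (-4 * m - 2)) →
      ∃ Y, SlashStable p Y ∧ HomotopyIso p ((A.shift p (2 * (m + 1))).sum (B.shift p (2 * (m + 1)))) Y ∧
        HomotopyIso p (Acx k (2 * m + 1)) (Y.qShift (2 * p * (m + 1) - 4 * m - 2)) := by
    intro A B hA hB h h'
    refine ⟨(A.qShift (-2 * p * (m + 1 : ℕ))).sum (B.qShift (-2 * p * (m + 1 : ℕ))), (hA.qShift _).sum (hB.qShift _),
      (shift_even_iso hp hA.isPComplex (m + 1)).sum (shift_even_iso hp hB.isPComplex (m + 1)), ?_⟩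
    refine (h.sum h').trans (HomotopyIso.of_eq ?_)
    have e : ∀ C : QComplex k, C.qShift (-4 * m - 2) =
        (C.qShift (-2 * p * (m + 1 : ℕ))).qShift (2 * p * (m + 1) - 4 * m - 2) := fun C => by
      rw [qShift_qShift]; congr 1; push_cast; ring
    rw [e A, e B]; rfl
  unfold YComplex
  split_ifs with h4 h5
  · exact key _ _ (stable_threeV hp _) (stable_V hp (by omega) _)
      (Wd_three_iso_of_eq (h1.mpr h4) (by push_cast; ring)) (Wd_three_iso_of_ne (h3 (h1.mpr h4)) (by push_cast; ring))
  · exact key _ _ (stable_V hp (by omega) _) (stable_threeV hp _)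
      (Wd_three_iso_of_ne (mt h1.mp h4) (by push_cast; ring)) (Wd_three_iso_of_eq (h2.mpr h5) (by push_cast; ring))
  · exact key _ _ (stable_V hp (by omega) _) (stable_V hp (by omega) _)
      (Wd_three_iso_of_ne (mt h1.mp h4) (by push_cast; ring)) (Wd_three_iso_of_ne (mt h2.mp h5) (by push_cast; ring))

end Summands

/-! ### The recursion on the number of crossings -/

section Recursion

variable {p : ℕ} [Fact p.Prime] [CharP k p]

open HqBimod

/-- The braid complex `Mn k p n` retracts onto the polynomial ring. -/
noncomputable def polRetractMn (hp : 2 < p) : ∀ n, PolRetract p (Mn k p n) n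
  | 0 => PolRetract.zero
  | n + 1 => (polRetractMn hp n).succ hp (good_Mn n)

/-- The case of the unknot with one crossing. -/
lemma totC_Mn_one (hp : 2 < p) : HomotopyIso p (totC p (Mn k p 1)) ((V k 1).qShift 2) := by
  have hB : Good p (Bn k 0) := good_Bn_of_retract good_reg (PolRetract.zero (k := k))
  have h1 := (PolRetract.zero (k := k)).cone_iso hp good_reg
  have h2 := cone_reg_iso (k := k) hp hB good_reg
  rw [show Mn k p 1 = TwistB p (reg k) from rfl]
  generalize tot p (PolRetract.zero (p := p) (k := k)).isBi_mulJ = f at h1 h2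
  have h3 := ((h2.trans (cone_projAS_iso hp)).trans (Wd_iso_V 1 4 one_ne_zero)).qShift (-3)
  rw [qShift_qShift] at h3
  exact HomotopyIso.trans h1 h3

lemma totC_Mn_even (hp : 2 < p) (m : ℕ) : HomotopyIso p (totC p (Mn k p (2 * m + 2)))
    (((Acx k (2 * m + 1)).qShift (-2 * m - 4)).sum ((Sm p (totC p (Mn k p (2 * m + 1)))).qShift (-3))) := by
  have hB : Good p (Bn k (2 * m + 1)) :=
    good_Bn_of_retract (good_Mn (2 * m + 1)) (polRetractMn (k := k) hp (2 * m + 1))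
  have h1 := (polRetractMn (k := k) hp (2 * m)).cone_iso_even hp (good_Mn (2 * m))
  rw [show Mn k p (2 * m + 2) = TwistB p (TwistB p (Mn k p (2 * m))) from rfl,
    show Mn k p (2 * m + 1) = TwistB p (Mn k p (2 * m)) from rfl]
  have h2 := (Bn_iso hp hB).qShift (-3)
  rw [qShift_qShift] at h2
  have h3 : (-2 * m - 4 : ℤ) = -((2 * m + 1 : ℕ) : ℤ) + -3 := by push_cast; ring
  rw [h3]
  generalize totC p (TwistB p (TwistB p (Mn k p (2 * m)))) = T at h1 ⊢
  generalize totC p (TwistB p (Mn k p (2 * m))) = T' at h1 ⊢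
  generalize totC p (Bn k (2 * m + 1)) = T'' at h1 h2
  exact h1.trans (HomotopyIso.sum (M := T''.qShift (-3)) (N := (Sm p T').qShift (-3)) h2 (HomotopyIso.refl _))

lemma HomotopyIso.trans_sum_qShift {T T' C D S : QComplex k} {a : ℤ} (h : HomotopyIso p T ((C.sum S).qShift a))
    (hC : HomotopyIso p (C.qShift a) D) (hS : HomotopyIso p (S.qShift a) T') : HomotopyIso p T (D.sum T') :=
  h.trans (HomotopyIso.sum (M := C.qShift a) (N := S.qShift a) hC hS)

lemma Sm_qShift_Sm_iso (hp : 2 < p) {T : QComplex k} (hT : IsPComplex p T) :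
    HomotopyIso p ((Sm p ((Sm p T).qShift (-3))).qShift (-3)) (T.qShift (2 * p - 6)) := by
  rw [Sm_qShift, qShift_qShift]
  have e := (sm_sm hp hT).qShift (-3 + -3)
  rw [qShift_qShift, show 2 * (p : ℤ) + (-3 + -3) = 2 * p - 6 by ring] at e
  exact e

lemma totC_Mn_odd (hp : 2 < p) (m : ℕ) : HomotopyIso p (totC p (Mn k p (2 * m + 3)))
    (((cone p (Acx k (2 * m + 1 + 1)) ((Acx k (2 * m + 1)).qShift (-2)) (opD k)).qShift (-2 * m - 5)).sum
      ((totC p (Mn k p (2 * m + 1))).qShift (2 * p - 6))) := by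
  have hB : Good p (Bn k (2 * m + 1)) :=
    good_Bn_of_retract (good_Mn (2 * m + 1)) (polRetractMn (k := k) hp (2 * m + 1))
  have hB' : Good p (Bn k (2 * m + 1 + 1)) :=
    good_Bn_of_retract (good_Mn (2 * m + 1 + 1)) (polRetractMn (k := k) hp (2 * m + 1 + 1))
  have hM := (good_Mn (k := k) (p := p) (2 * m + 1)).isPComplex hp
  have h1 := (polRetractMn (k := k) hp (2 * m + 1)).cone_iso_of_eq_zero hp (good_Mn (2 * m + 1))
    ((polRetractMn (k := k) hp (2 * m)).tot_mulJ_eq_zero hp (good_Mn (2 * m)))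
  have h2 := (cone_Bn_iso hp m hB' hB).qShift (-3)
  rw [qShift_qShift, show (-((2 * m + 1 + 1 : ℕ) : ℤ) + -3) = -2 * m - 5 by push_cast; ring] at h2
  rw [show Mn k p (2 * m + 3) = TwistB p (TwistB p (Mn k p (2 * m + 1))) from rfl]
  exact HomotopyIso.trans_sum_qShift h1 h2 (Sm_qShift_Sm_iso hp hM)

/-- The complex of an odd number of crossings: the step from `2m + 1` to `2m + 3` adds `X_{m+1}`. -/
lemma exists_stable_odd (hp : 2 < p) (m : ℕ) : ∃ G, SlashStable p G ∧
    HomotopyIso p ((((V k 1).qShift 5).shift p 1).sum (bigSum (indexSet p m) (XComplex k p))) G ∧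
    HomotopyIso p (totC p (Mn k p (2 * m + 1))) ((Sm p G).qShift (2 * p * m - 6 * m - 3)) := by
  induction m with
  | zero =>
    have hV : SlashStable p ((V k 1).qShift 5) := stable_V hp (by omega) 5
    have h1 := shift_odd_iso hp hV.isPComplex 0
    refine ⟨_, (hV.blk hp).qShift (-2 * p * ((0 : ℕ) + 1)), ?_, (totC_Mn_one hp).trans ?_⟩
    · rw [show indexSet p 0 = ∅ from rfl]
      exact (sum_contractible _ (bigSum_empty_contractible _)).trans h1
    · rw [Sm_qShift, qShift_qShift]
      have h2 := (sm_sm hp hV.isPComplex).qShift (-2 * (p : ℤ) * ((0 : ℕ) + 1) + (2 * p * (0 : ℕ) - 6 * (0 : ℕ) - 3))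
      rw [qShift_qShift, qShift_qShift] at h2
      refine HomotopyIso.trans (HomotopyIso.of_eq ?_) h2.symm
      congr 1; push_cast; ring
  | succ m ih =>
    obtain ⟨G, hG, h1, h2⟩ := ih
    have h3 := totC_Mn_odd (k := k) hp m
    have h4 := h2.qShift (2 * (p : ℤ) - 6)
    rw [qShift_qShift, show 2 * (p : ℤ) * m - 6 * m - 3 + (2 * p - 6) =
      2 * p * ((m + 1 : ℕ) : ℤ) - 6 * ((m + 1 : ℕ) : ℤ) - 3 by push_cast; ring] at h4
    have hI : indexSet p (m + 1) = if p = 3 ∧ 3 ∣ m + 1 then indexSet p m else insert (m + 1) (indexSet p m) := by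
      have hIcc : Finset.Icc 1 (m + 1) = insert (m + 1) (Finset.Icc 1 m) := by
        ext x; simp; omega
      rw [indexSet, hIcc, Finset.filter_insert]
      by_cases h : p = 3 ∧ 3 ∣ m + 1
      · rw [if_neg (not_not.mpr h), if_pos h]; rfl
      · rw [if_pos h, if_neg h]; rfl
    have hn : m + 1 ∉ indexSet p m := fun h => by simp [indexSet] at h
    -- for `p = 3` the product of the two factors vanishes exactly when `3 ∤ m + 1`
    have hcast : ((2 * m + 1 : ℕ) : k) * ((2 * m + 1 + 2 : ℕ) : k) = 4 * ((m + 1 : ℕ) : k) ^ 2 - 1 := by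
      push_cast; ring
    rw [show 2 * (m + 1) + 1 = 2 * m + 3 by ring]
    by_cases h : p = 3 ∧ 3 ∣ m + 1
    · have h5 : Contractible p (cone p (Acx k (2 * m + 1 + 1)) ((Acx k (2 * m + 1)).qShift (-2)) (opD k)) := by
        refine cone_opD_contractible h.1 _ ?_
        have h0 : ((m + 1 : ℕ) : k) = 0 := (CharP.cast_eq_zero_iff k p _).mpr (h.1 ▸ h.2)
        rw [hcast, h0]
        simp
      refine ⟨G, hG, ?_, h3.trans (((sum_comm_iso _ _).trans (sum_contractible _ (h5.qShift _))).trans h4)⟩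
      rw [hI, if_pos h]
      exact h1
    · obtain ⟨X, hX, h6, h7⟩ := exists_stable_XComplex (k := k) hp m
      have h5 : (((2 * m + 1 : ℕ) : k) * ((2 * m + 1 + 2 : ℕ) : k) = 0) ∨ 5 ≤ p := by
        by_cases h3 : p = 3
        · left
          subst h3
          have h8 : ¬ 3 ∣ m + 1 := fun h' => h ⟨rfl, h'⟩
          have : 3 ∣ (2 * m + 1) * (2 * m + 1 + 2) := by
            rcases (show m % 3 = 0 ∨ m % 3 = 1 by omega) with h9 | h9
            · exact Dvd.dvd.mul_left (by omega) _
            · exact Dvd.dvd.mul_right (by omega) _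
          rw [← Nat.cast_mul]
          exact (CharP.cast_eq_zero_iff k 3 _).mpr this
        · right
          have h4 : p ≠ 4 := by
            rintro rfl
            exact absurd (Fact.out : Nat.Prime 4) (by norm_num)
          omega
      have h8 := ((cone_opD_iso_sum (k := k) hp _ h5).trans h7).qShift (-2 * m - 5)
      rw [qShift_qShift, show (2 * (p : ℤ) - 4) * ((m + 1 : ℕ) : ℤ) + (-2 * m - 5) =
        2 * p * ((m + 1 : ℕ) : ℤ) - 6 * ((m + 1 : ℕ) : ℤ) - 3 by push_cast; ring] at h8
      refine ⟨X.sum G, hX.sum hG, ?_, (h3.trans (h8.sum h4)).trans (Sm_sum_qShift_iso X G _).symm⟩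
      rw [hI, if_neg h]
      refine ((HomotopyIso.refl _).sum (bigSum_insert _ _ hn _)).trans ?_
      refine (sum_assoc_iso _ _ _).symm.trans (((sum_comm_iso _ _).sum (HomotopyIso.refl _)).trans
        ((sum_assoc_iso _ _ _).trans ?_))
      exact h6.sum h1

/-- Slash homology does not change a complex isomorphic to a slash-stable one. -/
lemma pH_iso_of_stable (hp : 2 < p) {n : ℕ} {Z : QComplex k} (hZ : SlashStable p Z)
    (h : HomotopyIso p (totC p (Mn k p n)) Z) : HomotopyIso p (pH k p n) (Z.qShift (-2)) :=
  ((((torusComplex_iso hp n).trans h).slash).trans hZ.iso).qShift (-2)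

lemma pH_iso_answerOdd (hp : 2 < p) (m : ℕ) : HomotopyIso p (pH k p (2 * m + 1)) (answerOdd k p (2 * m + 1)) := by
  obtain ⟨G, hG, h1, h2⟩ := exists_stable_odd (k := k) hp m
  have h3 := pH_iso_of_stable hp ((hG.blk hp).qShift _) h2
  have h4 := (shiftNeg_odd_iso hp hG.isPComplex m h1).qShift (-3 * ((2 * m + 1 : ℕ) : ℤ) - 2)
  rw [qShift_qShift] at h3 h4
  rw [answerOdd, show (2 * m + 1 - 1) / 2 = m by omega]
  refine h3.trans (HomotopyIso.trans (HomotopyIso.of_eq ?_) h4.symm)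
  congr 1; push_cast; ring

lemma sum_Sm_iso (hp : 2 < p) {T T' A Y G : QComplex k} {a b : ℤ} (hG : IsPComplex p G)
    (h : HomotopyIso p T (A.sum ((Sm p T').qShift (-3)))) (hA : HomotopyIso p A (Y.qShift b))
    (hT : HomotopyIso p T' ((Sm p G).qShift a)) (hab : 2 * (p : ℤ) + (a + -3) = b) :
    HomotopyIso p T ((G.sum Y).qShift b) := by
  have h8 : HomotopyIso p ((Sm p T').qShift (-3)) ((Sm p ((Sm p G).qShift a)).qShift (-3)) :=
    (hT.blk (p - 1) 2).qShift (-3)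
  have h9 := (sm_sm hp hG).qShift (a + -3)
  rw [Sm_qShift, qShift_qShift] at h8
  rw [qShift_qShift, hab] at h9
  exact (h.trans (hA.sum (h8.trans h9))).trans (sum_comm_iso _ _)

lemma pH_iso_answerEven (hp : 2 < p) (m : ℕ) :
    HomotopyIso p (pH k p (2 * (m + 1))) (answerEven k p (2 * (m + 1))) := by
  obtain ⟨G, hG, h1, h2⟩ := exists_stable_odd (k := k) hp m
  obtain ⟨Y, hY, h3, h4⟩ := exists_stable_YComplex (k := k) hp m
  have h5 := totC_Mn_even (k := k) hp m
  have h6 := h4.qShift (-2 * m - 4)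
  rw [qShift_qShift, show 2 * (p : ℤ) * (m + 1) - 4 * m - 2 + (-2 * m - 4) = 2 * p * (m + 1) - 6 * m - 6 by ring] at h6
  have h8 := sum_Sm_iso hp hG.isPComplex h5 h6 h2
    (show 2 * (p : ℤ) + (2 * p * m - 6 * m - 3 + -3) = 2 * p * (m + 1) - 6 * m - 6 by ring)
  have h9 := pH_iso_of_stable hp ((hG.sum hY).qShift _) h8
  have h10 := (sum_assoc_iso (p := p) (((V k 1).qShift 5).shift p 1) (bigSum (indexSet p m) (XComplex k p))
    (YComplex k p (2 * (m + 1)))).symm.trans (h1.sum h3)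
  have h11 := (shiftNeg_even_iso hp (hG.sum hY).isPComplex (m + 1) h10).qShift (-3 * ((2 * (m + 1) : ℕ) : ℤ) - 2)
  rw [qShift_qShift] at h9 h11
  rw [answerEven, show (2 * (m + 1) - 2) / 2 = m by omega]
  refine h9.trans (HomotopyIso.trans (HomotopyIso.of_eq ?_) h11.symm)
  congr 1; push_cast; ring

end Recursion

end TorusLink

theorem mainTheorem9 {k : Type u} [Field k] (p : ℕ) [Fact p.Prime] [CharP k p] (hp : 2 < p)
    (n : ℕ) (hn : 1 ≤ n) :
    (TorusLink.torusComplex k p n).IsPComplex p ∧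
    (¬ 2 ∣ n → TorusLink.QComplex.HomotopyIso p (TorusLink.pH k p n)
      (TorusLink.answerOdd k p n)) ∧
    (2 ∣ n → TorusLink.QComplex.HomotopyIso p (TorusLink.pH k p n)
      (TorusLink.answerEven k p n)) := by
  refine ⟨TorusLink.HqBimod.torusComplex_isPComplex hp n, fun h => ?_, fun h => ?_⟩
  · obtain ⟨m, rfl⟩ : ∃ m, n = 2 * m + 1 := ⟨n / 2, by omega⟩
    exact TorusLink.pH_iso_answerOdd hp m
  · obtain ⟨m, rfl⟩ : ∃ m, n = 2 * (m + 1) := ⟨n / 2 - 1, by omega⟩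
    exact TorusLink.pH_iso_answerEven hp m
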